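/- Let $d\ge 2$, write points of $\mathbb R^d$ as $x=(\alpha,u)$ with $\alpha\in\mathbb R$, $u=\mathcal U x\in\mathbb R^{d-1}$, let $e$ be the first coordinate vector and $\Lambda=\{u\in\mathbb R^{d-1}:\|u\|\le \widehat M\}$ with $\widehat M>0$. All surface measures are Hausdorff measures normalized to agree with Lebesgue measure (counting measure in dimension $0$). **Random tube.** For $k\in\{d-1,d\}$ with $k\ge2$, the boundary of $A\subset\mathbb R^k$ is $(\varepsilon,L)$-Lipschitz if for every $x\in\partial A$ there are an affine isometry $I$ of $\mathbb R^k$ and an $L$-Lipschitz $f:\mathbb R^{k-1}\to\mathbb R$ with $I x=0$, $f(0)=0$ and $I(A\cap B(x,\varepsilon))=\{z\in B(0,\varepsilon): z^{(k)}>f(z^{(1)},\dots,z^{(k-1)})\}$; for $k=1$ it means that distinct points of $\partial A$ have distance larger than $\varepsilon$. Let $\mathfrak E$ be the set of open $A\subset\Lambda$ whose boundary is $(1/m,m)$-Lipschitz for some integer $m\ge1$, with the distance $|A\triangle B|$, let $\Omega$ be the space of continuous maps $\omega:\mathbb R\to\mathfrak E$ with the $\sigma$-algebra generated by the evaluations $\omega\mapsto\omega_\alpha$,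 and let $\mathbb P$ be a probability measure on $\Omega$ that is stationary and ergodic under the shifts $(\theta_a\omega)_\alpha=\omega_{\alpha+a}$. Denote the tube $\{(\alpha,u):u\in\omega_\alpha\}$ again by $\omega$. Assume that $\mathbb P$-a.s. $\omega$ is connected, that there are constants $\tilde\varepsilon,\tilde L>0$ such that $\mathbb P$-a.s. $\partial\omega$ is $(\tilde\varepsilon,\tilde L)$-Lipschitz, and that $\mathbb P$-a.s. $\nu^\omega(\partial\omega\setminus\mathcal R_\omega)=0$. Here $\nu^\omega$ is the $(d-1)$-dimensional Hausdorff measure on $\partial\omega$, $\mathbf n_\omega$ is the inner unit normal of $\omega$, and $\mathcal R_\omega$ is the set of the $x\in\partial\omega$ near which $\partial\omega$ is a $C^1$ graph and for which $|\mathbf n_\omega(x)\cdot e|\ne1$. **One step from $\mathbb Q$.** Let $\mathbb S_e=\{h\in\mathbb R^d:\|h\|=1,\ h\cdot e>0\}$, $dh$ the surface measure on it, and $\gamma_d=(\int_{\mathbb S_e}h\cdot e\,dh)^{-1}$. For fixed $\omega$, the law of $\xi_1$ given $\xi_0=x$ has the density $$K(x,y)=\gamma_d\frac{((y-x)\cdot\mathbf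 n_\omega(x))\,((x-y)\cdot\mathbf n_\omega(y))}{\|x-y\|^{d+1}}$$ with respect to $\nu^\omega(dy)$ if $x,y\in\mathcal R_\omega$ are distinct and the open segment between them lies in $\omega$, and $K(x,y)=0$ otherwise. Let $\kappa_x=\|\mathcal U\mathbf n_\omega(x)\|$, let $\mu_0^\omega$ be the $(d-2)$-dimensional Hausdorff measure on $\partial\omega_0$, and $$\mathcal Z=\int_\Omega d\mathbb P\int\kappa_{0,u}^{-1}\,d\mu_0^\omega(u),\qquad \langle f\rangle_{\mathbb Q}=\frac1{\mathcal Z}\int_\Omega d\mathbb P(\omega)\int\kappa_{0,u}^{-1}f(\omega,u)\,d\mu_0^\omega(u).$$ For an event $A$ depending on the step $(\xi_0,\xi_1)$, let $\langle\mathtt P_\omega[A]\rangle_{\mathbb Q}$ be this average of the conditional probability of $A$ given $\xi_0=(0,u)$, for fixed $\omega$. **Crossing.** Let $S\subset\Lambda$ be open and convex, $\widehat S=\mathbb R\times S$, and assume that $\widehat S\subset\omega$ $\mathbb P$-a.s. Let $\mathcal I$ be the event that $\xi_0+t(\xi_1-\xi_0)\in\widehat S$ for some $t\in[0,1]$. Let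 $(U_v)_{v\in\partial S}$ be a family of orthogonal operators of $\mathbb R^d$, measurable in $v$, such that $U_ve$ is the inner unit normal of $\widehat S$ at $(0,v)$ whenever $\partial S$ is differentiable at $v$. If the segment from $x$ to $y$ meets $\partial\widehat S$ and $z$ is its first point in $\partial\widehat S$, put $\mathsf L(x,y)=\mathcal Uz$ and $\mathsf Y(x,y)=U_{\mathsf L(x,y)}^{-1}\frac{y-x}{\|y-x\|}$; otherwise put $\mathsf L(x,y)=\infty$, $\mathsf Y(x,y)=0$. **Claim.** $0<\mathcal Z<\infty$, and $$\langle\mathtt P_\omega[\mathcal I]\rangle_{\mathbb Q}=\frac{|\partial S|}{\mathcal Z},$$ where $|\cdot|$ on $\partial S$ is the $(d-2)$-dimensional Hausdorff measure. For all Borel sets $B_1\subset\partial S$ and $B_2\subset\mathbb S_e$, $$\langle\mathtt P_\omega[\mathsf L(\xi_0,\xi_1)\in B_1,\ \mathsf Y(\xi_0,\xi_1)\in B_2]\rangle_{\mathbb Q}=\frac{|\partial S|}{\mathcal Z}\,\frac{|B_1|}{|\partial S|}\,\gamma_d\int_{B_2}h\cdot e\,dh,$$ and the same holds with $\mathcal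 I\cap\{\mathsf L(\xi_0,\xi_1)\in B_1,\mathsf Y(\xi_0,\xi_1)\in B_2\}$ in place of $\{\mathsf L(\xi_0,\xi_1)\in B_1,\mathsf Y(\xi_0,\xi_1)\in B_2\}$. (If $S=\emptyset$, all these probabilities are $0$, and the right-hand sides are read as $0$.) In other words, for $S\neq\emptyset$, conditioned on $\mathcal I$, the location $\mathsf L$ is uniform on $\partial S$, the direction $\mathsf Y$ has the cosine law on $\mathbb S_e$, and the two are independent. -/

import Mathlib

open MeasureTheory Set Filter Topology
open scoped ENNReal symmDiff

noncomputable section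

namespace KnudsenTube

/-- `ℝᵏ` with its Euclidean structure. The ambient space is `Euc (n + 2)`, i.e. `d = n + 2`, and the
transversal hyperplane `ℝᵈ⁻¹` is `Euc (n + 1)`. The first coordinate has index `0`. -/
abbrev Euc (k : ℕ) : Type := EuclideanSpace ℝ (Fin k)

/-! ### Local graphs, Lipschitz boundaries, normals -/

/-- The first `k` coordinates of a point of `ℝᵏ⁺¹`. -/
def initCoords {k : ℕ} (z : Euc (k + 1)) : Euc k :=
  WithLp.toLp 2 fun i => z i.castSucc

/-- In the affine isometric coordinates `I`, centred at `x`, and inside the ball of radius `r`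
around `x`, the set `A` is the strict epigraph of `f`, with `f 0 = 0`. -/
def IsLocalEpigraph {k : ℕ} (A : Set (Euc (k + 1))) (x : Euc (k + 1))
    (I : Euc (k + 1) ≃ᵃⁱ[ℝ] Euc (k + 1)) (f : Euc k → ℝ) (r : ℝ) : Prop :=
  I x = 0 ∧ f 0 = 0 ∧
    I '' (A ∩ Metric.ball x r) =
      {z | z ∈ Metric.ball (0 : Euc (k + 1)) r ∧ f (initCoords z) < z (Fin.last k)}

/-- `∂A` is `(ε, L)`-Lipschitz, for `A ⊆ ℝᵏ⁺¹` with `k + 1 ≥ 2`. -/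
def LipschitzBoundary {k : ℕ} (A : Set (Euc (k + 1))) (ε L : ℝ) : Prop :=
  ∀ x ∈ frontier A, ∃ (I : Euc (k + 1) ≃ᵃⁱ[ℝ] Euc (k + 1)) (f : Euc k → ℝ),
    (∀ z z', |f z - f z'| ≤ L * ‖z - z'‖) ∧ IsLocalEpigraph A x I f ε

/-- `∂A` is `(ε, L)`-Lipschitz, for a transversal section `A ⊆ ℝⁿ⁺¹`. On the line (`n = 0`) the
convention is that distinct boundary points have mutual distance larger than `ε`. -/
def SectionLipschitz : {n : ℕ} → Set (Euc (n + 1)) → ℝ → ℝ → Prop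
  | 0, A, ε, _ => ∀ x ∈ frontier A, ∀ y ∈ frontier A, x ≠ y → ε < dist x y
  | _ + 1, A, ε, L => LipschitzBoundary A ε L

/-- `∂A` is continuously differentiable in `x`: near `x` it is a `C¹` graph, with `A` on one
side. -/
def IsC1BoundaryAt {k : ℕ} (A : Set (Euc (k + 1))) (x : Euc (k + 1)) : Prop :=
  ∃ (I : Euc (k + 1) ≃ᵃⁱ[ℝ] Euc (k + 1)) (f : Euc k → ℝ) (r : ℝ),
    0 < r ∧ ContDiff ℝ 1 f ∧ IsLocalEpigraph A x I f r

/-- `∂A` is differentiable at the boundary point `x`, with inner unit normal `v`: to first order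
at `x`, the set `A` is the half-space of the points `y` with `⟪v, y - x⟫ > 0`. -/
def IsInnerNormal {k : ℕ} (A : Set (Euc k)) (x v : Euc k) : Prop :=
  x ∈ frontier A ∧ ‖v‖ = 1 ∧
    ∀ ε > 0, ∀ᶠ y in 𝓝 x,
      (ε * ‖y - x‖ < inner ℝ v (y - x) → y ∈ A) ∧
      (inner ℝ v (y - x) < -(ε * ‖y - x‖) → y ∉ A)

open Classical in
/-- The inner unit normal of `A` at `x` (and `0` where it does not exist). -/
def innerNormal {k : ℕ} (A : Set (Euc k)) (x : Euc k) : Euc k :=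
  if h : ∃ v, IsInnerNormal A x v then h.choose else 0

/-! ### Coordinates `x = (α, u)` -/

/-- The first coordinate vector `e` of `ℝᵈ`. -/
def e (n : ℕ) : Euc (n + 2) := EuclideanSpace.single 0 1

/-- The point `(α, u)` of `ℝᵈ`. -/
def pt {n : ℕ} (α : ℝ) (u : Euc (n + 1)) : Euc (n + 2) :=
  WithLp.toLp 2 (Fin.cons α fun i => u i)

/-- The projection `𝒰` of `ℝᵈ` onto `ℝᵈ⁻¹`: `𝒰 (α, u) = u`. -/
def proj {n : ℕ} (x : Euc (n + 2)) : Euc (n + 1) :=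
  WithLp.toLp 2 fun i => x i.succ

/-- The half-sphere `{h : ‖h‖ = 1, h · e > 0}`. -/
def halfSphere (n : ℕ) : Set (Euc (n + 2)) :=
  {h | ‖h‖ = 1 ∧ 0 < inner ℝ h (e n)}

/-- The constant `γ_d = (∫ h · e dh)⁻¹`, the integral being over the half-sphere with respect to
the surface measure. -/
def gammaConst (n : ℕ) : ℝ :=
  (∫ h in halfSphere n, inner ℝ h (e n) ∂(μHE[n + 1] : Measure (Euc (n + 2))))⁻¹

/-! ### Random tubes -/

/-- The set `𝔈` of the possible sections: open subsets of the closed ball `Λ` of radius `M` whose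
boundary is `(1/k, k)`-Lipschitz for some `k ≥ 1`. -/
def CrossSection (n : ℕ) (M : ℝ) : Type :=
  {A : Set (Euc (n + 1)) // IsOpen A ∧ A ⊆ Metric.closedBall 0 M ∧
    ∃ k : ℕ, 1 ≤ k ∧ SectionLipschitz A (1 / k) k}

/-- The distance between two sections is the Lebesgue measure of their symmetric difference. -/
instance (n : ℕ) (M : ℝ) : PseudoEMetricSpace (CrossSection n M) where
  edist A B := volume (A.1 ∆ B.1)
  edist_self A := by simp
  edist_comm A B := by rw [symmDiff_comm]
  edist_triangle A B C := measure_symmDiff_le _ _ _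

/-- The space `Ω` of the continuous functions `ℝ → 𝔈`. -/
def Env (n : ℕ) (M : ℝ) : Type :=
  {ω : ℝ → CrossSection n M // Continuous ω}

/-- The σ-algebra generated by the cylinder sets, for the Borel σ-algebra on `𝔈`. -/
instance (n : ℕ) (M : ℝ) : MeasurableSpace (Env n M) :=
  ⨆ α : ℝ, (borel (CrossSection n M)).comap fun ω => ω.1 α

/-- The spatial shift `(θ_a ω)_α = ω_(α + a)`. -/
def shift {n : ℕ} {M : ℝ} (a : ℝ) (ω : Env n M) : Env n M :=
  ⟨fun α => ω.1 (α + a), ω.2.comp (continuous_id.add continuous_const)⟩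

/-- The section `ω_α`. -/
def slice {n : ℕ} {M : ℝ} (ω : Env n M) (α : ℝ) : Set (Euc (n + 1)) := (ω.1 α).1

/-- The tube `{(α, u) : u ∈ ω_α}` in `ℝᵈ`. -/
def tube {n : ℕ} {M : ℝ} (ω : Env n M) : Set (Euc (n + 2)) :=
  {x | proj x ∈ slice ω (x 0)}

/-- `P` is stationary and ergodic with respect to the shifts. -/
def IsStationaryErgodic {n : ℕ} {M : ℝ} (P : Measure (Env n M)) : Prop :=
  (∀ a, MeasurePreserving (shift a) P P) ∧
    ∀ A : Set (Env n M), MeasurableSet A → (∀ a, shift a ⁻¹' A = A) → P A = 0 ∨ P A = 1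

/-- The surface measure `ν^ω` on the boundary of the tube. -/
def surfaceMeasure {n : ℕ} {M : ℝ} (ω : Env n M) : Measure (Euc (n + 2)) :=
  (μHE[n + 1] : Measure (Euc (n + 2))).restrict (frontier (tube ω))

/-- The `(d-2)`-dimensional Hausdorff measure `μ^ω_α` on `∂ω_α` (the counting measure if
`d = 2`). -/
def sliceMeasure {n : ℕ} {M : ℝ} (ω : Env n M) (α : ℝ) : Measure (Euc (n + 1)) :=
  (μHE[n] : Measure (Euc (n + 1))).restrict (frontier (slice ω α))

/-- The set `ℛ_ω` of regular boundary points. -/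
def regularPoints {n : ℕ} {M : ℝ} (ω : Env n M) : Set (Euc (n + 2)) :=
  {x | x ∈ frontier (tube ω) ∧ IsC1BoundaryAt (tube ω) x ∧
    |inner ℝ (innerNormal (tube ω) x) (e n)| ≠ 1}

/-- The normal vector `r_ω(x)` of the section: the normalized projection of `n_ω(x)` onto
`ℝᵈ⁻¹`. -/
def sliceNormal {n : ℕ} {M : ℝ} (ω : Env n M) (x : Euc (n + 2)) : Euc (n + 1) :=
  ‖proj (innerNormal (tube ω) x)‖⁻¹ • proj (innerNormal (tube ω) x)

/-- `κ_x = n_ω(x) · r_ω(x)`. -/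
def kappa {n : ℕ} {M : ℝ} (ω : Env n M) (x : Euc (n + 2)) : ℝ :=
  inner ℝ (innerNormal (tube ω) x) (pt 0 (sliceNormal ω x))

/-- `y` is seen from `x` in the open set `D`. -/
def Seen {k : ℕ} (D : Set (Euc k)) (x y : Euc k) : Prop :=
  ∃ (h : Euc k) (t₀ : ℝ), ‖h‖ = 1 ∧ 0 < t₀ ∧ (∀ t ∈ Ioo 0 t₀, x + t • h ∈ D) ∧ x + t₀ • h = y

open Classical in
/-- The transition density `K` of the Knudsen random walk. -/
def density {n : ℕ} {M : ℝ} (ω : Env n M) (x y : Euc (n + 2)) : ℝ :=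
  if x ∈ regularPoints ω ∧ y ∈ regularPoints ω ∧ Seen (tube ω) x y then
    gammaConst n * (inner ℝ (y - x) (innerNormal (tube ω) x) *
      inner ℝ (x - y) (innerNormal (tube ω) y)) / ‖x - y‖ ^ (n + 3)
  else 0

/-- The law of `ξ₁` given `ξ₀ = x`, for a fixed tube `ω`. -/
def stepLaw {n : ℕ} {M : ℝ} (ω : Env n M) (x : Euc (n + 2)) : Measure (Euc (n + 2)) :=
  (surfaceMeasure ω).withDensity fun y => ENNReal.ofReal (density ω x y)

/-! ### The stationary law `ℚ` -/

/-- The normalizing constant `𝒵 = ∫ dP(ω) ∫ κ_{0,u}⁻¹ dμ^ω_0(u)`. -/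
def normConst {n : ℕ} {M : ℝ} (P : Measure (Env n M)) : ℝ≥0∞ :=
  ∫⁻ ω, ∫⁻ u, (ENNReal.ofReal (kappa ω (pt 0 u)))⁻¹ ∂(sliceMeasure ω 0) ∂P

/-- The expectation `⟨f⟩ = 𝒵⁻¹ ∫ dP(ω) ∫ κ_{0,u}⁻¹ f(ω, u) dμ^ω_0(u)` of `f ≥ 0` under the law
`ℚ` of `(ω, u)`. -/
def avgQ {n : ℕ} {M : ℝ} (P : Measure (Env n M)) (f : Env n M → Euc (n + 1) → ℝ≥0∞) : ℝ≥0∞ :=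
  (normConst P)⁻¹ *
    ∫⁻ ω, ∫⁻ u, (ENNReal.ofReal (kappa ω (pt 0 u)))⁻¹ * f ω u ∂(sliceMeasure ω 0) ∂P

/-- The annealed probability `⟨P_ω[(ξ₀, ξ₁) ∈ event ∣ ξ₀ = (0, u)]⟩` of an event that depends on
one step `(ξ₀, ξ₁)` of the walk started from `ℚ`. -/
def stepProb {n : ℕ} {M : ℝ} (P : Measure (Env n M))
    (event : Euc (n + 2) → Euc (n + 2) → Prop) : ℝ≥0∞ :=
  avgQ P fun ω u => stepLaw ω (pt 0 u) {y | event (pt 0 u) y}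

/-! ### Crossing a straight cylinder -/

/-- The straight cylinder `Ŝ = ℝ × S`. -/
def cylinder {n : ℕ} (S : Set (Euc (n + 1))) : Set (Euc (n + 2)) := {x | proj x ∈ S}

/-- The jump from `x` to `y` crosses the cylinder. -/
def Crosses {n : ℕ} (S : Set (Euc (n + 1))) (x y : Euc (n + 2)) : Prop :=
  ∃ t ∈ Icc (0 : ℝ) 1, x + t • (y - x) ∈ cylinder S

/-- The times `t ∈ [0, 1]` at which the jump from `x` to `y` is on the boundary of the cylinder. -/
def hitTimes {n : ℕ} (S : Set (Euc (n + 1))) (x y : Euc (n + 2)) : Set ℝ :=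
  {t | t ∈ Icc (0 : ℝ) 1 ∧ x + t • (y - x) ∈ frontier (cylinder S)}

/-- `𝒰 (x + (y - x) t_{x,y})`, where `t_{x,y}` is the first hitting time (meaningful when there
is one). -/
def hitPoint {n : ℕ} (S : Set (Euc (n + 1))) (x y : Euc (n + 2)) : Euc (n + 1) :=
  proj (x + sInf (hitTimes S x y) • (y - x))

open Classical in
/-- The projected location `L(x, y)` of the crossing, `∞` if there is none. -/
def crossLoc {n : ℕ} (S : Set (Euc (n + 1))) (x y : Euc (n + 2)) : OnePoint (Euc (n + 1)) :=
  if (hitTimes S x y).Nonempty then (hitPoint S x y : OnePoint (Euc (n + 1))) else OnePoint.infty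

open Classical in
/-- The relative direction `Y(x, y)` of the crossing, `0` if there is none; `U v` is an orthogonal
operator that maps `e` to the normal of the cylinder over `v ∈ ∂S`. -/
def crossDir {n : ℕ} (S : Set (Euc (n + 1)))
    (U : Euc (n + 1) → Euc (n + 2) ≃ₗᵢ[ℝ] Euc (n + 2)) (x y : Euc (n + 2)) : Euc (n + 2) :=
  if (hitTimes S x y).Nonempty then (U (hitPoint S x y)).symm (‖y - x‖⁻¹ • (y - x)) else 0

/-- The event `{L(x, y) ∈ B₁, Y(x, y) ∈ B₂}`. -/
def CrossesIn {n : ℕ} (S : Set (Euc (n + 1)))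
    (U : Euc (n + 1) → Euc (n + 2) ≃ₗᵢ[ℝ] Euc (n + 2))
    (B₁ : Set (Euc (n + 1))) (B₂ : Set (Euc (n + 2))) (x y : Euc (n + 2)) : Prop :=
  crossLoc S x y ∈ (fun u : Euc (n + 1) => (u : OnePoint (Euc (n + 1)))) '' B₁ ∧
    crossDir S U x y ∈ B₂

/-- `(U v)` is a (measurable) family of orthogonal operators with `U_v e` equal to the inner
normal of the cylinder at `(0, v)`, at all `v ∈ ∂S` at which `∂S` is differentiable. -/
def IsNormalFrame {n : ℕ} (S : Set (Euc (n + 1)))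
    (U : Euc (n + 1) → Euc (n + 2) ≃ₗᵢ[ℝ] Euc (n + 2)) : Prop :=
  (∀ w, Measurable fun v : frontier S => U (v : Euc (n + 1)) w) ∧
    ∀ v ∈ frontier S, ∀ m, IsInnerNormal (cylinder S) (pt 0 v) m → U v (e n) = m

end KnudsenTube

end

open KnudsenTube

open scoped NNReal

namespace KnudsenTube

/-! ### Euclidean Hausdorff measure and Lipschitz maps -/

section Lipschitz

variable {X Y : Type*} [EMetricSpace X] [MeasurableSpace X] [BorelSpace X]
  [EMetricSpace Y] [MeasurableSpace Y] [BorelSpace Y]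

/-! Fix the tube. In polar coordinates around `x` the kernel `K(x, y) ν(dy)` becomes the cosine law
`γ_d (h · n(x)) dh` (`CylinderInDomain.lintegral_cosKernel`). Therefore, for each direction `h`, the
chord measure `K(x, y) ν(dx) ν(dy)` measures lines by the area they cut out of the hyperplane
orthogonal to `h`, and it does not matter on which surface a line is observed. A line that enters
the cylinder transversally does so only once, by convexity, and it enters along exactly one chord,
because the cylinder lies in the tube. So starting points of entering chords and entrance points
have the same projection along `h` (`CylinderInDomain.ae_lintegral_rays`). The flux of chords
through a piece of the cylinder is thus the integral of `γ_d (h · m(z))` over entrance points `z`,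
with inner normal `m(z)`, and directions `h`. It knows nothing of the tube, and after rotating by
`U` it is the product of a surface area and a cosine integral
(`CylinderInDomain.lintegral_cosKernel_entrances`).

Stationarity links this flux to averages under `ℚ`. The coarea factor of the first coordinate is
`κ`, so the sections weighted with `κ⁻¹` sweep the surface measure, and averaging over starting
points in the section at `0` is averaging over the boundary per unit of length. For translation
invariant events the mass transport formula `IsGoodLaw.lintegral_palmMean` permits cutting this unit
of length where the chord enters the cylinder instead of where it starts; this is
`IsGoodLaw.lintegral_palmMean_crossesIn`. The constant `𝒵` is the mean boundary area per unit of
length: finite by the uniform Lipschitz charts, positive because the boundary is nonempty and each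
chart has positive area. The events "crosses" and "hits the boundary going inwards" differ only on
lines that are tangential or pass through irregular points. These are negligible: null sets project
to null sets, and for almost all directions tangency happens on a null set
(`CylinderInDomain.ae_niceLine`).

Two supporting theories are built. The geometric one rests on `StrictNormal`, arbitrarily good
flatness near a point. It suffices for the area formula of maps that look like projections and for
the coarea formula, it holds at `C¹` points, and it holds wherever a convex boundary is
differentiable, which is almost everywhere by Rademacher's theorem for the gauge. The
measure-theoretic one shows that the tube, its regular points, its normals and its surface measures
depend measurably on `ω`, by reducing each to countably many tests (`IsRandomOpen`) and Hausdorff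
measure to finite covers. -/

theorem euclideanHausdorffMeasure_image_le {K : ℝ≥0} {f : X → Y} {s : Set X}
    (h : LipschitzOnWith K f s) (d : ℕ) : μHE[d] (f '' s) ≤ (K : ℝ≥0∞) ^ d * μHE[d] s := by
  simp_rw [Measure.euclideanHausdorffMeasure_def, Measure.smul_apply, ENNReal.smul_def, smul_eq_mul]
  rw [mul_left_comm]
  gcongr
  simpa using h.hausdorffMeasure_image_le (Nat.cast_nonneg d)

theorem euclideanHausdorffMeasure_eq_zero_iff (d : ℕ) (s : Set X) :
    μHE[d] s = 0 ↔ μH[(d : ℝ)] s = 0 := by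
  rw [Measure.euclideanHausdorffMeasure_def, Measure.smul_apply, ENNReal.smul_def, smul_eq_mul,
    mul_eq_zero, ENNReal.coe_eq_zero]
  simp [Measure.addHaarScalarFactor_volume_hausdorffMeasure_ne_zero]

/-- If distances between values of `f` are dominated by those between values of `g`, so are the
Hausdorff measures of the images. -/
theorem euclideanHausdorffMeasure_image_le_image {Z : Type*} {f : Z → X} {g : Z → Y} {s : Set Z}
    {K : ℝ≥0} (h : ∀ z ∈ s, ∀ z' ∈ s, edist (f z) (f z') ≤ K * edist (g z) (g z')) (d : ℕ) :
    μHE[d] (f '' s) ≤ (K : ℝ≥0∞) ^ d * μHE[d] (g '' s) := by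
  rcases s.eq_empty_or_nonempty with rfl | ⟨z₀, hz₀⟩
  · simp
  have : Nonempty Z := ⟨z₀⟩
  have hinv : ∀ z ∈ s, Function.invFunOn g s (g z) ∈ s ∧ g (Function.invFunOn g s (g z)) = g z :=
    fun z hz => ⟨Function.invFunOn_mem ⟨z, hz, rfl⟩, Function.invFunOn_eq ⟨z, hz, rfl⟩⟩
  -- Points of `s` with equal `g`-values have equal `f`-values, so `f` factors through `g '' s`
  -- although `g` need not be injective; the factor is `K`-Lipschitz.
  have hf : ∀ z ∈ s, f (Function.invFunOn g s (g z)) = f z := by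
    intro z hz
    have := h _ (hinv z hz).1 z hz
    rw [(hinv z hz).2, edist_self, mul_zero, nonpos_iff_eq_zero, edist_eq_zero] at this
    exact this
  have himg : f '' s = (fun y => f (Function.invFunOn g s y)) '' (g '' s) := by
    rw [image_image]
    exact image_congr fun z hz => (hf z hz).symm
  rw [himg]
  refine euclideanHausdorffMeasure_image_le ?_ d
  rintro _ ⟨z, hz, rfl⟩ _ ⟨z', hz', rfl⟩
  simp only
  rw [hf z hz, hf z' hz']
  exact h z hz z' hz'

end Lipschitz

/-! ### Projections along a direction and flat sets -/

/-- The component of `y` orthogonal to the unit vector `h`. -/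
noncomputable def perp {k : ℕ} (h : Euc k) : Euc k →ₗ[ℝ] Euc k :=
  LinearMap.id - (innerₛₗ ℝ h).smulRight h

theorem perp_apply {k : ℕ} (h y : Euc k) : perp h y = y - (inner ℝ h y : ℝ) • h := by
  simp [perp]

theorem continuous_perp {k : ℕ} (h : Euc k) : Continuous (perp h) :=
  LinearMap.continuous_of_finiteDimensional _

theorem inner_perp {k : ℕ} {h : Euc k} (hh : ‖h‖ = 1) (y : Euc k) : inner ℝ h (perp h y) = 0 := by
  simp [perp_apply, inner_sub_right, inner_smul_right, real_inner_self_eq_norm_sq, hh]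

theorem norm_perp_sq {k : ℕ} {h : Euc k} (hh : ‖h‖ = 1) (y : Euc k) :
    ‖perp h y‖ ^ 2 = ‖y‖ ^ 2 - (inner ℝ h y : ℝ) ^ 2 := by
  rw [perp_apply, norm_sub_sq_real, norm_smul, inner_smul_right, hh, real_inner_comm]
  simp
  ring

theorem norm_perp_le {k : ℕ} {h : Euc k} (hh : ‖h‖ = 1) (y : Euc k) : ‖perp h y‖ ≤ ‖y‖ := by
  have := norm_perp_sq hh y
  nlinarith [sq_nonneg (inner ℝ h y : ℝ), norm_nonneg y, norm_nonneg (perp h y)]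

theorem lipschitzWith_perp {k : ℕ} {h : Euc k} (hh : ‖h‖ = 1) : LipschitzWith 1 (perp h) :=
  LipschitzWith.of_dist_le_mul fun x y => by
    simpa [dist_eq_norm, ← map_sub] using norm_perp_le hh (x - y)

/-- For an orthonormal basis of `vᗮ` with inner products `c i` against `h`, the Gram matrix of the
projected basis is `1 - c cᵀ`. Its determinant `1 - |c|²` is, by Parseval, the square of the cosine
between `h` and `v`. -/
theorem normDet_perp {k : ℕ} {v h : Euc (k + 1)} (hv : ‖v‖ = 1) (hh : ‖h‖ = 1) :
    ((perp h).domRestrict (ℝ ∙ v)ᗮ).normDet = |(inner ℝ h v : ℝ)| := by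
  let b := stdOrthonormalBasis ℝ ((ℝ ∙ v)ᗮ : Submodule ℝ (Euc (k + 1)))
  have hsq := LinearMap.normDet_sq_eq_det_gram ((perp h).domRestrict (ℝ ∙ v)ᗮ) b
  let c : Fin (Module.finrank ℝ (ℝ ∙ v)ᗮ) → ℝ := fun i => inner ℝ h (b i : Euc (k + 1))
  have hgram : Matrix.gram ℝ (fun i => (perp h).domRestrict (ℝ ∙ v)ᗮ (b i)) =
      1 + Matrix.replicateCol Unit (-c) * Matrix.replicateRow Unit c := by
    ext i j
    have hb := orthonormal_iff_ite.1 b.orthonormal i j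
    rw [Submodule.coe_inner] at hb
    simp only [Matrix.gram_apply, LinearMap.domRestrict_apply, perp_apply, Matrix.add_apply,
      Matrix.mul_apply, Matrix.replicateCol_apply, Matrix.replicateRow_apply, Matrix.one_apply,
      inner_sub_left, inner_sub_right, inner_smul_left, inner_smul_right, hb,
      real_inner_self_eq_norm_sq, hh, c, Finset.univ_unique, Finset.sum_singleton, Pi.neg_apply,
      real_inner_comm h, conj_trivial]
    split_ifs <;> ring
  rw [hgram, Matrix.det_one_add_replicateCol_mul_replicateRow] at hsq
  have hpv : ‖h‖ ^ 2 = (inner ℝ v h : ℝ) ^ 2 + ∑ i, c i ^ 2 := by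
    have h1 := norm_perp_sq hv h
    have hmem : perp v h ∈ (ℝ ∙ v)ᗮ := by
      rw [Submodule.mem_orthogonal_singleton_iff_inner_right]
      exact inner_perp hv h
    have h2 := b.sum_sq_norm_inner_right ⟨perp v h, hmem⟩
    have h3 : ∀ i, ‖(inner ℝ (b i) (⟨perp v h, hmem⟩ : (ℝ ∙ v)ᗮ) : ℝ)‖ ^ 2 = c i ^ 2 := by
      intro i
      have hbi : inner ℝ (b i : Euc (k + 1)) v = (0 : ℝ) := by
        have := (b i).2
        rw [Submodule.mem_orthogonal_singleton_iff_inner_left] at this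
        exact this
      rw [Submodule.coe_inner, Real.norm_eq_abs, sq_abs]
      simp [perp_apply, inner_sub_right, inner_smul_right, hbi, c, real_inner_comm]
    rw [Finset.sum_congr rfl fun i _ => h3 i] at h2
    have h4 : ‖(⟨perp v h, hmem⟩ : (ℝ ∙ v)ᗮ)‖ = ‖perp v h‖ := rfl
    rw [h4, h1] at h2
    linarith
  have hdot : c ⬝ᵥ (-c) = -∑ i, c i ^ 2 := by
    simp [dotProduct, sq]
  rw [hdot, hh] at *
  have hfin : ((perp h).domRestrict (ℝ ∙ v)ᗮ).normDet ^ 2 = (inner ℝ h v : ℝ) ^ 2 := by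
    have h5 : (((perp h).domRestrict (ℝ ∙ v)ᗮ).normDet ^ 2 : ℝ) = 1 + -∑ i, c i ^ 2 := by
      simpa [dotProduct, sq] using hsq
    rw [h5, real_inner_comm]
    linarith
  rw [← abs_of_nonneg (LinearMap.normDet_nonneg ((perp h).domRestrict (ℝ ∙ v)ᗮ))]
  exact (sq_eq_sq_iff_abs_eq_abs _ _).1 hfin

theorem finrank_orthogonal_span {k : ℕ} {v : Euc (k + 1)} (hv : ‖v‖ = 1) :
    Module.finrank ℝ (ℝ ∙ v)ᗮ = k := by
  have : Fact (Module.finrank ℝ (Euc (k + 1)) = k + 1) := ⟨by simp⟩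
  exact Submodule.finrank_orthogonal_span_singleton (by rintro rfl; simp at hv)

/-- The linear area formula for the projection restricted to the hyperplane `vᗮ`, with the Jacobian
from `normDet_perp`. -/
theorem euclideanHausdorffMeasure_perp_image {k : ℕ} {v h : Euc (k + 1)} (hv : ‖v‖ = 1)
    (hh : ‖h‖ = 1) (s : Set (Euc (k + 1))) :
    μHE[k] (perp h '' (perp v '' s)) =
      ENNReal.ofReal |(inner ℝ h v : ℝ)| * μHE[k] (perp v '' s) := by
  have hmem : ∀ y, perp v y ∈ (ℝ ∙ v)ᗮ := fun y => by
    rw [Submodule.mem_orthogonal_singleton_iff_inner_right]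
    exact inner_perp hv y
  let t : Set ((ℝ ∙ v)ᗮ : Submodule ℝ (Euc (k + 1))) := (fun y => ⟨perp v y, hmem y⟩) '' s
  have ht : Subtype.val '' t = perp v '' s := by simp [t, image_image]
  have h1 := LinearMap.euclideanHausdorffMeasure_image ((perp h).domRestrict (ℝ ∙ v)ᗮ) t
  have h2 : μHE[k] t = μHE[k] (perp v '' s) :=
    (isometry_subtype_coe.euclideanHausdorffMeasure_image t).symm.trans (congrArg _ ht)
  rw [finrank_orthogonal_span hv, normDet_perp hv hh, h2] at h1
  rw [← h1, ← ht, image_image, image_image, image_image]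
  rfl

/-- On a flat set, increments are almost orthogonal to `v`. -/
def Flat {k : ℕ} (E : Set (Euc k)) (v : Euc k) (η : ℝ) : Prop :=
  ∀ y ∈ E, ∀ y' ∈ E, |(inner ℝ v (y - y') : ℝ)| ≤ η * ‖y - y'‖

theorem Flat.mono {k : ℕ} {E F : Set (Euc k)} {v : Euc k} {η : ℝ} (hF : Flat F v η) (h : E ⊆ F) :
    Flat E v η := fun y hy y' hy' => hF y (h hy) y' (h hy')

/-- Pythagoras: the component along `v` is at most `η` times the whole, so dropping it costs a
factor `(1 - η²)^(-1/2)`, which is at most `1 + η` for these `η`. -/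
theorem Flat.norm_le {k : ℕ} {E : Set (Euc k)} {v : Euc k} {η : ℝ} (hE : Flat E v η)
    (hv : ‖v‖ = 1) (hη : 0 ≤ η) (hη' : η ≤ 1 / 2) {y y' : Euc k} (hy : y ∈ E) (hy' : y' ∈ E) :
    ‖y - y'‖ ≤ (1 + η) * ‖perp v y - perp v y'‖ := by
  rw [← map_sub]
  have h1 := hE y hy y' hy'
  have h2 := norm_perp_sq hv (y - y')
  set w := y - y'
  have h3 : (inner ℝ v w : ℝ) ^ 2 ≤ (η * ‖w‖) ^ 2 := sq_le_sq' (by linarith [abs_le.1 h1]) (abs_le.1 h1).2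
  have h4 : (1 - η ^ 2) * ‖w‖ ^ 2 ≤ ‖perp v w‖ ^ 2 := by nlinarith
  have h5 : 1 ≤ (1 + η) ^ 2 * (1 - η ^ 2) := by nlinarith [mul_nonneg hη (sq_nonneg η), sq_nonneg (η^2)]
  apply le_of_sq_le_sq _ (by positivity)
  calc ‖w‖ ^ 2 ≤ ((1 + η) ^ 2 * (1 - η ^ 2)) * ‖w‖ ^ 2 := by nlinarith [sq_nonneg ‖w‖]
    _ = (1 + η) ^ 2 * ((1 - η ^ 2) * ‖w‖ ^ 2) := by ring
    _ ≤ (1 + η) ^ 2 * ‖perp v w‖ ^ 2 := by gcongr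
    _ = _ := by ring

theorem Flat.measure_perp_image_le {k d : ℕ} (E : Set (Euc k)) {v : Euc k} (hv : ‖v‖ = 1) :
    μHE[d] (perp v '' E) ≤ μHE[d] E := by
  simpa using euclideanHausdorffMeasure_image_le ((lipschitzWith_perp hv).lipschitzOnWith (s := E)) d

theorem Flat.measure_le {k d : ℕ} {E : Set (Euc k)} {v : Euc k} {η : ℝ} (hE : Flat E v η)
    (hv : ‖v‖ = 1) (hη : 0 ≤ η) (hη' : η ≤ 1 / 2) :
    μHE[d] E ≤ ENNReal.ofReal ((1 + η) ^ d) * μHE[d] (perp v '' E) := by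
  have := euclideanHausdorffMeasure_image_le_image (f := id) (g := perp v) (s := E)
    (K := Real.toNNReal (1 + η)) (fun z hz z' hz' => by
      rw [id, id, edist_dist, edist_dist, ← ENNReal.ofReal.eq_1, ← ENNReal.ofReal_mul (by linarith), dist_eq_norm, dist_eq_norm]
      exact ENNReal.ofReal_le_ofReal (hE.norm_le hv hη hη' hz hz')) d
  rw [image_id] at this
  rwa [ENNReal.ofReal_pow (by linarith)]

/-- A vector orthogonal to `v` pairs with `h` only through `perp v h`, whose squared norm is `1 -
⟨h, v⟩²`; Cauchy-Schwarz bounds what the projection along `h` can remove. -/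
theorem le_norm_perp_perp {k : ℕ} {v h : Euc k} {c : ℝ} (hv : ‖v‖ = 1) (hh : ‖h‖ = 1) (hc : 0 ≤ c)
    (hcv : c ≤ |(inner ℝ h v : ℝ)|) (w : Euc k) : c * ‖perp v w‖ ≤ ‖perp h (perp v w)‖ := by
  have h1 := norm_perp_sq hh (perp v w)
  have h2 : (inner ℝ h (perp v w) : ℝ) = inner ℝ (perp v h) (perp v w) := by
    have := inner_perp hv w
    rw [perp_apply v h, inner_sub_left, inner_smul_left, this]
    simp
  have h3 := norm_perp_sq hv h
  have h4 := abs_real_inner_le_norm (perp v h) (perp v w)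
  have h5 : (inner ℝ h (perp v w) : ℝ) ^ 2 ≤ (1 - c ^ 2) * ‖perp v w‖ ^ 2 := by
    rw [h2, ← sq_abs]
    calc |(inner ℝ (perp v h) (perp v w) : ℝ)| ^ 2 ≤ (‖perp v h‖ * ‖perp v w‖) ^ 2 := by gcongr
      _ = ‖perp v h‖ ^ 2 * ‖perp v w‖ ^ 2 := by ring
      _ ≤ (1 - c ^ 2) * ‖perp v w‖ ^ 2 := by
        gcongr
        rw [h3, hh, real_inner_comm, ← sq_abs (inner ℝ h v : ℝ)]
        nlinarith
  apply le_of_sq_le_sq _ (norm_nonneg _)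
  nlinarith

/-- The linear model of `ψ` on a flat set is `l • perp h ∘ perp v`, whose effect on measure is known
exactly. Replacing `y` by `perp v y` and `ψ` by its derivative costs `O(η)` times the increment. By
`le_norm_perp_perp` this is small relative to the increment of the model, which is what a Lipschitz
comparison of measures needs. -/
theorem Flat.dist_image_bounds {k : ℕ} {E : Set (Euc k)} {v h : Euc k} {η c l : ℝ}
    (hE : Flat E v η) (hv : ‖v‖ = 1) (hh : ‖h‖ = 1) (hc : 0 < c) (hcv : c ≤ |(inner ℝ h v : ℝ)|)
    (hl : 0 < l) (hη : 0 ≤ η) (hη' : η ≤ 1 / 2) {ψ : Euc k → Euc k}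
    (hψ : ∀ y ∈ E, ∀ y' ∈ E, ‖ψ y - ψ y' - l • perp h (y - y')‖ ≤ η * ‖y - y'‖)
    {y y' : Euc k} (hy : y ∈ E) (hy' : y' ∈ E) :
    |‖ψ y - ψ y'‖ - ‖l • perp h (perp v y) - l • perp h (perp v y')‖| ≤
      2 * (1 + l) * η / (c * l) * ‖l • perp h (perp v y) - l • perp h (perp v y')‖ := by
  have hw := hE.norm_le hv hη hη' hy hy'
  have hin := hE y hy y' hy'
  have hps := hψ y hy y' hy'
  rw [← smul_sub, ← map_sub, ← map_sub] at *
  set w := y - y'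
  have hb := le_norm_perp_perp hv hh hc.le hcv w
  have hw2 : ‖w‖ ≤ 2 * ‖perp v w‖ := hw.trans (by gcongr; linarith)
  have hdec : perp h w = perp h (perp v w) + (inner ℝ v w : ℝ) • perp h v := by
    rw [← map_smul, ← map_add, perp_apply v w, sub_add_cancel]
  have hpv : ‖perp h v‖ ≤ 1 := (norm_perp_le hh v).trans hv.le
  have hd : ‖ψ y - ψ y' - l • perp h (perp v w)‖ ≤ (1 + l) * η * ‖w‖ := by
    have e1 : ψ y - ψ y' - l • perp h (perp v w) =
        (ψ y - ψ y' - l • perp h w) + (l * inner ℝ v w : ℝ) • perp h v := by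
      rw [hdec, smul_add, mul_smul]; abel
    rw [e1]
    calc _ ≤ ‖ψ y - ψ y' - l • perp h w‖ + ‖(l * inner ℝ v w : ℝ) • perp h v‖ := norm_add_le _ _
      _ ≤ η * ‖w‖ + l * (η * ‖w‖) * 1 := by
        rw [norm_smul, norm_mul, Real.norm_of_nonneg hl.le]
        gcongr
        exact hin
      _ = _ := by ring
  have hlb : c * l * ‖perp v w‖ ≤ ‖l • perp h (perp v w)‖ := by
    rw [norm_smul, Real.norm_of_nonneg hl.le]
    nlinarith
  refine (abs_norm_sub_norm_le _ _).trans (hd.trans ?_)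
  rw [div_mul_eq_mul_div, le_div_iff₀ (by positivity)]
  calc (1 + l) * η * ‖w‖ * (c * l) ≤ (1 + l) * η * (2 * ‖perp v w‖) * (c * l) := by gcongr
    _ = 2 * (1 + l) * η * (c * l * ‖perp v w‖) := by ring
    _ ≤ _ := by gcongr

/-- A relative error below `1` cannot cancel a nonzero increment of the linear model, and the model
is injective on a flat set. -/
theorem Flat.injOn {k : ℕ} {E : Set (Euc k)} {v h : Euc k} {η c l : ℝ}
    (hE : Flat E v η) (hv : ‖v‖ = 1) (hh : ‖h‖ = 1) (hc : 0 < c) (hcv : c ≤ |(inner ℝ h v : ℝ)|)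
    (hl : 0 < l) (hη : 0 ≤ η) (hη' : η ≤ 1 / 2) {ψ : Euc k → Euc k}
    (hψ : ∀ y ∈ E, ∀ y' ∈ E, ‖ψ y - ψ y' - l • perp h (y - y')‖ ≤ η * ‖y - y'‖)
    (hsmall : 2 * (1 + l) * η / (c * l) < 1) : InjOn ψ E := by
  intro y hy y' hy' hyy
  have hb := hE.dist_image_bounds hv hh hc hcv hl hη hη' hψ hy hy'
  have hw := hE.norm_le hv hη hη' hy hy'
  rw [hyy, sub_self, norm_zero, zero_sub, abs_neg, abs_of_nonneg (norm_nonneg _), ← smul_sub,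
    ← map_sub, ← map_sub, norm_smul, Real.norm_of_nonneg hl.le] at hb
  rw [← map_sub] at hw
  have h1 := le_norm_perp_perp hv hh hc.le hcv (y - y')
  have h2 : ‖perp h (perp v (y - y'))‖ = 0 := by
    by_contra hne
    have : 0 < ‖perp h (perp v (y - y'))‖ := lt_of_le_of_ne (norm_nonneg _) (Ne.symm hne)
    have : 0 < l * ‖perp h (perp v (y - y'))‖ := by positivity
    nlinarith
  have h3 : ‖perp v (y - y')‖ = 0 := by
    rw [h2] at h1
    nlinarith [norm_nonneg (perp v (y - y'))]
  rw [h3, mul_zero] at hw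
  exact sub_eq_zero.1 (norm_le_zero_iff.1 hw)

-- Measures are compared along `E`, `perp v '' E`, the image under the model, and `ψ '' E`. The
-- middle step is an exact scaling by `l ^ k * |⟨h, v⟩|`; the other two are Lipschitz comparisons
-- with constants close to `1`.
open scoped Pointwise in
theorem Flat.measure_image_bounds {k : ℕ} {E : Set (Euc (k + 1))} {v h : Euc (k + 1)} {η c l : ℝ}
    (hE : Flat E v η) (hv : ‖v‖ = 1) (hh : ‖h‖ = 1) (hc : 0 < c) (hcv : c ≤ |(inner ℝ h v : ℝ)|)
    (hl : 0 < l) (hη : 0 ≤ η) (hη' : η ≤ 1 / 2) {ψ : Euc (k + 1) → Euc (k + 1)}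
    (hψ : ∀ y ∈ E, ∀ y' ∈ E, ‖ψ y - ψ y' - l • perp h (y - y')‖ ≤ η * ‖y - y'‖)
    (hsmall : 2 * (1 + l) * η / (c * l) < 1) :
    μHE[k] (ψ '' E) ≤ ENNReal.ofReal ((1 + 2 * (1 + l) * η / (c * l)) ^ k) *
        (ENNReal.ofReal (l ^ k * |(inner ℝ h v : ℝ)|) * μHE[k] E) ∧
      ENNReal.ofReal (l ^ k * |(inner ℝ h v : ℝ)|) * μHE[k] E ≤
        ENNReal.ofReal ((1 + η) ^ k * (1 - 2 * (1 + l) * η / (c * l))⁻¹ ^ k) *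
          μHE[k] (ψ '' E) := by
  have hbd := fun y hy y' hy' => hE.dist_image_bounds hv hh hc hcv hl hη hη' hψ (y := y) (y' := y') hy hy'
  set θ := 2 * (1 + l) * η / (c * l) with hθ
  have hθ0 : 0 ≤ θ := by positivity
  set g : Euc (k + 1) → Euc (k + 1) := fun y => l • perp h (perp v y)
  have hg : μHE[k] (g '' E) = ENNReal.ofReal (l ^ k * |(inner ℝ h v : ℝ)|) * μHE[k] (perp v '' E) := by
    have e1 : g '' E = l • (perp h '' (perp v '' E)) := by
      rw [image_image, ← image_smul, image_image]
    rw [e1, Measure.euclideanHausdorffMeasure_smul₀ k hl.ne', euclideanHausdorffMeasure_perp_image hv hh,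
      ENNReal.ofReal_mul (by positivity), mul_assoc, ENNReal.smul_def, smul_eq_mul, ENNReal.coe_pow,
      ENNReal.ofReal_pow hl.le]
    congr 2
    rw [← enorm_eq_nnnorm, Real.enorm_of_nonneg hl.le]
  constructor
  · have h1 := euclideanHausdorffMeasure_image_le_image (f := ψ) (g := g) (s := E)
      (K := Real.toNNReal (1 + θ)) (fun z hz z' hz' => by
        rw [edist_dist, edist_dist, ← ENNReal.ofReal.eq_1, ← ENNReal.ofReal_mul (by linarith),
          dist_eq_norm, dist_eq_norm]
        refine ENNReal.ofReal_le_ofReal ?_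
        have := (abs_le.1 (hbd z hz z' hz')).2
        linarith) k
    rw [hg, ← ENNReal.ofReal.eq_1, ← ENNReal.ofReal_pow (by linarith)] at h1
    exact h1.trans (mul_le_mul' le_rfl (mul_le_mul' le_rfl (Flat.measure_perp_image_le E hv)))
  · have h1 := euclideanHausdorffMeasure_image_le_image (f := g) (g := ψ) (s := E)
      (K := Real.toNNReal ((1 - θ)⁻¹)) (fun z hz z' hz' => by
        have hp : 0 < 1 - θ := by linarith
        rw [edist_dist, edist_dist, ← ENNReal.ofReal.eq_1, ← ENNReal.ofReal_mul (by positivity),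
          dist_eq_norm, dist_eq_norm]
        refine ENNReal.ofReal_le_ofReal ?_
        rw [inv_mul_eq_div, le_div_iff₀ hp]
        have := (abs_le.1 (hbd z hz z' hz')).1
        linarith) k
    have hp : 0 ≤ (1 - θ)⁻¹ := inv_nonneg.2 (by linarith)
    rw [hg, ← ENNReal.ofReal.eq_1, ← ENNReal.ofReal_pow hp] at h1
    calc _ ≤ ENNReal.ofReal (l ^ k * |(inner ℝ h v : ℝ)|) *
          (ENNReal.ofReal ((1 + η) ^ k) * μHE[k] (perp v '' E)) := by
          gcongr; exact hE.measure_le hv hη hη'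
      _ = ENNReal.ofReal ((1 + η) ^ k) *
          (ENNReal.ofReal (l ^ k * |(inner ℝ h v : ℝ)|) * μHE[k] (perp v '' E)) := mul_left_comm _ _ _
      _ ≤ ENNReal.ofReal ((1 + η) ^ k) * (ENNReal.ofReal ((1 - θ)⁻¹ ^ k) * μHE[k] (ψ '' E)) := by
          gcongr
      _ = _ := by rw [← mul_assoc, ← ENNReal.ofReal_mul (by positivity)]

/-- `v` is a unit normal of `Γ` at `x` in the strict sense: `Γ` is arbitrarily flat near `x`. -/
def StrictNormal {k : ℕ} (Γ : Set (Euc k)) (x v : Euc k) : Prop :=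
  ‖v‖ = 1 ∧ ∀ η > 0, ∃ ρ > 0, Flat (Γ ∩ Metric.ball x ρ) v η

theorem StrictNormal.mono {k : ℕ} {Γ Γ' : Set (Euc k)} {x v : Euc k} (h : StrictNormal Γ' x v)
    (hs : Γ ⊆ Γ') : StrictNormal Γ x v :=
  ⟨h.1, fun η hη => let ⟨ρ, hρ, hf⟩ := h.2 η hη; ⟨ρ, hρ, hf.mono (inter_subset_inter_left _ hs)⟩⟩

/-- `ψ` is strictly differentiable at `x` along `Γ`, with derivative `l • perp h`. -/
def StrictPerp {k : ℕ} (Γ : Set (Euc k)) (ψ : Euc k → Euc k) (x h : Euc k) (l : ℝ) : Prop :=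
  ∀ η > 0, ∃ ρ > 0, ∀ y ∈ Γ ∩ Metric.ball x ρ, ∀ y' ∈ Γ ∩ Metric.ball x ρ,
    ‖ψ y - ψ y' - l • perp h (y - y')‖ ≤ η * ‖y - y'‖

/-- Both distortion factors of `Flat.measure_image_bounds` tend to `1` as `η → 0`, so some positive
`η` keeps them below `δ`. Flatness and strict differentiability at that `η` provide the
neighbourhood. -/
theorem StrictNormal.exists_measure_image_bounds {k : ℕ} {Γ : Set (Euc (k + 1))}
    {x v h : Euc (k + 1)} {l : ℝ} {ψ : Euc (k + 1) → Euc (k + 1)} (hv : StrictNormal Γ x v)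
    (hψ : StrictPerp Γ ψ x h l) (hh : ‖h‖ = 1) (hhv : (inner ℝ h v : ℝ) ≠ 0) (hl : 0 < l)
    {δ : ℝ≥0} (hδ : 1 < δ) :
    ∃ N ∈ 𝓝 x, InjOn ψ (Γ ∩ N) ∧ ∀ E ⊆ Γ ∩ N,
      μHE[k] (ψ '' E) ≤ δ * (ENNReal.ofReal (l ^ k * |(inner ℝ h v : ℝ)|) * μHE[k] E) ∧
      ENNReal.ofReal (l ^ k * |(inner ℝ h v : ℝ)|) * μHE[k] E ≤ δ * μHE[k] (ψ '' E) := by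
  set c := |(inner ℝ h v : ℝ)| with hc
  have hc0 : 0 < c := abs_pos.2 hhv
  have hδ' : (1 : ℝ) < δ := by exact_mod_cast hδ
  have t0 : Tendsto (fun η : ℝ => 2 * (1 + l) * η / (c * l)) (𝓝 0) (𝓝 0) := by
    have : Continuous fun η : ℝ => 2 * (1 + l) * η / (c * l) := by fun_prop
    simpa using this.tendsto 0
  have t1 : Tendsto (fun η : ℝ => (1 + 2 * (1 + l) * η / (c * l)) ^ k) (𝓝 0) (𝓝 1) := by
    simpa using (t0.const_add 1).pow k
  have t2 : Tendsto (fun η : ℝ => (1 + η) ^ k * (1 - 2 * (1 + l) * η / (c * l))⁻¹ ^ k) (𝓝 0)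
      (𝓝 1) := by
    have ha : Tendsto (fun η : ℝ => (1 + η) ^ k) (𝓝 0) (𝓝 ((1 + 0) ^ k)) :=
      (tendsto_id.const_add 1).pow k
    have hb := ((t0.const_sub 1).inv₀ (by norm_num)).pow k
    simpa using ha.mul hb
  have hev : ∀ᶠ η in 𝓝[>] (0 : ℝ), 0 < η ∧ η ≤ 1 / 2 ∧ 2 * (1 + l) * η / (c * l) < 1 ∧
      (1 + 2 * (1 + l) * η / (c * l)) ^ k < δ ∧
      (1 + η) ^ k * (1 - 2 * (1 + l) * η / (c * l))⁻¹ ^ k < δ := by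
    refine Filter.Eventually.and self_mem_nhdsWithin ?_
    refine (Filter.Eventually.and ?_ (Filter.Eventually.and ?_ (Filter.Eventually.and ?_ ?_))).filter_mono
      nhdsWithin_le_nhds
    · exact tendsto_id.eventually_le_const (by norm_num)
    · exact t0.eventually_lt_const (by norm_num)
    · exact t1.eventually_lt_const hδ'
    · exact t2.eventually_lt_const hδ'
  obtain ⟨η, hη0, hη1, hη2, hη3, hη4⟩ := hev.exists
  obtain ⟨ρ₁, hρ₁, hf⟩ := hv.2 η hη0
  obtain ⟨ρ₂, hρ₂, hp⟩ := hψ η hη0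
  refine ⟨Metric.ball x ρ₁ ∩ Metric.ball x ρ₂,
    inter_mem (Metric.ball_mem_nhds x hρ₁) (Metric.ball_mem_nhds x hρ₂),
    (hf.mono (E := Γ ∩ _) fun y hy => ⟨hy.1, hy.2.1⟩).injOn hv.1 hh hc0
    le_rfl hl hη0.le hη1 (fun y hy y' hy' => hp y ⟨hy.1, hy.2.2⟩ y'
      ⟨hy'.1, hy'.2.2⟩) hη2, fun E hE => ?_⟩
  have hb := (hf.mono (E := E) fun y hy => ⟨(hE hy).1, (hE hy).2.1⟩).measure_image_bounds hv.1 hh hc0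
    le_rfl hl hη0.le hη1 (fun y hy y' hy' => hp y ⟨(hE hy).1, (hE hy).2.2⟩ y'
      ⟨(hE hy').1, (hE hy').2.2⟩) hη2
  have hco : ∀ r : ℝ, r < δ → ENNReal.ofReal r ≤ (δ : ℝ≥0∞) := fun r hr => by
    rw [← ENNReal.ofReal_coe_nnreal]
    exact ENNReal.ofReal_le_ofReal hr.le
  exact ⟨hb.1.trans (by gcongr; exact hco _ hη3), hb.2.trans (by gcongr; exact hco _ hη4)⟩

/-! ### Local comparison of measures -/

/-- A set with a positive measurable weight can be cut into countably many pieces, each in a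
prescribed neighbourhood of some point of the set, on which the weight is almost constant. -/
theorem exists_partition {X : Type*} [TopologicalSpace X] [SecondCountableTopology X]
    [MeasurableSpace X] [OpensMeasurableSpace X] {Γ : Set X} (hΓ : MeasurableSet Γ)
    (hne : Γ.Nonempty) {w : X → ℝ≥0} (hw : Measurable w) (hw0 : ∀ x ∈ Γ, 0 < w x) {δ : ℝ≥0}
    (hδ : 1 < δ) {N : X → Set X} (hN : ∀ x ∈ Γ, N x ∈ 𝓝 x) :
    ∃ (c : ℕ → X) (E : ℕ → Set X), (∀ i, c i ∈ Γ) ∧ (∀ i, MeasurableSet (E i)) ∧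
      (∀ i, E i ⊆ Γ ∩ N (c i)) ∧ Pairwise (Function.onFun Disjoint E) ∧ (⋃ i, E i) = Γ ∧
      ∀ i, ∀ y ∈ E i, w y ≤ δ * w (c i) ∧ w (c i) ≤ δ * w y := by
  have hδ0 : 0 < δ := zero_lt_one.trans hδ
  -- The cover is taken on the graph of `w`, so that a single countable subcover controls both the
  -- position and the value of the weight.
  let f : X × ℝ≥0 → Set (X × ℝ≥0) := fun p => interior (N p.1) ×ˢ Ioo (p.2 / δ) (p.2 * δ)
  let s : Set (X × ℝ≥0) := (fun x => (x, w x)) '' Γ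
  have hf : ∀ p ∈ s, f p ∈ 𝓝[s] p := by
    rintro _ ⟨x, hx, rfl⟩
    refine mem_nhdsWithin_of_mem_nhds (prod_mem_nhds (interior_mem_nhds.2 (hN x hx)) ?_)
    refine Ioo_mem_nhds ?_ ?_
    · exact div_lt_self (hw0 x hx) hδ
    · exact lt_mul_of_one_lt_right (hw0 x hx) hδ
  obtain ⟨t, hts, htc, hst⟩ := TopologicalSpace.countable_cover_nhdsWithin hf
  obtain ⟨x₀, hx₀⟩ := hne
  have htne : t.Nonempty := by
    have := hst ⟨x₀, hx₀, rfl⟩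
    rw [mem_iUnion₂] at this
    obtain ⟨p, hp, -⟩ := this
    exact ⟨p, hp⟩
  obtain ⟨q, hq⟩ := htc.exists_eq_range htne
  have hqs : ∀ i, ∃ x ∈ Γ, (x, w x) = q i := fun i => hts (hq ▸ mem_range_self i)
  choose c hc hcq using hqs
  let P : ℕ → Set X := fun i => Γ ∩ {y | (y, w y) ∈ f (q i)}
  have hPm : ∀ i, MeasurableSet (P i) := fun i =>
    hΓ.inter ((measurable_id.prodMk hw) (isOpen_interior.measurableSet.prod measurableSet_Ioo))
  refine ⟨c, disjointed P, hc, fun i => .disjointed hPm i, fun i y hy => ?_, disjoint_disjointed P,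
    ?_, fun i y hy => ?_⟩
  · have hy' := disjointed_subset P i hy
    rw [show P i = Γ ∩ {y | (y, w y) ∈ f (q i)} from rfl, ← hcq i] at hy'
    exact ⟨hy'.1, interior_subset hy'.2.1⟩
  · rw [iUnion_disjointed]
    refine Subset.antisymm (iUnion_subset fun i => inter_subset_left) fun x hx => ?_
    have := hst ⟨x, hx, rfl⟩
    rw [mem_iUnion₂] at this
    obtain ⟨p, hp, hxp⟩ := this
    rw [hq] at hp
    obtain ⟨i, rfl⟩ := hp
    exact mem_iUnion.2 ⟨i, hx, hxp⟩
  · have hy' := disjointed_subset P i hy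
    rw [show P i = Γ ∩ {y | (y, w y) ∈ f (q i)} from rfl, ← hcq i] at hy'
    have h2 := hy'.2.2
    simp only [mem_Ioo] at h2
    exact ⟨by rw [mul_comm]; exact h2.2.le, by rw [mul_comm]; exact ((div_lt_iff₀ hδ0).1 h2.1).le⟩

theorem ENNReal_le_of_forall_one_lt_mul {a b : ℝ≥0∞} (h : ∀ δ : ℝ≥0, 1 < δ → a ≤ δ * b) : a ≤ b := by
  have ht : Tendsto (fun δ : ℝ≥0 => (δ : ℝ≥0∞) * b) (𝓝[>] 1) (𝓝 ((1 : ℝ≥0) * b)) := by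
    refine ENNReal.Tendsto.mul_const ?_ (Or.inl (by simp))
    exact (ENNReal.tendsto_coe.2 tendsto_id).mono_left nhdsWithin_le_nhds
  rw [ENNReal.coe_one, one_mul] at ht
  exact ge_of_tendsto ht (by filter_upwards [self_mem_nhdsWithin] with δ hδ using h δ hδ)

theorem setLIntegral_bounds {X : Type*} [MeasurableSpace X] {μ : Measure X} {E : Set X}
    (hE : MeasurableSet E) {w : X → ℝ≥0} {a δ : ℝ≥0}
    (h : ∀ y ∈ E, w y ≤ δ * a ∧ a ≤ δ * w y) :
    ∫⁻ y in E, w y ∂μ ≤ δ * (a * μ E) ∧ a * μ E ≤ δ * ∫⁻ y in E, w y ∂μ := by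
  constructor
  · calc ∫⁻ y in E, w y ∂μ ≤ ∫⁻ y in E, (δ * a : ℝ≥0∞) ∂μ :=
          setLIntegral_mono' hE fun y hy => by exact_mod_cast (h y hy).1
      _ = _ := by rw [setLIntegral_const, mul_assoc]
  · calc a * μ E = ∫⁻ y in E, (a : ℝ≥0∞) ∂μ := by rw [setLIntegral_const]
      _ ≤ ∫⁻ y in E, (δ * w y : ℝ≥0∞) ∂μ :=
          setLIntegral_mono' hE fun y hy => by exact_mod_cast (h y hy).2
      _ = _ := lintegral_const_mul' _ _ ENNReal.coe_ne_top

/-- The passage from infinitesimal to global ratios: on each piece of a partition the weight is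
constant up to `δ` and `m` is that multiple of `μ` up to `δ`; one sums and lets `δ → 1`. Only
countable additivity inside `Γ` is required, so `m` may be the measure of the image under a map
injective on `Γ`. -/
theorem eq_lintegral_of_local_ratio {X : Type*} [TopologicalSpace X] [SecondCountableTopology X]
    [MeasurableSpace X] [OpensMeasurableSpace X] {μ : Measure X} {m : Set X → ℝ≥0∞} {Γ : Set X}
    (hΓ : MeasurableSet Γ) {w : X → ℝ≥0} (hw : Measurable w) (hw0 : ∀ x ∈ Γ, 0 < w x)
    (hm0 : m ∅ = 0)
    (hm : ∀ E : ℕ → Set X, (∀ i, MeasurableSet (E i)) → (∀ i, E i ⊆ Γ) →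
      Pairwise (Function.onFun Disjoint E) → m (⋃ i, E i) = ∑' i, m (E i))
    (hloc : ∀ x ∈ Γ, ∀ δ : ℝ≥0, 1 < δ → ∃ N ∈ 𝓝 x, ∀ E, MeasurableSet E → E ⊆ Γ ∩ N →
      m E ≤ δ * (w x * μ E) ∧ w x * μ E ≤ δ * m E) :
    m Γ = ∫⁻ x in Γ, w x ∂μ := by
  rcases Γ.eq_empty_or_nonempty with rfl | hne
  · simp [hm0]
  have key : ∀ δ : ℝ≥0, 1 < δ → m Γ ≤ (δ * δ : ℝ≥0) * ∫⁻ x in Γ, w x ∂μ ∧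
      ∫⁻ x in Γ, w x ∂μ ≤ (δ * δ : ℝ≥0) * m Γ := by
    intro δ hδ
    have hch : ∀ x, ∃ N : Set X, x ∈ Γ → N ∈ 𝓝 x ∧ ∀ E, MeasurableSet E → E ⊆ Γ ∩ N →
        m E ≤ δ * (w x * μ E) ∧ w x * μ E ≤ δ * m E := fun x => by
      by_cases hx : x ∈ Γ
      · obtain ⟨N, hN, h⟩ := hloc x hx δ hδ
        exact ⟨N, fun _ => ⟨hN, h⟩⟩
      · exact ⟨univ, fun h => absurd h hx⟩
    choose N hN using hch
    obtain ⟨c, E, hc, hEm, hEN, hEd, hEU, hEw⟩ :=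
      exists_partition hΓ hne hw hw0 hδ (N := N) fun x hx => (hN x hx).1
    have h1 : m Γ = ∑' i, m (E i) := by
      rw [← hm E hEm (fun i => (hEN i).trans inter_subset_left) hEd, hEU]
    have h2 : ∫⁻ x in Γ, w x ∂μ = ∑' i, ∫⁻ x in E i, w x ∂μ := by
      rw [← hEU, lintegral_iUnion hEm hEd]
    rw [h1, h2, ← ENNReal.tsum_mul_left, ← ENNReal.tsum_mul_left, ENNReal.coe_mul]
    constructor <;> refine ENNReal.tsum_le_tsum fun i => ?_
    · have ha := ((hN _ (hc i)).2 (E i) (hEm i) (hEN i)).1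
      have hb := (setLIntegral_bounds (μ := μ) (hEm i) (hEw i)).2
      calc m (E i) ≤ δ * (w (c i) * μ (E i)) := ha
        _ ≤ δ * (δ * ∫⁻ y in E i, w y ∂μ) := by gcongr
        _ = _ := by rw [mul_assoc]
    · have ha := ((hN _ (hc i)).2 (E i) (hEm i) (hEN i)).2
      have hb := (setLIntegral_bounds (μ := μ) (hEm i) (hEw i)).1
      calc _ ≤ δ * (w (c i) * μ (E i)) := hb
        _ ≤ δ * (δ * m (E i)) := by gcongr
        _ = _ := by rw [mul_assoc]
  -- Two comparisons at ratio `δ` cost `δ²`, hence the square root.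
  have hsq : ∀ a b : ℝ≥0∞, (∀ δ : ℝ≥0, 1 < δ → a ≤ (δ * δ : ℝ≥0) * b) → a ≤ b := fun a b h => by
    refine ENNReal_le_of_forall_one_lt_mul fun δ hδ => ?_
    have := h (NNReal.sqrt δ) (by simpa using NNReal.sqrt_lt_sqrt.2 hδ)
    rwa [NNReal.mul_self_sqrt] at this
  exact le_antisymm (hsq _ _ fun δ hδ => (key δ hδ).1) (hsq _ _ fun δ hδ => (key δ hδ).2)

/-! ### Area formula for maps that look like projections -/

theorem StrictPerp.continuousOn {k : ℕ} {Γ : Set (Euc k)} {ψ h : Euc k → Euc k} {l : Euc k → ℝ}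
    (hψ : ∀ x ∈ Γ, StrictPerp Γ ψ x (h x) (l x)) : ContinuousOn ψ Γ := by
  intro x hx
  obtain ⟨ρ, hρ, hp⟩ := hψ x hx 1 one_pos
  have hlin : Tendsto (fun y => l x • perp (h x) (y - x) ) (𝓝 x) (𝓝 0) := by
    have : Continuous fun y => l x • perp (h x) (y - x) :=
      ((continuous_perp (h x)).comp (continuous_id.sub continuous_const)).const_smul (l x)
    simpa using this.tendsto x
  have hb : Tendsto (fun y => ‖y - x‖ + ‖l x • perp (h x) (y - x)‖) (𝓝[Γ] x) (𝓝 0) := by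
    have h1 : Tendsto (fun y => ‖y - x‖) (𝓝 x) (𝓝 0) := by
      have : Continuous fun y : Euc k => ‖y - x‖ := by fun_prop
      simpa using this.tendsto x
    simpa using (h1.add hlin.norm).mono_left nhdsWithin_le_nhds
  refine tendsto_iff_norm_sub_tendsto_zero.2 (squeeze_zero' (.of_forall fun _ => norm_nonneg _) ?_ hb)
  filter_upwards [inter_mem_nhdsWithin Γ (Metric.ball_mem_nhds x hρ)] with y hy
  have := hp y hy x ⟨hx, Metric.mem_ball_self hρ⟩
  calc ‖ψ y - ψ x‖ = ‖(ψ y - ψ x - l x • perp (h x) (y - x)) + l x • perp (h x) (y - x)‖ := by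
        rw [sub_add_cancel]
    _ ≤ _ := (norm_add_le _ _).trans (by linarith)

theorem StrictPerp.mono {k : ℕ} {Γ Γ' : Set (Euc k)} {ψ : Euc k → Euc k} {x h : Euc k} {l : ℝ}
    (hψ : StrictPerp Γ' ψ x h l) (hs : Γ ⊆ Γ') : StrictPerp Γ ψ x h l := fun η hη =>
  let ⟨ρ, hρ, hp⟩ := hψ η hη
  ⟨ρ, hρ, fun y hy y' hy' => hp y ⟨hs hy.1, hy.2⟩ y' ⟨hs hy'.1, hy'.2⟩⟩

/-- Injectivity makes `E ↦ μHE[k] (ψ '' E)` additive, the images being Borel as injective continuous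
images of Borel sets; `StrictNormal.exists_measure_image_bounds` gives the local ratio to the
measure on `Γ`. -/
theorem area_formula {k : ℕ} {Γ : Set (Euc (k + 1))} (hΓ : MeasurableSet Γ)
    {ν h ψ : Euc (k + 1) → Euc (k + 1)} {l : Euc (k + 1) → ℝ}
    (hν : ∀ x ∈ Γ, StrictNormal Γ x (ν x)) (hψ : ∀ x ∈ Γ, StrictPerp Γ ψ x (h x) (l x))
    (hh : ∀ x ∈ Γ, ‖h x‖ = 1) (hl : ∀ x ∈ Γ, 0 < l x)
    (hhν : ∀ x ∈ Γ, (inner ℝ (h x) (ν x) : ℝ) ≠ 0) (hinj : InjOn ψ Γ)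
    (hm : Measurable fun x => l x ^ k * |(inner ℝ (h x) (ν x) : ℝ)|) :
    μHE[k] (ψ '' Γ) =
      ∫⁻ x in Γ, ENNReal.ofReal (l x ^ k * |(inner ℝ (h x) (ν x) : ℝ)|) ∂μHE[k] := by
  refine eq_lintegral_of_local_ratio (μ := μHE[k]) (m := fun E => μHE[k] (ψ '' E)) hΓ
    (w := fun x => Real.toNNReal (l x ^ k * |(inner ℝ (h x) (ν x) : ℝ)|)) hm.real_toNNReal ?_
    (by simp) ?_ ?_
  · intro x hx
    have := hl x hx
    have := abs_pos.2 (hhν x hx)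
    rw [Real.toNNReal_pos]
    positivity
  · intro E hE hEΓ hd
    simp only
    rw [image_iUnion, measure_iUnion]
    · intro i j hij
      exact (hd hij).image hinj (hEΓ i) (hEΓ j)
    · exact fun i => (hE i).image_of_continuousOn_injOn
        ((StrictPerp.continuousOn hψ).mono (hEΓ i)) (hinj.mono (hEΓ i))
  · intro x hx δ hδ
    obtain ⟨N, hN, -, hb⟩ := (hν x hx).exists_measure_image_bounds (hψ x hx) (hh x hx) (hhν x hx)
      (hl x hx) hδ
    exact ⟨N, hN, fun E _ hE => hb E hE⟩

/-- Applied to `Γ ∩ ψ ⁻¹' B` for all Borel `B`, the area formula says that the measure on `ψ '' Γ`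
is the push-forward of the weighted measure on `Γ`. -/
theorem area_formula_lintegral {k : ℕ} {Γ : Set (Euc (k + 1))} (hΓ : MeasurableSet Γ)
    {ν h ψ : Euc (k + 1) → Euc (k + 1)} {l : Euc (k + 1) → ℝ}
    (hν : ∀ x ∈ Γ, StrictNormal Γ x (ν x)) (hψ : ∀ x ∈ Γ, StrictPerp Γ ψ x (h x) (l x))
    (hh : ∀ x ∈ Γ, ‖h x‖ = 1) (hl : ∀ x ∈ Γ, 0 < l x)
    (hhν : ∀ x ∈ Γ, (inner ℝ (h x) (ν x) : ℝ) ≠ 0) (hinj : InjOn ψ Γ)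
    (hm : Measurable fun x => l x ^ k * |(inner ℝ (h x) (ν x) : ℝ)|) (hψm : Measurable ψ)
    {G : Euc (k + 1) → ℝ≥0∞} (hG : Measurable G) :
    ∫⁻ y in ψ '' Γ, G y ∂μHE[k] =
      ∫⁻ x in Γ, ENNReal.ofReal (l x ^ k * |(inner ℝ (h x) (ν x) : ℝ)|) * G (ψ x) ∂μHE[k] := by
  have hmeas : (μHE[k] : Measure (Euc (k + 1))).restrict (ψ '' Γ) =
      (((μHE[k] : Measure (Euc (k + 1))).restrict Γ).withDensity fun x =>
        ENNReal.ofReal (l x ^ k * |(inner ℝ (h x) (ν x) : ℝ)|)).map ψ := by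
    ext B hB
    rw [Measure.map_apply hψm hB, withDensity_apply _ (hψm hB), Measure.restrict_apply hB,
      Measure.restrict_restrict (hψm hB), inter_comm, ← image_inter_preimage, inter_comm Γ]
    have hs : ψ ⁻¹' B ∩ Γ ⊆ Γ := inter_subset_right
    exact area_formula ((hψm hB).inter hΓ) (fun x hx => (hν x hx.2).mono hs)
      (fun x hx => (hψ x hx.2).mono hs) (fun x hx => hh x hx.2) (fun x hx => hl x hx.2)
      (fun x hx => hhν x hx.2) (hinj.mono hs) hm
  rw [hmeas, lintegral_map hG hψm]
  exact lintegral_withDensity_eq_lintegral_mul _ hm.ennreal_ofReal (hG.comp hψm)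

theorem strictPerp_perp {k : ℕ} (Γ : Set (Euc k)) (x h : Euc k) :
    StrictPerp Γ (perp h) x h 1 := fun η hη =>
  ⟨1, one_pos, fun y _ y' _ => by simp [← map_sub]; positivity⟩

/-- The area formula for the projection along `h`. -/
theorem area_formula_perp {k : ℕ} {Γ : Set (Euc (k + 1))} (hΓ : MeasurableSet Γ)
    {ν : Euc (k + 1) → Euc (k + 1)} {h : Euc (k + 1)} (hν : ∀ x ∈ Γ, StrictNormal Γ x (ν x))
    (hh : ‖h‖ = 1) (hhν : ∀ x ∈ Γ, (inner ℝ h (ν x) : ℝ) ≠ 0) (hinj : InjOn (perp h) Γ)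
    (hm : Measurable ν) :
    μHE[k] (perp h '' Γ) = ∫⁻ x in Γ, ENNReal.ofReal |(inner ℝ h (ν x) : ℝ)| ∂μHE[k] := by
  have := area_formula (h := fun _ => h) (l := fun _ => 1) hΓ hν (fun x _ => strictPerp_perp Γ x h)
    (fun _ _ => hh) (fun _ _ => one_pos) hhν hinj (by fun_prop)
  simpa using this

/-! ### Slices -/

theorem proj_pt {n : ℕ} (α : ℝ) (u : Euc (n + 1)) : proj (pt α u) = u := by
  ext i; simp [proj, pt]

theorem pt_zero {n : ℕ} (α : ℝ) (u : Euc (n + 1)) : pt α u 0 = α := by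
  simp [pt]

theorem pt_proj {n : ℕ} (x : Euc (n + 2)) : pt (x 0) (proj x) = x := by
  ext i
  refine Fin.cases ?_ (fun j => ?_) i <;> simp [proj, pt]

theorem pt_sub {n : ℕ} (α β : ℝ) (u v : Euc (n + 1)) : pt α u - pt β v = pt (α - β) (u - v) := by
  ext i
  refine Fin.cases ?_ (fun j => ?_) i <;> simp [pt]

theorem pt_add {n : ℕ} (α β : ℝ) (u v : Euc (n + 1)) : pt α u + pt β v = pt (α + β) (u + v) := by
  ext i
  refine Fin.cases ?_ (fun j => ?_) i <;> simp [pt]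

theorem pt_smul {n : ℕ} (c α : ℝ) (u : Euc (n + 1)) : c • pt α u = pt (c * α) (c • u) := by
  ext i
  refine Fin.cases ?_ (fun j => ?_) i <;> simp [pt]

theorem inner_pt {n : ℕ} (x : Euc (n + 2)) (α : ℝ) (u : Euc (n + 1)) :
    (inner ℝ x (pt α u) : ℝ) = x 0 * α + inner ℝ (proj x) u := by
  simp [PiLp.inner_apply, Fin.sum_univ_succ, proj, pt, mul_comm]

theorem norm_pt_sq {n : ℕ} (α : ℝ) (u : Euc (n + 1)) : ‖pt α u‖ ^ 2 = α ^ 2 + ‖u‖ ^ 2 := by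
  rw [← real_inner_self_eq_norm_sq, inner_pt, proj_pt, pt_zero, real_inner_self_eq_norm_sq, sq α]

theorem norm_pt_zero {n : ℕ} (u : Euc (n + 1)) : ‖pt 0 u‖ = ‖u‖ := by
  have := norm_pt_sq 0 u
  rw [← sq_eq_sq₀ (norm_nonneg _) (norm_nonneg _), this]
  ring

theorem proj_sub {n : ℕ} (x y : Euc (n + 2)) : proj (x - y) = proj x - proj y := by
  ext i; simp [proj]

theorem proj_add {n : ℕ} (x y : Euc (n + 2)) : proj (x + y) = proj x + proj y := by
  ext i; simp [proj]

theorem proj_smul {n : ℕ} (c : ℝ) (x : Euc (n + 2)) : proj (c • x) = c • proj x := by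
  ext i; simp [proj]

theorem continuous_proj {n : ℕ} : Continuous (proj : Euc (n + 2) → Euc (n + 1)) := by
  unfold proj
  fun_prop

theorem continuous_pt {n : ℕ} : Continuous fun p : ℝ × Euc (n + 1) => pt p.1 p.2 := by
  unfold pt
  refine (PiLp.continuous_toLp 2 _).comp (continuous_pi fun i => ?_)
  refine Fin.cases ?_ (fun j => ?_) i
  · simpa using continuous_fst
  · simp only [Fin.cons_succ]
    fun_prop

theorem continuous_pt_right {n : ℕ} (α : ℝ) : Continuous fun u : Euc (n + 1) => pt α u :=
  continuous_pt.comp (continuous_const.prodMk continuous_id)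

theorem isometry_pt {n : ℕ} (α : ℝ) : Isometry fun u : Euc (n + 1) => pt α u :=
  Isometry.of_dist_eq fun u v => by rw [dist_eq_norm, dist_eq_norm, pt_sub, sub_self, norm_pt_zero]

theorem norm_proj_le {n : ℕ} (x : Euc (n + 2)) : ‖proj x‖ ≤ ‖x‖ := by
  have := norm_pt_sq (x 0) (proj x)
  rw [pt_proj] at this
  apply le_of_sq_le_sq _ (norm_nonneg _)
  nlinarith [sq_nonneg (x 0)]

theorem abs_zero_le {n : ℕ} (x : Euc (n + 2)) : |x 0| ≤ ‖x‖ := by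
  have := norm_pt_sq (x 0) (proj x)
  rw [pt_proj] at this
  apply le_of_sq_le_sq _ (norm_nonneg _)
  rw [sq_abs]
  nlinarith [sq_nonneg ‖proj x‖]

/-- The slice of `E` at height `α`. -/
def sliceAt {n : ℕ} (E : Set (Euc (n + 2))) (α : ℝ) : Set (Euc (n + 1)) := {u | pt α u ∈ E}

theorem perp_pt {n : ℕ} (r : Euc (n + 1)) (α : ℝ) (u : Euc (n + 1)) :
    perp (pt 0 r) (pt α u) = pt α (perp r u) := by
  rw [perp_apply, perp_apply, inner_pt, proj_pt, pt_zero, pt_smul, pt_sub]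
  simp

/-- Fubini in the hyperplane orthogonal to `(0, r)`. -/
theorem measure_perp_image_eq_lintegral {n : ℕ} {r : Euc (n + 1)} (hr : ‖r‖ = 1)
    {E : Set (Euc (n + 2))} (hE : MeasurableSet (perp (pt 0 r) '' E)) :
    Measurable (fun α => μHE[n] (perp r '' sliceAt E α)) ∧
    μHE[n + 1] (perp (pt 0 r) '' E) = ∫⁻ α : ℝ, μHE[n] (perp r '' sliceAt E α) := by
  let W : Submodule ℝ (Euc (n + 1)) := (ℝ ∙ r)ᗮ
  have hW : Module.finrank ℝ W = n := finrank_orthogonal_span hr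
  have hmem : ∀ y, perp r y ∈ W := fun y => by
    rw [Submodule.mem_orthogonal_singleton_iff_inner_right]
    exact inner_perp hr y
  -- The hyperplane orthogonal to `(0, r)` is isometric to the `L²` product of `ℝ` and `rᗮ`, where
  -- Hausdorff measure is volume and Tonelli applies.
  let j : WithLp 2 (ℝ × W) → Euc (n + 2) := fun p => pt p.fst p.snd
  have hj : Isometry j := Isometry.of_dist_eq fun p q => by
    rw [dist_eq_norm, dist_eq_norm, pt_sub, ← sq_eq_sq₀ (norm_nonneg _) (norm_nonneg _),
      norm_pt_sq, WithLp.prod_norm_sq_eq_of_L2]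
    simp
  have hfr : Module.finrank ℝ (WithLp 2 (ℝ × W)) = n + 1 := by
    rw [(WithLp.linearEquiv 2 ℝ (ℝ × W)).finrank_eq, Module.finrank_prod, hW]
    simp [add_comm]
  let A : Set (ℝ × W) := {p | pt p.1 (p.2 : Euc (n + 1)) ∈ perp (pt 0 r) '' E}
  have hA : MeasurableSet A := by
    refine measurableSet_preimage ?_ hE
    exact (continuous_pt.comp (continuous_fst.prodMk
      (continuous_subtype_val.comp continuous_snd))).measurable
  have himg : perp (pt 0 r) '' E = j '' (WithLp.ofLp ⁻¹' A) := by
    ext y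
    constructor
    · rintro ⟨x, hx, rfl⟩
      refine ⟨WithLp.toLp 2 (x 0, ⟨perp r (proj x), hmem _⟩), ?_, ?_⟩
      · refine ⟨x, hx, ?_⟩
        conv_lhs => rw [← pt_proj x, perp_pt]
      · conv_rhs => rw [← pt_proj x, perp_pt]
        rfl
    · rintro ⟨p, hp, rfl⟩
      exact hp
  have hsl : ∀ α, μHE[n] (perp r '' sliceAt E α) = volume (Prod.mk α ⁻¹' A) := by
    intro α
    have e1 : perp r '' sliceAt E α = Subtype.val '' (Prod.mk α ⁻¹' A) := by
      ext y
      constructor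
      · rintro ⟨u, hu, rfl⟩
        exact ⟨⟨perp r u, hmem _⟩, ⟨pt α u, hu, perp_pt _ _ _⟩, rfl⟩
      · rintro ⟨w, ⟨x, hx, hxw⟩, rfl⟩
        rw [← pt_proj x, perp_pt] at hxw
        have h0 : x 0 = α := by
          have := congrArg (fun z => z 0) hxw
          simpa [pt_zero] using this
        refine ⟨proj x, ?_, ?_⟩
        · rw [sliceAt, mem_ofPred_eq, ← h0, pt_proj]; exact hx
        · have := congrArg proj hxw
          simpa [proj_pt] using this
    rw [e1, ← InnerProductSpace.euclideanHausdorffMeasure_eq_volume, hW]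
    exact isometry_subtype_coe.euclideanHausdorffMeasure_image (X := W) _
  simp_rw [hsl]
  refine ⟨measurable_measure_prodMk_left hA, ?_⟩
  rw [himg, hj.euclideanHausdorffMeasure_image]
  have hvol : (μHE[n + 1] : Measure (WithLp 2 (ℝ × W))) = volume :=
    (congrArg (fun d => (μHE[d] : Measure (WithLp 2 (ℝ × W)))) hfr.symm).trans
      InnerProductSpace.euclideanHausdorffMeasure_eq_volume
  rw [hvol, (WithLp.volume_preserving_ofLp ℝ W).measure_preimage hA.nullMeasurableSet,
    Measure.volume_eq_prod, Measure.prod_apply hA]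

/-- Projection along `(0, r)`, with `r` the normalized projection of `v`, commutes with slicing, so
`measure_perp_image_eq_lintegral` computes area from slices. The tilt factor is `⟨(0, r), v⟩ = ‖proj
v‖`, and the slices are flat with normal `r`. The function `g`, the measure of the projected slice,
stands in for the measure of the slice itself, whose measurability is not yet known. -/
theorem StrictNormal.exists_slice_bounds {n : ℕ} {Γ : Set (Euc (n + 2))} {x v : Euc (n + 2)}
    (hv : StrictNormal Γ x v) (hκ : proj v ≠ 0) {δ : ℝ≥0} (hδ : 1 < δ) :
    ∃ N ∈ 𝓝 x, ∀ E, MeasurableSet E → E ⊆ Γ ∩ N → ∃ g : ℝ → ℝ≥0∞, Measurable g ∧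
      (∀ α, g α ≤ μHE[n] (sliceAt E α) ∧ μHE[n] (sliceAt E α) ≤ δ * g α) ∧
      ∫⁻ α, g α ≤ δ * (ENNReal.ofReal ‖proj v‖ * μHE[n + 1] E) ∧
      ENNReal.ofReal ‖proj v‖ * μHE[n + 1] E ≤ δ * ∫⁻ α, g α := by
  set κ := ‖proj v‖ with hκdef
  have hκ0 : 0 < κ := norm_pos_iff.2 hκ
  set r : Euc (n + 1) := κ⁻¹ • proj v with hrdef
  have hr : ‖r‖ = 1 := by
    rw [hrdef, norm_smul, norm_inv, norm_norm, ← hκdef, inv_mul_cancel₀ hκ0.ne']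
  have hrv : (inner ℝ (pt 0 r) v : ℝ) = κ := by
    rw [real_inner_comm, inner_pt, hrdef, inner_smul_right, real_inner_self_eq_norm_sq, ← hκdef]
    field_simp
    ring
  obtain ⟨N, hN, hinj, hb⟩ := hv.exists_measure_image_bounds (strictPerp_perp Γ x (pt 0 r))
    ((norm_pt_zero r).trans hr) (by rw [hrv]; exact hκ0.ne') one_pos hδ
  have hδ' : (1 : ℝ) < δ := by exact_mod_cast hδ
  have t1 : Tendsto (fun η : ℝ => (1 + η) ^ n) (𝓝 0) (𝓝 1) := by
    have : Continuous fun η : ℝ => (1 + η) ^ n := by fun_prop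
    simpa using this.tendsto 0
  have hev : ∀ᶠ η : ℝ in 𝓝[>] (0 : ℝ), 0 < η ∧ η ≤ 1 / 2 ∧ (1 + η) ^ n < (δ : ℝ) :=
    Filter.Eventually.and self_mem_nhdsWithin ((Filter.Eventually.and
      (tendsto_id.eventually_le_const (by norm_num)) (t1.eventually_lt_const hδ')).filter_mono
      nhdsWithin_le_nhds)
  obtain ⟨η, hη0, hη1, hη2⟩ := hev.exists
  -- A displacement inside a slice pairs with `v` as `κ` times its inner product with `r`, so
  -- flatness `η * κ` in space becomes flatness `η` in the slice.
  obtain ⟨ρ, hρ, hf⟩ := hv.2 (η * κ) (by positivity)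
  refine ⟨N ∩ Metric.ball x ρ, inter_mem hN (Metric.ball_mem_nhds x hρ), fun E hE hEN => ?_⟩
  have hEN' : E ⊆ Γ ∩ N := fun y hy => ⟨(hEN hy).1, (hEN hy).2.1⟩
  have himg : MeasurableSet (perp (pt 0 r) '' E) :=
    hE.image_of_continuousOn_injOn (continuous_perp _).continuousOn (hinj.mono hEN')
  obtain ⟨hgm, hgi⟩ := measure_perp_image_eq_lintegral hr himg
  obtain ⟨hb1, hb2⟩ := hb E hEN'
  rw [hrv, one_pow, one_mul, abs_of_pos hκ0, hgi] at hb1 hb2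
  refine ⟨_, hgm, fun α => ⟨Flat.measure_perp_image_le _ hr, ?_⟩, hb1, hb2⟩
  have hfl : Flat (sliceAt E α) r η := by
    intro u hu u' hu'
    have h1 := hf (pt α u) ⟨(hEN hu).1, (hEN hu).2.2⟩ (pt α u') ⟨(hEN hu').1, (hEN hu').2.2⟩
    rw [pt_sub, sub_self, inner_pt, mul_zero, zero_add, norm_pt_zero] at h1
    rw [hrdef, inner_smul_left, abs_mul]
    simp only [conj_trivial, abs_inv, abs_of_pos hκ0]
    rw [inv_mul_le_iff₀ hκ0]
    linarith
  refine (hfl.measure_le hr hη0.le hη1).trans ?_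
  gcongr
  rw [← ENNReal.ofReal_coe_nnreal]
  exact ENNReal.ofReal_le_ofReal hη2.le

theorem sliceAt_iUnion {n : ℕ} {ι : Type*} (E : ι → Set (Euc (n + 2))) (α : ℝ) :
    sliceAt (⋃ i, E i) α = ⋃ i, sliceAt (E i) α := by
  ext u; simp [sliceAt]

theorem measurableSet_sliceAt {n : ℕ} {E : Set (Euc (n + 2))} (hE : MeasurableSet E) (α : ℝ) :
    MeasurableSet (sliceAt E α) := (continuous_pt_right α).measurable hE

/-- The coarea formula for the first coordinate, on a set with strict normals. -/
theorem coarea_formula {n : ℕ} {Γ : Set (Euc (n + 2))} (hΓ : MeasurableSet Γ)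
    {ν : Euc (n + 2) → Euc (n + 2)} (hν : ∀ x ∈ Γ, StrictNormal Γ x (ν x))
    (hκ : ∀ x ∈ Γ, proj (ν x) ≠ 0) (hm : Measurable ν) :
    Measurable (fun α => μHE[n] (sliceAt Γ α)) ∧
      ∫⁻ α, μHE[n] (sliceAt Γ α) = ∫⁻ x in Γ, ENNReal.ofReal ‖proj (ν x)‖ ∂μHE[n + 1] := by
  rcases Γ.eq_empty_or_nonempty with rfl | hne
  · simp [sliceAt]
  have key : ∀ δ : ℝ≥0, 1 < δ → ∃ g : ℝ → ℝ≥0∞, Measurable g ∧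
      (∀ α, g α ≤ μHE[n] (sliceAt Γ α) ∧ μHE[n] (sliceAt Γ α) ≤ δ * g α) ∧
      ∫⁻ α, g α ≤ (δ * δ : ℝ≥0) * ∫⁻ x in Γ, ENNReal.ofReal ‖proj (ν x)‖ ∂μHE[n + 1] ∧
      ∫⁻ x in Γ, ENNReal.ofReal ‖proj (ν x)‖ ∂μHE[n + 1] ≤ (δ * δ : ℝ≥0) * ∫⁻ α, g α := by
    intro δ hδ
    have hch : ∀ x, ∃ N : Set (Euc (n + 2)), x ∈ Γ → N ∈ 𝓝 x ∧
        ∀ E, MeasurableSet E → E ⊆ Γ ∩ N → ∃ g : ℝ → ℝ≥0∞, Measurable g ∧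
        (∀ α, g α ≤ μHE[n] (sliceAt E α) ∧ μHE[n] (sliceAt E α) ≤ δ * g α) ∧
        ∫⁻ α, g α ≤ δ * (ENNReal.ofReal ‖proj (ν x)‖ * μHE[n + 1] E) ∧
        ENNReal.ofReal ‖proj (ν x)‖ * μHE[n + 1] E ≤ δ * ∫⁻ α, g α := fun x => by
      by_cases hx : x ∈ Γ
      · obtain ⟨N, hN, h⟩ := (hν x hx).exists_slice_bounds (hκ x hx) hδ
        exact ⟨N, fun _ => ⟨hN, h⟩⟩
      · exact ⟨univ, fun h => absurd h hx⟩
    choose N hN using hch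
    have hwm : Measurable fun x => Real.toNNReal ‖proj (ν x)‖ :=
      ((continuous_proj.measurable.comp hm).norm).real_toNNReal
    obtain ⟨c, E, hc, hEm, hEN, hEd, hEU, hEw⟩ := exists_partition hΓ hne hwm
      (fun x hx => Real.toNNReal_pos.2 (norm_pos_iff.2 (hκ x hx))) hδ (N := N)
      fun x hx => (hN x hx).1
    choose g hgm hg1 hg2 hg3 using fun i => (hN (c i) (hc i)).2 (E i) (hEm i) (hEN i)
    have hsl : ∀ α, μHE[n] (sliceAt Γ α) = ∑' i, μHE[n] (sliceAt (E i) α) := fun α => by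
      rw [← hEU, sliceAt_iUnion, measure_iUnion (fun i j hij => ?_)
        fun i => measurableSet_sliceAt (hEm i) α]
      exact (hEd hij).preimage _
    have h2 : ∫⁻ x in Γ, ENNReal.ofReal ‖proj (ν x)‖ ∂μHE[n + 1] =
        ∑' i, ∫⁻ x in E i, ENNReal.ofReal ‖proj (ν x)‖ ∂μHE[n + 1] := by
      rw [← hEU, lintegral_iUnion hEm hEd]
    refine ⟨fun α => ∑' i, g i α, Measurable.tsum hgm, fun α => ⟨?_, ?_⟩, ?_, ?_⟩
    · rw [hsl]
      exact ENNReal.tsum_le_tsum fun i => (hg1 i α).1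
    · rw [hsl, ← ENNReal.tsum_mul_left]
      exact ENNReal.tsum_le_tsum fun i => (hg1 i α).2
    · rw [lintegral_tsum fun i => (hgm i).aemeasurable, h2, ← ENNReal.tsum_mul_left]
      refine ENNReal.tsum_le_tsum fun i => ?_
      have hb := (setLIntegral_bounds (μ := μHE[n + 1]) (hEm i) (hEw i)).2
      calc _ ≤ δ * (ENNReal.ofReal ‖proj (ν (c i))‖ * μHE[n + 1] (E i)) := hg2 i
        _ ≤ δ * (δ * ∫⁻ x in E i, ENNReal.ofReal ‖proj (ν x)‖ ∂μHE[n + 1]) :=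
          mul_le_mul' le_rfl hb
        _ = _ := by rw [← mul_assoc, ENNReal.coe_mul]
    · rw [lintegral_tsum fun i => (hgm i).aemeasurable, h2, ← ENNReal.tsum_mul_left]
      refine ENNReal.tsum_le_tsum fun i => ?_
      have hb := (setLIntegral_bounds (μ := μHE[n + 1]) (hEm i) (hEw i)).1
      calc _ ≤ δ * (ENNReal.ofReal ‖proj (ν (c i))‖ * μHE[n + 1] (E i)) := hb
        _ ≤ δ * (δ * ∫⁻ α, g i α) := mul_le_mul' le_rfl (hg3 i)
        _ = _ := by rw [← mul_assoc, ENNReal.coe_mul]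
  have hd : ∀ m : ℕ, (1 : ℝ≥0) < 1 + 1 / (m + 1) := fun m => by
    have : (0 : ℝ≥0) < 1 / (m + 1) := by positivity
    exact lt_add_of_pos_right _ this
  constructor
  -- The slice measure is the supremum of the measurable minorants `g m`, which miss it by factors
  -- tending to `1`.
  · choose g hgm hg1 _ _ using fun m : ℕ => key _ (hd m)
    have : (fun α => μHE[n] (sliceAt Γ α)) = fun α => ⨆ m, g m α := by
      funext α
      refine le_antisymm (ENNReal_le_of_forall_one_lt_mul fun δ hδ => ?_)
        (iSup_le fun m => (hg1 m α).1)
      obtain ⟨m, hm⟩ := exists_nat_one_div_lt (tsub_pos_of_lt hδ)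
      refine (hg1 m α).2.trans (mul_le_mul' ?_ (le_iSup (fun m => g m α) m))
      rw [ENNReal.coe_le_coe]
      have h3 : (1 : ℝ≥0) + 1 / (m + 1) ≤ 1 + (δ - 1) := by gcongr
      rwa [add_tsub_cancel_of_le hδ.le] at h3
    rw [this]
    exact Measurable.iSup hgm
  · refine le_antisymm ?_ ?_ <;> refine ENNReal_le_of_forall_one_lt_mul fun δ hδ => ?_
    all_goals
      -- At most three comparison factors are collected, so a fourth root of `δ` is enough.
      set θ := NNReal.sqrt (NNReal.sqrt δ) with hθ
      have hθ1 : 1 < θ := by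
        simpa using NNReal.sqrt_lt_sqrt.2 (show 1 < NNReal.sqrt δ by simpa using NNReal.sqrt_lt_sqrt.2 hδ)
      have hθδ : (θ : ℝ≥0∞) * (θ * θ : ℝ≥0) ≤ δ := by
        have h4 : θ * θ * (θ * θ) = δ := by
          rw [hθ, NNReal.mul_self_sqrt, NNReal.mul_self_sqrt]
        rw [← ENNReal.coe_mul, ENNReal.coe_le_coe]
        calc θ * (θ * θ) ≤ θ * (θ * θ) * θ := le_mul_of_one_le_right zero_le hθ1.le
          _ = δ := by rw [← h4]; ring
      obtain ⟨g, hgm, hg1, hg2, hg3⟩ := key θ hθ1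
    · calc ∫⁻ α, μHE[n] (sliceAt Γ α) ≤ ∫⁻ α, θ * g α := lintegral_mono fun α => (hg1 α).2
        _ = θ * ∫⁻ α, g α := lintegral_const_mul _ hgm
        _ ≤ θ * ((θ * θ : ℝ≥0) * ∫⁻ x in Γ, ENNReal.ofReal ‖proj (ν x)‖ ∂μHE[n + 1]) := by gcongr
        _ ≤ _ := by rw [← mul_assoc]; gcongr
    · calc _ ≤ (θ * θ : ℝ≥0) * ∫⁻ α, g α := hg3
        _ ≤ δ * ∫⁻ α, g α := by
          refine mul_le_mul' (le_trans ?_ hθδ) le_rfl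
          exact le_mul_of_one_le_left (by positivity) (by exact_mod_cast hθ1.le)
        _ ≤ _ := by gcongr with α; exact (hg1 α).1

/-- Indicators reduce to `coarea_formula` on `Γ ∩ B`. Measurability in `α` has to travel through the
induction, because the later steps exchange the integral with sums and suprema. -/
theorem coarea_formula_lintegral {n : ℕ} {Γ : Set (Euc (n + 2))} (hΓ : MeasurableSet Γ)
    {ν : Euc (n + 2) → Euc (n + 2)} (hν : ∀ x ∈ Γ, StrictNormal Γ x (ν x))
    (hκ : ∀ x ∈ Γ, proj (ν x) ≠ 0) (hm : Measurable ν) {G : Euc (n + 2) → ℝ≥0∞}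
    (hG : Measurable G) :
    Measurable (fun α => ∫⁻ u in sliceAt Γ α, G (pt α u) ∂μHE[n]) ∧
      ∫⁻ α, ∫⁻ u in sliceAt Γ α, G (pt α u) ∂μHE[n] =
        ∫⁻ x in Γ, ENNReal.ofReal ‖proj (ν x)‖ * G x ∂μHE[n + 1] := by
  have hwm : Measurable fun x => ENNReal.ofReal ‖proj (ν x)‖ :=
    ((continuous_proj.measurable.comp hm).norm).ennreal_ofReal
  have hpt : ∀ α : ℝ, Measurable fun u : Euc (n + 1) => pt α u :=
    fun α => (continuous_pt_right α).measurable
  refine Measurable.ennreal_induction (motive := fun G =>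
    Measurable (fun α => ∫⁻ u in sliceAt Γ α, G (pt α u) ∂μHE[n]) ∧
      ∫⁻ α, ∫⁻ u in sliceAt Γ α, G (pt α u) ∂μHE[n] =
        ∫⁻ x in Γ, ENNReal.ofReal ‖proj (ν x)‖ * G x ∂μHE[n + 1]) ?_ ?_ ?_ hG
  · intro c B hB
    have h1 : ∀ α, ∫⁻ u in sliceAt Γ α, B.indicator (fun _ => c) (pt α u) ∂μHE[n] =
        c * μHE[n] (sliceAt (Γ ∩ B) α) := fun α => by
      have e1 : (fun u => B.indicator (fun _ => c) (pt α u)) =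
          (sliceAt B α).indicator fun _ => c := rfl
      rw [e1, lintegral_indicator (measurableSet_sliceAt hB α), setLIntegral_const,
        Measure.restrict_apply (measurableSet_sliceAt hB α), inter_comm]
      rfl
    have hs : Γ ∩ B ⊆ Γ := inter_subset_left
    have h2 := coarea_formula (hΓ.inter hB) (fun x hx => (hν x hx.1).mono hs)
      (fun x hx => hκ x hx.1) hm
    simp_rw [h1]
    refine ⟨h2.1.const_mul c, ?_⟩
    rw [lintegral_const_mul _ h2.1, h2.2]
    have e2 : ∀ x, ENNReal.ofReal ‖proj (ν x)‖ * B.indicator (fun _ => c) x =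
        B.indicator (fun x => c * ENNReal.ofReal ‖proj (ν x)‖) x := fun x => by
      by_cases hx : x ∈ B <;> simp [hx, mul_comm]
    simp_rw [e2]
    rw [lintegral_indicator hB, Measure.restrict_restrict hB, lintegral_const_mul _ hwm, inter_comm]
  · intro f g _ hf hg ihf ihg
    have e1 : ∀ α, ∫⁻ u in sliceAt Γ α, (f + g) (pt α u) ∂μHE[n] =
        ∫⁻ u in sliceAt Γ α, f (pt α u) ∂μHE[n] + ∫⁻ u in sliceAt Γ α, g (pt α u) ∂μHE[n] :=
      fun α => lintegral_add_left (hf.comp (hpt α)) _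
    simp_rw [e1]
    refine ⟨ihf.1.add ihg.1, ?_⟩
    rw [lintegral_add_left ihf.1, ihf.2, ihg.2]
    refine (lintegral_add_left (hwm.mul hf) _).symm.trans ?_
    simp only [Pi.add_apply, mul_add, Pi.mul_apply]
  · intro f hf hmono ih
    have e1 : ∀ α, ∫⁻ u in sliceAt Γ α, (⨆ i, f i (pt α u)) ∂μHE[n] =
        ⨆ i, ∫⁻ u in sliceAt Γ α, f i (pt α u) ∂μHE[n] := fun α =>
      lintegral_iSup (fun i => (hf i).comp (hpt α)) fun i j hij u => hmono hij _
    simp_rw [e1]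
    refine ⟨Measurable.iSup fun i => (ih i).1, ?_⟩
    rw [lintegral_iSup (fun i => (ih i).1) fun i j hij α => lintegral_mono fun u => hmono hij _]
    simp_rw [fun i => (ih i).2]
    refine (lintegral_iSup (fun i => hwm.mul (hf i))
      fun i j hij x => mul_le_mul' le_rfl (hmono hij x)).symm.trans ?_
    simp only [ENNReal.mul_iSup, Pi.mul_apply]

/-! ### Slices of null sets -/

theorem exists_cover_of_hausdorffMeasure_eq_zero {X : Type*} [EMetricSpace X] [MeasurableSpace X]
    [BorelSpace X] {d : ℝ} {N : Set X} (hN : μH[d] N = 0) {r ε : ℝ≥0∞} (hr : 0 < r) (hε : 0 < ε) :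
    ∃ t : ℕ → Set X, N ⊆ ⋃ i, t i ∧ (∀ i, Metric.ediam (t i) ≤ r) ∧
      ∑' i, ⨆ _ : (t i).Nonempty, Metric.ediam (t i) ^ d < ε := by
  rw [Measure.hausdorffMeasure_apply] at hN
  have h := (iSup_eq_bot.1 hN) r
  rw [iSup_eq_bot] at h
  have h' := h hr
  rw [bot_eq_zero] at h'
  have h2 := h'.trans_lt hε
  simp only [iInf_lt_iff] at h2
  obtain ⟨t, ht, htr, hts⟩ := h2
  exact ⟨t, ht, htr, hts⟩

/-- An Eilenberg type inequality: a set of diameter `d` meets slices over a set of heights of length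
at most `d`, each in diameter at most `d`. Covers with `∑ d^(n+1) < 2^(-m)` therefore have slice
sums whose integrals are summable in `m`, so the sums tend to `0` at almost every height. -/
theorem ae_measure_sliceAt_eq_zero {n : ℕ} {N : Set (Euc (n + 2))} (hN : μHE[n + 1] N = 0) :
    ∀ᵐ α : ℝ, μHE[n] (sliceAt N α) = 0 := by
  rw [euclideanHausdorffMeasure_eq_zero_iff] at hN
  have hcov := fun m : ℕ => exists_cover_of_hausdorffMeasure_eq_zero hN
    (r := ((m : ℝ≥0∞) + 1)⁻¹) (ε := 2⁻¹ ^ m) (by simp) (ENNReal.pow_pos (by simp) m)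
  choose t htN htr hts using hcov
  -- The covering sets are arbitrary; the closure makes their shadows measurable and keeps the
  -- diameter.
  let J : ℕ → ℕ → Set ℝ := fun m i => closure ((fun x : Euc (n + 2) => x 0) '' t m i)
  let g : ℕ → ℝ → ℝ≥0∞ := fun m α => ∑' i, (J m i).indicator (fun _ => Metric.ediam (t m i) ^ n) α
  have hJm : ∀ m i, MeasurableSet (J m i) := fun m i => isClosed_closure.measurableSet
  have hgm : ∀ m, Measurable (g m) := fun m =>
    Measurable.tsum fun i => measurable_const.indicator (hJm m i)
  have hlip : LipschitzWith 1 fun x : Euc (n + 2) => x 0 :=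
    LipschitzWith.of_dist_le_mul fun x y => by
      simpa [Real.dist_eq, dist_eq_norm] using abs_zero_le (x - y)
  have hgi : ∀ m, ∫⁻ α, g m α ≤ 2⁻¹ ^ m := by
    intro m
    rw [lintegral_tsum fun i => (measurable_const.indicator (hJm m i)).aemeasurable]
    refine le_trans (ENNReal.tsum_le_tsum fun i => ?_) (hts m).le
    rw [lintegral_indicator_const (hJm m i)]
    rcases (t m i).eq_empty_or_nonempty with he | hne
    · simp [J, he]
    · rw [iSup_pos hne]
      have h1 : volume (J m i) ≤ Metric.ediam (t m i) := by
        refine (Real.volume_le_diam _).trans ?_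
        rw [Metric.ediam_closure]
        simpa using hlip.ediam_image_le (t m i)
      calc _ ≤ Metric.ediam (t m i) ^ n * Metric.ediam (t m i) := by gcongr
        _ = _ := by rw [← pow_succ, ← ENNReal.rpow_natCast]
  have hsum : ∫⁻ α, ∑' m, g m α ≠ ∞ := by
    rw [lintegral_tsum fun m => (hgm m).aemeasurable]
    refine ne_top_of_le_ne_top ?_ (ENNReal.tsum_le_tsum hgi)
    rw [ENNReal.tsum_geometric]
    simp
  filter_upwards [ae_lt_top (Measurable.tsum hgm) hsum] with α hα
  have hlim : Tendsto (fun m => g m α) atTop (𝓝 0) :=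
    ENNReal.tendsto_atTop_zero_of_tsum_ne_top hα.ne
  rw [euclideanHausdorffMeasure_eq_zero_iff]
  have hb := Measure.hausdorffMeasure_le_liminf_tsum (n : ℝ) (sliceAt N α) (l := atTop)
    (ι := fun m => {i : ℕ // α ∈ J m i}) (fun m : ℕ => ((m : ℝ≥0∞) + 1)⁻¹) ?_
    (fun m i => sliceAt (t m i) α) (.of_forall fun m i => ?_) (.of_forall fun m => ?_)
  · refine le_antisymm (hb.trans ?_) zero_le
    rw [← hlim.liminf_eq]
    refine liminf_le_liminf (.of_forall fun m => ?_)
    have h3 : ∀ i : {i : ℕ // α ∈ J m i}, Metric.ediam (sliceAt (t m i) α) ≤ Metric.ediam (t m i) :=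
      fun i => by
        rw [← (isometry_pt α).ediam_image]
        exact Metric.ediam_mono (by rintro _ ⟨u, hu, rfl⟩; exact hu)
    calc ∑' i : {i : ℕ // α ∈ J m i}, Metric.ediam (sliceAt (t m i) α) ^ (n : ℝ)
        ≤ ∑' i : {i : ℕ // α ∈ J m i}, Metric.ediam (t m i) ^ n := by
          refine ENNReal.tsum_le_tsum fun i => ?_
          rw [ENNReal.rpow_natCast]
          exact pow_le_pow_left' (h3 i) n
      _ = g m α := by
          refine (tsum_subtype {i | α ∈ J m i} fun i => Metric.ediam (t m i) ^ n).trans ?_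
          refine tsum_congr fun i => ?_
          by_cases hi : α ∈ J m i <;> simp [hi]
  · have : Tendsto (fun m : ℕ => ((m + 1 : ℕ) : ℝ≥0∞)⁻¹) atTop (𝓝 0) :=
      (tendsto_add_atTop_iff_nat 1).2 ENNReal.tendsto_inv_nat_nhds_zero
    simpa using this
  · refine le_trans ?_ (htr m i)
    rw [← (isometry_pt α).ediam_image]
    exact Metric.ediam_mono (by rintro _ ⟨u, hu, rfl⟩; exact hu)
  · intro u hu
    obtain ⟨i, hi⟩ := mem_iUnion.1 (htN m (show pt α u ∈ N from hu))
    exact mem_iUnion.2 ⟨⟨i, subset_closure ⟨_, hi, pt_zero α u⟩⟩, hi⟩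

/-! ### Measurable families of open sets -/

section RandomOpen

variable {T : Type*} [MeasurableSpace T] {X : Type*} [TopologicalSpace X]

/-- A family of open sets is countably generated and measurable if membership is tested by
countably many rectangles. -/
def IsRandomOpen (V : T → Set X) : Prop :=
  ∃ (A : ℕ → Set T) (U : ℕ → Set X), (∀ i, MeasurableSet (A i)) ∧ (∀ i, IsOpen (U i)) ∧
    ∀ t x, x ∈ V t ↔ ∃ i, t ∈ A i ∧ x ∈ U i

theorem IsRandomOpen.of_countable {ι : Type*} [Countable ι] {V : T → Set X} {A : ι → Set T}
    {U : ι → Set X} (hA : ∀ i, MeasurableSet (A i)) (hU : ∀ i, IsOpen (U i))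
    (h : ∀ t x, x ∈ V t ↔ ∃ i, t ∈ A i ∧ x ∈ U i) : IsRandomOpen V := by
  rcases isEmpty_or_nonempty ι with hι | hι
  · exact ⟨fun _ => ∅, fun _ => ∅, fun _ => .empty, fun _ => isOpen_empty, fun t x => by simp [h]⟩
  · obtain ⟨f, hf⟩ := exists_surjective_nat ι
    refine ⟨fun i => A (f i), fun i => U (f i), fun i => hA _, fun i => hU _, fun t x => ?_⟩
    rw [h, hf.exists]

theorem IsRandomOpen.isOpen {V : T → Set X} (hV : IsRandomOpen V) (t : T) : IsOpen (V t) := by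
  obtain ⟨A, U, hA, hU, h⟩ := hV
  have : V t = ⋃ i, ⋃ _ : t ∈ A i, U i := by ext x; simp [h]
  rw [this]
  exact isOpen_iUnion fun i => isOpen_iUnion fun _ => hU i

theorem IsRandomOpen.const {U : Set X} (hU : IsOpen U) : IsRandomOpen fun _ : T => U :=
  IsRandomOpen.of_countable (ι := Unit) (A := fun _ => univ) (U := fun _ => U) (fun _ => .univ)
    (fun _ => hU) (by simp)

theorem IsRandomOpen.union {V W : T → Set X} (hV : IsRandomOpen V) (hW : IsRandomOpen W) :
    IsRandomOpen fun t => V t ∪ W t := by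
  obtain ⟨A, U, hA, hU, h⟩ := hV
  obtain ⟨A', U', hA', hU', h'⟩ := hW
  refine IsRandomOpen.of_countable (A := Sum.elim A A') (U := Sum.elim U U') ?_ ?_ ?_
  · rintro (i | i) <;> simp [hA, hA']
  · rintro (i | i) <;> simp [hU, hU']
  · simp [h, h']

theorem IsRandomOpen.preimage {Y : Type*} [TopologicalSpace Y] {V : T → Set X}
    (hV : IsRandomOpen V) {f : Y → X} (hf : Continuous f) : IsRandomOpen fun t => f ⁻¹' V t := by
  obtain ⟨A, U, hA, hU, h⟩ := hV
  exact ⟨A, fun i => f ⁻¹' U i, hA, fun i => (hU i).preimage hf, fun t x => h t (f x)⟩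

theorem IsRandomOpen.comp {T' : Type*} [MeasurableSpace T'] {V : T → Set X}
    (hV : IsRandomOpen V) {g : T' → T} (hg : Measurable g) : IsRandomOpen fun t => V (g t) := by
  obtain ⟨A, U, hA, hU, h⟩ := hV
  exact ⟨fun i => g ⁻¹' A i, U, fun i => hg (hA i), hU, fun t x => h (g t) x⟩

theorem IsRandomOpen.measurableSet_prod [MeasurableSpace X] [OpensMeasurableSpace X]
    {V : T → Set X} (hV : IsRandomOpen V) : MeasurableSet {p : T × X | p.2 ∈ V p.1} := by
  obtain ⟨A, U, hA, hU, h⟩ := hV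
  have : {p : T × X | p.2 ∈ V p.1} = ⋃ i, A i ×ˢ U i := by
    ext p; simp [h, mem_prod]
  rw [this]
  exact .iUnion fun i => (hA i).prod (hU i).measurableSet

/-- The points all of whose translates over a compact set of parameters lie in the open set. -/
theorem IsRandomOpen.forall_compact {Z C : Type*} [TopologicalSpace Z] [TopologicalSpace C]
    [CompactSpace C] {V : T → Set X} (hV : IsRandomOpen V) {f : Z × C → X} (hf : Continuous f) :
    IsRandomOpen fun t => {z : Z | ∀ c, f (z, c) ∈ V t} := by
  obtain ⟨A, U, hA, hU, h⟩ := hV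
  -- By compactness of `C`, finitely many rectangles already cover all translates, so the countable
  -- family of finite index sets suffices.
  refine IsRandomOpen.of_countable (ι := Finset ℕ) (A := fun I => ⋂ i ∈ I, A i)
    (U := fun I => {z | ∀ c, f (z, c) ∈ ⋃ i ∈ I, U i})
    (fun I => .biInter I.countable_toSet fun i _ => hA i) (fun I => ?_) (fun t z => ?_)
  · have hO : IsOpen (f ⁻¹' ⋃ i ∈ I, U i) := (isOpen_biUnion fun i _ => hU i).preimage hf
    have : {z | ∀ c, f (z, c) ∈ ⋃ i ∈ I, U i} =
        {z | ∀ c ∈ (univ : Set C), (z, c) ∈ f ⁻¹' ⋃ i ∈ I, U i} := by ext; simp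
    rw [this, isOpen_iff_mem_nhds]
    intro z hz
    have hz' : ({z} : Set Z) ×ˢ (univ : Set C) ⊆ f ⁻¹' ⋃ i ∈ I, U i := by
      rintro ⟨z', c⟩ ⟨rfl, -⟩
      exact hz c trivial
    obtain ⟨u, v, hu, -, hzu, hcv, huv⟩ :=
      generalized_tube_lemma isCompact_singleton isCompact_univ hO hz'
    exact mem_of_superset (hu.mem_nhds (hzu rfl)) fun z' hz' c hc => huv ⟨hz', hcv hc⟩
  · constructor
    · intro hz
      have hcov : (univ : Set C) ⊆ ⋃ i : {i // t ∈ A i}, {c | f (z, c) ∈ U i} := fun c _ => by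
        obtain ⟨i, hi, hc⟩ := (h _ _).1 (hz c)
        exact mem_iUnion.2 ⟨⟨i, hi⟩, hc⟩
      obtain ⟨J, hJ⟩ := isCompact_univ.elim_finite_subcover _ (fun i : {i // t ∈ A i} =>
        (hU i).preimage (hf.comp (continuous_const.prodMk continuous_id))) hcov
      refine ⟨J.map (Function.Embedding.subtype _), ?_, fun c => ?_⟩
      · simp only [mem_iInter, Finset.mem_map]
        rintro _ ⟨i, -, rfl⟩
        exact i.2
      · obtain ⟨i, hiJ, hi⟩ := mem_iUnion₂.1 (hJ (mem_univ c))
        exact mem_iUnion₂.2 ⟨i, Finset.mem_map.2 ⟨i, hiJ, rfl⟩, hi⟩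
    · rintro ⟨I, hI, hz⟩ c
      obtain ⟨i, hi, hc⟩ := mem_iUnion₂.1 (hz c)
      exact (h _ _).2 ⟨i, mem_iInter₂.1 hI i hi, hc⟩

/-- `IsRandomOpen.forall_compact` over a one-point base: the condition then depends on `t` alone and
is a countable union of measurable sets. -/
theorem IsRandomOpen.measurableSet_superset {V : T → Set X} (hV : IsRandomOpen V) {K : Set X}
    (hK : IsCompact K) : MeasurableSet {t | K ⊆ V t} := by
  have : CompactSpace K := isCompact_iff_compactSpace.1 hK
  obtain ⟨A, U, hA, hU, h⟩ := hV.forall_compact (Z := Unit) (C := K) (f := fun p => (p.2 : X))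
    (by fun_prop)
  have : {t | K ⊆ V t} = ⋃ i, ⋃ _ : () ∈ U i, A i := by
    ext t
    have := h t ()
    simp only [mem_ofPred_eq, Subtype.forall] at this
    simp only [mem_iUnion, exists_prop, mem_ofPred_eq]
    rw [show K ⊆ V t ↔ ∀ a ∈ K, a ∈ V t from Iff.rfl, this]
    simp [and_comm]
  rw [this]
  exact .iUnion fun i => .iUnion fun _ => hA i

theorem IsRandomOpen.measurableSet_superset_of_isSigmaCompact {V : T → Set X}
    (hV : IsRandomOpen V) {K : Set X} (hK : IsSigmaCompact K) : MeasurableSet {t | K ⊆ V t} := by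
  obtain ⟨C, hC, rfl⟩ := hK
  simp only [iUnion_subset_iff, ofPred_forall]
  exact .iInter fun i => hV.measurableSet_superset (hC i)

end RandomOpen

/-! ### Hausdorff measures of random closed sets -/

section RandomHausdorff

variable {X : Type*} [MetricSpace X] [SecondCountableTopology X] [MeasurableSpace X] [BorelSpace X]

/-- Finite unions of sets of a countable basis. -/
def basisUnion (w : Finset (TopologicalSpace.countableBasis X)) : Set X := ⋃ b ∈ w, (b : Set X)

theorem isOpen_basisUnion (w : Finset (TopologicalSpace.countableBasis X)) :
    IsOpen (basisUnion w) :=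
  isOpen_biUnion fun b _ => TopologicalSpace.isOpen_of_mem_countableBasis b.2

/-- The `d`-dimensional size of the least finite covering by basic sets of diameter at most `r`. -/
noncomputable def basisContent (d : ℕ) (r : ℝ≥0∞) (E : Set X) : ℝ≥0∞ :=
  ⨅ (S : Finset (Finset (TopologicalSpace.countableBasis X)))
    (_ : ∀ w ∈ S, Metric.ediam (basisUnion w) ≤ r) (_ : E ⊆ ⋃ w ∈ S, basisUnion w),
    ∑ w ∈ S, ⨆ _ : (basisUnion w).Nonempty, Metric.ediam (basisUnion w) ^ d

/-- The open `η`-thickening increases the diameter by at most `2 η`, and the power is continuous.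
The supremum over nonemptiness lets the empty set count `0` even for `d = 0`. -/
theorem exists_open_superset_ediam (d : ℕ) (E : Set X) {r ε : ℝ≥0∞} (hr : Metric.ediam E < r)
    (hε : 0 < ε) : ∃ V, IsOpen V ∧ E ⊆ V ∧ Metric.ediam V ≤ r ∧
      ⨆ _ : V.Nonempty, Metric.ediam V ^ d ≤ (⨆ _ : E.Nonempty, Metric.ediam E ^ d) + ε := by
  rcases E.eq_empty_or_nonempty with rfl | hne
  · exact ⟨∅, isOpen_empty, subset_rfl, by simp, by simp⟩
  have hcont : Tendsto (fun η : ℝ≥0 => Metric.ediam E + 2 * η) (𝓝[>] 0) (𝓝 (Metric.ediam E)) := by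
    have h2 : Tendsto (fun η : ℝ≥0 => (2 : ℝ≥0∞) * η) (𝓝[>] 0) (𝓝 (2 * (0 : ℝ≥0))) :=
      ENNReal.Tendsto.const_mul ((ENNReal.tendsto_coe.2 tendsto_id).mono_left nhdsWithin_le_nhds)
        (Or.inr (by simp))
    simpa using h2.const_add (Metric.ediam E)
  have hpow : Tendsto (fun η : ℝ≥0 => (Metric.ediam E + 2 * η) ^ d) (𝓝[>] 0)
      (𝓝 (Metric.ediam E ^ d)) := ((ENNReal.continuous_pow d).tendsto _).comp hcont
  have hfin : Metric.ediam E ^ d ≠ ∞ := ENNReal.pow_ne_top hr.ne_top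
  have hev := (hcont.eventually_lt_const hr).and ((hpow.eventually_lt_const
    (ENNReal.lt_add_right hfin hε.ne')).and self_mem_nhdsWithin)
  obtain ⟨η, h1, h2, h3⟩ := hev.exists
  have hth := Metric.ediam_thickening_le (s := E) η
  have hsub : E ⊆ Metric.thickening η E := Metric.self_subset_thickening (by exact_mod_cast h3) E
  refine ⟨Metric.thickening η E, Metric.isOpen_thickening, hsub, hth.trans h1.le, ?_⟩
  rw [iSup_pos (hne.mono hsub), iSup_pos hne]
  exact (pow_le_pow_left' hth d).trans h2.le

/-- Each member of a countable cover is enlarged to an open set at a summable cost. Compactness then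
selects finitely many basic sets, and grouping them by the enlarged member that contains them gives
an admissible finite cover of no larger size. -/
theorem basisContent_le {d : ℕ} {r : ℝ≥0∞} (hr : 0 < r) (hr' : r ≠ ∞) {E : Set X}
    (hE : IsCompact E) : basisContent d r E ≤ μH[(d : ℝ)] E := by
  refine ENNReal.le_of_forall_pos_le_add fun ε hε _ => ?_
  obtain ⟨ε', hε', hsum⟩ := ENNReal.exists_pos_sum_of_countable' (ε := (ε : ℝ≥0∞))
    (by simpa using hε.ne') ℕ
  rw [Measure.hausdorffMeasure_apply]
  -- Covers of mesh `r / 2` leave room for enlarging their members up to diameter `r`.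
  refine le_trans ?_ (add_le_add_left (le_iSup₂ (f := fun (r : ℝ≥0∞) (_ : 0 < r) =>
    ⨅ (t : ℕ → Set X) (_ : E ⊆ ⋃ n, t n) (_ : ∀ n, Metric.ediam (t n) ≤ r),
          ∑' n, ⨆ _ : (t n).Nonempty, Metric.ediam (t n) ^ (d : ℝ)) (r / 2)
          (ENNReal.half_pos hr.ne')) _)
  simp only [ENNReal.iInf_add]
  refine le_iInf fun t => le_iInf fun ht => le_iInf fun htr => ?_
  choose V hVo htV hVr hVd using fun i => exists_open_superset_ediam d (t i)
    ((htr i).trans_lt (ENNReal.half_lt_self hr.ne' hr')) (hε' i)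
  have hb := TopologicalSpace.isBasis_countableBasis X
  let J : Type _ := {p : ℕ × TopologicalSpace.countableBasis X // (p.2 : Set X) ⊆ V p.1}
  have hcov : E ⊆ ⋃ p : J, (p.1.2 : Set X) := fun x hx => by
    obtain ⟨i, hi⟩ := mem_iUnion.1 (ht hx)
    obtain ⟨b, hbB, hxb, hbV⟩ := hb.exists_subset_of_mem_open (htV i hi) (hVo i)
    exact mem_iUnion.2 ⟨⟨(i, ⟨b, hbB⟩), hbV⟩, hxb⟩
  obtain ⟨I, hI⟩ := hE.elim_finite_subcover _
    (fun p : J => TopologicalSpace.isOpen_of_mem_countableBasis p.1.2.2) hcov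
  classical
  let N : Finset ℕ := I.image fun p => p.1.1
  let w : ℕ → Finset (TopologicalSpace.countableBasis X) := fun i =>
    (I.filter fun p => p.1.1 = i).image fun p => p.1.2
  have hwV : ∀ i, basisUnion (w i) ⊆ V i := fun i x hx => by
    simp only [basisUnion, w, Finset.mem_image, Finset.mem_filter, mem_iUnion] at hx
    obtain ⟨b, ⟨p, ⟨hp, rfl⟩, rfl⟩, hx⟩ := hx
    exact p.2 hx
  refine le_trans (iInf_le_of_le (N.image w) (iInf_le_of_le ?_ (iInf_le_of_le ?_ le_rfl))) ?_
  · intro v hv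
    obtain ⟨i, -, rfl⟩ := Finset.mem_image.1 hv
    exact (Metric.ediam_mono (hwV i)).trans (hVr i)
  · intro x hx
    obtain ⟨p, hp, hxp⟩ := mem_iUnion₂.1 (hI hx)
    refine mem_iUnion₂.2 ⟨w p.1.1, Finset.mem_image_of_mem _ (Finset.mem_image_of_mem _ hp), ?_⟩
    simp only [basisUnion, w, Finset.mem_image, Finset.mem_filter, mem_iUnion]
    exact ⟨p.1.2, ⟨p, ⟨hp, rfl⟩, rfl⟩, hxp⟩
  · simp only [ENNReal.rpow_natCast]
    let φ : Finset (TopologicalSpace.countableBasis X) → ℝ≥0∞ := fun v =>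
      ⨆ _ : (basisUnion v).Nonempty, Metric.ediam (basisUnion v) ^ d
    calc ∑ v ∈ N.image w, φ v ≤ ∑ i ∈ N, φ (w i) :=
          Finset.sum_image_le_of_nonneg fun _ _ => zero_le
      _ ≤ ∑ i ∈ N, ⨆ _ : (V i).Nonempty, Metric.ediam (V i) ^ d := by
          refine Finset.sum_le_sum fun i _ => iSup_le fun hne => ?_
          rw [iSup_pos (hne.mono (hwV i))]
          exact pow_le_pow_left' (Metric.ediam_mono (hwV i)) d
      _ ≤ ∑ i ∈ N, ((⨆ _ : (t i).Nonempty, Metric.ediam (t i) ^ d) + ε' i) :=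
          Finset.sum_le_sum fun i _ => hVd i
      _ ≤ ∑' i, ((⨆ _ : (t i).Nonempty, Metric.ediam (t i) ^ d) + ε' i) :=
          ENNReal.sum_le_tsum _
      _ ≤ _ := by
          rw [ENNReal.tsum_add]
          exact add_le_add le_rfl hsum.le

/-- The measure of a compact set thus depends on countably many finite covers only, which is what
makes it measurable for a random set. The upper bound holds since Hausdorff measure is at most the
lower limit of the sums over covers of vanishing mesh. -/
theorem hausdorffMeasure_eq_iSup_basisContent {d : ℕ} {E : Set X} (hE : IsCompact E) :
    μH[(d : ℝ)] E = ⨆ m : ℕ, basisContent d ((m : ℝ≥0∞) + 1)⁻¹ E := by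
  refine le_antisymm ?_ (iSup_le fun m => basisContent_le (by simp) (by simp) hE)
  refine le_of_forall_gt_imp_ge_of_dense fun c hc => ?_
  have hS : ∀ m : ℕ, ∃ S : Finset (Finset (TopologicalSpace.countableBasis X)),
      (∀ w ∈ S, Metric.ediam (basisUnion w) ≤ ((m : ℝ≥0∞) + 1)⁻¹) ∧
      (E ⊆ ⋃ w ∈ S, basisUnion w) ∧
      ∑ w ∈ S, ⨆ _ : (basisUnion w).Nonempty, Metric.ediam (basisUnion w) ^ d < c := fun m => by
    have := (le_iSup (fun m : ℕ => basisContent d ((m : ℝ≥0∞) + 1)⁻¹ E) m).trans_lt hc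
    simp only [basisContent, iInf_lt_iff] at this
    obtain ⟨S, h1, h2, h3⟩ := this
    exact ⟨S, h1, h2, h3⟩
  choose S hS1 hS2 hS3 using hS
  have hb := Measure.hausdorffMeasure_le_liminf_tsum (d : ℝ) E (l := atTop)
    (ι := fun m => {w // w ∈ S m ∧ (basisUnion w).Nonempty}) (fun m : ℕ => ((m : ℝ≥0∞) + 1)⁻¹) ?_
    (fun m w => basisUnion w.1) (.of_forall fun m w => hS1 m _ w.2.1) (.of_forall fun m x hx => ?_)
  · refine hb.trans (liminf_le_of_le ?_ ?_)
    · isBoundedDefault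
    · intro b hb'
      obtain ⟨m, hm⟩ := hb'.exists
      refine hm.trans (le_trans ?_ (hS3 m).le)
      let φ : Finset (TopologicalSpace.countableBasis X) → ℝ≥0∞ := fun w =>
        ⨆ _ : (basisUnion w).Nonempty, Metric.ediam (basisUnion w) ^ d
      let j : {w // w ∈ S m ∧ (basisUnion w).Nonempty} → {w // w ∈ S m} := fun w => ⟨w.1, w.2.1⟩
      have hj : Function.Injective j := fun w w' h => Subtype.ext (congrArg (fun v => v.1) h)
      calc _ = ∑' w : {w // w ∈ S m ∧ (basisUnion w).Nonempty}, φ (j w) :=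
            tsum_congr fun w => by
              simp only [φ, j, ENNReal.rpow_natCast]
              rw [iSup_pos w.2.2]
        _ ≤ ∑' w : {w // w ∈ S m}, φ w :=
            ENNReal.tsum_comp_le_tsum_of_injective hj fun w : {w // w ∈ S m} => φ w
        _ = ∑ w ∈ S m, φ w := Finset.tsum_subtype (S m) φ
  · have : Tendsto (fun m : ℕ => ((m + 1 : ℕ) : ℝ≥0∞)⁻¹) atTop (𝓝 0) :=
      (tendsto_add_atTop_iff_nat 1).2 ENNReal.tendsto_inv_nat_nhds_zero
    simpa using this
  · obtain ⟨w, hw, hxw⟩ := mem_iUnion₂.1 (hS2 m hx)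
    exact mem_iUnion.2 ⟨⟨w, hw, ⟨x, hxw⟩⟩, hxw⟩

variable {T : Type*} [MeasurableSpace T]

/-- The content is below `c` if and only if one of countably many finite families covers `K \ V t`.
Being covered by an open set `O` means that the compact set `K \ O` lies in `V t`, a measurable
event. -/
theorem IsRandomOpen.measurable_hausdorffMeasure_diff {V : T → Set X} (hV : IsRandomOpen V)
    (d : ℕ) {K : Set X} (hK : IsCompact K) : Measurable fun t => μHE[d] (K \ V t) := by
  have hKV : ∀ t, IsCompact (K \ V t) := fun t => hK.diff (hV.isOpen t)
  simp_rw [Measure.euclideanHausdorffMeasure_def, Measure.smul_apply, ENNReal.smul_def, smul_eq_mul,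
    fun t => hausdorffMeasure_eq_iSup_basisContent (d := d) (hKV t)]
  refine (Measurable.iSup fun m => ?_).const_mul _
  refine measurable_of_Iio fun c => ?_
  simp only [basisContent, preimage_ofPred_eq, Iio, iInf_lt_iff, ofPred_exists]
  refine .iUnion fun S => .iUnion fun _ => ?_
  have : ∀ t, K \ V t ⊆ ⋃ w ∈ S, basisUnion w ↔ K \ ⋃ w ∈ S, basisUnion w ⊆ V t := fun t => by
    rw [sdiff_subset_iff, sdiff_subset_iff, union_comm]
  simp only [this, exists_prop]
  refine .inter (hV.measurableSet_superset ?_) (.const _)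
  exact hK.diff (isOpen_biUnion fun w _ => isOpen_basisUnion w)

/-- The Hausdorff measure on a random closed set is a measurable function of the parameter. -/
theorem IsRandomOpen.measurable_restrict_compl [ProperSpace X] {V : T → Set X}
    (hV : IsRandomOpen V) (d : ℕ)
    (hfin : ∀ t, ∀ K : Set X, IsCompact K → μHE[d] (K \ V t) < ∞) :
    Measurable fun t => (μHE[d] : Measure X).restrict (V t)ᶜ := by
  have hVm : ∀ t, MeasurableSet (V t)ᶜ := fun t => (hV.isOpen t).measurableSet.compl
  have hsub : ∀ m : ℕ, Measurable fun t =>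
      (μHE[d] : Measure X).restrict (compactCovering X m \ V t) := by
    intro m
    have hcm := isCompact_compactCovering X m
    have : ∀ t, IsFiniteMeasure ((μHE[d] : Measure X).restrict (compactCovering X m \ V t)) :=
      fun t => ⟨by rw [Measure.restrict_apply_univ]; exact hfin t _ hcm⟩
    refine Measurable.measure_of_isPiSystem (S := {s : Set X | IsClosed s}) ?_ isPiSystem_isClosed
      ?_ ?_
    · rw [BorelSpace.measurable_eq (α := X), borel_eq_generateFrom_isClosed]
    · intro s hs
      have : ∀ t, (μHE[d] : Measure X).restrict (compactCovering X m \ V t) s =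
          μHE[d] ((s ∩ compactCovering X m) \ V t) := fun t => by
        rw [Measure.restrict_apply (IsClosed.measurableSet hs), inter_sdiff_assoc]
      simp_rw [this]
      exact hV.measurable_hausdorffMeasure_diff d (hcm.inter_left hs)
    · simp_rw [Measure.restrict_apply_univ]
      exact hV.measurable_hausdorffMeasure_diff d hcm
  refine Measure.measurable_of_measurable_coe _ fun s hs => ?_
  have : ∀ t, (μHE[d] : Measure X).restrict (V t)ᶜ s =
      ⨆ m, (μHE[d] : Measure X).restrict (compactCovering X m \ V t) s := fun t => by
    simp_rw [Measure.restrict_apply hs]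
    rw [← Monotone.measure_iUnion]
    · congr 1
      rw [← inter_iUnion, ← iUnion_sdiff, iUnion_compactCovering, compl_eq_univ_sdiff]
    · intro i j hij
      exact inter_subset_inter_right _ (sdiff_subset_sdiff_left (compactCovering_subset X hij))
  simp_rw [this]
  exact Measurable.iSup fun m => Measure.measurable_coe hs |>.comp (hsub m)

end RandomHausdorff

-- The parameter space is cut according to the integer part of the total mass; on each piece the
-- kernel is uniformly bounded.
open ProbabilityTheory in
theorem isSFiniteKernel_of_isFiniteMeasure {T X : Type*} [MeasurableSpace T] [MeasurableSpace X]
    (κ : Kernel T X) (h : ∀ t, IsFiniteMeasure (κ t)) : IsSFiniteKernel κ := by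
  classical
  have hm : Measurable fun t => κ t univ := κ.measurable_coe .univ
  let B : ℕ → Set T := fun j => {t | (j : ℝ≥0∞) ≤ κ t univ ∧ κ t univ < j + 1}
  have hB : ∀ j, MeasurableSet (B j) := fun j =>
    (measurableSet_le measurable_const hm).inter (measurableSet_lt hm measurable_const)
  have hBu : ∀ t, ∃! j, t ∈ B j := fun t => by
    have hne : κ t univ ≠ ∞ := measure_ne_top _ _
    refine ⟨⌊(κ t univ).toReal⌋₊, ⟨?_, ?_⟩, ?_⟩
    · rw [← ENNReal.ofReal_toReal hne, ← ENNReal.ofReal_natCast]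
      simp only [ENNReal.toReal_ofReal ENNReal.toReal_nonneg]
      exact ENNReal.ofReal_le_ofReal (Nat.floor_le ENNReal.toReal_nonneg)
    · rw [← ENNReal.toReal_lt_toReal hne (by simp)]
      rw [ENNReal.toReal_add (by simp) (by simp)]
      simpa using Nat.lt_floor_add_one (κ t univ).toReal
    · rintro j ⟨h1, h2⟩
      symm
      rw [Nat.floor_eq_iff ENNReal.toReal_nonneg]
      rw [← ENNReal.toReal_le_toReal (by simp) hne] at h1
      rw [← ENNReal.toReal_lt_toReal hne (by simp), ENNReal.toReal_add (by simp) (by simp)] at h2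
      exact ⟨by simpa using h1, by simpa using h2⟩
  refine ⟨fun j => Kernel.piecewise (hB j) κ 0, fun j => ⟨j + 1, by simp, fun t => ?_⟩, ?_⟩
  · rw [Kernel.piecewise_apply]
    split_ifs with ht
    · exact ht.2.le
    · simp
  · ext t s hs
    rw [Kernel.sum_apply' _ _ hs]
    obtain ⟨j, hj, hju⟩ := hBu t
    rw [tsum_eq_single j]
    · rw [Kernel.piecewise_apply, if_pos hj]
    · intro i hi
      rw [Kernel.piecewise_apply, if_neg fun ht => hi (hju i ht)]
      simp

/-! ### Sets that are local epigraphs -/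

theorem continuous_initCoords {k : ℕ} : Continuous (initCoords : Euc (k + 1) → Euc k) := by
  unfold initCoords
  fun_prop

theorem initCoords_sub {k : ℕ} (x y : Euc (k + 1)) :
    initCoords (x - y) = initCoords x - initCoords y := by
  ext i; simp [initCoords]

/-- The point with first coordinates `p` and last coordinate `s`. -/
noncomputable def snocPt {k : ℕ} (p : Euc k) (s : ℝ) : Euc (k + 1) :=
  WithLp.toLp 2 (Fin.snoc (α := fun _ => ℝ) (fun i => p i) s)

theorem snocPt_last {k : ℕ} (p : Euc k) (s : ℝ) : snocPt p s (Fin.last k) = s := by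
  simp [snocPt]

theorem initCoords_snocPt {k : ℕ} (p : Euc k) (s : ℝ) : initCoords (snocPt p s) = p := by
  ext i; simp [snocPt, initCoords]

theorem snocPt_initCoords {k : ℕ} (z : Euc (k + 1)) : snocPt (initCoords z) (z (Fin.last k)) = z := by
  ext i
  refine Fin.lastCases ?_ (fun j => ?_) i <;> simp [snocPt, initCoords]

theorem snocPt_sub {k : ℕ} (p q : Euc k) (s t : ℝ) :
    snocPt p s - snocPt q t = snocPt (p - q) (s - t) := by
  ext i
  refine Fin.lastCases ?_ (fun j => ?_) i <;> simp [snocPt]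

theorem inner_snocPt {k : ℕ} (p q : Euc k) (s t : ℝ) :
    (inner ℝ (snocPt p s) (snocPt q t) : ℝ) = inner ℝ p q + s * t := by
  simp [PiLp.inner_apply, Fin.sum_univ_castSucc, snocPt, mul_comm]

theorem norm_snocPt_sq {k : ℕ} (p : Euc k) (s : ℝ) : ‖snocPt p s‖ ^ 2 = ‖p‖ ^ 2 + s ^ 2 := by
  rw [← real_inner_self_eq_norm_sq, inner_snocPt, real_inner_self_eq_norm_sq, sq s]

theorem norm_snocPt_le {k : ℕ} (p : Euc k) (s : ℝ) : ‖snocPt p s‖ ≤ ‖p‖ + |s| := by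
  apply le_of_sq_le_sq _ (by positivity)
  rw [norm_snocPt_sq, add_sq, sq_abs]
  nlinarith [mul_nonneg (norm_nonneg p) (abs_nonneg s)]

theorem norm_initCoords_le {k : ℕ} (z : Euc (k + 1)) : ‖initCoords z‖ ≤ ‖z‖ := by
  have := norm_snocPt_sq (initCoords z) (z (Fin.last k))
  rw [snocPt_initCoords] at this
  apply le_of_sq_le_sq _ (norm_nonneg _)
  nlinarith [sq_nonneg (z (Fin.last k))]

section Epigraph

variable {k : ℕ} {A : Set (Euc (k + 1))} {x : Euc (k + 1)} {I : Euc (k + 1) ≃ᵃⁱ[ℝ] Euc (k + 1)}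
  {f : Euc k → ℝ} {r : ℝ}

/-- The height of `y` over the graph. -/
noncomputable def heightOver (I : Euc (k + 1) ≃ᵃⁱ[ℝ] Euc (k + 1)) (f : Euc k → ℝ) (y : Euc (k + 1)) : ℝ :=
  I y (Fin.last k) - f (initCoords (I y))

theorem continuous_heightOver (hf : Continuous f) : Continuous (heightOver I f) := by
  unfold heightOver
  have h1 : Continuous fun y => I y := I.continuous
  have h2 : Continuous fun z : Euc (k + 1) => z (Fin.last k) := by fun_prop
  exact (h2.comp h1).sub (hf.comp (continuous_initCoords.comp h1))

theorem IsLocalEpigraph.mem_iff (h : IsLocalEpigraph A x I f r) {y : Euc (k + 1)}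
    (hy : y ∈ Metric.ball x r) : y ∈ A ↔ 0 < heightOver I f y := by
  have hIy : I y ∈ Metric.ball (0 : Euc (k + 1)) r := by
    rw [← h.1, Metric.mem_ball, I.dist_map]
    exact hy
  have h1 : I y ∈ I '' (A ∩ Metric.ball x r) ↔ y ∈ A := by
    rw [I.injective.mem_set_image]
    exact ⟨fun h => h.1, fun h => ⟨h, hy⟩⟩
  rw [← h1, h.2.2, heightOver, sub_pos]
  exact ⟨fun h => h.2, fun h => ⟨hIy, h⟩⟩

theorem isLocalEpigraph_of_mem_iff (hIx : I x = 0) (hf0 : f 0 = 0)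
    (h : ∀ y ∈ Metric.ball x r, (y ∈ A ↔ 0 < heightOver I f y)) : IsLocalEpigraph A x I f r := by
  refine ⟨hIx, hf0, ?_⟩
  have hball : ∀ y, I y ∈ Metric.ball (0 : Euc (k + 1)) r ↔ y ∈ Metric.ball x r := fun y => by
    rw [← hIx, Metric.mem_ball, I.dist_map, Metric.mem_ball]
  ext z
  obtain ⟨y, rfl⟩ := I.surjective z
  rw [I.injective.mem_set_image, mem_ofPred_eq, hball, mem_inter_iff]
  constructor
  · rintro ⟨hy, hyr⟩
    exact ⟨hyr, sub_pos.1 ((h y hyr).1 hy)⟩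
  · rintro ⟨hyr, hy⟩
    exact ⟨(h y hyr).2 (sub_pos.2 hy), hyr⟩

/-- The vertical direction of the chart. -/
noncomputable def vertical (I : Euc (k + 1) ≃ᵃⁱ[ℝ] Euc (k + 1)) : Euc (k + 1) :=
  I.linearIsometryEquiv.symm (snocPt 0 1)

theorem heightOver_add_vertical (y : Euc (k + 1)) (t : ℝ) :
    heightOver I f (y + t • vertical I) = heightOver I f y + t := by
  have h1 : I (y + t • vertical I) = snocPt (initCoords (I y)) (I y (Fin.last k) + t) := by
    have := I.map_vadd y (t • vertical I)
    rw [vadd_eq_add, vadd_eq_add, add_comm (t • vertical I) y] at this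
    rw [this, map_smul, vertical, LinearIsometryEquiv.apply_symm_apply]
    conv_lhs => rw [← snocPt_initCoords (I y)]
    ext i
    refine Fin.lastCases ?_ (fun j => ?_) i <;> simp [snocPt, add_comm]
  rw [heightOver, heightOver, h1, snocPt_last, initCoords_snocPt]
  ring

/-- The height grows at unit rate along the vertical direction, so a point of height `0` is a limit
of points of `A` without lying in `A`; strict signs of the height persist nearby. -/
theorem IsLocalEpigraph.mem_frontier_iff (h : IsLocalEpigraph A x I f r) (hf : Continuous f)
    {y : Euc (k + 1)} (hy : y ∈ Metric.ball x r) : y ∈ frontier A ↔ heightOver I f y = 0 := by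
  have hc := continuous_heightOver (I := I) hf
  have hball := Metric.isOpen_ball.mem_nhds hy
  constructor
  · intro hyA
    rcases lt_trichotomy (heightOver I f y) 0 with hlt | heq | hgt
    · exfalso
      have hev : ∀ᶠ z in 𝓝 y, z ∉ A := by
        filter_upwards [hball, hc.continuousAt.eventually_lt_const hlt] with z hz hz'
        rw [h.mem_iff hz]
        exact hz'.le.not_gt
      exact (mem_closure_iff_frequently.1 hyA.1) hev
    · exact heq
    · exfalso
      apply hyA.2
      rw [mem_interior_iff_mem_nhds]
      filter_upwards [hball, hc.continuousAt.eventually_const_lt hgt] with z hz hz'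
      exact (h.mem_iff hz).2 hz'
  · intro hy0
    have hlim : Tendsto (fun t : ℝ => y + t • vertical I) (𝓝[>] 0) (𝓝 y) := by
      have : Continuous fun t : ℝ => y + t • vertical I := by fun_prop
      simpa using (this.tendsto 0).mono_left nhdsWithin_le_nhds
    refine ⟨mem_closure_of_tendsto hlim ?_, fun hint => ?_⟩
    · filter_upwards [hlim hball, self_mem_nhdsWithin] with t ht ht0
      rw [h.mem_iff ht, heightOver_add_vertical, hy0, zero_add]
      exact ht0
    · have := (h.mem_iff hy).1 (interior_subset hint)
      exact this.ne' hy0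

theorem IsLocalEpigraph.notMem_interior_closure (h : IsLocalEpigraph A x I f r) (hf : Continuous f)
    {y : Euc (k + 1)} (hy : y ∈ Metric.ball x r) (hyA : y ∈ frontier A) :
    y ∉ interior (closure A) := by
  intro hint
  have hy0 := (h.mem_frontier_iff hf hy).1 hyA
  have hlim : Tendsto (fun t : ℝ => y + t • vertical I) (𝓝[<] 0) (𝓝 y) := by
    have : Continuous fun t : ℝ => y + t • vertical I := by fun_prop
    simpa using (this.tendsto 0).mono_left nhdsWithin_le_nhds
  have hev : ∀ᶠ t : ℝ in 𝓝[<] 0, False := by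
    filter_upwards [hlim (Metric.isOpen_ball.mem_nhds hy), self_mem_nhdsWithin,
      hlim (mem_interior_iff_mem_nhds.1 hint)] with t ht ht0 htc
    have hneg : heightOver I f (y + t • vertical I) < 0 := by
      rw [heightOver_add_vertical, hy0, zero_add]
      exact ht0
    have hfr : y + t • vertical I ∉ frontier A := fun hfr =>
      hneg.ne ((h.mem_frontier_iff hf ht).1 hfr)
    have hA : y + t • vertical I ∉ A := fun hA => hneg.not_gt ((h.mem_iff ht).1 hA)
    exact hfr ⟨htc, fun hi => hA (interior_subset hi)⟩
  exact hev.exists.elim fun _ h => h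

end Epigraph

theorem continuous_of_abs_sub_le {k : ℕ} {f : Euc k → ℝ} {L : ℝ}
    (hf : ∀ z z', |f z - f z'| ≤ L * ‖z - z'‖) : Continuous f := by
  have : LipschitzWith (Real.toNNReal L) f := LipschitzWith.of_dist_le_mul fun z z' => by
    rw [Real.dist_eq, dist_eq_norm]
    exact (hf z z').trans (by gcongr; exact Real.le_coe_toNNReal L)
  exact this.continuous

theorem LipschitzBoundary.isOpen {k : ℕ} {A : Set (Euc (k + 1))} {ε L : ℝ}
    (h : LipschitzBoundary A ε L) (hε : 0 < ε) : IsOpen A := by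
  rw [← subset_interior_iff_isOpen]
  intro x hx
  by_contra hxi
  obtain ⟨I, f, hf, hI⟩ := h x ⟨subset_closure hx, hxi⟩
  have hxb := Metric.mem_ball_self (x := x) hε
  have h0 := (hI.mem_frontier_iff (continuous_of_abs_sub_le hf) hxb).1 ⟨subset_closure hx, hxi⟩
  exact ((hI.mem_iff hxb).1 hx).ne' h0

/-- A Lipschitz domain has no slits: below a boundary point there is exterior. This allows the tube
to be recovered from tests that see its sections only up to null sets. -/
theorem LipschitzBoundary.interior_closure {k : ℕ} {A : Set (Euc (k + 1))} {ε L : ℝ}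
    (h : LipschitzBoundary A ε L) (hε : 0 < ε) : interior (closure A) = A := by
  refine Subset.antisymm (fun x hx => ?_) ((h.isOpen hε).subset_interior_closure)
  by_contra hxA
  have hfr : x ∈ frontier A := ⟨interior_subset hx, fun hi => hxA (interior_subset hi)⟩
  obtain ⟨I, f, hf, hI⟩ := h x hfr
  exact hI.notMem_interior_closure (continuous_of_abs_sub_le hf) (Metric.mem_ball_self hε) hfr hx

/-! ### Normals -/

/-- Along `v - v'` one enters `A` according to `v` and leaves it according to `v'`. -/
theorem IsInnerNormal.eq {k : ℕ} {A : Set (Euc k)} {x v v' : Euc k} (h : IsInnerNormal A x v)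
    (h' : IsInnerNormal A x v') : v = v' := by
  by_contra hne
  set d := v - v' with hd
  have hd0 : 0 < ‖d‖ := norm_pos_iff.2 (sub_ne_zero.2 hne)
  have hsq : ‖d‖ ^ 2 = 2 - 2 * inner ℝ v v' := by
    rw [hd, norm_sub_sq_real, h.2.1, h'.2.1]; ring
  have h1 : (inner ℝ v d : ℝ) = ‖d‖ ^ 2 / 2 := by
    rw [hsq, hd, inner_sub_right, real_inner_self_eq_norm_sq, h.2.1]; ring
  have h2 : (inner ℝ v' d : ℝ) = -(‖d‖ ^ 2 / 2) := by
    rw [hsq, hd, inner_sub_right, real_inner_self_eq_norm_sq, h'.2.1, real_inner_comm]; ring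
  have hlim : Tendsto (fun t : ℝ => x + t • d) (𝓝[>] 0) (𝓝 x) := by
    have : Continuous fun t : ℝ => x + t • d := by fun_prop
    simpa using (this.tendsto 0).mono_left nhdsWithin_le_nhds
  have hev := (hlim.eventually (h.2.2 (‖d‖ / 4) (by positivity))).and
    ((hlim.eventually (h'.2.2 (‖d‖ / 4) (by positivity))).and self_mem_nhdsWithin)
  obtain ⟨t, ha, hb, ht⟩ := hev.exists
  have ht' : 0 < t := ht
  rw [add_sub_cancel_left, inner_smul_right, norm_smul, Real.norm_of_nonneg ht'.le] at ha hb
  have hp : 0 < t * ‖d‖ ^ 2 := by positivity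
  refine (hb.2 ?_) (ha.1 ?_)
  · rw [h2]; nlinarith
  · rw [h1]; nlinarith

theorem innerNormal_eq {k : ℕ} {A : Set (Euc k)} {x v : Euc k} (h : IsInnerNormal A x v) :
    innerNormal A x = v := by
  have hex : ∃ v, IsInnerNormal A x v := ⟨v, h⟩
  rw [innerNormal, dif_pos hex]
  exact hex.choose_spec.eq h

/-- A strictly differentiable defining function gives normals. -/
theorem normals_of_hasStrictFDerivAt {k : ℕ} {A : Set (Euc k)} {x : Euc k} {φ : Euc k → ℝ}
    {φ' : Euc k →L[ℝ] ℝ} (hφ : HasStrictFDerivAt φ φ' x) (hφ' : φ' ≠ 0) (hx : x ∈ frontier A)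
    (hA : ∀ᶠ y in 𝓝 x, (y ∈ A ↔ 0 < φ y)) (hfr : ∀ᶠ y in 𝓝 x, y ∈ frontier A → φ y = 0) :
    ∃ v, IsInnerNormal A x v ∧ StrictNormal (frontier A) x v := by
  set w : Euc k := (InnerProductSpace.toDual ℝ (Euc k)).symm φ' with hw
  have hwφ : ∀ z, φ' z = inner ℝ w z := fun z => by
    rw [hw, InnerProductSpace.toDual_symm_apply]
  have hw0 : 0 < ‖w‖ := by
    rw [norm_pos_iff]
    rintro h0
    apply hφ'
    ext z
    rw [hwφ, h0, inner_zero_left]; rfl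
  have hφx : φ x = 0 := hfr.self_of_nhds hx
  have hinner : ∀ z, (inner ℝ (‖w‖⁻¹ • w) z : ℝ) = ‖w‖⁻¹ * φ' z := fun z => by
    rw [inner_smul_left, hwφ]; simp
  have hnorm : ‖‖w‖⁻¹ • w‖ = 1 := by
    rw [norm_smul, norm_inv, norm_norm, inv_mul_cancel₀ hw0.ne']
  refine ⟨‖w‖⁻¹ • w, ⟨hx, hnorm, fun ε hε => ?_⟩, hnorm, fun η hη => ?_⟩
  · have h1 := (hφ.hasFDerivAt.isLittleO.def (show 0 < ε * ‖w‖ by positivity))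
    filter_upwards [h1, hA] with y hy hyA
    rw [hφx, sub_zero, Real.norm_eq_abs, abs_le] at hy
    rw [hinner, hyA]
    constructor
    · intro h
      rw [lt_inv_mul_iff₀ hw0] at h
      nlinarith [hy.1]
    · intro h
      have h' : φ' (y - x) < -(ε * ‖y - x‖) * ‖w‖ := by
        rw [inv_mul_eq_div, div_lt_iff₀ hw0] at h
        exact h
      nlinarith [hy.2]
  · have h1 := hφ.isLittleO.def (show 0 < η * ‖w‖ by positivity)
    rw [nhds_prod_eq] at h1
    obtain ⟨s, hs, hsp⟩ := Filter.eventually_prod_self_iff'.1 h1 |>.imp fun s hs => hs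
    obtain ⟨ρ, hρ, hρs⟩ := Metric.mem_nhds_iff.1 (inter_mem hs hfr)
    refine ⟨ρ, hρ, fun y hy y' hy' => ?_⟩
    have h2 := hsp y (hρs hy.2).1 y' (hρs hy'.2).1
    simp only at h2
    rw [(hρs hy.2).2 hy.1, (hρs hy'.2).2 hy'.1, sub_self, zero_sub, norm_neg, Real.norm_eq_abs] at h2
    rw [hinner, abs_mul, abs_of_pos (inv_pos.2 hw0), inv_mul_le_iff₀ hw0]
    linarith

theorem IsLocalEpigraph.normals {k : ℕ} {A : Set (Euc (k + 1))} {x : Euc (k + 1)}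
    {I : Euc (k + 1) ≃ᵃⁱ[ℝ] Euc (k + 1)} {f : Euc k → ℝ} {r : ℝ}
    (h : IsLocalEpigraph A x I f r) (hf : ContDiff ℝ 1 f) {y : Euc (k + 1)}
    (hy : y ∈ Metric.ball x r) (hyA : y ∈ frontier A) :
    ∃ v, IsInnerNormal A y v ∧ StrictNormal (frontier A) y v := by
  have hφ : ContDiff ℝ 1 (heightOver I f) := by
    unfold heightOver
    have hI : ContDiff ℝ 1 fun y => I y :=
      (I.toAffineIsometry.toContinuousAffineMap).contDiff
    have h2 : ContDiff ℝ 1 fun z : Euc (k + 1) => z (Fin.last k) := by fun_prop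
    have h3 : ContDiff ℝ 1 (initCoords : Euc (k + 1) → Euc k) := by
      unfold initCoords
      fun_prop
    exact (h2.comp hI).sub (hf.comp (h3.comp hI))
  have hd := hφ.contDiffAt.hasStrictFDerivAt (x := y) one_ne_zero
  refine normals_of_hasStrictFDerivAt hd ?_ hyA ?_ ?_
  -- The derivative cannot vanish, because the height has derivative `1` along the vertical
  -- direction.
  · intro h0
    have h1 : HasDerivAt (fun t : ℝ => heightOver I f (y + t • vertical I)) 0 0 := by
      have hl : HasDerivAt (fun t : ℝ => y + t • vertical I) (vertical I) 0 := by
        simpa using ((hasDerivAt_id (0 : ℝ)).smul_const (vertical I)).const_add y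
      have hd' := hd.hasFDerivAt
      rw [h0] at hd'
      have := HasFDerivAt.comp_hasDerivAt (x := (0 : ℝ)) (f := fun t : ℝ => y + t • vertical I)
        (l := heightOver I f) (l' := 0) (by simpa using hd') hl
      exact this
    have h2 : HasDerivAt (fun t : ℝ => heightOver I f (y + t • vertical I)) 1 0 := by
      simp_rw [heightOver_add_vertical]
      exact (hasDerivAt_id (0 : ℝ)).const_add _
    exact zero_ne_one (h1.unique h2)
  · filter_upwards [Metric.isOpen_ball.mem_nhds hy] with z hz using h.mem_iff hz
  · filter_upwards [Metric.isOpen_ball.mem_nhds hy] with z hz using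
      (h.mem_frontier_iff hf.continuous hz).1

theorem IsC1BoundaryAt.exists_ball {k : ℕ} {A : Set (Euc (k + 1))} {x : Euc (k + 1)}
    (h : IsC1BoundaryAt A x) : ∃ r > 0, ∀ y ∈ frontier A ∩ Metric.ball x r,
      ∃ v, IsInnerNormal A y v ∧ StrictNormal (frontier A) y v := by
  obtain ⟨I, f, r, hr, hf, hI⟩ := h
  exact ⟨r, hr, fun y hy => hI.normals hf hy.2 hy.1⟩

theorem IsC1BoundaryAt.normals {k : ℕ} {A : Set (Euc (k + 1))} {x : Euc (k + 1)}
    (h : IsC1BoundaryAt A x) (hx : x ∈ frontier A) :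
    IsInnerNormal A x (innerNormal A x) ∧ StrictNormal (frontier A) x (innerNormal A x) := by
  obtain ⟨r, hr, hn⟩ := h.exists_ball
  obtain ⟨v, hv, hv'⟩ := hn x ⟨hx, Metric.mem_ball_self hr⟩
  rw [innerNormal_eq hv]
  exact ⟨hv, hv'⟩

/-! ### Continuously differentiable boundary points from strict flatness -/

theorem norm_le_of_forall_abs_inner_sub_le {k : ℕ} {w p : Euc k} {η ρ : ℝ} (hη : 0 ≤ η) (hρ : 0 < ρ)
    (h : ∀ q ∈ Metric.ball p ρ, ∀ q' ∈ Metric.ball p ρ, |(inner ℝ w (q - q') : ℝ)| ≤ η * ‖q - q'‖) :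
    ‖w‖ ≤ η := by
  rcases eq_or_ne w 0 with rfl | hw
  · simpa using hη
  have hw0 : 0 < ‖w‖ := norm_pos_iff.2 hw
  have ht : 0 < ρ / (2 * ‖w‖) := by positivity
  have := h (p + (ρ / (2 * ‖w‖)) • w) (by
    rw [Metric.mem_ball, dist_eq_norm, add_sub_cancel_left, norm_smul, Real.norm_of_nonneg ht.le]
    field_simp; linarith) p (Metric.mem_ball_self hρ)
  rw [add_sub_cancel_left, inner_smul_right, real_inner_self_eq_norm_sq, norm_smul,
    Real.norm_of_nonneg ht.le, abs_of_nonneg (by positivity)] at this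
  have h2 : ρ / (2 * ‖w‖) * ‖w‖ * ‖w‖ ≤ ρ / (2 * ‖w‖) * ‖w‖ * η := by nlinarith
  exact le_of_mul_le_mul_left h2 (by positivity)

/-- `f` has the slope `g` up to the error `η` near `p`. -/
def SlopeNear {k : ℕ} (f : Euc k → ℝ) (p g : Euc k) (η : ℝ) : Prop :=
  ∃ ρ > 0, ∀ q ∈ Metric.ball p ρ, ∀ q' ∈ Metric.ball p ρ,
    |f q - f q' - inner ℝ g (q - q')| ≤ η * ‖q - q'‖

/-- Both approximations are valid on a small ball around `p'`, and two affine approximations on a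
common ball have close slopes. -/
theorem SlopeNear.dist_le {k : ℕ} {f : Euc k → ℝ} {p p' g g' : Euc k} {η η' ρ : ℝ}
    (hη : 0 ≤ η) (hη' : 0 ≤ η')
    (h : ∀ q ∈ Metric.ball p ρ, ∀ q' ∈ Metric.ball p ρ,
      |f q - f q' - inner ℝ g (q - q')| ≤ η * ‖q - q'‖)
    (h' : SlopeNear f p' g' η') (hp' : p' ∈ Metric.ball p ρ) : ‖g - g'‖ ≤ η + η' := by
  obtain ⟨ρ', hρ', h'⟩ := h'
  obtain ⟨δ, hδ, hδs⟩ := Metric.isOpen_iff.1 (Metric.isOpen_ball.inter Metric.isOpen_ball) p'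
    (⟨hp', Metric.mem_ball_self hρ'⟩ : p' ∈ Metric.ball p ρ ∩ Metric.ball p' ρ')
  refine norm_le_of_forall_abs_inner_sub_le (p := p') (add_nonneg hη hη') hδ fun q hq q' hq' => ?_
  have h1 := h q (hδs hq).1 q' (hδs hq').1
  have h2 := h' q (hδs hq).2 q' (hδs hq').2
  rw [abs_le] at h1 h2 ⊢
  rw [inner_sub_left, add_mul]
  constructor <;> linarith

/-- Slopes at error `1 / (j + 1)` form a Cauchy sequence by `SlopeNear.dist_le`, and their limit
works for every error. -/
theorem exists_slope {k : ℕ} {f : Euc k → ℝ} {p : Euc k} (h : ∀ η > 0, ∃ g, SlopeNear f p g η) :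
    ∃ g, ∀ η > 0, SlopeNear f p g η := by
  have hpos : ∀ j : ℕ, (0 : ℝ) < 1 / (j + 1) := fun j => Nat.one_div_pos_of_nat
  choose g hg using fun j : ℕ => h (1 / ((j : ℝ) + 1)) (hpos j)
  have hlim := tendsto_one_div_add_atTop_nhds_zero_nat (𝕜 := ℝ)
  have hdist : ∀ i j, ‖g i - g j‖ ≤ 1 / ((i : ℝ) + 1) + 1 / ((j : ℝ) + 1) := fun i j => by
    obtain ⟨ρ, hρ, hgi⟩ := hg i
    exact SlopeNear.dist_le (hpos i).le (hpos j).le hgi (hg j) (Metric.mem_ball_self hρ)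
  have hcau : CauchySeq g := by
    refine cauchySeq_of_le_tendsto_0 (fun N : ℕ => 1 / ((N : ℝ) + 1) + 1 / ((N : ℝ) + 1))
      (fun i j N hi hj => ?_) (by simpa using hlim.add hlim)
    rw [dist_eq_norm]
    exact (hdist i j).trans (add_le_add (Nat.one_div_le_one_div hi) (Nat.one_div_le_one_div hj))
  obtain ⟨g₀, hg₀⟩ := cauchySeq_tendsto_of_complete hcau
  refine ⟨g₀, fun η hη => ?_⟩
  have hev := ((hlim.eventually_lt_const (show 0 < η / 2 by positivity))).and
    (Metric.tendsto_nhds.1 hg₀ (η / 2) (by positivity))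
  obtain ⟨j, hj, hj'⟩ := hev.exists
  obtain ⟨ρ, hρ, hgj⟩ := hg j
  refine ⟨ρ, hρ, fun q hq q' hq' => ?_⟩
  have h1 := hgj q hq q' hq'
  have h2 := abs_real_inner_le_norm (g j - g₀) (q - q')
  rw [dist_eq_norm] at hj'
  have h3 : ‖g j - g₀‖ * ‖q - q'‖ ≤ η / 2 * ‖q - q'‖ := by gcongr
  have h4 : 1 / ((j : ℝ) + 1) * ‖q - q'‖ ≤ η / 2 * ‖q - q'‖ := by gcongr
  rw [inner_sub_left] at h2
  rw [abs_le] at h1 h2 ⊢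
  constructor <;> linarith

/-- The slope condition is strict, with two free points near `p`. Hence it can be compared with the
slope at a neighbouring point, and that comparison is continuity of the gradient. -/
theorem contDiffAt_one_of_slopes {k : ℕ} {f : Euc k → ℝ} {u : Set (Euc k)} (hu : IsOpen u)
    (h : ∀ p ∈ u, ∀ η > 0, ∃ g, SlopeNear f p g η) {p : Euc k} (hp : p ∈ u) :
    ContDiffAt ℝ 1 f p := by
  choose! g hg using fun p hp => exists_slope (h p hp)
  rw [contDiffAt_one_iff]
  refine ⟨fun q => innerSL ℝ (g q), u, hu.mem_nhds hp, ?_, fun q hq => ?_⟩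
  · refine (innerSL ℝ (E := Euc k)).continuous.comp_continuousOn fun q hq => ?_
    rw [ContinuousWithinAt, Metric.tendsto_nhds]
    intro η hη
    obtain ⟨ρ, hρ, hgq⟩ := hg q hq (η / 4) (by positivity)
    filter_upwards [mem_nhdsWithin_of_mem_nhds (Metric.ball_mem_nhds q hρ), self_mem_nhdsWithin]
      with q' hq' hq'u
    rw [dist_comm, dist_eq_norm]
    exact (SlopeNear.dist_le (by positivity) (by positivity) hgq
      (hg q' hq'u (η / 4) (by positivity)) hq').trans_lt (by linarith)
  · rw [hasFDerivAt_iff_isLittleO]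
    refine Asymptotics.IsLittleO.of_bound fun η hη => ?_
    obtain ⟨ρ, hρ, hgq⟩ := hg q hq η hη
    filter_upwards [Metric.ball_mem_nhds q hρ] with q' hq'
    simpa using hgq q' hq' q (Metric.mem_ball_self hρ)

/-- A Lipschitz function whose graph is flat near a point has a slope there. -/
theorem slopeNear_of_graph {k : ℕ} {f : Euc k → ℝ} {L : ℝ} (hL : 0 ≤ L)
    (hf : ∀ z z', |f z - f z'| ≤ L * ‖z - z'‖) {p a : Euc k} {b η ρ : ℝ} (hρ : 0 < ρ)
    (hη : 0 < η) (hη1 : η * (1 + L) ≤ 1 / 4) (hab : ‖a‖ ^ 2 + b ^ 2 = 1)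
    (h : ∀ q ∈ Metric.ball p ρ, ∀ q' ∈ Metric.ball p ρ,
      |inner ℝ a (q - q') + b * (f q - f q')| ≤ η * (1 + L) * ‖q - q'‖) :
    SlopeNear f p (-(b⁻¹ • a)) (2 * (1 + L) * (η * (1 + L))) := by
  -- The Lipschitz bound on `f` prevents the normal `(a, b)` from being almost horizontal: `a` is
  -- controlled by `b`.
  have ha : ‖a‖ ≤ |b| * L + η * (1 + L) := by
    refine norm_le_of_forall_abs_inner_sub_le (p := p) (by positivity) hρ fun q hq q' hq' => ?_
    have h1 := h q hq q' hq'
    have h2 : |b * (f q - f q')| ≤ |b| * (L * ‖q - q'‖) := by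
      rw [abs_mul]
      exact mul_le_mul_of_nonneg_left (hf q q') (abs_nonneg b)
    rw [abs_le] at h1 h2 ⊢
    constructor <;> nlinarith
  -- Otherwise `|b| ≤ 1/2` and `‖a‖ ≤ 3/4`, against `‖a‖² + b² = 1`.
  have hb : 1 ≤ 2 * (1 + L) * |b| := by
    by_contra! hlt
    have hb0 := abs_nonneg b
    have hb1 : |b| ≤ 1 / 2 := by nlinarith
    have ha1 : ‖a‖ ≤ 3 / 4 := by nlinarith
    have := sq_abs b
    nlinarith [norm_nonneg a]
  have hb0 : b ≠ 0 := by
    rintro rfl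
    simp at hb
    linarith
  refine ⟨ρ, hρ, fun q hq q' hq' => ?_⟩
  have h1 := h q hq q' hq'
  have h2 : f q - f q' - inner ℝ (-(b⁻¹ • a)) (q - q') =
      b⁻¹ * (inner ℝ a (q - q') + b * (f q - f q')) := by
    rw [inner_neg_left, inner_smul_left]
    simp
    field_simp
    ring
  rw [h2, abs_mul, abs_inv, inv_mul_le_iff₀ (abs_pos.2 hb0)]
  calc _ ≤ η * (1 + L) * ‖q - q'‖ := h1
    _ ≤ (2 * (1 + L) * |b|) * (η * (1 + L) * ‖q - q'‖) := le_mul_of_one_le_left (by positivity) hb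
    _ = _ := by ring

theorem continuous_snocPt {k : ℕ} : Continuous fun z : Euc k × ℝ => snocPt z.1 z.2 := by
  have h : ∀ i : Fin (k + 1), Continuous fun z : Euc k × ℝ => snocPt z.1 z.2 i := fun i => by
    refine Fin.lastCases ?_ (fun j => ?_) i
    · simpa [snocPt] using continuous_snd
    · simp only [snocPt, Fin.snoc_castSucc]
      fun_prop
  exact (PiLp.continuous_toLp 2 _).comp (continuous_pi h)

theorem snocPt_zero {k : ℕ} : snocPt (0 : Euc k) 0 = 0 := by
  ext i
  refine Fin.lastCases ?_ (fun j => ?_) i <;> simp [snocPt]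

theorem heightOver_symm_snocPt {k : ℕ} (I : Euc (k + 1) ≃ᵃⁱ[ℝ] Euc (k + 1)) (f : Euc k → ℝ)
    (p : Euc k) (s : ℝ) : heightOver I f (I.symm (snocPt p s)) = s - f p := by
  rw [heightOver, AffineIsometryEquiv.apply_symm_apply, snocPt_last, initCoords_snocPt]

theorem symm_sub_symm {k : ℕ} (I : Euc k ≃ᵃⁱ[ℝ] Euc k) (z z' : Euc k) :
    I.symm z - I.symm z' = I.linearIsometryEquiv.symm (z - z') := by
  apply I.linearIsometryEquiv.injective
  rw [LinearIsometryEquiv.apply_symm_apply, ← vsub_eq_sub, I.map_vsub]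
  simp

/-- In the Lipschitz chart flatness turns into slopes of the graph function by `slopeNear_of_graph`,
and `contDiffAt_one_of_slopes` applies. The normal may change with the scale `η`, so that the
condition can be tested on countably many vectors. -/
theorem isC1BoundaryAt_of_flat {k : ℕ} {A : Set (Euc (k + 1))} {ε L : ℝ} (hε : 0 < ε) (hL : 0 ≤ L)
    (hA : LipschitzBoundary A ε L) {x : Euc (k + 1)} (hx : x ∈ frontier A) {N : Set (Euc (k + 1))}
    (hN : N ∈ 𝓝 x) (hflat : ∀ y ∈ frontier A ∩ N, ∀ η > 0, ∃ ρ > 0, ∃ v, ‖v‖ = 1 ∧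
      Flat (frontier A ∩ Metric.ball y ρ) v η) : IsC1BoundaryAt A x := by
  obtain ⟨I, f, hf, hI⟩ := hA x hx
  have hfc := continuous_of_abs_sub_le hf
  set Y : Euc k → Euc (k + 1) := fun p => I.symm (snocPt p (f p)) with hY
  have hYc : Continuous Y :=
    I.symm.continuous.comp (continuous_snocPt.comp (continuous_id.prodMk hfc))
  have hY0 : Y 0 = x := by
    rw [hY]
    simp only [hI.2.1]
    rw [snocPt_zero, ← hI.1, I.symm_apply_apply]
  have hnb : Y ⁻¹' (N ∩ Metric.ball x ε) ∈ 𝓝 (0 : Euc k) := by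
    apply hYc.continuousAt
    rw [hY0]
    exact inter_mem hN (Metric.ball_mem_nhds x hε)
  obtain ⟨δ, hδ, hδs⟩ := Metric.mem_nhds_iff.1 hnb
  have hYfr : ∀ p, Y p ∈ Metric.ball x ε → Y p ∈ frontier A := fun p hp => by
    rw [hI.mem_frontier_iff hfc hp, heightOver_symm_snocPt, sub_self]
  have hslope : ∀ p ∈ Metric.ball (0 : Euc k) δ, ∀ η > 0, ∃ g, SlopeNear f p g η := by
    intro p hp η hη
    -- The first bound is the smallness required by `slopeNear_of_graph`; the second makes its
    -- resulting error at most `η`.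
    set η' : ℝ := min (1 / (4 * (1 + L))) (η / (2 * (1 + L) * (1 + L))) with hη'
    have hη'0 : 0 < η' := by positivity
    have hη'1 : η' * (1 + L) ≤ 1 / 4 := by
      calc η' * (1 + L) ≤ 1 / (4 * (1 + L)) * (1 + L) := by gcongr; exact min_le_left _ _
        _ = 1 / 4 := by field_simp
    have hη'2 : 2 * (1 + L) * (η' * (1 + L)) ≤ η := by
      calc 2 * (1 + L) * (η' * (1 + L)) = η' * (2 * (1 + L) * (1 + L)) := by ring
        _ ≤ η / (2 * (1 + L) * (1 + L)) * (2 * (1 + L) * (1 + L)) := by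
          gcongr; exact min_le_right _ _
        _ = η := by field_simp
    have hpm := hδs hp
    obtain ⟨ρ, hρ, v, hv, hfl⟩ := hflat (Y p) ⟨hYfr p hpm.2, hpm.1⟩ η' hη'0
    have hnb' : Y ⁻¹' (Metric.ball (Y p) ρ ∩ Metric.ball x ε) ∈ 𝓝 p :=
      hYc.continuousAt (inter_mem (Metric.ball_mem_nhds _ hρ) (Metric.isOpen_ball.mem_nhds hpm.2))
    obtain ⟨σ, hσ, hσs⟩ := Metric.mem_nhds_iff.1 hnb'
    set w := I.linearIsometryEquiv v with hw
    have hab : ‖initCoords w‖ ^ 2 + (w (Fin.last k)) ^ 2 = 1 := by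
      rw [← norm_snocPt_sq, snocPt_initCoords, hw, LinearIsometryEquiv.norm_map, hv, one_pow]
    have hsl := slopeNear_of_graph hL hf hσ hη'0 hη'1 hab (p := p) fun q hq q' hq' => by
      have h1 := hfl (Y q) ⟨hYfr q (hσs hq).2, (hσs hq).1⟩ (Y q') ⟨hYfr q' (hσs hq').2, (hσs hq').1⟩
      have h2 : Y q - Y q' = I.linearIsometryEquiv.symm (snocPt (q - q') (f q - f q')) := by
        rw [hY, ← snocPt_sub, symm_sub_symm]
      have h3 : (inner ℝ v (Y q - Y q') : ℝ) =
          inner ℝ (initCoords w) (q - q') + w (Fin.last k) * (f q - f q') := by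
        rw [← inner_snocPt, snocPt_initCoords, h2, hw, ← LinearIsometryEquiv.inner_map_eq_flip]
      rw [h3] at h1
      refine h1.trans ?_
      rw [h2, LinearIsometryEquiv.norm_map, mul_assoc]
      gcongr
      refine (norm_snocPt_le _ _).trans ?_
      have := hf q q'
      linarith
    obtain ⟨ρ', hρ', hs'⟩ := hsl
    exact ⟨_, ρ', hρ', fun q hq q' hq' => (hs' q hq q' hq').trans (by gcongr)⟩
  -- A globally `C¹` function is demanded, so `f` is cut off: the bump equals `1` where the new
  -- chart looks and is supported where `f` has slopes.
  let χ : ContDiffBump (0 : Euc k) := ⟨δ / 4, δ / 2, by positivity, by linarith⟩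
  refine ⟨I, fun p => χ p * f p, min ε (δ / 4), by positivity, ?_, ?_⟩
  · rw [contDiff_iff_contDiffAt]
    intro p
    by_cases hp : p ∈ tsupport (fun p => χ p * f p)
    swap
    · exact (contDiffAt_const (c := (0 : ℝ))).congr_of_eventuallyEq (notMem_tsupport_iff_eventuallyEq.1 hp)
    have hp' : p ∈ Metric.ball (0 : Euc k) δ := by
      have h1 := tsupport_mul_subset_left hp
      rw [χ.tsupport_eq] at h1
      exact Metric.closedBall_subset_ball (show δ / 2 < δ by linarith) h1
    exact χ.contDiffAt.mul (contDiffAt_one_of_slopes Metric.isOpen_ball hslope hp')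
  · refine isLocalEpigraph_of_mem_iff hI.1 (by simp [hI.2.1]) fun y hy => ?_
    rw [hI.mem_iff (Metric.ball_subset_ball (min_le_left _ _) hy)]
    have h1 : χ (initCoords (I y)) = 1 := by
      apply χ.one_of_mem_closedBall
      have h2 : ‖I y‖ < δ / 4 := by
        have : dist (I y) (I x) = dist y x := I.dist_map y x
        rw [hI.1, dist_zero_right] at this
        rw [this]
        exact (Metric.mem_ball.1 hy).trans_le (min_le_right _ _)
      rw [mem_closedBall_zero_iff]
      exact ((norm_initCoords_le _).trans_lt h2).le
    rw [heightOver, heightOver, h1, one_mul]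

/-! ### Measure of Lipschitz boundaries -/

theorem IsLocalEpigraph.measure_frontier_le {k : ℕ} {A : Set (Euc (k + 1))} {x : Euc (k + 1)}
    {I : Euc (k + 1) ≃ᵃⁱ[ℝ] Euc (k + 1)} {f : Euc k → ℝ} {ε L : ℝ} (hL : 0 ≤ L)
    (h : IsLocalEpigraph A x I f ε) (hf : ∀ z z', |f z - f z'| ≤ L * ‖z - z'‖) :
    μHE[k] (frontier A ∩ Metric.ball x ε) ≤
      (Real.toNNReal (1 + L) : ℝ≥0∞) ^ k * volume (Metric.ball (0 : Euc k) ε) := by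
  have hlip : LipschitzOnWith (Real.toNNReal (1 + L)) (fun p => I.symm (snocPt p (f p)))
      (Metric.ball 0 ε) := by
    refine LipschitzOnWith.of_dist_le_mul fun p _ q _ => ?_
    rw [I.symm.dist_map, dist_eq_norm, dist_eq_norm, snocPt_sub, Real.coe_toNNReal _ (by positivity)]
    refine (norm_snocPt_le _ _).trans ?_
    have := hf p q
    linarith
  rw [← EuclideanSpace.euclideanHausdorffMeasure_eq_volume]
  refine (measure_mono ?_).trans (euclideanHausdorffMeasure_image_le hlip k)
  rintro y ⟨hyA, hy⟩
  have h0 := (h.mem_frontier_iff (continuous_of_abs_sub_le hf) hy).1 hyA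
  refine ⟨initCoords (I y), ?_, ?_⟩
  · rw [mem_ball_zero_iff]
    refine (norm_initCoords_le _).trans_lt ?_
    have : dist (I y) (I x) = dist y x := I.dist_map y x
    rw [h.1, dist_zero_right] at this
    rw [this]
    exact hy
  · have h1 : f (initCoords (I y)) = I y (Fin.last k) := by
      rw [heightOver] at h0; linarith
    simp only [h1, snocPt_initCoords, I.symm_apply_apply]

/-- Finitely many balls of radius `ε / 2` cover `K`, and inside each of them the boundary lies in
one chart. The bound depends on `ε`, `L` and `K` but not on `A`; this uniformity makes the mean area
finite. -/
theorem exists_measure_frontier_le {k : ℕ} {ε L : ℝ} (hε : 0 < ε) (hL : 0 ≤ L)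
    {K : Set (Euc (k + 1))} (hK : Bornology.IsBounded K) :
    ∃ C : ℝ≥0∞, C < ⊤ ∧ ∀ A : Set (Euc (k + 1)), LipschitzBoundary A ε L →
      μHE[k] (frontier A ∩ K) ≤ C := by
  obtain ⟨t, ht, hKt⟩ := Metric.totallyBounded_iff.1 (hK.isCompact_closure.totallyBounded.subset subset_closure) (ε / 2) (by positivity)
  set c : ℝ≥0∞ := (Real.toNNReal (1 + L) : ℝ≥0∞) ^ k * volume (Metric.ball (0 : Euc k) ε) with hc
  have hc' : c < ⊤ := ENNReal.mul_lt_top (ENNReal.pow_lt_top ENNReal.coe_lt_top)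
    measure_ball_lt_top
  refine ⟨ht.toFinset.card * c, ENNReal.mul_lt_top (ENNReal.natCast_lt_top _) hc', fun A hA => ?_⟩
  calc μHE[k] (frontier A ∩ K)
      ≤ μHE[k] (⋃ y ∈ ht.toFinset, frontier A ∩ Metric.ball y (ε / 2)) := by
        apply measure_mono
        rintro z ⟨hzA, hzK⟩
        obtain ⟨y, hy, hzy⟩ := mem_iUnion₂.1 (hKt hzK)
        exact mem_iUnion₂.2 ⟨y, ht.mem_toFinset.2 hy, hzA, hzy⟩
    _ ≤ ∑ y ∈ ht.toFinset, μHE[k] (frontier A ∩ Metric.ball y (ε / 2)) :=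
        measure_biUnion_finset_le _ _
    _ ≤ ∑ y ∈ ht.toFinset, c := by
        refine Finset.sum_le_sum fun y _ => ?_
        rcases (frontier A ∩ Metric.ball y (ε / 2)).eq_empty_or_nonempty with h0 | ⟨x, hxA, hxy⟩
        · rw [h0, measure_empty]; exact zero_le
        · obtain ⟨I, f, hf, hI⟩ := hA x hxA
          refine (measure_mono ?_).trans (hI.measure_frontier_le hL hf)
          rintro z ⟨hzA, hzy⟩
          refine ⟨hzA, ?_⟩
          have := dist_triangle_right z x y
          rw [Metric.mem_ball] at *
          linarith
    _ = _ := by rw [Finset.sum_const, nsmul_eq_mul]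

/-- The projection of the graph to the base of the chart does not increase measure, and its image
contains a ball. -/
theorem LipschitzBoundary.measure_frontier_pos {k : ℕ} {A : Set (Euc (k + 1))} {ε L : ℝ}
    (hε : 0 < ε) (hA : LipschitzBoundary A ε L) {x : Euc (k + 1)} (hx : x ∈ frontier A) :
    0 < μHE[k] (frontier A ∩ Metric.ball x ε) := by
  obtain ⟨I, f, hf, hI⟩ := hA x hx
  have hfc := continuous_of_abs_sub_le hf
  set Y : Euc k → Euc (k + 1) := fun p => I.symm (snocPt p (f p)) with hY
  have hYc : Continuous Y :=
    I.symm.continuous.comp (continuous_snocPt.comp (continuous_id.prodMk hfc))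
  have hY0 : Y 0 = x := by
    rw [hY]
    simp only [hI.2.1]
    rw [snocPt_zero, ← hI.1, I.symm_apply_apply]
  have hnb : Y ⁻¹' (Metric.ball x ε) ∈ 𝓝 (0 : Euc k) := by
    apply hYc.continuousAt
    rw [hY0]
    exact Metric.ball_mem_nhds x hε
  obtain ⟨δ, hδ, hδs⟩ := Metric.mem_nhds_iff.1 hnb
  have hlip : LipschitzOnWith 1 (fun y => initCoords (I y)) (frontier A ∩ Metric.ball x ε) := by
    refine LipschitzOnWith.of_dist_le_mul fun y _ z _ => ?_
    rw [dist_eq_norm, ← initCoords_sub, NNReal.coe_one, one_mul]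
    refine (norm_initCoords_le _).trans ?_
    rw [← dist_eq_norm, I.dist_map]
  have h1 := euclideanHausdorffMeasure_image_le hlip k
  rw [ENNReal.coe_one, one_pow, one_mul] at h1
  refine lt_of_lt_of_le ?_ h1
  refine lt_of_lt_of_le ?_ (measure_mono (s := Metric.ball (0 : Euc k) δ) fun p hp =>
    ⟨Y p, ⟨?_, hδs hp⟩, ?_⟩)
  · rw [EuclideanSpace.euclideanHausdorffMeasure_eq_volume]
    exact Metric.measure_ball_pos _ _ hδ
  · rw [hI.mem_frontier_iff hfc (hδs hp), heightOver_symm_snocPt, sub_self]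
  · simp only [hY, I.apply_symm_apply, initCoords_snocPt]

/-- For `n = 0` an infinite boundary would accumulate inside a compact set, against the separation
of its points; otherwise `exists_measure_frontier_le` applies. -/
theorem measure_frontier_lt_top_of_sectionLipschitz {n : ℕ} {A : Set (Euc (n + 1))}
    (hA : Bornology.IsBounded A) {ε L : ℝ} (hε : 0 < ε) (hL : 0 ≤ L) (h : SectionLipschitz A ε L) :
    μHE[n] (frontier A) < ⊤ := by
  have hbd : Bornology.IsBounded (frontier A) := hA.closure.subset frontier_subset_closure
  match n, A, hA, h, hbd with
  | 0, A, _, h, hbd =>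
    have hfin : (frontier A).Finite := by
      by_contra hinf
      have hc : IsCompact (frontier A) := Metric.isCompact_of_isClosed_isBounded isClosed_frontier hbd
      obtain ⟨x, hx, hacc⟩ := Set.Infinite.exists_accPt_of_subset_isCompact hinf hc subset_rfl
      rw [accPt_iff_frequently] at hacc
      obtain ⟨y, ⟨hne, hy⟩, hyx⟩ := (hacc.and_eventually (Metric.ball_mem_nhds x hε)).exists
      exact lt_irrefl _ ((h y hy x hx hne).trans hyx)
    rw [Measure.euclideanHausdorffMeasure_zero]
    have hle := measure_biUnion_finset_le (μ := (μH[0] : Measure (Euc 1))) hfin.toFinset fun x => {x}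
    simp only [Measure.hausdorffMeasure_zero_singleton, Finite.mem_toFinset, biUnion_of_singleton,
      Finset.sum_const, nsmul_eq_mul, mul_one] at hle
    exact hle.trans_lt (ENNReal.natCast_lt_top _)
  | m + 1, A, _, h, hbd =>
    obtain ⟨C, hC, hAC⟩ := exists_measure_frontier_le hε hL hbd
    have := hAC A h
    rw [inter_self] at this
    exact this.trans_lt hC

/-! ### Measurability of boundary regularity for random domains -/

section RandomDomain

variable {T : Type*} [MeasurableSpace T] {k : ℕ}

theorem isSigmaCompact_of_isOpen {X : Type*} [TopologicalSpace X] [LocallyCompactSpace X]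
    [SecondCountableTopology X] {u : Set X} (hu : IsOpen u) : IsSigmaCompact u := by
  have : LocallyCompactSpace u := hu.locallyCompactSpace
  rw [isSigmaCompact_iff_sigmaCompactSpace]
  infer_instance

/-- The pairs in `b × b` that violate the flatness inequality form an open, hence σ-compact, set.
Flatness says that each such pair has a point in `V t`, that is, this set is contained in the random
open set `V t × Euc k ∪ Euc k × V t`. -/
theorem measurableSet_flat {V : T → Set (Euc k)} (hV : IsRandomOpen V) {b : Set (Euc k)}
    (hb : IsOpen b) (v : Euc k) (η : ℝ) : MeasurableSet {t | Flat ((V t)ᶜ ∩ b) v η} := by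
  have hW : IsRandomOpen fun t => Prod.fst ⁻¹' V t ∪ Prod.snd ⁻¹' V t :=
    (hV.preimage (f := (Prod.fst : Euc k × Euc k → Euc k)) continuous_fst).union
      (hV.preimage (f := (Prod.snd : Euc k × Euc k → Euc k)) continuous_snd)
  have hO : IsOpen {p : Euc k × Euc k | p.1 ∈ b ∧ p.2 ∈ b ∧
      η * ‖p.1 - p.2‖ < |(inner ℝ v (p.1 - p.2) : ℝ)|} := by
    refine (hb.preimage continuous_fst).inter ((hb.preimage continuous_snd).inter ?_)
    exact isOpen_lt (f := fun p : Euc k × Euc k => η * ‖p.1 - p.2‖)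
      (g := fun p => |(inner ℝ v (p.1 - p.2) : ℝ)|) (by fun_prop) (by fun_prop)
  convert hW.measurableSet_superset_of_isSigmaCompact (isSigmaCompact_of_isOpen hO) using 1
  ext t
  simp only [Flat, mem_ofPred_eq, subset_def, Prod.forall, mem_union, mem_preimage, mem_inter_iff,
    mem_compl_iff]
  constructor
  · rintro h y y' ⟨hy, hy', hlt⟩
    by_contra! hcon
    exact (h y ⟨hcon.1, hy⟩ y' ⟨hcon.2, hy'⟩).not_gt hlt
  · intro h y hy y' hy'
    by_contra! hlt
    exact (h y y' ⟨hy.2, hy'.2, hlt⟩).elim hy.1 hy'.1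

instance : Nonempty (Metric.sphere (0 : Euc (k + 1)) 1) :=
  (NormedSpace.sphere_nonempty.2 zero_le_one).to_subtype

variable (k) in
/-- A dense sequence of unit vectors. -/
noncomputable def unitSeq (i : ℕ) : Euc (k + 1) :=
  (TopologicalSpace.denseSeq (Metric.sphere (0 : Euc (k + 1)) 1) i : Euc (k + 1))

theorem norm_unitSeq (i : ℕ) : ‖unitSeq k i‖ = 1 :=
  mem_sphere_zero_iff_norm.1 (TopologicalSpace.denseSeq (Metric.sphere (0 : Euc (k + 1)) 1) i).2

theorem exists_dist_unitSeq_lt {v : Euc (k + 1)} (hv : ‖v‖ = 1) {ε : ℝ} (hε : 0 < ε) :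
    ∃ i, dist v (unitSeq k i) < ε :=
  (TopologicalSpace.denseRange_denseSeq (Metric.sphere (0 : Euc (k + 1)) 1)).exists_dist_lt
    ⟨v, mem_sphere_zero_iff_norm.2 hv⟩ hε

/-- The points with a neighbourhood in the basis in which the complement of `V` is flat. -/
def flatSet (V : Set (Euc (k + 1))) (η : ℝ) : Set (Euc (k + 1)) :=
  {x | ∃ b ∈ TopologicalSpace.countableBasis (Euc (k + 1)), x ∈ b ∧
    ∃ i, Flat (Vᶜ ∩ b) (unitSeq k i) η}

theorem isRandomOpen_flatSet {V : T → Set (Euc (k + 1))} (hV : IsRandomOpen V) (η : ℝ) :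
    IsRandomOpen fun t => flatSet (V t) η := by
  refine IsRandomOpen.of_countable (ι := TopologicalSpace.countableBasis (Euc (k + 1)) × ℕ)
    (A := fun p => {t | Flat ((V t)ᶜ ∩ p.1) (unitSeq k p.2) η})
    (U := fun p => p.1) (fun p => measurableSet_flat hV (TopologicalSpace.isOpen_of_mem_countableBasis p.1.2) _ _)
    (fun p => TopologicalSpace.isOpen_of_mem_countableBasis p.1.2) fun t x => ?_
  simp only [flatSet, mem_ofPred_eq, Prod.exists, Subtype.exists]
  constructor
  · rintro ⟨b, hb, hx, i, hi⟩
    exact ⟨b, hb, i, hi, hx⟩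
  · rintro ⟨b, hb, i, hi, hx⟩
    exact ⟨b, hb, hx, i, hi⟩

theorem StrictNormal.mem_flatSet {V : Set (Euc (k + 1))} {x v : Euc (k + 1)}
    (h : StrictNormal Vᶜ x v) {η : ℝ} (hη : 0 < η) : x ∈ flatSet V η := by
  obtain ⟨ρ, hρ, hfl⟩ := h.2 (η / 2) (by positivity)
  obtain ⟨b, hb, hxb, hbρ⟩ := (TopologicalSpace.isBasis_countableBasis (Euc (k + 1))).exists_subset_of_mem_open
    (Metric.mem_ball_self (x := x) hρ) Metric.isOpen_ball
  obtain ⟨i, hi⟩ := exists_dist_unitSeq_lt h.1 (show 0 < η / 2 by positivity)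
  refine ⟨b, hb, hxb, i, fun y hy y' hy' => ?_⟩
  have h1 := hfl y ⟨hy.1, hbρ hy.2⟩ y' ⟨hy'.1, hbρ hy'.2⟩
  set w : Euc (k + 1) := (unitSeq k i) with hw
  have h2 := abs_real_inner_le_norm (v - w) (y - y')
  have h3 : ‖v - w‖ ≤ η / 2 := by
    rw [← dist_eq_norm]
    exact hi.le
  have h4 : ‖v - w‖ * ‖y - y'‖ ≤ η / 2 * ‖y - y'‖ := by gcongr
  rw [inner_sub_left] at h2
  rw [abs_le] at h1 h2 ⊢
  constructor <;> linarith

/-- Charts range over an uncountable family. Flatness on basic open sets with normals from a dense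
sequence replaces them by countably many tests; `isC1BoundaryAt_of_flat` is the converse direction.
-/
theorem isC1BoundaryAt_iff_flatSet {A : Set (Euc (k + 1))} {ε L : ℝ} (hε : 0 < ε) (hL : 0 ≤ L)
    (hA : LipschitzBoundary A ε L) {x : Euc (k + 1)} (hx : x ∈ frontier A) :
    IsC1BoundaryAt A x ↔ ∃ b ∈ TopologicalSpace.countableBasis (Euc (k + 1)), x ∈ b ∧
      ∀ j : ℕ, b ⊆ (frontier A)ᶜ ∪ flatSet (frontier A)ᶜ (1 / ((j : ℝ) + 1)) := by
  constructor
  · intro h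
    obtain ⟨r, hr, hn⟩ := h.exists_ball
    obtain ⟨b, hb, hxb, hbr⟩ := (TopologicalSpace.isBasis_countableBasis (Euc (k + 1))).exists_subset_of_mem_open
      (Metric.mem_ball_self (x := x) hr) Metric.isOpen_ball
    refine ⟨b, hb, hxb, fun j y hy => ?_⟩
    by_cases hyA : y ∈ frontier A
    · obtain ⟨v, -, hv⟩ := hn y ⟨hyA, hbr hy⟩
      right
      rw [← compl_compl (frontier A)] at hv
      exact hv.mem_flatSet Nat.one_div_pos_of_nat
    · exact Or.inl hyA
  · rintro ⟨b, hb, hxb, hbj⟩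
    have hbo := TopologicalSpace.isOpen_of_mem_countableBasis hb
    refine isC1BoundaryAt_of_flat hε hL hA hx (hbo.mem_nhds hxb) fun y hy η hη => ?_
    obtain ⟨j, hj⟩ := exists_nat_one_div_lt hη
    rcases hbj j hy.2 with h | ⟨b', hb', hyb', i, hi⟩
    · exact absurd hy.1 h
    · obtain ⟨ρ, hρ, hρb⟩ := Metric.isOpen_iff.1 (TopologicalSpace.isOpen_of_mem_countableBasis hb') y hyb'
      rw [compl_compl] at hi
      refine ⟨ρ, hρ, _, norm_unitSeq i, fun z hz z' hz' => ?_⟩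
      exact (hi z ⟨hz.1, hρb hz.2⟩ z' ⟨hz'.1, hρb hz'.2⟩).trans (by gcongr)

theorem measurableSet_isC1BoundaryAt {D : T → Set (Euc (k + 1))} {ε L : ℝ} (hε : 0 < ε) (hL : 0 ≤ L)
    (hD : ∀ t, LipschitzBoundary (D t) ε L) (hV : IsRandomOpen fun t => (frontier (D t))ᶜ) :
    MeasurableSet {p : T × Euc (k + 1) | p.2 ∈ frontier (D p.1) ∧ IsC1BoundaryAt (D p.1) p.2} := by
  have hF := hV.measurableSet_prod.compl
  have : {p : T × Euc (k + 1) | p.2 ∈ frontier (D p.1) ∧ IsC1BoundaryAt (D p.1) p.2} =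
      {p : T × Euc (k + 1) | p.2 ∈ (frontier (D p.1))ᶜ}ᶜ ∩
        ⋃ b ∈ TopologicalSpace.countableBasis (Euc (k + 1)),
          (⋂ j : ℕ, {t | b ⊆ (frontier (D t))ᶜ ∪ flatSet (frontier (D t))ᶜ (1 / ((j : ℝ) + 1))}) ×ˢ b := by
    ext ⟨t, x⟩
    simp only [mem_ofPred_eq, mem_inter_iff, mem_compl_iff, not_not, mem_iUnion, mem_prod,
      mem_iInter, exists_prop]
    refine and_congr_right fun hx => ?_
    rw [isC1BoundaryAt_iff_flatSet hε hL (hD t) hx]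
    refine exists_congr fun b => and_congr_right fun _ => and_comm
  rw [this]
  refine hF.inter (.biUnion (TopologicalSpace.countable_countableBasis _) fun b hb => .prod (.iInter fun j => ?_) ?_)
  · exact (hV.union (isRandomOpen_flatSet hV _)).measurableSet_superset_of_isSigmaCompact
      (isSigmaCompact_of_isOpen (TopologicalSpace.isOpen_of_mem_countableBasis hb))
  · exact (TopologicalSpace.isOpen_of_mem_countableBasis hb).measurableSet

/-- The rays from `x` in direction `w` starts inside `A`, tested on rationals. -/
def RayInside (A : Set (Euc k)) (x w : Euc k) : Prop :=
  ∃ δ : ℚ, 0 < δ ∧ ∀ s : ℚ, 0 < s → s < δ → x + (s : ℝ) • w ∈ A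

theorem IsInnerNormal.rayInside {A : Set (Euc k)} {x v w : Euc k} (h : IsInnerNormal A x v)
    (hw : 0 < (inner ℝ v w : ℝ)) : RayInside A x w := by
  have hw0 : 0 < ‖w‖ := by
    rw [norm_pos_iff]
    rintro rfl
    simp at hw
  have h1 := h.2.2 ((inner ℝ v w : ℝ) / (2 * ‖w‖)) (by positivity)
  have hlim : Tendsto (fun t : ℝ => x + t • w) (𝓝[>] 0) (𝓝 x) := by
    have : Continuous fun t : ℝ => x + t • w := by fun_prop
    simpa using (this.tendsto 0).mono_left nhdsWithin_le_nhds
  obtain ⟨δ, hδ, hδs⟩ := mem_nhdsGT_iff_exists_Ioo_subset.1 (hlim.eventually h1)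
  obtain ⟨q, hq, hqδ⟩ := exists_rat_btwn (show (0 : ℝ) < δ from hδ)
  refine ⟨q, by exact_mod_cast hq, fun s hs hsq => ?_⟩
  have hs' : (0 : ℝ) < s := by exact_mod_cast hs
  refine (hδs ⟨hs', (show (s : ℝ) < q by exact_mod_cast hsq).trans hqδ⟩).1 ?_
  rw [add_sub_cancel_left, inner_smul_right, norm_smul, Real.norm_of_nonneg hs'.le]
  have : (inner ℝ v w : ℝ) / (2 * ‖w‖) * (s * ‖w‖) = s * inner ℝ v w / 2 := by field_simp
  rw [this]
  have : 0 < s * (inner ℝ v w : ℝ) := by positivity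
  linarith

theorem IsInnerNormal.not_rayInside {A : Set (Euc k)} {x v w : Euc k} (h : IsInnerNormal A x v)
    (hw : (inner ℝ v w : ℝ) < 0) : ¬ RayInside A x w := by
  rintro ⟨q, hq, hs⟩
  have hw0 : 0 < ‖w‖ := by
    rw [norm_pos_iff]
    rintro rfl
    simp at hw
  have h1 := h.2.2 (-(inner ℝ v w : ℝ) / (2 * ‖w‖)) (div_pos (by linarith) (by positivity))
  have hlim : Tendsto (fun t : ℝ => x + t • w) (𝓝[>] 0) (𝓝 x) := by
    have : Continuous fun t : ℝ => x + t • w := by fun_prop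
    simpa using (this.tendsto 0).mono_left nhdsWithin_le_nhds
  obtain ⟨δ, hδ, hδs⟩ := mem_nhdsGT_iff_exists_Ioo_subset.1 (hlim.eventually h1)
  obtain ⟨s, hs0, hsδ⟩ := exists_rat_btwn (show (0 : ℝ) < min δ q from
    lt_min hδ (by exact_mod_cast hq))
  refine (hδs ⟨hs0, hsδ.trans_le (min_le_left _ _)⟩).2 ?_
    (hs s (by exact_mod_cast hs0) (by exact_mod_cast hsδ.trans_le (min_le_right _ _)))
  rw [add_sub_cancel_left, inner_smul_right, norm_smul, Real.norm_of_nonneg hs0.le]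
  have : -(inner ℝ v w : ℝ) / (2 * ‖w‖) * (s * ‖w‖) = -(s * inner ℝ v w) / 2 := by field_simp
  rw [this]
  have : s * (inner ℝ v w : ℝ) < 0 := mul_neg_of_pos_of_neg hs0 hw
  linarith

/-- Rays decide every direction except the tangential ones, where they may start inside or outside.
Requiring a whole neighbourhood of directions, sampled on a dense sequence, removes this ambiguity.
-/
theorem IsInnerNormal.inner_pos_iff {A : Set (Euc k)} {x v : Euc k} (h : IsInnerNormal A x v)
    (w : Euc k) : 0 < (inner ℝ v w : ℝ) ↔ ∃ m : ℕ, ∀ i,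
      dist (TopologicalSpace.denseSeq (Euc k) i) w < 1 / ((m : ℝ) + 1) →
        RayInside A x (TopologicalSpace.denseSeq (Euc k) i) := by
  have hc : Continuous fun w : Euc k => (inner ℝ v w : ℝ) := by fun_prop
  constructor
  · intro hw
    obtain ⟨δ, hδ, hδs⟩ := Metric.isOpen_iff.1 (isOpen_Ioi.preimage hc) w hw
    obtain ⟨m, hm⟩ := exists_nat_one_div_lt hδ
    exact ⟨m, fun i hi => h.rayInside (hδs (hi.trans hm))⟩
  · rintro ⟨m, hm⟩
    by_contra! hw
    have hpos : (0 : ℝ) < 1 / ((m : ℝ) + 1) := Nat.one_div_pos_of_nat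
    have hO : IsOpen (Metric.ball w (1 / ((m : ℝ) + 1)) ∩ {w | (inner ℝ v w : ℝ) < 0}) :=
      Metric.isOpen_ball.inter (isOpen_lt hc continuous_const)
    have hne : (Metric.ball w (1 / ((m : ℝ) + 1)) ∩ {w | (inner ℝ v w : ℝ) < 0}).Nonempty := by
      refine ⟨w - (1 / ((m : ℝ) + 1) / 2) • v, ?_, ?_⟩
      · rw [Metric.mem_ball, dist_eq_norm, sub_sub_cancel_left, norm_neg, norm_smul, h.2.1,
          Real.norm_of_nonneg (by positivity)]
        linarith
      · rw [mem_ofPred_eq, inner_sub_right, inner_smul_right, real_inner_self_eq_norm_sq, h.2.1]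
        linarith
    obtain ⟨i, hi, hi'⟩ := (TopologicalSpace.denseRange_denseSeq (Euc k)).exists_mem_open hO hne
    exact h.not_rayInside hi' (hm i hi)

theorem measurableSet_rayInside {D : T → Set (Euc k)} (hD : IsRandomOpen D) (w : Euc k) :
    MeasurableSet {p : T × Euc k | RayInside (D p.1) p.2 w} := by
  simp only [RayInside, ofPred_exists, ofPred_and, ofPred_forall]
  refine .iUnion fun δ => .inter (.const _) (.iInter fun s => .iInter fun _ => .iInter fun _ => ?_)
  have h : Measurable fun p : T × Euc k => (p.1, p.2 + (s : ℝ) • w) := by fun_prop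
  exact h hD.measurableSet_prod

/-- A unit vector field is measurable if all its half-space tests are. -/
theorem measurable_of_measurableSet_inner_pos {Ω : Type*} [MeasurableSpace Ω] {v : Ω → Euc k}
    (hv : ∀ p, ‖v p‖ = 1) (h : ∀ w, MeasurableSet {p | 0 < (inner ℝ (v p) w : ℝ)}) :
    Measurable v := by
  let G : Metric.sphere (0 : Euc k) 1 → ℕ → Prop := fun u i =>
    0 < (inner ℝ (u : Euc k) (TopologicalSpace.denseSeq (Euc k) i) : ℝ)
  have hGm : Measurable G := by
    refine measurable_pi_lambda _ fun i => ?_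
    rw [← measurableSet_setOfPred]
    exact measurableSet_lt measurable_const (by fun_prop)
  have hGi : Function.Injective G := by
    intro u u' huu
    by_contra hne
    have hne' : (u : Euc k) ≠ u' := fun h => hne (Subtype.ext h)
    have hu : ‖(u : Euc k)‖ = 1 := mem_sphere_zero_iff_norm.1 u.2
    have hu' : ‖(u' : Euc k)‖ = 1 := mem_sphere_zero_iff_norm.1 u'.2
    set d := (u : Euc k) - u' with hd
    have hd0 : 0 < ‖d‖ := norm_pos_iff.2 (sub_ne_zero.2 hne')
    have hsq : ‖d‖ ^ 2 = 2 - 2 * inner ℝ (u : Euc k) u' := by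
      rw [hd, norm_sub_sq_real, hu, hu']; ring
    have h1 : (inner ℝ (u : Euc k) d : ℝ) = ‖d‖ ^ 2 / 2 := by
      rw [hsq, hd, inner_sub_right, real_inner_self_eq_norm_sq, hu]; ring
    have h2 : (inner ℝ (u' : Euc k) d : ℝ) = -(‖d‖ ^ 2 / 2) := by
      rw [hsq, hd, inner_sub_right, real_inner_self_eq_norm_sq, hu', real_inner_comm]; ring
    have hO : IsOpen ({w | 0 < (inner ℝ (u : Euc k) w : ℝ)} ∩ {w | (inner ℝ (u' : Euc k) w : ℝ) < 0}) :=
      (isOpen_lt continuous_const (by fun_prop)).inter (isOpen_lt (by fun_prop) continuous_const)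
    have hp : 0 < ‖d‖ ^ 2 := by positivity
    obtain ⟨i, hi, hi'⟩ := (TopologicalSpace.denseRange_denseSeq (Euc k)).exists_mem_open hO
      ⟨d, by rw [mem_ofPred_eq, h1]; linarith, by rw [mem_ofPred_eq, h2]; linarith⟩
    have : G u' i := by rw [← huu]; exact hi
    exact lt_asymm this hi'
  -- Countably many half-space tests separate unit vectors, and an injective measurable map on the
  -- standard Borel sphere is a measurable embedding; hence measurability may be checked on the
  -- tests.
  have hemb : MeasurableEmbedding G := hGm.measurableEmbedding hGi
  let v' : Ω → Metric.sphere (0 : Euc k) 1 := fun p => ⟨v p, mem_sphere_zero_iff_norm.2 (hv p)⟩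
  have hv' : Measurable v' := by
    rw [← hemb.measurable_comp_iff]
    refine measurable_pi_lambda _ fun i => ?_
    rw [← measurableSet_setOfPred]
    exact h _
  exact measurable_subtype_coe.comp hv'

theorem measurable_innerNormal {D : T → Set (Euc (k + 1))} {ε L : ℝ} (hε : 0 < ε) (hL : 0 ≤ L)
    (hLip : ∀ t, LipschitzBoundary (D t) ε L) (hD : IsRandomOpen D)
    (hV : IsRandomOpen fun t => (frontier (D t))ᶜ) :
    Measurable ({p : T × Euc (k + 1) | p.2 ∈ frontier (D p.1) ∧ IsC1BoundaryAt (D p.1) p.2}.indicator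
      fun p => innerNormal (D p.1) p.2) := by
  have hM := measurableSet_isC1BoundaryAt hε hL hLip hV
  refine measurable_of_restrict_of_restrict_compl hM ?_ ?_
  · have hv : Measurable fun p : {p : T × Euc (k + 1) | p.2 ∈ frontier (D p.1) ∧
        IsC1BoundaryAt (D p.1) p.2} => innerNormal (D p.1.1) p.1.2 := by
      refine measurable_of_measurableSet_inner_pos (fun p => (p.2.2.normals p.2.1).1.2.1) fun w => ?_
      have h1 : ∀ i, MeasurableSet {p : {p : T × Euc (k + 1) | p.2 ∈ frontier (D p.1) ∧
          IsC1BoundaryAt (D p.1) p.2} | RayInside (D p.1.1) p.1.2 (TopologicalSpace.denseSeq (Euc (k + 1)) i)} :=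
        fun i => measurable_subtype_coe (measurableSet_rayInside hD _)
      have h2 := fun p : {p : T × Euc (k + 1) | p.2 ∈ frontier (D p.1) ∧
        IsC1BoundaryAt (D p.1) p.2} => (p.2.2.normals p.2.1).1.inner_pos_iff w
      simp only [h2, ofPred_exists, ofPred_forall]
      exact .iUnion fun m => .iInter fun i => .iInter fun _ => h1 i
    convert hv using 1
    ext1 p
    exact indicator_of_mem p.2 _
  · convert measurable_const (a := (0 : Euc (k + 1))) using 1
    ext1 p
    exact indicator_of_notMem p.2 _

end RandomDomain

/-! ### Visibility along segments -/

theorem seen_iff {k : ℕ} {D : Set (Euc k)} {x y : Euc k} :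
    Seen D x y ↔ x ≠ y ∧ ∀ s ∈ Ioo (0 : ℝ) 1, x + s • (y - x) ∈ D := by
  constructor
  · rintro ⟨h, t, hh, ht, hD, rfl⟩
    constructor
    · intro heq
      have : t • h = 0 := by simpa using heq
      rw [smul_eq_zero] at this
      rcases this with h0 | h0
      · exact ht.ne' h0
      · rw [h0, norm_zero] at hh; exact zero_ne_one hh
    · intro s hs
      rw [add_sub_cancel_left, smul_smul]
      exact hD _ ⟨mul_pos hs.1 ht, by nlinarith [hs.2]⟩
  · rintro ⟨hne, hD⟩
    have h0 : 0 < ‖y - x‖ := norm_pos_iff.2 (sub_ne_zero.2 hne.symm)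
    refine ⟨‖y - x‖⁻¹ • (y - x), ‖y - x‖, ?_, h0, fun t ht => ?_, ?_⟩
    · rw [norm_smul, norm_inv, norm_norm, inv_mul_cancel₀ h0.ne']
    · rw [smul_smul]
      exact hD _ ⟨mul_pos ht.1 (inv_pos.2 h0), by rw [← div_eq_mul_inv, div_lt_one h0]; exact ht.2⟩
    · rw [smul_smul, mul_inv_cancel₀ h0.ne', one_smul, add_sub_cancel]

/-- The open segment is exhausted by compact parameter intervals, for each of which
`IsRandomOpen.forall_compact` applies. -/
theorem measurableSet_seen {T : Type*} [MeasurableSpace T] {k : ℕ} {D : T → Set (Euc k)}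
    (hD : IsRandomOpen D) :
    MeasurableSet {p : T × (Euc k × Euc k) | Seen (D p.1) p.2.1 p.2.2} := by
  have h1 : ∀ m : ℕ, MeasurableSet {p : T × (Euc k × Euc k) |
      p.2 ∈ {z : Euc k × Euc k | ∀ c : Icc (1 / ((m : ℝ) + 1)) (1 - 1 / ((m : ℝ) + 1)),
        z.1 + (c : ℝ) • (z.2 - z.1) ∈ D p.1}} := fun m =>
    (hD.forall_compact (f := fun q : (Euc k × Euc k) × Icc (1 / ((m : ℝ) + 1)) (1 - 1 / ((m : ℝ) + 1)) =>
      q.1.1 + (q.2 : ℝ) • (q.1.2 - q.1.1)) (by fun_prop)).measurableSet_prod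
  have : {p : T × (Euc k × Euc k) | Seen (D p.1) p.2.1 p.2.2} =
      {p : T × (Euc k × Euc k) | p.2.1 = p.2.2}ᶜ ∩ ⋂ m : ℕ, {p : T × (Euc k × Euc k) |
      p.2 ∈ {z : Euc k × Euc k | ∀ c : Icc (1 / ((m : ℝ) + 1)) (1 - 1 / ((m : ℝ) + 1)),
        z.1 + (c : ℝ) • (z.2 - z.1) ∈ D p.1}} := by
    ext ⟨t, x, y⟩
    simp only [mem_ofPred_eq, seen_iff, mem_inter_iff, mem_compl_iff, mem_iInter, Subtype.forall]
    refine and_congr_right fun _ => ⟨fun h m c hc => h c ⟨?_, ?_⟩, fun h s hs => ?_⟩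
    · exact (show (0 : ℝ) < 1 / ((m : ℝ) + 1) from Nat.one_div_pos_of_nat).trans_le hc.1
    · have : (0 : ℝ) < 1 / ((m : ℝ) + 1) := Nat.one_div_pos_of_nat
      linarith [hc.2]
    · obtain ⟨m, hm⟩ := exists_nat_one_div_lt (lt_min hs.1 (sub_pos.2 hs.2))
      exact h m s ⟨(hm.le.trans (min_le_left _ _)), by linarith [hm.le.trans (min_le_right s (1 - s))]⟩
  rw [this]
  exact (measurableSet_eq_fun (by fun_prop) (by fun_prop)).compl.inter (.iInter h1)

/-! ### Measurability of the environment -/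

section Env

variable {n : ℕ} {M : ℝ}

theorem continuous_volume_inter (B : Set (Euc (n + 1))) :
    Continuous fun A : CrossSection n M => volume (B ∩ A.1) := by
  refine continuous_of_le_add_edist 1 ENNReal.one_ne_top fun A A' => ?_
  rw [one_mul]
  calc volume (B ∩ A.1) ≤ volume ((B ∩ A'.1) ∪ (A.1 ∆ A'.1)) := by
        apply measure_mono
        rintro x ⟨hB, hA⟩
        by_cases hA' : x ∈ A'.1
        · exact Or.inl ⟨hB, hA'⟩
        · exact Or.inr (Or.inl ⟨hA, hA'⟩)
    _ ≤ _ := measure_union_le _ _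

theorem continuous_volume_diff (B : Set (Euc (n + 1))) :
    Continuous fun A : CrossSection n M => volume (B \ A.1) := by
  refine continuous_of_le_add_edist 1 ENNReal.one_ne_top fun A A' => ?_
  rw [one_mul]
  calc volume (B \ A.1) ≤ volume ((B \ A'.1) ∪ (A.1 ∆ A'.1)) := by
        apply measure_mono
        rintro x ⟨hB, hA⟩
        by_cases hA' : x ∈ A'.1
        · exact Or.inr (Or.inr ⟨hA', hA⟩)
        · exact Or.inl ⟨hB, hA'⟩
    _ ≤ _ := measure_union_le _ _

theorem measurable_eval (α : ℝ) :
    Measurable[_, borel (CrossSection n M)] fun ω : Env n M => ω.1 α := by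
  intro s hs
  exact le_iSup (fun α : ℝ => (borel (CrossSection n M)).comap fun ω : Env n M => ω.1 α) α _
    ⟨s, hs, rfl⟩

theorem measurable_eval_of_continuous {f : CrossSection n M → ℝ≥0∞} (hf : Continuous f) (α : ℝ) :
    Measurable fun ω : Env n M => f (ω.1 α) := by
  let _ : MeasurableSpace (CrossSection n M) := borel _
  have : BorelSpace (CrossSection n M) := ⟨rfl⟩
  exact hf.measurable.comp (measurable_eval α)

/-- Each coordinate of the shifted environment is continuous in the position and measurable in `ω`,
hence jointly measurable. Exchanging integrals over positions with expectations requires joint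
measurability. -/
theorem measurable_shift : Measurable fun p : ℝ × Env n M => shift p.1 p.2 := by
  let _ : MeasurableSpace (CrossSection n M) := borel _
  have : BorelSpace (CrossSection n M) := ⟨rfl⟩
  have h1 : ∀ β : ℝ, Measurable fun p : ℝ × Env n M => p.2.1 (β + p.1) := fun β =>
    measurable_uncurry_of_continuous_of_measurable (u := fun (α : ℝ) (ω : Env n M) => ω.1 (β + α))
      (fun ω => ω.2.comp (by fun_prop)) (fun α => measurable_eval _)
  have h2 : @Measurable (ℝ × Env n M) (Env n M) _
      (⨆ α : ℝ, (borel (CrossSection n M)).comap fun ω : Env n M => ω.1 α)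
      fun p : ℝ × Env n M => shift p.1 p.2 := by
    rw [measurable_iff_comap_le, MeasurableSpace.comap_iSup]
    refine iSup_le fun β => ?_
    rw [MeasurableSpace.comap_comp, ← measurable_iff_comap_le]
    exact h1 β
  exact h2

/-- Basic boxes `(a, a') × b`. -/
def box (a a' : ℚ) (b : Set (Euc (n + 1))) : Set (Euc (n + 2)) :=
  {x | (a : ℝ) < x 0 ∧ x 0 < a' ∧ proj x ∈ b}

theorem isOpen_box (a a' : ℚ) {b : Set (Euc (n + 1))} (hb : IsOpen b) : IsOpen (box a a' b) := by
  have h0 : Continuous fun x : Euc (n + 2) => x 0 := by fun_prop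
  exact (isOpen_lt continuous_const h0).inter ((isOpen_lt h0 continuous_const).inter
    (hb.preimage continuous_proj))

theorem exists_box_subset {O : Set (Euc (n + 2))} (hO : IsOpen O) {x : Euc (n + 2)} (hx : x ∈ O) :
    ∃ (a a' : ℚ) (b : TopologicalSpace.countableBasis (Euc (n + 1))), x ∈ box a a' b ∧
      box a a' (b : Set (Euc (n + 1))) ⊆ O := by
  have hc : Continuous fun p : ℝ × Euc (n + 1) => pt p.1 p.2 := continuous_pt
  have hnb : (fun p : ℝ × Euc (n + 1) => pt p.1 p.2) ⁻¹' O ∈ 𝓝 (x 0, proj x) := by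
    apply hc.continuousAt
    simp only [pt_proj]
    exact hO.mem_nhds hx
  obtain ⟨u, hu, v, hv, huv⟩ := mem_nhds_prod_iff.1 hnb
  obtain ⟨l, r, hlr, hlru⟩ := mem_nhds_iff_exists_Ioo_subset.1 hu
  obtain ⟨a, ha, ha'⟩ := exists_rat_btwn hlr.1
  obtain ⟨a', hb, hb'⟩ := exists_rat_btwn hlr.2
  obtain ⟨b, hbb, hxb, hbv⟩ := (TopologicalSpace.isBasis_countableBasis (Euc (n + 1))).mem_nhds_iff.1 hv
  refine ⟨a, a', ⟨b, hbb⟩, ⟨ha', hb, hxb⟩, fun y hy => ?_⟩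
  have := huv (mk_mem_prod (hlru ⟨ha.trans hy.1, hy.2.1.trans hb'⟩) (hbv hy.2.2))
  rwa [mem_preimage, pt_proj] at this

theorem eq_zero_of_rat {f : ℝ → ℝ≥0∞} (hf : Continuous f) {a a' : ℚ}
    (h : ∀ q : ℚ, a < q → q < a' → f q = 0) {α : ℝ} (hα : (a : ℝ) < α) (hα' : α < a') : f α = 0 := by
  by_contra hne
  have hO : IsOpen ({s | f s ≠ 0} ∩ Ioo (a : ℝ) a') :=
    (isOpen_ne_fun hf continuous_const).inter isOpen_Ioo
  obtain ⟨q, hq, hq'⟩ := Rat.denseRange_cast.exists_mem_open hO ⟨α, hne, hα, hα'⟩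
  exact hq (h q (by exact_mod_cast hq'.1) (by exact_mod_cast hq'.2))

theorem isOpen_slice (ω : Env n M) (α : ℝ) : IsOpen (slice ω α) := (ω.1 α).2.1

theorem slice_subset (ω : Env n M) (α : ℝ) : slice ω α ⊆ Metric.closedBall 0 M := (ω.1 α).2.2.1

theorem measurableSet_volume_diff_eq_zero (a a' : ℚ) (b : Set (Euc (n + 1))) :
    MeasurableSet {ω : Env n M | ∀ q : ℚ, a < q → q < a' → volume (b \ slice ω q) = 0} := by
  simp only [ofPred_forall]
  exact .iInter fun q => .iInter fun _ => .iInter fun _ =>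
    measurable_eval_of_continuous (continuous_volume_diff b) q (measurableSet_singleton 0)

theorem measurableSet_volume_inter_eq_zero (a a' : ℚ) (b : Set (Euc (n + 1))) :
    MeasurableSet {ω : Env n M | ∀ q : ℚ, a < q → q < a' → volume (b ∩ slice ω q) = 0} := by
  simp only [ofPred_forall]
  exact .iInter fun q => .iInter fun _ => .iInter fun _ =>
    measurable_eval_of_continuous (continuous_volume_inter b) q (measurableSet_singleton 0)

/-- A box misses the tube once its base meets the rational sections in null sets: by continuity this
extends to all sections, and an open set of measure zero is empty. -/
theorem isRandomOpen_compl_closure_tube :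
    IsRandomOpen fun ω : Env n M => (closure (tube ω))ᶜ := by
  refine IsRandomOpen.of_countable
    (ι := ℚ × ℚ × TopologicalSpace.countableBasis (Euc (n + 1)))
    (A := fun p => {ω : Env n M | ∀ q : ℚ, p.1 < q → q < p.2.1 → volume (p.2.2 ∩ slice ω q) = 0})
    (U := fun p => box p.1 p.2.1 p.2.2) (fun p => measurableSet_volume_inter_eq_zero _ _ _)
    (fun p => isOpen_box _ _ (TopologicalSpace.isOpen_of_mem_countableBasis p.2.2.2)) fun ω x => ?_
  constructor
  · intro hx
    obtain ⟨a, a', b, hxb, hb⟩ := exists_box_subset isClosed_closure.isOpen_compl hx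
    refine ⟨(a, a', b), fun q hq hq' => ?_, hxb⟩
    convert measure_empty (μ := volume)
    rw [eq_empty_iff_forall_notMem]
    rintro u ⟨hu, huω⟩
    have h1 : pt (q : ℝ) u ∈ box a a' (b : Set (Euc (n + 1))) :=
      ⟨by rw [pt_zero]; exact_mod_cast hq, by rw [pt_zero]; exact Rat.cast_lt.2 hq', by rwa [proj_pt]⟩
    refine hb h1 (subset_closure ?_)
    rw [tube, mem_ofPred_eq, proj_pt, pt_zero]
    exact huω
  · rintro ⟨⟨a, a', b⟩, hω, hx⟩
    have hbo := TopologicalSpace.isOpen_of_mem_countableBasis b.2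
    intro hcl
    obtain ⟨y, hy, hyω⟩ := mem_closure_iff.1 hcl _ (isOpen_box a a' hbo) hx
    have h0 : volume ((b : Set (Euc (n + 1))) ∩ slice ω (y 0)) = 0 :=
      eq_zero_of_rat ((continuous_volume_inter _).comp ω.2) hω hy.1 hy.2.1
    have hne := (hbo.inter (isOpen_slice ω (y 0))).measure_ne_zero volume ⟨proj y, hy.2.2, hyω⟩
    exact hne h0

/-- Volumes of sections show only that a box lies in the closure of the tube;
`LipschitzBoundary.interior_closure` puts it into the tube itself. -/
theorem isRandomOpen_tube {G : Set (Env n M)} {ε L : ℝ} (hε : 0 < ε)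
    (hG : ∀ ω ∈ G, LipschitzBoundary (tube ω) ε L) : IsRandomOpen fun ω : G => tube ω.1 := by
  refine IsRandomOpen.of_countable
    (ι := ℚ × ℚ × TopologicalSpace.countableBasis (Euc (n + 1)))
    (A := fun p => Subtype.val ⁻¹' {ω : Env n M | ∀ q : ℚ, p.1 < q → q < p.2.1 → volume (p.2.2 \ slice ω q) = 0})
    (U := fun p => box p.1 p.2.1 p.2.2)
    (fun p => measurable_subtype_coe (measurableSet_volume_diff_eq_zero _ _ _))
    (fun p => isOpen_box _ _ (TopologicalSpace.isOpen_of_mem_countableBasis p.2.2.2)) fun ω x => ?_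
  constructor
  · intro hx
    obtain ⟨a, a', b, hxb, hb⟩ := exists_box_subset ((hG ω ω.2).isOpen hε) hx
    refine ⟨(a, a', b), fun q hq hq' => ?_, hxb⟩
    convert measure_empty (μ := volume)
    rw [eq_empty_iff_forall_notMem]
    rintro u ⟨hu, huω⟩
    have h1 : pt (q : ℝ) u ∈ box a a' (b : Set (Euc (n + 1))) :=
      ⟨by rw [pt_zero]; exact_mod_cast hq, by rw [pt_zero]; exact Rat.cast_lt.2 hq', by rwa [proj_pt]⟩
    have := hb h1
    rw [tube, mem_ofPred_eq, proj_pt, pt_zero] at this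
    exact huω this
  · rintro ⟨⟨a, a', b⟩, hω, hx⟩
    have hbo := TopologicalSpace.isOpen_of_mem_countableBasis b.2
    rw [← (hG ω ω.2).interior_closure hε, mem_interior]
    refine ⟨box a a' b, fun y hy => ?_, isOpen_box a a' hbo, hx⟩
    have h0 : volume ((b : Set (Euc (n + 1))) \ slice ω.1 (y 0)) = 0 :=
      eq_zero_of_rat ((continuous_volume_diff _).comp ω.1.2) hω hy.1 hy.2.1
    have hcl : proj y ∈ closure (slice ω.1 (y 0)) := by
      rw [mem_closure_iff]
      intro o ho hyo
      by_contra hemp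
      refine (ho.inter hbo).measure_ne_zero volume ⟨proj y, hyo, hy.2.2⟩ (measure_mono_null ?_ h0)
      rintro u ⟨huo, hub⟩
      exact ⟨hub, fun hus => hemp ⟨u, huo, hus⟩⟩
    have himg : pt (y 0) (proj y) ∈ closure (pt (y 0) '' slice ω.1 (y 0)) :=
      image_closure_subset_closure_image (continuous_pt_right _) ⟨_, hcl, rfl⟩
    rw [pt_proj] at himg
    refine closure_mono ?_ himg
    rintro _ ⟨u, hu, rfl⟩
    rw [tube, mem_ofPred_eq, proj_pt, pt_zero]
    exact hu

theorem isRandomOpen_compl_frontier_tube {G : Set (Env n M)} {ε L : ℝ} (hε : 0 < ε)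
    (hG : ∀ ω ∈ G, LipschitzBoundary (tube ω) ε L) :
    IsRandomOpen fun ω : G => (frontier (tube ω.1))ᶜ := by
  have h := (isRandomOpen_tube hε hG).union
    ((isRandomOpen_compl_closure_tube (n := n) (M := M)).comp (measurable_subtype_coe (p := (· ∈ G))))
  convert h using 2 with ω
  rw [frontier, ((hG ω ω.2).isOpen hε).interior_eq, sdiff_eq, compl_inter, compl_compl, union_comm]

theorem isRandomOpen_compl_frontier_slice {G : Set (Env n M)} {ε L : ℝ} (hε : 0 < ε)
    (hG : ∀ ω ∈ G, LipschitzBoundary (tube ω) ε L) :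
    IsRandomOpen fun ω : G => (frontier (slice ω.1 0))ᶜ := by
  have h1 : IsRandomOpen fun ω : G => slice ω.1 0 := by
    convert (isRandomOpen_tube hε hG).preimage (continuous_pt_right (n := n) 0) using 2 with ω
    ext u
    rw [mem_preimage, tube, mem_ofPred_eq, proj_pt, pt_zero]
  have h2 : IsRandomOpen fun ω : G => (closure (slice ω.1 0))ᶜ := by
    refine IsRandomOpen.of_countable (ι := TopologicalSpace.countableBasis (Euc (n + 1)))
      (A := fun b => Subtype.val ⁻¹' {ω : Env n M | volume ((b : Set (Euc (n + 1))) ∩ slice ω 0) = 0}) (U := fun b => b)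
      (fun b => measurable_subtype_coe (measurable_eval_of_continuous (continuous_volume_inter (b : Set (Euc (n + 1)))) 0
        (measurableSet_singleton 0)))
      (fun b => TopologicalSpace.isOpen_of_mem_countableBasis b.2) fun ω u => ?_
    constructor
    · intro hu
      obtain ⟨b, hb, hub, hbs⟩ := (TopologicalSpace.isBasis_countableBasis (Euc (n + 1))).exists_subset_of_mem_open
        hu isClosed_closure.isOpen_compl
      refine ⟨⟨b, hb⟩, ?_, hub⟩
      have : b ∩ slice ω.1 0 = ∅ := by
        rw [eq_empty_iff_forall_notMem]
        rintro w ⟨hw, hw'⟩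
        exact hbs hw (subset_closure hw')
      simp [this]
    · rintro ⟨b, hb, hub⟩ hcl
      have hbo := TopologicalSpace.isOpen_of_mem_countableBasis b.2
      exact (hbo.inter (isOpen_slice ω.1 0)).measure_ne_zero volume (mem_closure_iff.1 hcl _ hbo hub) hb
  convert h1.union h2 using 2 with ω
  rw [frontier, (isOpen_slice ω.1 0).interior_eq, sdiff_eq, compl_inter, compl_compl, union_comm]

/-! ### Kernels -/

theorem measurable_surfaceMeasure {G : Set (Env n M)} {ε L : ℝ} (hε : 0 < ε) (hL : 0 ≤ L)
    (hG : ∀ ω ∈ G, LipschitzBoundary (tube ω) ε L) :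
    Measurable fun ω : G => surfaceMeasure ω.1 := by
  have := (isRandomOpen_compl_frontier_tube hε hG).measurable_restrict_compl (n + 1) fun ω K hK => by
    obtain ⟨C, hC, h⟩ := exists_measure_frontier_le (k := n + 1) hε hL hK.isBounded
    rw [sdiff_compl, inter_comm]
    exact (h _ (hG ω ω.2)).trans_lt hC
  simp only [compl_compl] at this
  exact this

theorem measure_frontier_slice_lt_top (ω : Env n M) (α : ℝ) : μHE[n] (frontier (slice ω α)) < ⊤ := by
  obtain ⟨-, hb, k, hk, h⟩ := (ω.1 α).2
  have : (0 : ℝ) < k := by exact_mod_cast hk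
  exact measure_frontier_lt_top_of_sectionLipschitz (Metric.isBounded_closedBall.subset hb)
    (by positivity) this.le h

instance (ω : Env n M) (α : ℝ) : IsFiniteMeasure (sliceMeasure ω α) :=
  ⟨by rw [sliceMeasure, Measure.restrict_apply_univ]; exact measure_frontier_slice_lt_top ω α⟩

theorem measurable_sliceMeasure {G : Set (Env n M)} {ε L : ℝ} (hε : 0 < ε)
    (hG : ∀ ω ∈ G, LipschitzBoundary (tube ω) ε L) :
    Measurable fun ω : G => sliceMeasure ω.1 0 := by
  have := (isRandomOpen_compl_frontier_slice hε hG).measurable_restrict_compl n fun ω K hK => by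
    rw [sdiff_compl]
    exact (measure_mono inter_subset_right).trans_lt (measure_frontier_slice_lt_top ω.1 0)
  simp only [compl_compl] at this
  exact this

end Env

theorem isSFiniteKernel_of_isFiniteMeasureOnCompacts {T X : Type*} [MeasurableSpace T]
    [TopologicalSpace X] [T2Space X] [SigmaCompactSpace X] [MeasurableSpace X] [OpensMeasurableSpace X]
    (κ : ProbabilityTheory.Kernel T X) (h : ∀ t, ∀ K, IsCompact K → κ t K < ⊤) :
    ProbabilityTheory.IsSFiniteKernel κ := by
  let s : ℕ → Set X := disjointed (compactCovering X)
  have hcm : ∀ m, MeasurableSet (compactCovering X m) := fun m =>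
    (isCompact_compactCovering X m).isClosed.measurableSet
  have hs : ∀ m, MeasurableSet (s m) := MeasurableSet.disjointed hcm
  have hsum : κ = ProbabilityTheory.Kernel.sum fun m => κ.restrict (hs m) := by
    ext1 t
    rw [ProbabilityTheory.Kernel.sum_apply]
    simp only [ProbabilityTheory.Kernel.restrict_apply]
    rw [← Measure.restrict_iUnion (disjoint_disjointed _) hs, iUnion_disjointed,
      iUnion_compactCovering, Measure.restrict_univ]
  rw [hsum]
  have : ∀ m, ProbabilityTheory.IsSFiniteKernel (κ.restrict (hs m)) := fun m =>
    isSFiniteKernel_of_isFiniteMeasure _ fun t => ⟨by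
      rw [ProbabilityTheory.Kernel.restrict_apply, Measure.restrict_apply_univ]
      exact (measure_mono (disjointed_subset _ _)).trans_lt (h t _ (isCompact_compactCovering X m))⟩
  exact ProbabilityTheory.Kernel.isSFiniteKernel_sum

/-! ### Measurability of the step law -/

section StepMeasurable

variable {n : ℕ} {M : ℝ} {G : Set (Env n M)} {ε L : ℝ}

/-- The normal at regular points, `0` elsewhere. -/
noncomputable def regNormal (ω : Env n M) (x : Euc (n + 2)) : Euc (n + 2) :=
  open Classical in if x ∈ regularPoints ω then innerNormal (tube ω) x else 0

theorem regNormal_of_mem {ω : Env n M} {x : Euc (n + 2)} (hx : x ∈ regularPoints ω) :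
    regNormal ω x = innerNormal (tube ω) x := if_pos hx

theorem measurableSet_regularPoints (hε : 0 < ε) (hL : 0 ≤ L)
    (hG : ∀ ω ∈ G, LipschitzBoundary (tube ω) ε L) :
    MeasurableSet {p : G × Euc (n + 2) | p.2 ∈ regularPoints p.1.1} := by
  have hM := measurableSet_isC1BoundaryAt (k := n + 1) (D := fun ω : G => tube ω.1) hε hL
    (fun ω => hG ω ω.2) (isRandomOpen_compl_frontier_tube hε hG)
  have hN := measurable_innerNormal (k := n + 1) (D := fun ω : G => tube ω.1) hε hL
    (fun ω => hG ω ω.2) (isRandomOpen_tube hε hG) (isRandomOpen_compl_frontier_tube hε hG)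
  have h1 : MeasurableSet {p : G × Euc (n + 2) | |(inner ℝ ({p : G × Euc (n + 2) |
      p.2 ∈ frontier (tube p.1.1) ∧ IsC1BoundaryAt (tube p.1.1) p.2}.indicator
      (fun p => innerNormal (tube p.1.1) p.2) p) (e n) : ℝ)| = 1} :=
    measurableSet_eq_fun (by fun_prop) measurable_const
  classical
  convert hM.inter h1.compl using 1
  ext p
  simp only [regularPoints, mem_ofPred_eq, mem_inter_iff, mem_compl_iff]
  constructor
  · rintro ⟨h2, h3, h4⟩
    refine ⟨⟨h2, h3⟩, ?_⟩
    rwa [Set.indicator_apply, if_pos (by exact ⟨h2, h3⟩)]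
  · rintro ⟨⟨h2, h3⟩, h4⟩
    refine ⟨h2, h3, ?_⟩
    rwa [Set.indicator_apply, if_pos (by exact ⟨h2, h3⟩)] at h4

theorem measurable_regNormal (hε : 0 < ε) (hL : 0 ≤ L)
    (hG : ∀ ω ∈ G, LipschitzBoundary (tube ω) ε L) :
    Measurable fun p : G × Euc (n + 2) => regNormal p.1.1 p.2 := by
  have hN := measurable_innerNormal (k := n + 1) (D := fun ω : G => tube ω.1) hε hL
    (fun ω => hG ω ω.2) (isRandomOpen_tube hε hG) (isRandomOpen_compl_frontier_tube hε hG)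
  convert hN.indicator (measurableSet_regularPoints hε hL hG) using 1
  classical
  ext1 p
  by_cases hp : p.2 ∈ regularPoints p.1.1
  · rw [Set.indicator_apply, if_pos (by exact hp), Set.indicator_apply,
      if_pos (by exact ⟨hp.1, hp.2.1⟩), regNormal_of_mem hp]
  · rw [Set.indicator_apply, if_neg (by exact hp), regNormal, if_neg hp]

theorem kappa_eq (ω : Env n M) (x : Euc (n + 2)) :
    kappa ω x = ‖proj (innerNormal (tube ω) x)‖ := by
  rw [kappa, sliceNormal, inner_pt]
  set p := proj (innerNormal (tube ω) x)
  rw [mul_zero, zero_add, inner_smul_right, real_inner_self_eq_norm_sq]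
  rcases eq_or_ne ‖p‖ 0 with h | h
  · simp [h]
  · field_simp

/-- The weight `κ⁻¹` at regular points, `0` elsewhere. -/
noncomputable def weight (ω : Env n M) (x : Euc (n + 2)) : ℝ≥0∞ :=
  open Classical in if x ∈ regularPoints ω then (ENNReal.ofReal (kappa ω x))⁻¹ else 0

theorem measurable_weight (hε : 0 < ε) (hL : 0 ≤ L)
    (hG : ∀ ω ∈ G, LipschitzBoundary (tube ω) ε L) :
    Measurable fun p : G × Euc (n + 2) => weight p.1.1 p.2 := by
  have hN := measurable_regNormal hε hL hG
  have h1 : Measurable fun p : G × Euc (n + 2) => (ENNReal.ofReal ‖proj (regNormal p.1.1 p.2)‖)⁻¹ :=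
    (((continuous_proj.measurable.comp hN).norm).ennreal_ofReal).inv
  convert h1.indicator (measurableSet_regularPoints hε hL hG) using 1
  classical
  ext1 p
  by_cases hp : p.2 ∈ regularPoints p.1.1
  · rw [Set.indicator_apply, if_pos (by exact hp), weight, if_pos hp, kappa_eq,
      regNormal_of_mem hp]
  · rw [Set.indicator_apply, if_neg (by exact hp), weight, if_neg hp]

theorem measurable_density (hε : 0 < ε) (hL : 0 ≤ L)
    (hG : ∀ ω ∈ G, LipschitzBoundary (tube ω) ε L) :
    Measurable fun p : G × (Euc (n + 2) × Euc (n + 2)) => density p.1.1 p.2.1 p.2.2 := by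
  have hx : Measurable fun p : G × (Euc (n + 2) × Euc (n + 2)) => (p.1, p.2.1) := by fun_prop
  have hy : Measurable fun p : G × (Euc (n + 2) × Euc (n + 2)) => (p.1, p.2.2) := by fun_prop
  have hN := measurable_regNormal hε hL hG
  have hNx := hN.comp hx
  have hNy := hN.comp hy
  have hR := measurableSet_regularPoints hε hL hG
  have hS := measurableSet_seen (isRandomOpen_tube hε hG)
  have h1 : Measurable fun p : G × (Euc (n + 2) × Euc (n + 2)) =>
      gammaConst n * (inner ℝ (p.2.2 - p.2.1) (regNormal p.1.1 p.2.1) *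
        inner ℝ (p.2.1 - p.2.2) (regNormal p.1.1 p.2.2)) / ‖p.2.1 - p.2.2‖ ^ (n + 3) := by
    have a : Measurable fun p : G × (Euc (n + 2) × Euc (n + 2)) =>
      (inner ℝ (p.2.2 - p.2.1) (regNormal p.1.1 p.2.1) : ℝ) := Measurable.inner (by fun_prop) hNx
    have b : Measurable fun p : G × (Euc (n + 2) × Euc (n + 2)) =>
      (inner ℝ (p.2.1 - p.2.2) (regNormal p.1.1 p.2.2) : ℝ) := Measurable.inner (by fun_prop) hNy
    exact ((a.mul b).const_mul _).div (by fun_prop)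
  convert h1.indicator ((hx hR).inter ((hy hR).inter hS)) using 1
  classical
  ext1 p
  by_cases hp : p.2.1 ∈ regularPoints p.1.1 ∧ p.2.2 ∈ regularPoints p.1.1 ∧
    Seen (tube p.1.1) p.2.1 p.2.2
  · rw [indicator_of_mem (by exact ⟨hp.1, hp.2.1, hp.2.2⟩), density, if_pos hp,
      regNormal_of_mem hp.1, regNormal_of_mem hp.2.1]
  · rw [indicator_of_notMem, density, if_neg hp]
    rintro ⟨h1, h2, h3⟩
    exact hp ⟨h1, h2, h3⟩

/-- The surface measure as a kernel. -/
noncomputable def surfaceKernel (hε : 0 < ε) (hL : 0 ≤ L)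
    (hG : ∀ ω ∈ G, LipschitzBoundary (tube ω) ε L) : ProbabilityTheory.Kernel G (Euc (n + 2)) :=
  ⟨fun ω => surfaceMeasure ω.1, measurable_surfaceMeasure hε hL hG⟩

theorem surfaceMeasure_compact_lt_top {ω : Env n M} (hε : 0 < ε) (hL : 0 ≤ L)
    (hω : LipschitzBoundary (tube ω) ε L) {K : Set (Euc (n + 2))} (hK : Bornology.IsBounded K)
    (hKm : MeasurableSet K) : surfaceMeasure ω K < ⊤ := by
  obtain ⟨C, hC, h⟩ := exists_measure_frontier_le (k := n + 1) hε hL hK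
  rw [surfaceMeasure, Measure.restrict_apply hKm, inter_comm]
  exact (h _ hω).trans_lt hC

theorem isSFiniteKernel_surfaceKernel (hε : 0 < ε) (hL : 0 ≤ L)
    (hG : ∀ ω ∈ G, LipschitzBoundary (tube ω) ε L) :
    ProbabilityTheory.IsSFiniteKernel (surfaceKernel hε hL hG) :=
  isSFiniteKernel_of_isFiniteMeasureOnCompacts _ fun ω K hK =>
    surfaceMeasure_compact_lt_top hε hL (hG ω ω.2) hK.isBounded hK.isClosed.measurableSet

theorem sigmaFinite_surfaceMeasure {ω : Env n M} (hε : 0 < ε) (hL : 0 ≤ L)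
    (hω : LipschitzBoundary (tube ω) ε L) : SigmaFinite (surfaceMeasure ω) := by
  have : IsFiniteMeasureOnCompacts (surfaceMeasure ω) := ⟨fun K hK =>
    surfaceMeasure_compact_lt_top hε hL hω hK.isBounded hK.isClosed.measurableSet⟩
  infer_instance

/-- The boundary measure of the section at `0` as a kernel. -/
noncomputable def sliceKernel (hε : 0 < ε)
    (hG : ∀ ω ∈ G, LipschitzBoundary (tube ω) ε L) : ProbabilityTheory.Kernel G (Euc (n + 1)) :=
  ⟨fun ω => sliceMeasure ω.1 0, measurable_sliceMeasure hε hG⟩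

theorem isSFiniteKernel_sliceKernel (hε : 0 < ε)
    (hG : ∀ ω ∈ G, LipschitzBoundary (tube ω) ε L) :
    ProbabilityTheory.IsSFiniteKernel (sliceKernel hε hG) :=
  isSFiniteKernel_of_isFiniteMeasure _ fun ω =>
    inferInstanceAs (IsFiniteMeasure (sliceMeasure ω.1 0))

theorem measurable_lintegral_sliceMeasure {A : Type*} [MeasurableSpace A] (hε : 0 < ε)
    (hG : ∀ ω ∈ G, LipschitzBoundary (tube ω) ε L) {f : (A × G) × Euc (n + 1) → ℝ≥0∞}
    (hf : Measurable f) : Measurable fun p : A × G => ∫⁻ u, f (p, u) ∂(sliceMeasure p.2.1 0) := by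
  have := isSFiniteKernel_sliceKernel hε hG
  exact hf.lintegral_kernel_prod_right' (κ := (sliceKernel hε hG).comap Prod.snd measurable_snd)

theorem measurable_lintegral_surfaceMeasure {A : Type*} [MeasurableSpace A] (hε : 0 < ε) (hL : 0 ≤ L)
    (hG : ∀ ω ∈ G, LipschitzBoundary (tube ω) ε L) {f : (A × G) × Euc (n + 2) → ℝ≥0∞}
    (hf : Measurable f) : Measurable fun p : A × G => ∫⁻ y, f (p, y) ∂(surfaceMeasure p.2.1) := by
  have := isSFiniteKernel_surfaceKernel hε hL hG
  exact hf.lintegral_kernel_prod_right' (κ := (surfaceKernel hε hL hG).comap Prod.snd measurable_snd)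

/-- The mean of a function of the step with respect to the step law. -/
noncomputable def stepMean (ω : Env n M) (w : Euc (n + 2) → Euc (n + 2) → ℝ≥0∞) (x : Euc (n + 2)) :
    ℝ≥0∞ := ∫⁻ y, ENNReal.ofReal (density ω x y) * w x y ∂(surfaceMeasure ω)

theorem measurable_stepMean {A : Type*} [MeasurableSpace A] (hε : 0 < ε) (hL : 0 ≤ L)
    (hG : ∀ ω ∈ G, LipschitzBoundary (tube ω) ε L)
    {w : A × (Euc (n + 2) × Euc (n + 2)) → ℝ≥0∞} (hw : Measurable w) :
    Measurable fun p : (A × G) × Euc (n + 2) =>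
      stepMean p.1.2.1 (fun x y => w (p.1.1, x, y)) p.2 := by
  have hf : Measurable fun q : ((A × Euc (n + 2)) × G) × Euc (n + 2) =>
      ENNReal.ofReal (density q.1.2.1 q.1.1.2 q.2) * w (q.1.1.1, q.1.1.2, q.2) := by
    have h1 : Measurable fun q : ((A × Euc (n + 2)) × G) × Euc (n + 2) =>
        (q.1.2, (q.1.1.2, q.2)) := by fun_prop
    have h2 : Measurable fun q : ((A × Euc (n + 2)) × G) × Euc (n + 2) =>
        (q.1.1.1, (q.1.1.2, q.2)) := by fun_prop
    exact ((measurable_density hε hL hG).comp h1).ennreal_ofReal.mul (hw.comp h2)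
  have h3 := measurable_lintegral_surfaceMeasure hε hL hG hf
  have h4 : Measurable fun p : (A × G) × Euc (n + 2) => ((p.1.1, p.2), p.1.2) := by fun_prop
  have h5 := h3.comp h4
  simp only [Function.comp_def] at h5
  exact h5

/-- The unnormalized mean of a function of the step started from the section at `0`. -/
noncomputable def palmMean (ω : Env n M) (w : Euc (n + 2) → Euc (n + 2) → ℝ≥0∞) : ℝ≥0∞ :=
  ∫⁻ u, weight ω (pt 0 u) * stepMean ω w (pt 0 u) ∂(sliceMeasure ω 0)

theorem measurable_palmMean {A : Type*} [MeasurableSpace A] (hε : 0 < ε) (hL : 0 ≤ L)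
    (hG : ∀ ω ∈ G, LipschitzBoundary (tube ω) ε L)
    {w : A × (Euc (n + 2) × Euc (n + 2)) → ℝ≥0∞} (hw : Measurable w) :
    Measurable fun p : A × G => palmMean p.2.1 (fun x y => w (p.1, x, y)) := by
  have hpt : Measurable fun u : Euc (n + 1) => pt 0 u := (continuous_pt_right 0).measurable
  have h1 : Measurable fun q : (A × G) × Euc (n + 1) => (q.1.2, pt 0 q.2) := by fun_prop
  have h2 : Measurable fun q : (A × G) × Euc (n + 1) => (q.1, pt 0 q.2) := by fun_prop
  have h3 := (measurable_weight hε hL hG).comp h1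
  have h4 := (measurable_stepMean hε hL hG hw).comp h2
  simp only [Function.comp_def] at h3 h4
  exact measurable_lintegral_sliceMeasure hε hG (h3.mul h4)

theorem measurable_weightMean (hε : 0 < ε) (hL : 0 ≤ L)
    (hG : ∀ ω ∈ G, LipschitzBoundary (tube ω) ε L) :
    Measurable fun ω : G => ∫⁻ u, weight ω.1 (pt 0 u) ∂(sliceMeasure ω.1 0) := by
  have hpt : Measurable fun u : Euc (n + 1) => pt 0 u := (continuous_pt_right 0).measurable
  have h1 : Measurable fun q : (Unit × G) × Euc (n + 1) => (q.1.2, pt 0 q.2) := by fun_prop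
  have h3 := (measurable_weight hε hL hG).comp h1
  have h4 : Measurable fun ω : G => ((), ω) := by fun_prop
  have h5 := (measurable_lintegral_sliceMeasure hε hG h3).comp h4
  simp only [Function.comp_def] at h5
  exact h5

theorem measurable_sliceMeasure_irregular (hε : 0 < ε) (hL : 0 ≤ L)
    (hG : ∀ ω ∈ G, LipschitzBoundary (tube ω) ε L) :
    Measurable fun ω : G => sliceMeasure ω.1 0 {u | pt 0 u ∉ regularPoints ω.1} := by
  have hpt : Measurable fun u : Euc (n + 1) => pt 0 u := (continuous_pt_right 0).measurable
  have h1 : Measurable fun q : G × Euc (n + 1) => (q.1, pt 0 q.2) := by fun_prop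
  have hs : MeasurableSet {q : G × Euc (n + 1) | pt 0 q.2 ∉ regularPoints q.1.1} :=
    (h1 (measurableSet_regularPoints hε hL hG)).compl
  have := isSFiniteKernel_sliceKernel hε hG
  exact ProbabilityTheory.Kernel.measurable_kernel_prodMk_left (κ := sliceKernel hε hG) hs

end StepMeasurable

/-! ### Measurability of crossing events -/

section Crossing

variable {n : ℕ} {S : Set (Euc (n + 1))}

/-- The first point of the segment from `x` to `y` on the boundary of the cylinder. -/
noncomputable def hitPt (S : Set (Euc (n + 1))) (x y : Euc (n + 2)) : Euc (n + 2) :=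
  x + sInf (hitTimes S x y) • (y - x)

theorem isOpen_setOf_forall_notMem (F : Set (Euc (n + 2))) (hF : IsClosed F) (a : ℝ) :
    IsOpen {z : Euc (n + 2) × Euc (n + 2) | ∀ c ∈ Icc 0 a, z.1 + c • (z.2 - z.1) ∉ F} := by
  have h := (IsRandomOpen.const (T := Unit) hF.isOpen_compl).forall_compact
    (f := fun q : (Euc (n + 2) × Euc (n + 2)) × Icc 0 a => q.1.1 + (q.2 : ℝ) • (q.1.2 - q.1.1))
    (by fun_prop)
  simpa using h.isOpen ()

theorem hitTimes_nonneg {x y : Euc (n + 2)} : 0 ≤ sInf (hitTimes S x y) :=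
  Real.sInf_nonneg fun _ h => h.1.1

theorem isCompact_hitTimes (x y : Euc (n + 2)) : IsCompact (hitTimes S x y) := by
  have hc : Continuous fun t : ℝ => x + t • (y - x) := by fun_prop
  exact isCompact_Icc.inter_right (isClosed_frontier.preimage hc)

theorem sInf_hitTimes_mem {x y : Euc (n + 2)} (h : (hitTimes S x y).Nonempty) :
    sInf (hitTimes S x y) ∈ hitTimes S x y := (isCompact_hitTimes x y).sInf_mem h

theorem measurableSet_hitTimes_nonempty :
    MeasurableSet {p : Euc (n + 2) × Euc (n + 2) | (hitTimes S p.1 p.2).Nonempty} := by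
  have h := (isOpen_setOf_forall_notMem (frontier (cylinder S)) isClosed_frontier 1).measurableSet.compl
  convert h using 1
  ext p
  simp only [mem_compl_iff, mem_ofPred_eq, not_forall, not_not, Set.Nonempty, hitTimes, exists_prop]

theorem measurable_sInf_hitTimes :
    Measurable fun p : Euc (n + 2) × Euc (n + 2) => sInf (hitTimes S p.1 p.2) := by
  refine measurable_of_Iic fun a => ?_
  rcases lt_or_ge a 0 with ha | ha
  · convert MeasurableSet.empty
    ext p
    simp only [mem_preimage, mem_Iic, mem_empty_iff_false, iff_false, not_le]
    exact ha.trans_le hitTimes_nonneg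
  -- Without a hit `sInf ∅ = 0`, so such pairs belong to the sublevel set for every `a ≥ 0`; with a
  -- hit the infimum is attained.
  · have h1 := (measurableSet_hitTimes_nonempty (S := S)).compl
    have h2 := (isOpen_setOf_forall_notMem (frontier (cylinder S)) isClosed_frontier
      (min a 1)).measurableSet.compl
    convert h1.union h2 using 1
    ext p
    simp only [mem_preimage, mem_Iic, mem_union, mem_compl_iff, mem_ofPred_eq, not_forall, not_not,
      exists_prop]
    constructor
    · intro hp
      by_cases hne : (hitTimes S p.1 p.2).Nonempty
      · right
        have := sInf_hitTimes_mem hne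
        exact ⟨_, ⟨this.1.1, le_min hp this.1.2⟩, this.2⟩
      · exact Or.inl hne
    · rintro (hne | ⟨c, hc, hcF⟩)
      · rw [not_nonempty_iff_eq_empty.1 hne, Real.sInf_empty]
        exact ha
      · exact (csInf_le (isCompact_hitTimes _ _).bddBelow
          ⟨⟨hc.1, hc.2.trans (min_le_right _ _)⟩, hcF⟩).trans (hc.2.trans (min_le_left _ _))

theorem measurable_hitPt :
    Measurable fun p : Euc (n + 2) × Euc (n + 2) => hitPt S p.1 p.2 := by
  have := measurable_sInf_hitTimes (S := S)
  exact measurable_fst.add (this.smul (measurable_snd.sub measurable_fst))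

theorem frontier_cylinder : frontier (cylinder S) = {x | proj x ∈ frontier S} := by
  have ho : IsOpenMap (proj : Euc (n + 2) → Euc (n + 1)) := by
    intro o ho
    rw [isOpen_iff_mem_nhds]
    rintro _ ⟨x, hx, rfl⟩
    have : (fun u => pt (x 0) u) ⁻¹' o ∈ 𝓝 (proj x) := by
      apply (continuous_pt_right (x 0)).continuousAt
      simp only [pt_proj]
      exact ho.mem_nhds hx
    exact mem_of_superset this fun u hu => ⟨_, hu, proj_pt _ _⟩
  exact (ho.preimage_frontier_eq_frontier_preimage continuous_proj S).symm

theorem crossesIn_iff {U : Euc (n + 1) → Euc (n + 2) ≃ₗᵢ[ℝ] Euc (n + 2)} {B₁ : Set (Euc (n + 1))}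
    {B₂ : Set (Euc (n + 2))} {x y : Euc (n + 2)} : CrossesIn S U B₁ B₂ x y ↔
      (hitTimes S x y).Nonempty ∧ proj (hitPt S x y) ∈ B₁ ∧
        (U (proj (hitPt S x y))).symm (‖y - x‖⁻¹ • (y - x)) ∈ B₂ := by
  rw [CrossesIn, crossLoc, crossDir]
  by_cases h : (hitTimes S x y).Nonempty
  · simp [h, hitPoint, hitPt]
  · simp [h]

/-- The inverse rotations, as a jointly measurable function. -/
noncomputable def invRot (S : Set (Euc (n + 1))) (U : Euc (n + 1) → Euc (n + 2) ≃ₗᵢ[ℝ] Euc (n + 2))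
    (v : Euc (n + 1)) (w : Euc (n + 2)) : Euc (n + 2) :=
  ∑ i, (inner ℝ ((frontier S).indicator (fun v => U v (EuclideanSpace.single i 1)) v) w : ℝ) •
    EuclideanSpace.single i (1 : ℝ)

theorem invRot_eq {U : Euc (n + 1) → Euc (n + 2) ≃ₗᵢ[ℝ] Euc (n + 2)} {v : Euc (n + 1)}
    (hv : v ∈ frontier S) (w : Euc (n + 2)) : invRot S U v w = (U v).symm w := by
  have h1 : ∀ i, (inner ℝ (U v (EuclideanSpace.single i 1)) w : ℝ) = (U v).symm w i := fun i => by
    rw [LinearIsometryEquiv.inner_map_eq_flip, EuclideanSpace.inner_single_left]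
    simp
  simp only [invRot, indicator_of_mem hv, h1]
  ext j
  simp [Finset.sum_apply, Pi.single_apply]

theorem measurable_invRot {U : Euc (n + 1) → Euc (n + 2) ≃ₗᵢ[ℝ] Euc (n + 2)}
    (hU : ∀ w, Measurable fun v : frontier S => U (v : Euc (n + 1)) w) :
    Measurable fun p : Euc (n + 1) × Euc (n + 2) => invRot S U p.1 p.2 := by
  have h1 : ∀ i, Measurable ((frontier S).indicator fun v => U v (EuclideanSpace.single i (1 : ℝ))) := by
    intro i
    refine measurable_of_restrict_of_restrict_compl (s := frontier S) isClosed_frontier.measurableSet ?_ ?_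
    · convert hU (EuclideanSpace.single i 1) using 1
      ext1 p
      exact indicator_of_mem p.2 _
    · convert measurable_const (a := (0 : Euc (n + 2))) using 1
      ext1 p
      exact indicator_of_notMem p.2 _
  unfold invRot
  refine Finset.measurable_sum _ fun i _ => ?_
  exact (Measurable.inner ((h1 i).comp measurable_fst) measurable_snd).smul_const _

theorem measurableSet_crossesIn {U : Euc (n + 1) → Euc (n + 2) ≃ₗᵢ[ℝ] Euc (n + 2)}
    (hU : ∀ w, Measurable fun v : frontier S => U (v : Euc (n + 1)) w)
    {B₁ : Set (Euc (n + 1))} {B₂ : Set (Euc (n + 2))} (hB₁ : MeasurableSet B₁)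
    (hB₁S : B₁ ⊆ frontier S) (hB₂ : MeasurableSet B₂) :
    MeasurableSet {p : Euc (n + 2) × Euc (n + 2) | CrossesIn S U B₁ B₂ p.1 p.2} := by
  have hz : Measurable fun p : Euc (n + 2) × Euc (n + 2) => proj (hitPt S p.1 p.2) :=
    continuous_proj.measurable.comp measurable_hitPt
  have hw : Measurable fun p : Euc (n + 2) × Euc (n + 2) => ‖p.2 - p.1‖⁻¹ • (p.2 - p.1) := by fun_prop
  have hr := (measurable_invRot hU).comp (hz.prodMk hw)
  convert measurableSet_hitTimes_nonempty.inter ((hz hB₁).inter (hr hB₂)) using 1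
  ext p
  simp only [mem_ofPred_eq, crossesIn_iff, mem_inter_iff, mem_preimage, Function.comp]
  refine and_congr_right fun h1 => and_congr_right fun h2 => ?_
  rw [invRot_eq (hB₁S h2)]

theorem measurableSet_crosses (hS : IsOpen S) :
    MeasurableSet {p : Euc (n + 2) × Euc (n + 2) | Crosses S p.1 p.2} := by
  have hC : IsOpen (cylinder S) := hS.preimage continuous_proj
  have : {p : Euc (n + 2) × Euc (n + 2) | Crosses S p.1 p.2} =
      ⋃ t ∈ Icc (0 : ℝ) 1, (fun p => p.1 + t • (p.2 - p.1)) ⁻¹' cylinder S := by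
    ext p; simp [Crosses]
  rw [this]
  exact (isOpen_biUnion fun t _ => hC.preimage (by fun_prop)).measurableSet

end Crossing

/-! ### Normals of convex sets -/

theorem exists_supporting_normal {k : ℕ} {C : Set (Euc k)} (hC : Convex ℝ C) (hO : IsOpen C)
    {y : Euc k} (hy : y ∈ frontier C) :
    ∃ w : Euc k, ‖w‖ = 1 ∧ ∀ z ∈ closure C, 0 ≤ (inner ℝ w (z - y) : ℝ) := by
  have hyC : y ∉ C := fun h => by
    rw [hO.frontier_eq] at hy
    exact hy.2 h
  obtain ⟨f, hf⟩ := geometric_hahn_banach_open_point hC hO hyC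
  set w₀ : Euc k := (InnerProductSpace.toDual ℝ (Euc k)).symm (-f) with hw₀
  have hwf : ∀ z, (inner ℝ w₀ z : ℝ) = -f z := fun z => by
    rw [hw₀, InnerProductSpace.toDual_symm_apply]; rfl
  have hpos : 0 < ‖w₀‖ := by
    rw [norm_pos_iff]
    intro h0
    obtain ⟨c, hc⟩ : C.Nonempty := closure_nonempty_iff.1 ⟨y, hy.1⟩
    have h1 := hf c hc
    have h2 := hwf c
    have h3 := hwf y
    rw [h0, inner_zero_left] at h2 h3
    linarith
  refine ⟨‖w₀‖⁻¹ • w₀, ?_, fun z hz => ?_⟩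
  · rw [norm_smul, norm_inv, norm_norm, inv_mul_cancel₀ hpos.ne']
  · rw [inner_smul_left, hwf, map_sub]
    have hle : f z ≤ f y := by
      have hcl : IsClosed {z | f z ≤ f y} := isClosed_le f.continuous continuous_const
      exact closure_minimal (fun a ha => (hf a ha).le) hcl hz
    have : 0 ≤ ‖w₀‖⁻¹ * -(f z - f y) := by
      apply mul_nonneg (by positivity); linarith
    simpa using this

/-- If `w` stayed away from `v`, a step from `x` along `v - w` would land in `C` according to `v`,
but on the wrong side of the hyperplane that supports `C` at the nearby point `y`. This continuity
of supporting normals upgrades a normal of a convex set to a strict one. -/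
theorem IsInnerNormal.exists_supporting_near {k : ℕ} {C : Set (Euc k)} {x v : Euc k}
    (h : IsInnerNormal C x v) {η : ℝ} (hη : 0 < η) :
    ∃ ρ > 0, ∀ y ∈ Metric.ball x ρ, ∀ w : Euc k, ‖w‖ = 1 →
      (∀ z ∈ C, 0 ≤ (inner ℝ w (z - y) : ℝ)) → ‖w - v‖ < η := by
  obtain ⟨r, hr, hrs⟩ := Metric.eventually_nhds_iff.1 (h.2.2 (η / 4) (by positivity))
  refine ⟨r * η / 4, by positivity, fun y hy w hw hwC => ?_⟩
  by_contra! hge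
  set d := v - w with hd
  have hdη : η ≤ ‖d‖ := by rw [hd, norm_sub_rev]; exact hge
  have hd0 : 0 < ‖d‖ := hη.trans_le hdη
  have hsq : ‖d‖ ^ 2 = 2 - 2 * inner ℝ v w := by
    rw [hd, norm_sub_sq_real, h.2.1, hw]; ring
  have h1 : (inner ℝ v d : ℝ) = ‖d‖ ^ 2 / 2 := by
    rw [hsq, hd, inner_sub_right, real_inner_self_eq_norm_sq, h.2.1]; ring
  have h2 : (inner ℝ w d : ℝ) = -(‖d‖ ^ 2 / 2) := by
    rw [hsq, hd, inner_sub_right, real_inner_self_eq_norm_sq, hw, real_inner_comm]; ring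
  set s : Euc k := (r / 2 / ‖d‖) • d with hs
  have hsn : ‖s‖ = r / 2 := by
    rw [hs, norm_smul, Real.norm_of_nonneg (by positivity)]; field_simp
  have hvs : (inner ℝ v s : ℝ) = r / 4 * ‖d‖ := by
    rw [hs, inner_smul_right, h1]; field_simp; norm_num
  have hws : (inner ℝ w s : ℝ) = -(r / 4 * ‖d‖) := by
    rw [hs, inner_smul_right, h2]; field_simp; norm_num
  have hzC : x + s ∈ C := by
    refine (hrs ?_).1 ?_
    · rw [dist_eq_norm, add_sub_cancel_left, hsn]; linarith
    · rw [add_sub_cancel_left, hvs, hsn]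
      nlinarith
  have h3 := hwC _ hzC
  have h4 : (inner ℝ w (x + s - y) : ℝ) = inner ℝ w s + inner ℝ w (x - y) := by
    rw [← inner_add_right]; congr 1; abel
  have h5 := real_inner_le_norm w (x - y)
  rw [hw, one_mul, ← dist_eq_norm, dist_comm] at h5
  rw [Metric.mem_ball] at hy
  rw [h4, hws] at h3
  nlinarith

/-- Differentiable boundary points of convex sets have strict normals. -/
theorem IsInnerNormal.strictNormal_of_convex {k : ℕ} {C : Set (Euc k)} {x v : Euc k}
    (h : IsInnerNormal C x v) (hC : Convex ℝ C) (hO : IsOpen C) :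
    StrictNormal (frontier C) x v := by
  refine ⟨h.2.1, fun η hη => ?_⟩
  obtain ⟨ρ, hρ, hn⟩ := h.exists_supporting_near hη
  refine ⟨ρ, hρ, ?_⟩
  have key : ∀ y ∈ frontier C ∩ Metric.ball x ρ, ∀ y' ∈ frontier C ∩ Metric.ball x ρ,
      -(η * ‖y' - y‖) ≤ (inner ℝ v (y' - y) : ℝ) := by
    intro y hy y' hy'
    obtain ⟨w, hw, hwC⟩ := exists_supporting_normal hC hO hy.1
    have h1 := hn y hy.2 w hw fun z hz => hwC z (subset_closure hz)
    have h2 := hwC y' hy'.1.1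
    have h3 := real_inner_le_norm (w - v) (y' - y)
    rw [inner_sub_left] at h3
    have h4 : ‖w - v‖ * ‖y' - y‖ ≤ η * ‖y' - y‖ := by gcongr
    linarith
  intro y hy y' hy'
  rw [abs_le]
  constructor
  · have := key y' hy' y hy
    linarith
  · have := key y hy y' hy'
    rw [norm_sub_rev, ← neg_sub y y', inner_neg_right] at this
    linarith

theorem isInnerNormal_of_hasFDerivAt {k : ℕ} {A : Set (Euc k)} {x : Euc k} {φ : Euc k → ℝ}
    {φ' : Euc k →L[ℝ] ℝ} (hφ : HasFDerivAt φ φ' x) (hφ' : φ' ≠ 0) (hx : x ∈ frontier A)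
    (hφx : φ x = 0) (hA : ∀ y, y ∈ A ↔ 0 < φ y) : ∃ v, IsInnerNormal A x v := by
  set w : Euc k := (InnerProductSpace.toDual ℝ (Euc k)).symm φ' with hw
  have hwφ : ∀ z, φ' z = inner ℝ w z := fun z => by
    rw [hw, InnerProductSpace.toDual_symm_apply]
  have hw0 : 0 < ‖w‖ := by
    rw [norm_pos_iff]
    rintro h0
    apply hφ'
    ext z
    rw [hwφ, h0, inner_zero_left]; rfl
  have hinner : ∀ z, (inner ℝ (‖w‖⁻¹ • w) z : ℝ) = ‖w‖⁻¹ * φ' z := fun z => by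
    rw [inner_smul_left, hwφ]; simp
  refine ⟨‖w‖⁻¹ • w, hx, by rw [norm_smul, norm_inv, norm_norm, inv_mul_cancel₀ hw0.ne'],
    fun ε hε => ?_⟩
  filter_upwards [hφ.isLittleO.def (show 0 < ε * ‖w‖ by positivity)] with y hy
  rw [hφx, sub_zero, Real.norm_eq_abs, abs_le] at hy
  rw [hinner, hA]
  constructor
  · intro h
    rw [lt_inv_mul_iff₀ hw0] at h
    nlinarith [hy.1]
  · intro h
    have h' : φ' (y - x) < -(ε * ‖y - x‖) * ‖w‖ := by
      rw [inv_mul_eq_div, div_lt_iff₀ hw0] at h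
      exact h
    nlinarith [hy.2]

/-! ### Almost everywhere differentiability of convex boundaries -/

/-- By homogeneity this part of the level set is a radial graph over the hyperplane at height `1`,
through `p ↦ (φ p)⁻¹ • (p, 1)`, and `g` is differentiable on the ray over `p` where `φ` is
differentiable at `p`. Rademacher's theorem applies to `φ`, and the lift carries null sets to null
sets. -/
theorem measure_not_differentiableAt_of_last_pos {k : ℕ} {g : Euc (k + 1) → ℝ} {K : ℝ≥0}
    (hg : LipschitzWith K g) (hhom : ∀ t : ℝ, 0 < t → ∀ x, g (t • x) = t * g x) :
    μHE[k] {x | g x = 1 ∧ 0 < x (Fin.last k) ∧ ¬DifferentiableAt ℝ g x} = 0 := by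
  set φ : Euc k → ℝ := fun p => g (snocPt p 1) with hφ
  have hsn : ∀ p q : Euc k, ‖snocPt p 1 - snocPt q 1‖ = ‖p - q‖ := fun p q => by
    rw [snocPt_sub, sub_self]
    have := norm_snocPt_sq (p - q) 0
    rw [zero_pow two_ne_zero, add_zero] at this
    exact (sq_eq_sq₀ (norm_nonneg _) (norm_nonneg _)).1 this
  have hφL : ∀ p q, |φ p - φ q| ≤ K * ‖p - q‖ := fun p q => by
    have := hg.dist_le_mul (snocPt p 1) (snocPt q 1)
    rwa [Real.dist_eq, dist_eq_norm, hsn] at this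
  have hφLip : LipschitzWith K φ := LipschitzWith.of_dist_le_mul fun p q => by
    rw [Real.dist_eq, dist_eq_norm]; exact hφL p q
  set N : Set (Euc k) := {p | ¬DifferentiableAt ℝ φ p} with hN
  have hN0 : volume N = 0 := hφLip.ae_differentiableAt
  -- Bounding `p` and keeping `φ` away from `0` makes the radial lift `F` Lipschitz on each piece.
  set E : ℕ → Set (Euc k) := fun m => N ∩ {p | ‖p‖ ≤ m ∧ 1 / ((m : ℝ) + 1) ≤ φ p} with hE
  set F : Euc k → Euc (k + 1) := fun p => (φ p)⁻¹ • snocPt p 1 with hF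
  have hFE : ∀ m, μHE[k] (F '' E m) = 0 := by
    intro m
    have hm1 : (0 : ℝ) < (m : ℝ) + 1 := by positivity
    have hinv : ∀ p ∈ E m, 0 < φ p ∧ (φ p)⁻¹ ≤ m + 1 := fun p hp => by
      have h0 : 0 < φ p := (show (0 : ℝ) < 1 / ((m : ℝ) + 1) by positivity).trans_le hp.2.2
      refine ⟨h0, inv_le_of_inv_le₀ hm1 ?_⟩
      rw [← one_div]; exact hp.2.2
    have hlip : LipschitzOnWith (Real.toNNReal ((m + 1) + (m + 1) ^ 3 * K)) F (E m) := by
      refine LipschitzOnWith.of_dist_le_mul fun p hp q hq => ?_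
      rw [dist_eq_norm, dist_eq_norm, Real.coe_toNNReal _ (by positivity)]
      have h1 : F p - F q = (φ p)⁻¹ • (snocPt p 1 - snocPt q 1) +
          ((φ p)⁻¹ - (φ q)⁻¹) • snocPt q 1 := by
        rw [hF]; simp only; rw [smul_sub, sub_smul]; abel
      have hp' := hinv p hp
      have hq' := hinv q hq
      have h2 : |(φ p)⁻¹ - (φ q)⁻¹| ≤ (m + 1) * (m + 1) * (K * ‖p - q‖) := by
        rw [inv_sub_inv hp'.1.ne' hq'.1.ne', abs_div, abs_of_pos (mul_pos hp'.1 hq'.1),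
          div_eq_inv_mul, mul_inv]
        have h3 := hφL q p
        rw [norm_sub_rev] at h3
        have := inv_pos.2 hp'.1
        have := inv_pos.2 hq'.1
        gcongr
        · exact hp'.2
        · exact hq'.2
      have h3 : ‖snocPt q 1‖ ≤ m + 1 := (norm_snocPt_le _ _).trans (by
        rw [abs_one]; have := hq.2.1; linarith)
      calc ‖F p - F q‖ ≤ (φ p)⁻¹ * ‖p - q‖ + |(φ p)⁻¹ - (φ q)⁻¹| * ‖snocPt q 1‖ := by
            rw [h1]
            refine (norm_add_le _ _).trans ?_
            rw [norm_smul, norm_smul, hsn, Real.norm_of_nonneg (inv_pos.2 hp'.1).le, Real.norm_eq_abs]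
        _ ≤ (m + 1) * ‖p - q‖ + ((m + 1) * (m + 1) * (K * ‖p - q‖)) * (m + 1) := by
            gcongr; exact hp'.2
        _ = _ := by ring
    have h0 : μHE[k] (E m) = 0 := by
      rw [EuclideanSpace.euclideanHausdorffMeasure_eq_volume]
      exact measure_mono_null inter_subset_left hN0
    have := euclideanHausdorffMeasure_image_le hlip k
    rwa [h0, mul_zero, nonpos_iff_eq_zero] at this
  refine measure_mono_null ?_ (measure_iUnion_null hFE)
  rintro x ⟨hx1, hxl, hxd⟩
  set s := x (Fin.last k) with hs
  set p : Euc k := s⁻¹ • initCoords x with hp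
  have hxp : ∀ y : Euc (k + 1), 0 < y (Fin.last k) →
      y = y (Fin.last k) • snocPt ((y (Fin.last k))⁻¹ • initCoords y) 1 := fun y hy => by
    ext i
    refine Fin.lastCases ?_ (fun j => ?_) i
    · simp [snocPt]
    · simp [snocPt, initCoords, hy.ne']
  have hgy : ∀ y : Euc (k + 1), 0 < y (Fin.last k) →
      g y = y (Fin.last k) * φ ((y (Fin.last k))⁻¹ • initCoords y) := fun y hy => by
    conv_lhs => rw [hxp y hy, hhom _ hy]
  have hpN : p ∈ N := by
    intro hpd
    apply hxd
    have hlast : DifferentiableAt ℝ (fun y : Euc (k + 1) => y (Fin.last k)) x := by fun_prop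
    have hinit : DifferentiableAt ℝ (initCoords : Euc (k + 1) → Euc k) x := by
      have : ContDiff ℝ 1 (initCoords : Euc (k + 1) → Euc k) := by
        unfold initCoords; fun_prop
      exact (this.differentiable one_ne_zero) x
    have h1 : DifferentiableAt ℝ (fun y : Euc (k + 1) => (y (Fin.last k))⁻¹ • initCoords y) x :=
      (hlast.inv hxl.ne').smul hinit
    have h2 : DifferentiableAt ℝ
        (fun y : Euc (k + 1) => y (Fin.last k) * φ ((y (Fin.last k))⁻¹ • initCoords y)) x :=
      hlast.mul (DifferentiableAt.comp (g := φ) x hpd h1)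
    refine h2.congr_of_eventuallyEq ?_
    have hc : Continuous fun y : Euc (k + 1) => y (Fin.last k) := by fun_prop
    filter_upwards [hc.continuousAt.eventually_const_lt hxl] with y hy using hgy y hy
  have hsφ : s * φ p = 1 := by rw [← hgy x hxl, hx1]
  have hφp : 0 < φ p := by
    by_contra! hle
    nlinarith
  obtain ⟨m₁, hm₁⟩ := exists_nat_ge ‖p‖
  obtain ⟨m₂, hm₂⟩ := exists_nat_one_div_lt hφp
  refine mem_iUnion.2 ⟨max m₁ m₂, p, ⟨hpN, ?_, ?_⟩, ?_⟩
  · exact hm₁.trans (by exact_mod_cast le_max_left _ _)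
  · refine le_trans ?_ hm₂.le
    exact Nat.one_div_le_one_div (le_max_right _ _)
  · rw [hF]
    simp only
    rw [← eq_inv_of_mul_eq_one_left hsφ]
    exact (hxp x hxl).symm

theorem exists_linearIsometryEquiv_last {k : ℕ} {w : Euc (k + 1)} (hw : ‖w‖ = 1) :
    ∃ R : Euc (k + 1) ≃ₗᵢ[ℝ] Euc (k + 1), ∀ x, R x (Fin.last k) = inner ℝ w x := by
  have h1 : ‖(EuclideanSpace.single (Fin.last k) (1 : ℝ) : Euc (k + 1))‖ = 1 := by simp
  refine ⟨Submodule.reflection (ℝ ∙ (w - EuclideanSpace.single (Fin.last k) (1 : ℝ)))ᗮ, fun x => ?_⟩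
  set R := Submodule.reflection (ℝ ∙ (w - EuclideanSpace.single (Fin.last k) (1 : ℝ)))ᗮ with hR
  have h2 : R w = EuclideanSpace.single (Fin.last k) 1 := Submodule.reflection_sub (hw.trans h1.symm)
  have h3 : (inner ℝ (EuclideanSpace.single (Fin.last k) (1 : ℝ)) (R x) : ℝ) = R x (Fin.last k) := by
    rw [EuclideanSpace.inner_single_left]; simp
  rw [← h3, ← h2, R.inner_map_map]

/-- The open half-spaces around the positive and negative coordinate directions cover all nonzero
vectors, and an isometry brings each of them to the position of
`measure_not_differentiableAt_of_last_pos`. -/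
theorem measure_not_differentiableAt {k : ℕ} {g : Euc (k + 1) → ℝ} {K : ℝ≥0}
    (hg : LipschitzWith K g) (hhom : ∀ t : ℝ, 0 < t → ∀ x, g (t • x) = t * g x) (hg0 : g 0 = 0) :
    μHE[k] {x | g x = 1 ∧ ¬DifferentiableAt ℝ g x} = 0 := by
  have hw : ∀ w : Euc (k + 1), ‖w‖ = 1 →
      μHE[k] {x | g x = 1 ∧ 0 < (inner ℝ w x : ℝ) ∧ ¬DifferentiableAt ℝ g x} = 0 := by
    intro w hw
    obtain ⟨R, hR⟩ := exists_linearIsometryEquiv_last hw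
    have h1 := measure_not_differentiableAt_of_last_pos (g := fun y => g (R.symm y)) (K := K * 1)
      (hg.comp R.symm.lipschitz) (fun t ht x => by rw [map_smul, hhom t ht])
    have h2 := euclideanHausdorffMeasure_image_le (R.symm.lipschitz.lipschitzOnWith
      (s := {x | g (R.symm x) = 1 ∧ 0 < x (Fin.last k) ∧ ¬DifferentiableAt ℝ (fun y => g (R.symm y)) x})) k
    rw [h1, mul_zero, nonpos_iff_eq_zero] at h2
    refine measure_mono_null ?_ h2
    rintro x ⟨hx1, hx2, hx3⟩
    refine ⟨R x, ⟨by rw [R.symm_apply_apply]; exact hx1, by rw [hR]; exact hx2, fun hd => hx3 ?_⟩,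
      R.symm_apply_apply x⟩
    have h3 : DifferentiableAt ℝ (fun y => (fun y => g (R.symm y)) (R y)) x :=
      DifferentiableAt.comp (g := fun y => g (R.symm y)) x hd R.differentiableAt
    simpa using h3
  have hb : ∀ (i : Fin (k + 1)) (σ : Bool), ‖(if σ then (1 : ℝ) else -1) •
      (EuclideanSpace.single i (1 : ℝ) : Euc (k + 1))‖ = 1 := fun i σ => by
    cases σ <;> simp [norm_smul]
  refine measure_mono_null ?_ (measure_iUnion_null fun i : Fin (k + 1) =>
    measure_iUnion_null fun σ : Bool => hw _ (hb i σ))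
  rintro x ⟨hx1, hx2⟩
  have hx0 : x ≠ 0 := by
    rintro rfl
    rw [hg0] at hx1
    exact zero_ne_one hx1
  obtain ⟨i, hi⟩ : ∃ i, x i ≠ 0 := by
    by_contra! h
    exact hx0 (by ext i; simpa using h i)
  rcases lt_or_gt_of_ne hi with h | h
  · refine mem_iUnion₂.2 ⟨i, false, hx1, ?_, hx2⟩
    simpa [inner_smul_left, EuclideanSpace.inner_single_left] using h
  · refine mem_iUnion₂.2 ⟨i, true, hx1, ?_, hx2⟩
    simpa [inner_smul_left, EuclideanSpace.inner_single_left] using h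

/-- After a translation the boundary is the unit level set of the gauge, a homogeneous Lipschitz
function, and differentiability of the gauge yields a normal. -/
theorem measure_not_isInnerNormal_of_convex {k : ℕ} {C : Set (Euc (k + 1))} (hC : Convex ℝ C)
    (hO : IsOpen C) : μHE[k] {x | x ∈ frontier C ∧ ¬∃ v, IsInnerNormal C x v} = 0 := by
  rcases C.eq_empty_or_nonempty with rfl | ⟨c, hc⟩
  · simp
  set B : Set (Euc (k + 1)) := (fun x => x + c) ⁻¹' C with hB
  have hBC : Convex ℝ B := hC.translate_preimage_left c
  have hBO : IsOpen B := hO.preimage (by fun_prop)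
  have hB0 : (0 : Euc (k + 1)) ∈ B := by simpa [hB] using hc
  have hBn : B ∈ 𝓝 0 := hBO.mem_nhds hB0
  obtain ⟨K, hK⟩ := hBC.lipschitz_gauge hBn
  have hhom : ∀ t : ℝ, 0 < t → ∀ x, gauge B (t • x) = t * gauge B x := fun t ht x => by
    rw [gauge_smul_of_nonneg ht.le, smul_eq_mul]
  have h0 := measure_not_differentiableAt hK hhom gauge_zero
  have h1 := euclideanHausdorffMeasure_image_le
    ((IsometryEquiv.addRight c).isometry.lipschitz.lipschitzOnWith
      (s := {x | gauge B x = 1 ∧ ¬DifferentiableAt ℝ (gauge B) x})) k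
  rw [h0, mul_zero, nonpos_iff_eq_zero] at h1
  refine measure_mono_null ?_ h1
  rintro x ⟨hx, hxn⟩
  have hlt : ∀ y, y ∈ C ↔ 0 < 1 - gauge B (y - c) := fun y => by
    rw [sub_pos]
    have := setOfPred_gauge_lt_one_eq_self_of_isOpen hBC hB0 hBO
    have h2 : y - c ∈ B ↔ y ∈ C := by simp [hB]
    rw [← h2, ← this, mem_ofPred_eq, this]
  have hfr : gauge B (x - c) = 1 := by
    rw [gauge_eq_one_iff_mem_frontier hBC hBn, hB]
    have : frontier ((Homeomorph.addRight c) ⁻¹' C) = (Homeomorph.addRight c) ⁻¹' frontier C :=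
      ((Homeomorph.addRight c).preimage_frontier C).symm
    change x - c ∈ frontier ((Homeomorph.addRight c) ⁻¹' C)
    rw [this]
    simpa using hx
  refine ⟨x - c, ⟨hfr, fun hd => hxn ?_⟩, by simp⟩
  have hd1 : DifferentiableAt ℝ (fun y => 1 - gauge B (y - c)) x := by
    refine (differentiableAt_const _).sub ?_
    exact DifferentiableAt.comp (g := gauge B) x hd (by fun_prop)
  have hd' := hd1.hasFDerivAt
  refine isInnerNormal_of_hasFDerivAt hd' ?_ hx (by rw [hfr, sub_self]) hlt
  -- Along the ray from `c` through `x` the gauge is linear with slope `1`, so the derivative is not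
  -- zero.
  intro hz
  rw [hz] at hd'
  have hl : HasDerivAt (fun t : ℝ => x + t • (x - c)) (x - c) 0 := by
    simpa using ((hasDerivAt_id (0 : ℝ)).smul_const (x - c)).const_add x
  have h2 := HasFDerivAt.comp_hasDerivAt (x := (0 : ℝ)) (f := fun t : ℝ => x + t • (x - c))
    (l := fun y => 1 - gauge B (y - c)) (l' := 0) (by simpa using hd') hl
  have h3 : HasDerivAt (fun t : ℝ => -t) (-1) 0 := (hasDerivAt_id (0 : ℝ)).neg
  have h4 : (fun y => 1 - gauge B (y - c)) ∘ (fun t : ℝ => x + t • (x - c)) =ᶠ[𝓝 0] fun t => -t := by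
    filter_upwards [lt_mem_nhds (show (-1 : ℝ) < 0 by norm_num)] with t ht
    have : x + t • (x - c) - c = (1 + t) • (x - c) := by rw [add_smul, one_smul]; abel
    simp only [Function.comp]
    rw [this, hhom _ (by linarith), hfr]
    ring
  have := (h3.congr_of_eventuallyEq h4).unique h2
  simp at this

/-! ### Regular boundary points of the cylinder -/

section Cylinder

variable {n : ℕ} {S : Set (Euc (n + 1))} {U : Euc (n + 1) → Euc (n + 2) ≃ₗᵢ[ℝ] Euc (n + 2)}

theorem inner_e (x : Euc (n + 2)) : (inner ℝ x (e n) : ℝ) = x 0 := by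
  rw [e, EuclideanSpace.inner_single_right]; simp

theorem norm_e : ‖e n‖ = 1 := by simp [e]

theorem e_eq_pt : e n = pt 1 0 := by
  ext i
  refine Fin.cases ?_ (fun j => ?_) i <;> simp [e, pt]

theorem proj_e : proj (e n) = 0 := by rw [e_eq_pt, proj_pt]

theorem proj_add_smul_e (x : Euc (n + 2)) (t : ℝ) : proj (x + t • e n) = proj x := by
  rw [proj_add, proj_smul, proj_e, smul_zero, add_zero]

theorem isOpen_cylinder (hS : IsOpen S) : IsOpen (cylinder S) := hS.preimage continuous_proj

theorem convex_cylinder (hS : Convex ℝ S) : Convex ℝ (cylinder S) := by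
  intro x hx y hy a b ha hb hab
  rw [cylinder, mem_ofPred_eq, proj_add, proj_smul, proj_smul]
  exact hS hx hy ha hb hab

theorem add_smul_e_mem_cylinder {x : Euc (n + 2)} (t : ℝ) : x + t • e n ∈ cylinder S ↔ x ∈ cylinder S := by
  rw [cylinder, mem_ofPred_eq, mem_ofPred_eq, proj_add_smul_e]

theorem IsInnerNormal.cylinder_add {z m : Euc (n + 2)} (h : IsInnerNormal (cylinder S) z m) (t : ℝ) :
    IsInnerNormal (cylinder S) (z + t • e n) m := by
  refine ⟨?_, h.2.1, fun ε hε => ?_⟩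
  · have := h.1
    rw [frontier_cylinder, mem_ofPred_eq] at this ⊢
    rwa [proj_add_smul_e]
  · have hc : Tendsto (fun y : Euc (n + 2) => y + (-t) • e n) (𝓝 (z + t • e n)) (𝓝 z) := by
      have : Continuous fun y : Euc (n + 2) => y + (-t) • e n := by fun_prop
      simpa [add_assoc] using this.tendsto (z + t • e n)
    filter_upwards [hc.eventually (h.2.2 ε hε)] with y hy
    have h1 : y + (-t) • e n - z = y - (z + t • e n) := by rw [neg_smul]; abel
    rwa [h1, add_smul_e_mem_cylinder] at hy

/-- The line through `z` along `e` stays outside the open cylinder, so neither `e` nor `-e` has a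
positive inner product with the inner normal. -/
theorem IsInnerNormal.cylinder_inner_e (hS : IsOpen S) {z m : Euc (n + 2)}
    (h : IsInnerNormal (cylinder S) z m) : (inner ℝ m (e n) : ℝ) = 0 := by
  have hnot : ∀ t : ℝ, z + t • e n ∉ cylinder S := fun t ht => by
    rw [add_smul_e_mem_cylinder] at ht
    have := h.1
    rw [(isOpen_cylinder hS).frontier_eq] at this
    exact this.2 ht
  have key : ∀ w : Euc (n + 2), (∀ t : ℝ, z + t • w ∉ cylinder S) → (inner ℝ m w : ℝ) ≤ 0 := by
    intro w hw
    by_contra! hpos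
    obtain ⟨δ, hδ, hs⟩ := h.rayInside hpos
    exact hw _ (hs (δ / 2) (by linarith) (by linarith))
  have h1 := key (e n) hnot
  have h2 := key (-e n) fun t => by
    rw [smul_neg, ← neg_smul]; exact hnot _
  rw [inner_neg_right] at h2
  linarith

/-- The normal of the cylinder given by the frame. -/
noncomputable def cylNormal (S : Set (Euc (n + 1)))
    (U : Euc (n + 1) → Euc (n + 2) ≃ₗᵢ[ℝ] Euc (n + 2)) (z : Euc (n + 2)) : Euc (n + 2) :=
  (frontier S).indicator (fun v => U v (e n)) (proj z)

theorem measurable_cylNormal (hU : IsNormalFrame S U) : Measurable (cylNormal S U) := by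
  have h1 : Measurable ((frontier S).indicator fun v => U v (e n)) := by
    refine measurable_of_restrict_of_restrict_compl (s := frontier S)
      isClosed_frontier.measurableSet ?_ ?_
    · convert hU.1 (e n) using 1
      ext1 p
      exact indicator_of_mem p.2 _
    · convert measurable_const (a := (0 : Euc (n + 2))) using 1
      ext1 p
      exact indicator_of_notMem p.2 _
  exact h1.comp continuous_proj.measurable

theorem IsNormalFrame.cylNormal_eq (hU : IsNormalFrame S U) {z m : Euc (n + 2)}
    (h : IsInnerNormal (cylinder S) z m) : cylNormal S U z = m := by
  have hz := h.1
  rw [frontier_cylinder, mem_ofPred_eq] at hz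
  rw [cylNormal, indicator_of_mem hz]
  refine hU.2 _ hz m ?_
  have := h.cylinder_add (-(z 0))
  have h1 : z + (-(z 0)) • e n = pt 0 (proj z) := by
    conv_lhs => rw [← pt_proj z]
    rw [pt_zero, e_eq_pt, pt_smul, pt_add]
    simp
  rwa [h1] at this

/-- Almost all boundary points of the cylinder are regular. -/
theorem exists_regular_cylinder (hSo : IsOpen S) (hSc : Convex ℝ S) (hU : IsNormalFrame S U) :
    ∃ Q : Set (Euc (n + 2)), MeasurableSet Q ∧ Q ⊆ frontier (cylinder S) ∧
      μHE[n + 1] (frontier (cylinder S) \ Q) = 0 ∧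
      ∀ z ∈ Q, IsInnerNormal (cylinder S) z (cylNormal S U z) := by
  have h0 := measure_not_isInnerNormal_of_convex (k := n + 1) (convex_cylinder hSc) (isOpen_cylinder hSo)
  set N := {x | x ∈ frontier (cylinder S) ∧ ¬∃ v, IsInnerNormal (cylinder S) x v} with hN
  -- Removing a measurable hull of the irregular points, still a null set, keeps `Q` measurable.
  refine ⟨frontier (cylinder S) \ toMeasurable μHE[n + 1] N,
    isClosed_frontier.measurableSet.diff (measurableSet_toMeasurable _ _), sdiff_subset, ?_, ?_⟩
  · refine measure_mono_null ?_ ((measure_toMeasurable N).trans h0)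
    rintro z ⟨hz, hzn⟩
    by_contra h
    exact hzn ⟨hz, h⟩
  · rintro z ⟨hz, hzn⟩
    have : ∃ v, IsInnerNormal (cylinder S) z v := by
      by_contra h
      exact hzn (subset_toMeasurable _ _ ⟨hz, h⟩)
    obtain ⟨v, hv⟩ := this
    rwa [hU.cylNormal_eq hv]

theorem norm_proj_of_inner_e_eq_zero {m : Euc (n + 2)} (hm : (inner ℝ m (e n) : ℝ) = 0) :
    ‖proj m‖ = ‖m‖ := by
  rw [inner_e] at hm
  conv_rhs => rw [← pt_proj m, hm, norm_pt_zero]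

/-- The measure of a unit piece of the cylinder over `B`. -/
theorem measure_cylinder_piece {Q : Set (Euc (n + 2))} (hQ : MeasurableSet Q) (hSo : IsOpen S)
    (hSc : Convex ℝ S) (hU : IsNormalFrame S U)
    (hQ0 : μHE[n + 1] (frontier (cylinder S) \ Q) = 0)
    (hQn : ∀ z ∈ Q, IsInnerNormal (cylinder S) z (cylNormal S U z)) {B : Set (Euc (n + 1))}
    (hB : MeasurableSet B) (hBS : B ⊆ frontier S) :
    μHE[n + 1] {z | z ∈ Q ∧ proj z ∈ B ∧ z 0 ∈ Ico (0 : ℝ) 1} = μHE[n] B := by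
  set Γ := {z : Euc (n + 2) | z ∈ Q ∧ proj z ∈ B ∧ z 0 ∈ Ico (0 : ℝ) 1} with hΓ
  have h0c : Continuous fun z : Euc (n + 2) => z 0 := by fun_prop
  have hΓm : MeasurableSet Γ :=
    hQ.inter ((continuous_proj.measurable hB).inter (h0c.measurable measurableSet_Ico))
  -- The normal of the cylinder is orthogonal to `e`, so the coarea factor is `1`.
  have hκ : ∀ z ∈ Γ, ‖proj (cylNormal S U z)‖ = 1 := fun z hz => by
    rw [norm_proj_of_inner_e_eq_zero ((hQn z hz.1).cylinder_inner_e hSo), (hQn z hz.1).2.1]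
  have hco := (coarea_formula hΓm (ν := cylNormal S U) (fun z hz =>
    ((hQn z hz.1).strictNormal_of_convex (convex_cylinder hSc) (isOpen_cylinder hSo)).mono
      fun z hz => (hQn z hz.1).1) (fun z hz h => by
        have := hκ z hz
        rw [h, norm_zero] at this
        exact zero_ne_one this) (measurable_cylNormal hU)).2
  have h1 : ∫⁻ z in Γ, ENNReal.ofReal ‖proj (cylNormal S U z)‖ ∂μHE[n + 1] = μHE[n + 1] Γ := by
    rw [setLIntegral_congr_fun (g := fun _ => 1) hΓm fun z hz => by simp only [hκ z hz, ENNReal.ofReal_one]]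
    simp
  rw [h1] at hco
  rw [← hco]
  have h2 : ∀ᵐ α : ℝ, μHE[n] (sliceAt Γ α) = (Ico (0 : ℝ) 1).indicator (fun _ => μHE[n] B) α := by
    filter_upwards [ae_measure_sliceAt_eq_zero hQ0] with α hα
    by_cases hαI : α ∈ Ico (0 : ℝ) 1
    · rw [indicator_of_mem hαI]
      apply le_antisymm
      · apply measure_mono
        intro u hu
        have := hu.2.1
        rwa [proj_pt] at this
      · calc μHE[n] B ≤ μHE[n] (sliceAt Γ α ∪ sliceAt (frontier (cylinder S) \ Q) α) := by
              apply measure_mono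
              intro u hu
              by_cases hq : pt α u ∈ Q
              · exact Or.inl ⟨hq, by rwa [proj_pt], by rwa [pt_zero]⟩
              · refine Or.inr ⟨?_, hq⟩
                rw [frontier_cylinder, mem_ofPred_eq, proj_pt]
                exact hBS hu
          _ ≤ _ := (measure_union_le _ _).trans (by rw [hα, add_zero])
    · rw [indicator_of_notMem hαI]
      convert measure_empty (μ := μHE[n])
      rw [eq_empty_iff_forall_notMem]
      intro u hu
      have := hu.2.2
      rw [pt_zero] at this
      exact hαI this
  rw [lintegral_congr_ae h2, lintegral_indicator measurableSet_Ico]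
  simp

end Cylinder

/-! ### The unit sphere -/

section Sphere

variable {k : ℕ}

/-- On a cap where `⟨w, x⟩ > 1/2`, distances are at most three times those of the projections to the
equatorial disc, so a cap has finite measure; finitely many caps cover the sphere. -/
theorem measure_sphere_lt_top : μHE[k] (Metric.sphere (0 : Euc (k + 1)) 1) < ⊤ := by
  have hcap : ∀ w : Euc (k + 1), ‖w‖ = 1 →
      μHE[k] (Metric.sphere (0 : Euc (k + 1)) 1 ∩ {x | 1 / 2 < (inner ℝ w x : ℝ)}) < ⊤ := by
    intro w hw
    obtain ⟨R, hR⟩ := exists_linearIsometryEquiv_last hw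
    have hsq : ∀ x : Euc (k + 1), ‖x‖ = 1 → ‖initCoords (R x)‖ ^ 2 + (R x (Fin.last k)) ^ 2 = 1 :=
      fun x hx => by
        rw [← norm_snocPt_sq, snocPt_initCoords, R.norm_map, hx, one_pow]
    have hle : ∀ x ∈ Metric.sphere (0 : Euc (k + 1)) 1 ∩ {x | 1 / 2 < (inner ℝ w x : ℝ)},
        ∀ x' ∈ Metric.sphere (0 : Euc (k + 1)) 1 ∩ {x | 1 / 2 < (inner ℝ w x : ℝ)},
        edist (id x) (id x') ≤ (3 : ℝ≥0) * edist (initCoords (R x)) (initCoords (R x')) := by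
      rintro x ⟨hx, hx2⟩ x' ⟨hx', hx2'⟩
      rw [mem_sphere_zero_iff_norm] at hx hx'
      rw [mem_ofPred_eq, ← hR] at hx2 hx2'
      have h1 := hsq x hx
      have h2 := hsq x' hx'
      set p := initCoords (R x)
      set p' := initCoords (R x')
      set s := R x (Fin.last k)
      set s' := R x' (Fin.last k)
      rw [edist_dist, edist_dist, ← ENNReal.ofReal_coe_nnreal, ← ENNReal.ofReal_mul (by positivity)]
      apply ENNReal.ofReal_le_ofReal
      have h3 : dist (id x) (id x') ≤ ‖p - p'‖ + |s - s'| := by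
        rw [id, id, dist_eq_norm, ← R.norm_map, map_sub]
        refine le_trans (le_of_eq ?_) (norm_snocPt_le _ _)
        rw [← snocPt_sub, snocPt_initCoords, snocPt_initCoords]
      have hp : ‖p‖ ≤ 1 := by nlinarith [norm_nonneg p]
      have hp' : ‖p'‖ ≤ 1 := by nlinarith [norm_nonneg p']
      have h4 : |s - s'| ≤ 2 * ‖p - p'‖ := by
        have h5 : (s - s') * (s + s') = (‖p'‖ - ‖p‖) * (‖p'‖ + ‖p‖) := by nlinarith
        have h6 : |s - s'| * (s + s') = |‖p'‖ - ‖p‖| * (‖p'‖ + ‖p‖) := by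
          rw [← abs_of_pos (show 0 < s + s' by linarith), ← abs_mul, h5, abs_mul,
            abs_of_nonneg (show 0 ≤ ‖p'‖ + ‖p‖ by positivity)]
        have h7 : |‖p'‖ - ‖p‖| ≤ ‖p - p'‖ := by
          rw [norm_sub_rev]; exact abs_norm_sub_norm_le _ _
        have h8 : |s - s'| * (s + s') ≤ ‖p - p'‖ * 2 := by
          rw [h6]
          gcongr
          linarith
        have h9 : |s - s'| * 1 ≤ |s - s'| * (s + s') :=
          mul_le_mul_of_nonneg_left (by linarith) (abs_nonneg _)
        linarith
      rw [dist_eq_norm p p']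
      push_cast
      linarith
    have := euclideanHausdorffMeasure_image_le_image hle k
    rw [image_id] at this
    refine this.trans_lt (ENNReal.mul_lt_top (ENNReal.pow_lt_top ENNReal.coe_lt_top) ?_)
    rw [EuclideanSpace.euclideanHausdorffMeasure_eq_volume]
    refine (measure_mono ?_).trans_lt (measure_closedBall_lt_top (x := (0 : Euc k)) (r := 1))
    rintro _ ⟨x, ⟨hx, -⟩, rfl⟩
    rw [mem_closedBall_zero_iff]
    rw [mem_sphere_zero_iff_norm] at hx
    exact (norm_initCoords_le _).trans (by rw [R.norm_map, hx])
  obtain ⟨t, hts, ht⟩ := (isCompact_sphere (0 : Euc (k + 1)) 1).elim_nhds_subcover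
    (fun w => {x | 1 / 2 < (inner ℝ w x : ℝ)}) fun w hw => by
      refine (isOpen_lt continuous_const (by fun_prop)).mem_nhds ?_
      rw [mem_sphere_zero_iff_norm] at hw
      rw [mem_ofPred_eq, real_inner_self_eq_norm_sq, hw]
      norm_num
  calc μHE[k] (Metric.sphere (0 : Euc (k + 1)) 1)
      ≤ μHE[k] (⋃ w ∈ t, Metric.sphere (0 : Euc (k + 1)) 1 ∩ {x | 1 / 2 < (inner ℝ w x : ℝ)}) := by
        apply measure_mono
        intro x hx
        obtain ⟨w, hw, hxw⟩ := mem_iUnion₂.1 (ht hx)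
        exact mem_iUnion₂.2 ⟨w, hw, hx, hxw⟩
    _ < ⊤ := measure_biUnion_lt_top t.finite_toSet fun w hw =>
        hcap w (mem_sphere_zero_iff_norm.1 (hts w hw))

/-- The great sphere orthogonal to `v` is an isometric copy of the unit sphere one dimension lower,
which is Lebesgue null in its own space. -/
theorem measure_sphere_inner_eq_zero {v : Euc (k + 2)} (hv : ‖v‖ = 1) :
    μHE[k + 1] (Metric.sphere (0 : Euc (k + 2)) 1 ∩ {h | (inner ℝ h v : ℝ) = 0}) = 0 := by
  obtain ⟨R, hR⟩ := exists_linearIsometryEquiv_last hv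
  have hlip : LipschitzWith 1 fun p : Euc (k + 1) => R.symm (snocPt p 0) := by
    refine LipschitzWith.of_dist_le_mul fun p q => ?_
    rw [R.symm.dist_map, dist_eq_norm, dist_eq_norm, snocPt_sub, NNReal.coe_one, one_mul, sub_zero]
    simpa using norm_snocPt_le (p - q) 0
  have h1 := euclideanHausdorffMeasure_image_le
    (hlip.lipschitzOnWith (s := Metric.sphere (0 : Euc (k + 1)) 1)) (k + 1)
  rw [EuclideanSpace.euclideanHausdorffMeasure_eq_volume, Measure.addHaar_sphere, mul_zero,
    nonpos_iff_eq_zero] at h1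
  refine measure_mono_null ?_ h1
  rintro h ⟨hh, hv0⟩
  have h2 : R h (Fin.last (k + 1)) = 0 := by rw [hR, real_inner_comm]; exact hv0
  refine ⟨initCoords (R h), ?_, ?_⟩
  · rw [mem_sphere_zero_iff_norm] at hh ⊢
    have := norm_snocPt_sq (initCoords (R h)) (R h (Fin.last (k + 1)))
    rw [snocPt_initCoords, R.norm_map, hh, h2] at this
    have h3 : ‖initCoords (R h)‖ ^ 2 = 1 := by linarith
    exact (pow_eq_one_iff_of_nonneg (norm_nonneg _) two_ne_zero).1 h3
  · simp only
    rw [← h2, snocPt_initCoords, R.symm_apply_apply]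

/-- The surface measure of the unit sphere. -/
noncomputable def sphMeasure (k : ℕ) : Measure (Euc (k + 1)) :=
  (μHE[k] : Measure (Euc (k + 1))).restrict (Metric.sphere 0 1)

instance : IsFiniteMeasure (sphMeasure k) :=
  ⟨by rw [sphMeasure, Measure.restrict_apply_univ]; exact measure_sphere_lt_top⟩

theorem ae_sphMeasure_norm : ∀ᵐ h ∂(sphMeasure k), ‖h‖ = 1 := by
  filter_upwards [self_mem_ae_restrict (Metric.isClosed_sphere.measurableSet)] with h hh
  exact mem_sphere_zero_iff_norm.1 hh

theorem lintegral_sphMeasure_comp (R : Euc (k + 1) ≃ₗᵢ[ℝ] Euc (k + 1)) (f : Euc (k + 1) → ℝ≥0∞) :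
    ∫⁻ h, f (R h) ∂(sphMeasure k) = ∫⁻ h, f h ∂(sphMeasure k) := by
  have h1 : MeasurePreserving R.toIsometryEquiv (μHE[k] : Measure (Euc (k + 1))) μHE[k] :=
    R.toIsometryEquiv.measurePreserving_euclideanHausdorffMeasure k
  have h2 := h1.restrict_preimage (Metric.isClosed_sphere (x := (0 : Euc (k + 1))) (ε := 1)).measurableSet
  have h3 : R.toIsometryEquiv ⁻¹' Metric.sphere 0 1 = Metric.sphere (0 : Euc (k + 1)) 1 := by
    ext h
    simp
  rw [h3] at h2
  exact h2.lintegral_comp_emb R.toIsometryEquiv.toHomeomorph.measurableEmbedding f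

end Sphere

section Gamma

variable {n : ℕ}

theorem measurableSet_halfSphere : MeasurableSet (halfSphere n) :=
  (measurableSet_eq_fun measurable_norm measurable_const).inter
    (measurableSet_lt (f := fun _ => (0 : ℝ)) (g := fun h : Euc (n + 2) => (inner ℝ h (e n) : ℝ))
      measurable_const (by fun_prop))

theorem restrict_subset_halfSphere {B : Set (Euc (n + 2))} (hB : B ⊆ halfSphere n) :
    (μHE[n + 1] : Measure (Euc (n + 2))).restrict B = (sphMeasure (n + 1)).restrict B := by
  rw [sphMeasure, Measure.restrict_restrict_of_subset]
  exact fun h hh => mem_sphere_zero_iff_norm.2 (hB hh).1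

theorem ofReal_integral_inner_e {B : Set (Euc (n + 2))} (hBm : MeasurableSet B) (hB : B ⊆ halfSphere n) :
    ENNReal.ofReal (∫ h in B, inner ℝ h (e n) ∂(μHE[n + 1] : Measure (Euc (n + 2)))) =
      ∫⁻ h in B, ENNReal.ofReal (inner ℝ h (e n)) ∂(sphMeasure (n + 1)) := by
  rw [restrict_subset_halfSphere hB]
  have hnn : 0 ≤ᵐ[(sphMeasure (n + 1)).restrict B] fun h => (inner ℝ h (e n) : ℝ) := by
    filter_upwards [self_mem_ae_restrict hBm] with h hh
    exact (hB hh).2.le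
  refine ofReal_integral_eq_lintegral_ofReal ?_ hnn
  refine Integrable.of_bound (C := 1) (by fun_prop) ?_
  filter_upwards [self_mem_ae_restrict hBm] with h hh
  have := abs_real_inner_le_norm h (e n)
  rwa [(hB hh).1, norm_e, one_mul] at this

/-- The projection along `e` does not increase measure and maps the half-sphere onto a set
containing the open unit ball. -/
theorem measure_halfSphere_pos : 0 < sphMeasure (n + 1) (halfSphere n) := by
  have hsub : halfSphere n ⊆ Metric.sphere 0 1 := fun h hh => mem_sphere_zero_iff_norm.2 hh.1
  rw [sphMeasure, Measure.restrict_apply measurableSet_halfSphere, inter_eq_left.2 hsub]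
  have hlip : LipschitzWith 1 (proj : Euc (n + 2) → Euc (n + 1)) :=
    LipschitzWith.of_dist_le_mul fun x y => by
      rw [dist_eq_norm, dist_eq_norm, ← proj_sub, NNReal.coe_one, one_mul]
      exact norm_proj_le _
  have h1 := euclideanHausdorffMeasure_image_le (hlip.lipschitzOnWith (s := halfSphere n)) (n + 1)
  rw [ENNReal.coe_one, one_pow, one_mul, EuclideanSpace.euclideanHausdorffMeasure_eq_volume] at h1
  refine lt_of_lt_of_le (Metric.measure_ball_pos volume (0 : Euc (n + 1)) one_pos)
    ((measure_mono ?_).trans h1)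
  intro u hu
  rw [mem_ball_zero_iff] at hu
  have hs : 0 < 1 - ‖u‖ ^ 2 := by nlinarith [norm_nonneg u]
  refine ⟨pt (Real.sqrt (1 - ‖u‖ ^ 2)) u, ⟨?_, ?_⟩, proj_pt _ _⟩
  · have := norm_pt_sq (Real.sqrt (1 - ‖u‖ ^ 2)) u
    rw [Real.sq_sqrt hs.le, sub_add_cancel] at this
    exact (pow_eq_one_iff_of_nonneg (norm_nonneg _) two_ne_zero).1 this
  · rw [inner_e, pt_zero]
    exact Real.sqrt_pos.2 hs

theorem gammaConst_pos : 0 < gammaConst n := by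
  rw [gammaConst, inv_pos]
  have h1 := ofReal_integral_inner_e (n := n) measurableSet_halfSphere subset_rfl
  rw [← ENNReal.ofReal_pos, h1, setLIntegral_pos_iff (by fun_prop)]
  convert measure_halfSphere_pos (n := n) using 2
  rw [inter_eq_right]
  intro h hh
  rw [Function.mem_support]
  exact (ENNReal.ofReal_pos.2 hh.2).ne'

theorem ofReal_gammaConst_mul_lintegral :
    ENNReal.ofReal (gammaConst n) * ∫⁻ h in halfSphere n, ENNReal.ofReal (inner ℝ h (e n))
      ∂(sphMeasure (n + 1)) = 1 := by
  rw [← ofReal_integral_inner_e measurableSet_halfSphere subset_rfl, ← ENNReal.ofReal_mul gammaConst_pos.le,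
    gammaConst, inv_mul_cancel₀, ENNReal.ofReal_one]
  have := gammaConst_pos (n := n)
  rw [gammaConst, inv_pos] at this
  exact this.ne'

end Gamma

/-! ### Null sets and projections -/

/-- At transversal points the projection locally keeps a positive proportion of measure. So a null
family of parallel lines meets the boundary transversally in a null set only. -/
theorem measure_eq_zero_of_perp_image {k : ℕ} {Γ E : Set (Euc (k + 1))} {ν : Euc (k + 1) → Euc (k + 1)}
    {h : Euc (k + 1)} (hν : ∀ x ∈ E, StrictNormal Γ x (ν x)) (hE : E ⊆ Γ) (hh : ‖h‖ = 1)
    (hhν : ∀ x ∈ E, (inner ℝ h (ν x) : ℝ) ≠ 0) (h0 : μHE[k] (perp h '' E) = 0) :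
    μHE[k] E = 0 := by
  refine measure_null_of_locally_null E fun x hx => ?_
  obtain ⟨N, hN, -, hNb⟩ := (hν x hx).exists_measure_image_bounds (strictPerp_perp Γ x h) hh
    (hhν x hx) one_pos (δ := 2) one_lt_two
  refine ⟨E ∩ N, inter_mem_nhdsWithin E hN, ?_⟩
  have h1 := (hNb (E ∩ N) (inter_subset_inter_left _ hE)).2
  have h2 : μHE[k] (perp h '' (E ∩ N)) = 0 := measure_mono_null (image_mono inter_subset_left) h0
  rw [h2, mul_zero, nonpos_iff_eq_zero, mul_eq_zero] at h1
  refine h1.resolve_left ?_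
  rw [one_pow, one_mul]
  exact (ENNReal.ofReal_pos.2 (abs_pos.2 (hhν x hx))).ne'

theorem measure_perp_image_eq_zero {k : ℕ} {E : Set (Euc (k + 1))} {h : Euc (k + 1)} (hh : ‖h‖ = 1)
    (h0 : μHE[k] E = 0) : μHE[k] (perp h '' E) = 0 := by
  have := euclideanHausdorffMeasure_image_le ((lipschitzWith_perp hh).lipschitzOnWith (s := E)) k
  rwa [h0, mul_zero, nonpos_iff_eq_zero] at this

/-! ### Domains and convex subsets along lines -/

section Lines

variable {k : ℕ}

theorem IsInnerNormal.eventually_mem {A : Set (Euc k)} {x v w : Euc k} (h : IsInnerNormal A x v)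
    (hw : 0 < (inner ℝ w v : ℝ)) : ∀ᶠ s : ℝ in 𝓝[>] 0, x + s • w ∈ A := by
  rw [real_inner_comm] at hw
  have hw0 : 0 < ‖w‖ := by
    rw [norm_pos_iff]
    rintro rfl
    simp at hw
  have hlim : Tendsto (fun t : ℝ => x + t • w) (𝓝[>] 0) (𝓝 x) := by
    have : Continuous fun t : ℝ => x + t • w := by fun_prop
    simpa using (this.tendsto 0).mono_left nhdsWithin_le_nhds
  filter_upwards [hlim.eventually (h.2.2 ((inner ℝ v w : ℝ) / (2 * ‖w‖)) (by positivity)),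
    self_mem_nhdsWithin] with s hs hs0
  have hs0' : (0 : ℝ) < s := hs0
  refine hs.1 ?_
  rw [add_sub_cancel_left, inner_smul_right, norm_smul, Real.norm_of_nonneg hs0'.le]
  have h1 : (inner ℝ v w : ℝ) / (2 * ‖w‖) * (s * ‖w‖) = s * inner ℝ v w / 2 := by field_simp
  rw [h1]
  have : 0 < s * (inner ℝ v w : ℝ) := by positivity
  linarith

theorem IsInnerNormal.eventually_notMem {A : Set (Euc k)} {x v w : Euc k} (h : IsInnerNormal A x v)
    (hw : (inner ℝ w v : ℝ) < 0) : ∀ᶠ s : ℝ in 𝓝[>] 0, x + s • w ∉ A := by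
  rw [real_inner_comm] at hw
  have hw0 : 0 < ‖w‖ := by
    rw [norm_pos_iff]
    rintro rfl
    simp at hw
  have hlim : Tendsto (fun t : ℝ => x + t • w) (𝓝[>] 0) (𝓝 x) := by
    have : Continuous fun t : ℝ => x + t • w := by fun_prop
    simpa using (this.tendsto 0).mono_left nhdsWithin_le_nhds
  filter_upwards [hlim.eventually (h.2.2 (-(inner ℝ v w : ℝ) / (2 * ‖w‖))
    (div_pos (by linarith) (by positivity))), self_mem_nhdsWithin] with s hs hs0
  have hs0' : (0 : ℝ) < s := hs0
  refine hs.2 ?_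
  rw [add_sub_cancel_left, inner_smul_right, norm_smul, Real.norm_of_nonneg hs0'.le]
  have h1 : -(inner ℝ v w : ℝ) / (2 * ‖w‖) * (s * ‖w‖) = -(s * inner ℝ v w) / 2 := by field_simp
  rw [h1]
  have : s * (inner ℝ v w : ℝ) < 0 := mul_neg_of_pos_of_neg hs0' hw
  linarith

theorem notMem_of_mem_frontier {A : Set (Euc k)} (hA : IsOpen A) {x : Euc k} (hx : x ∈ frontier A) :
    x ∉ A := by
  rw [hA.frontier_eq] at hx
  exact hx.2

theorem line_mem_of_convex {C : Set (Euc k)} (hC : Convex ℝ C) (hO : IsOpen C) {z h : Euc k}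
    {a b c : ℝ} (ha : z + a • h ∈ C) (hb : z + b • h ∈ closure C)
    (hc : (a ≤ c ∧ c < b) ∨ (b < c ∧ c ≤ a)) : z + c • h ∈ C := by
  have hab : a - b ≠ 0 := by
    rcases hc with h | h
    · exact (by linarith : a - b < 0).ne
    · exact (by linarith : 0 < a - b).ne'
  have hs : (c - b) / (a - b) ∈ Ioc (0 : ℝ) 1 := by
    rcases hc with h | h
    · exact ⟨div_pos_of_neg_of_neg (by linarith) (by linarith),
        (div_le_one_of_neg (by linarith)).2 (by linarith)⟩
    · exact ⟨div_pos (by linarith) (by linarith), (div_le_one (by linarith)).2 (by linarith)⟩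
  have := hC.add_smul_sub_mem_interior' hb (by rwa [hO.interior_eq]) hs
  rw [hO.interior_eq] at this
  convert this using 1
  rw [add_sub_add_left_eq_sub, ← sub_smul, smul_smul, div_mul_cancel₀ _ hab, add_assoc, ← add_smul]
  congr 2
  ring

/-- A line enters a convex open set at most once. -/
theorem not_enter_twice {C : Set (Euc k)} (hC : Convex ℝ C) (hO : IsOpen C) {z h m m' : Euc k} {s : ℝ}
    (hs : 0 < s) (hz : IsInnerNormal C z m) (hzm : 0 < (inner ℝ h m : ℝ))
    (hz' : IsInnerNormal C (z + s • h) m') (hzm' : 0 < (inner ℝ h m' : ℝ)) : False := by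
  -- Just after `z` the line is inside. Just before the second entrance it is outside, although
  -- convexity keeps it inside up to there.
  obtain ⟨ε, hε, hε0, hεs⟩ := ((hz.eventually_mem hzm).and
    (Ioo_mem_nhdsGT hs)).exists
  have h1 : (inner ℝ (-h) m' : ℝ) < 0 := by rw [inner_neg_left]; linarith
  obtain ⟨ε', hε', hε0', hεs'⟩ := ((hz'.eventually_notMem h1).and
    (Ioo_mem_nhdsGT (show 0 < s - ε by linarith))).exists
  apply hε'
  have := line_mem_of_convex hC hO hε hz'.1.1 (c := s - ε') (Or.inl ⟨by linarith, by linarith⟩)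
  convert this using 1
  rw [sub_smul, smul_neg]; abel

theorem exists_exit {D : Set (Euc k)} (hD : IsOpen D) {z h : Euc k} {a c : ℝ} (ha : z + a • h ∈ D)
    (hac : a < c) (hc : z + c • h ∉ D) :
    ∃ b > a, z + b • h ∈ frontier D ∧ ∀ t, a ≤ t → t < b → z + t • h ∈ D := by
  have hcont : Continuous fun t : ℝ => z + t • h := by fun_prop
  set T : Set ℝ := {t | a ≤ t ∧ z + t • h ∉ D} with hT
  have hTc : IsClosed T := isClosed_Ici.inter (hD.isClosed_compl.preimage hcont)
  have hTne : T.Nonempty := ⟨c, hac.le, hc⟩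
  have hTb : BddBelow T := ⟨a, fun t ht => ht.1⟩
  have hb := hTc.csInf_mem hTne hTb
  have hab : a < sInf T := lt_of_le_of_ne hb.1 fun heq => hb.2 (by rw [← heq]; exact ha)
  have hin : ∀ t, a ≤ t → t < sInf T → z + t • h ∈ D := fun t hat htb => by
    by_contra hn
    exact (csInf_le hTb ⟨hat, hn⟩).not_gt htb
  refine ⟨sInf T, hab, ?_, hin⟩
  rw [hD.frontier_eq]
  refine ⟨?_, hb.2⟩
  have hlim : Tendsto (fun t : ℝ => z + t • h) (𝓝[<] sInf T) (𝓝 (z + sInf T • h)) :=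
    (hcont.tendsto _).mono_left nhdsWithin_le_nhds
  refine mem_closure_of_tendsto hlim ?_
  filter_upwards [Ioo_mem_nhdsLT hab] with t ht using hin t ht.1.le ht.2

end Lines

/-! ### Chords and crossings -/

section Chords

variable {n : ℕ}

/-- The direction from `x` to `y`. -/
noncomputable def dir {k : ℕ} (x y : Euc k) : Euc k := ‖y - x‖⁻¹ • (y - x)

theorem norm_dir {k : ℕ} {x y : Euc k} (h : x ≠ y) : ‖dir x y‖ = 1 := by
  rw [dir, norm_smul, norm_inv, norm_norm, inv_mul_cancel₀]
  exact norm_ne_zero_iff.2 (sub_ne_zero.2 h.symm)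

theorem add_norm_smul_dir {k : ℕ} {x y : Euc k} (h : x ≠ y) : x + ‖y - x‖ • dir x y = y := by
  rw [dir, smul_smul, mul_inv_cancel₀ (norm_ne_zero_iff.2 (sub_ne_zero.2 h.symm)), one_smul,
    add_sub_cancel]

theorem norm_sub_smul_dir {k : ℕ} {x y : Euc k} (h : x ≠ y) : ‖y - x‖ • dir x y = y - x := by
  rw [dir, smul_smul, mul_inv_cancel₀ (norm_ne_zero_iff.2 (sub_ne_zero.2 h.symm)), one_smul]

theorem dir_add_smul {k : ℕ} {x h : Euc k} (hh : ‖h‖ = 1) {r : ℝ} (hr : 0 < r) :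
    dir x (x + r • h) = h := by
  rw [dir, add_sub_cancel_left, norm_smul, Real.norm_of_nonneg hr.le, hh, mul_one, smul_smul,
    inv_mul_cancel₀ hr.ne', one_smul]

theorem Seen.mem {k : ℕ} {D : Set (Euc k)} {x y : Euc k} (h : Seen D x y) {s : ℝ} (hs : 0 < s)
    (hs' : s < ‖y - x‖) : x + s • dir x y ∈ D := by
  rw [seen_iff] at h
  have h0 : 0 < ‖y - x‖ := hs.trans hs'
  have := h.2 (s * ‖y - x‖⁻¹) ⟨by positivity, by
    rw [← div_eq_mul_inv, div_lt_one h0]; exact hs'⟩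
  rwa [mul_smul] at this

/-- A domain `D` with regular boundary part `R` and normals `N`, that contains the convex cylinder
over `S`, with regular boundary part `Q` and normals `m`. -/
structure CylinderInDomain (S : Set (Euc (n + 1))) (D R : Set (Euc (n + 2)))
    (N : Euc (n + 2) → Euc (n + 2)) (Q : Set (Euc (n + 2))) (m : Euc (n + 2) → Euc (n + 2)) : Prop where
  isOpen : IsOpen D
  bounded : ∃ M, ∀ x ∈ D, ‖proj x‖ ≤ M
  meas_R : MeasurableSet R
  R_subset : R ⊆ frontier D
  null_R : μHE[n + 1] (frontier D \ R) = 0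
  meas_N : Measurable N
  normal : ∀ x ∈ R, IsInnerNormal D x (N x)
  strict : ∀ x ∈ R, StrictNormal (frontier D) x (N x)
  open_S : IsOpen S
  convex_S : Convex ℝ S
  cylinder_subset : cylinder S ⊆ D
  meas_Q : MeasurableSet Q
  Q_subset : Q ⊆ frontier (cylinder S)
  null_Q : μHE[n + 1] (frontier (cylinder S) \ Q) = 0
  meas_m : Measurable m
  normal_m : ∀ z ∈ Q, IsInnerNormal (cylinder S) z (m z)

/-- The line through `x` in direction `h` meets both boundaries transversally at regular points. -/
def NiceLine (S : Set (Euc (n + 1))) (D R : Set (Euc (n + 2)))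
    (N : Euc (n + 2) → Euc (n + 2)) (Q : Set (Euc (n + 2))) (m : Euc (n + 2) → Euc (n + 2))
    (h x : Euc (n + 2)) : Prop :=
  (∀ t : ℝ, x + t • h ∈ frontier D → x + t • h ∈ R ∧ (inner ℝ h (N (x + t • h)) : ℝ) ≠ 0) ∧
  ∀ t : ℝ, x + t • h ∈ frontier (cylinder S) →
    x + t • h ∈ Q ∧ (inner ℝ h (m (x + t • h)) : ℝ) ≠ 0

variable {S : Set (Euc (n + 1))} {D R : Set (Euc (n + 2))} {N : Euc (n + 2) → Euc (n + 2)}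
  {Q : Set (Euc (n + 2))} {m : Euc (n + 2) → Euc (n + 2)} {h x y z : Euc (n + 2)}

theorem CylinderInDomain.inner_left_nonneg (H : CylinderInDomain S D R N Q m) (hx : x ∈ R)
    (hs : Seen D x y) : 0 ≤ (inner ℝ (dir x y) (N x) : ℝ) := by
  have hne := (seen_iff.1 hs).1
  have h0 : 0 < ‖y - x‖ := norm_pos_iff.2 (sub_ne_zero.2 hne.symm)
  by_contra! hlt
  obtain ⟨s, h1, h2⟩ := (((H.normal x hx).eventually_notMem hlt).and (Ioo_mem_nhdsGT h0)).exists
  exact h1 (hs.mem h2.1 h2.2)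

theorem CylinderInDomain.inner_right_nonpos (H : CylinderInDomain S D R N Q m) (hy : y ∈ R)
    (hs : Seen D x y) : (inner ℝ (dir x y) (N y) : ℝ) ≤ 0 := by
  have hne := (seen_iff.1 hs).1
  have h0 : 0 < ‖y - x‖ := norm_pos_iff.2 (sub_ne_zero.2 hne.symm)
  by_contra! hlt
  have h1 : (inner ℝ (-dir x y) (N y) : ℝ) < 0 := by rw [inner_neg_left]; linarith
  obtain ⟨s, h1, h2⟩ := (((H.normal y hy).eventually_notMem h1).and (Ioo_mem_nhdsGT h0)).exists
  apply h1
  have h3 := hs.mem (s := ‖y - x‖ - s) (by linarith [h2.2]) (by linarith [h2.1])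
  rwa [sub_smul, ← add_sub_assoc, add_norm_smul_dir hne, sub_eq_add_neg, ← smul_neg] at h3

/-- The end of a chord is the first point after `x` outside `D`, hence determined by `x` and the
direction. -/
theorem Seen.eq_of_dir_eq {k : ℕ} {D : Set (Euc k)} {x y y' : Euc k} (hy : y ∉ D) (hy' : y' ∉ D)
    (hs : Seen D x y) (hs' : Seen D x y') (hd : dir x y = dir x y') : y = y' := by
  have hne := (seen_iff.1 hs).1
  have hne' := (seen_iff.1 hs').1
  have h0 : 0 < ‖y - x‖ := norm_pos_iff.2 (sub_ne_zero.2 hne.symm)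
  have h0' : 0 < ‖y' - x‖ := norm_pos_iff.2 (sub_ne_zero.2 hne'.symm)
  have h1 := add_norm_smul_dir hne
  have h1' := add_norm_smul_dir hne'
  rcases lt_trichotomy ‖y - x‖ ‖y' - x‖ with hlt | heq | hgt
  · exact absurd (by rw [← h1, hd]; exact hs'.mem h0 hlt) hy
  · rw [← h1, ← h1', hd, heq]
  · exact absurd (by rw [← h1', ← hd]; exact hs.mem h0' hgt) hy'

theorem hitPt_eq (hne : x ≠ y) :
    hitPt S x y = x + (sInf (hitTimes S x y) * ‖y - x‖) • dir x y := by
  rw [hitPt, mul_smul, norm_sub_smul_dir hne]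

theorem hitPt_mem_frontier (hh : (hitTimes S x y).Nonempty) : hitPt S x y ∈ frontier (cylinder S) :=
  (sInf_hitTimes_mem hh).2

/-- A chord that enters the cylinder does so before its end. -/
theorem CylinderInDomain.sInf_hitTimes_lt_one (H : CylinderInDomain S D R N Q m)
    (hl : NiceLine S D R N Q m (dir x y) x) (hy : y ∈ R) (hs : Seen D x y)
    (hh : (hitTimes S x y).Nonempty) (hm : 0 < (inner ℝ (dir x y) (m (hitPt S x y)) : ℝ)) :
    sInf (hitTimes S x y) < 1 := by
  have hne := (seen_iff.1 hs).1
  refine lt_of_le_of_ne (sInf_hitTimes_mem hh).1.2 fun heq => ?_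
  have hz : hitPt S x y = y := by rw [hitPt, heq, one_smul, add_sub_cancel]
  have hyfr : y ∈ frontier (cylinder S) := by
    rw [← hz]; exact hitPt_mem_frontier hh
  rw [hz] at hm
  have h1 := hl.1 ‖y - x‖
  have h2 := hl.2 ‖y - x‖
  rw [add_norm_smul_dir hne] at h1 h2
  -- If `y` itself were the entrance point, the direction would lead into the cylinder, hence into
  -- `D`; but at the transversal end of a chord it leads out of `D`.
  have h3 := (H.normal_m y (h2 hyfr).1).eventually_mem hm
  have h4 : (inner ℝ (dir x y) (N y) : ℝ) < 0 :=
    lt_of_le_of_ne (H.inner_right_nonpos hy hs) (h1 (H.R_subset hy)).2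
  have h5 := (H.normal y hy).eventually_notMem h4
  obtain ⟨s, hs1, hs2⟩ := (h3.and h5).exists
  exact hs2 (H.cylinder_subset hs1)

/-- A chord that enters the cylinder crosses it. -/
theorem CylinderInDomain.crosses (H : CylinderInDomain S D R N Q m)
    (hl : NiceLine S D R N Q m (dir x y) x) (hy : y ∈ R) (hs : Seen D x y)
    (hh : (hitTimes S x y).Nonempty) (hm : 0 < (inner ℝ (dir x y) (m (hitPt S x y)) : ℝ)) :
    Crosses S x y := by
  have hne := (seen_iff.1 hs).1
  have h0 : 0 < ‖y - x‖ := norm_pos_iff.2 (sub_ne_zero.2 hne.symm)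
  have hlt := H.sInf_hitTimes_lt_one hl hy hs hh hm
  have hfr := hitPt_mem_frontier hh
  have hQ : hitPt S x y ∈ Q := by
    have := hl.2 (sInf (hitTimes S x y) * ‖y - x‖)
    rw [← hitPt_eq hne] at this
    exact (this hfr).1
  obtain ⟨s, h1, h2⟩ := (((H.normal_m _ hQ).eventually_mem hm).and (Ioo_mem_nhdsGT
    (show 0 < (1 - sInf (hitTimes S x y)) * ‖y - x‖ by
      apply mul_pos _ h0; linarith))).exists
  refine ⟨sInf (hitTimes S x y) + s * ‖y - x‖⁻¹, ⟨?_, ?_⟩, ?_⟩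
  · have := hitTimes_nonneg (S := S) (x := x) (y := y)
    have := h2.1
    positivity
  · have h3 : s * ‖y - x‖⁻¹ < 1 - sInf (hitTimes S x y) := by
      rw [← div_eq_mul_inv, div_lt_iff₀ h0]; exact h2.2
    linarith
  · rw [add_smul, ← add_assoc, mul_smul]
    exact h1

/-- A chord that crosses the cylinder enters it. -/
theorem CylinderInDomain.enters (H : CylinderInDomain S D R N Q m)
    (hl : NiceLine S D R N Q m (dir x y) x) (hx : x ∈ R) (hne : x ≠ y) (hc : Crosses S x y) :
    (hitTimes S x y).Nonempty ∧ 0 < (inner ℝ (dir x y) (m (hitPt S x y)) : ℝ) := by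
  have h0 : 0 < ‖y - x‖ := norm_pos_iff.2 (sub_ne_zero.2 hne.symm)
  have hCo := isOpen_cylinder H.open_S
  have hCc := convex_cylinder H.convex_S
  obtain ⟨t, ht, htC⟩ := hc
  have hxC : x ∉ cylinder S := fun h =>
    notMem_of_mem_frontier H.isOpen (H.R_subset hx) (H.cylinder_subset h)
  have ht0 : 0 < t := lt_of_le_of_ne ht.1 fun h => hxC (by rw [← h, zero_smul, add_zero] at htC; exact htC)
  -- Going backwards from a time spent in the cylinder to the start outside it, one meets its
  -- boundary; this proves a hit before `t`.
  obtain ⟨b, hb, hbfr, hbin⟩ := exists_exit hCo (z := x) (h := -(y - x)) (a := -t) (c := 0)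
    (by rw [smul_neg, neg_smul, neg_neg]; exact htC) (by linarith) (by simpa using hxC)
  have hb0 : b ≤ 0 := by
    by_contra! hlt
    have := hbin 0 (by linarith) hlt
    rw [zero_smul, add_zero] at this
    exact hxC this
  rw [smul_neg, ← neg_smul] at hbfr
  have hmem : -b ∈ hitTimes S x y := ⟨⟨by linarith, by linarith [ht.2]⟩, hbfr⟩
  have hne' : (hitTimes S x y).Nonempty := ⟨_, hmem⟩
  refine ⟨hne', ?_⟩
  set τ := sInf (hitTimes S x y) with hτ
  have hτt : τ < t := (csInf_le (isCompact_hitTimes x y).bddBelow hmem).trans_lt (by linarith)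
  have hfr := hitPt_mem_frontier hne'
  have hz := hl.2 (τ * ‖y - x‖)
  rw [← hitPt_eq hne] at hz
  obtain ⟨hzQ, hz0⟩ := hz hfr
  -- If the direction pointed outwards at the first hit, the segment would be in the cylinder
  -- shortly before; since it is in the cylinder again at time `t`, convexity would put the hit
  -- point inside.
  by_contra! hle
  have h1 : 0 < (inner ℝ (-(y - x)) (m (hitPt S x y)) : ℝ) := by
    rw [← norm_sub_smul_dir hne, inner_neg_left, inner_smul_left]
    have := lt_of_le_of_ne hle hz0
    have h2 : ‖y - x‖ * (inner ℝ (dir x y) (m (hitPt S x y)) : ℝ) < 0 := mul_neg_of_pos_of_neg h0 this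
    simpa using h2
  obtain ⟨s, hs, hs0⟩ := (((H.normal_m _ hzQ).eventually_mem h1).and self_mem_nhdsWithin).exists
  have hs0' : (0 : ℝ) < s := hs0
  have h2 : x + (τ - s) • (y - x) ∈ cylinder S := by
    convert hs using 1
    rw [hitPt, ← hτ, sub_smul, smul_neg]; abel
  have h3 := line_mem_of_convex hCc hCo htC (subset_closure h2) (c := τ) (Or.inr ⟨by linarith, hτt.le⟩)
  exact notMem_of_mem_frontier hCo hfr h3

/-- Every transversal entrance point of the cylinder lies on a chord. -/
theorem CylinderInDomain.exists_chord (H : CylinderInDomain S D R N Q m) (hh : ‖h‖ = 1)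
    (hz : z ∈ Q) (hl : NiceLine S D R N Q m h z) (hm : 0 < (inner ℝ h (m z) : ℝ)) :
    ∃ (a b : ℝ), z + a • h ∈ R ∧ z + b • h ∈ R ∧ Seen D (z + a • h) (z + b • h) ∧
      dir (z + a • h) (z + b • h) = h ∧
      (hitTimes S (z + a • h) (z + b • h)).Nonempty ∧ hitPt S (z + a • h) (z + b • h) = z := by
  have hCo := isOpen_cylinder H.open_S
  have hCc := convex_cylinder H.convex_S
  have hzn := H.normal_m z hz
  have hzC := notMem_of_mem_frontier hCo hzn.1
  -- The normal is orthogonal to `e` and `h` is not orthogonal to the normal, so `h` is not axial,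
  -- and the line leaves the tube of bounded cross-section in both senses.
  have hph : 0 < ‖proj h‖ := by
    rw [norm_pos_iff]
    intro h0
    have h1 : h = (h 0) • e n := by
      conv_lhs => rw [← pt_proj h, h0]
      rw [e_eq_pt, pt_smul, mul_one, smul_zero]
    rw [h1, inner_smul_left, real_inner_comm, hzn.cylinder_inner_e H.open_S, mul_zero] at hm
    exact lt_irrefl _ hm
  obtain ⟨M, hM⟩ := H.bounded
  have hout : ∀ t : ℝ, (M + ‖proj z‖) / ‖proj h‖ < |t| → z + t • h ∉ D := by
    intro t ht hD
    have h1 := hM _ hD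
    rw [proj_add, proj_smul] at h1
    have h2 := norm_sub_le (proj z + t • proj h) (proj z)
    rw [add_sub_cancel_left, norm_smul, Real.norm_eq_abs] at h2
    rw [div_lt_iff₀ hph] at ht
    linarith
  -- Both exits are sought from a point slightly inside, because the cylinder may touch the boundary
  -- of `D` at `z`.
  obtain ⟨ε, hε, hε0⟩ := ((hzn.eventually_mem hm).and self_mem_nhdsWithin).exists
  have hε0' : (0 : ℝ) < ε := hε0
  have hεD := H.cylinder_subset hε
  set c : ℝ := max (ε + 1) ((M + ‖proj z‖) / ‖proj h‖ + 1) with hc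
  have hc1 : ε < c := by have := le_max_left (ε + 1) ((M + ‖proj z‖) / ‖proj h‖ + 1); linarith
  have hc2 : (M + ‖proj z‖) / ‖proj h‖ < |c| := by
    rw [abs_of_pos (hε0'.trans hc1)]
    have := le_max_right (ε + 1) ((M + ‖proj z‖) / ‖proj h‖ + 1); linarith
  obtain ⟨b, hb, hbfr, hbin⟩ := exists_exit H.isOpen hεD hc1 (hout c hc2)
  obtain ⟨a', ha, hafr, hain⟩ := exists_exit H.isOpen (z := z) (h := -h) (a := -ε) (c := c)
    (by rwa [neg_smul_neg]) (by linarith) (by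
      rw [smul_neg, ← neg_smul]; exact hout _ (by rwa [abs_neg]))
  rw [smul_neg, ← neg_smul] at hafr
  set a := -a' with ha'
  have hain' : ∀ t, a < t → t ≤ ε → z + t • h ∈ D := fun t h1 h2 => by
    have := hain (-t) (by linarith) (by linarith)
    rwa [neg_smul_neg] at this
  -- Between `z` and the inner point the line is in the cylinder, hence in `D`, so the backward exit
  -- does not occur before reaching `z`.
  have ha0 : a ≤ 0 := by
    by_contra! hlt
    have h1 : z + a • h ∈ cylinder S := by
      refine line_mem_of_convex hCc hCo hε (b := 0) (by simpa using hzn.1.1) (Or.inr ⟨hlt, by linarith⟩)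
    exact notMem_of_mem_frontier H.isOpen hafr (H.cylinder_subset h1)
  have hab : 0 < b - a := by linarith
  have hyx : z + b • h = (z + a • h) + (b - a) • h := by rw [add_assoc, ← add_smul]; congr 2; ring
  refine ⟨a, b, (hl.1 a hafr).1, (hl.1 b hbfr).1, ⟨h, b - a, hh, hab, fun t ht => ?_, hyx.symm⟩, ?_, ?_⟩
  · rw [add_assoc, ← add_smul]
    rcases le_or_gt (a + t) ε with hle | hgt
    · exact hain' _ (by linarith [ht.1]) hle
    · exact hbin _ hgt.le (by linarith [ht.2])
  · rw [hyx, dir_add_smul hh hab]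
  · have hpar : ∀ t : ℝ, (z + a • h) + t • ((z + b • h) - (z + a • h)) = z + (a + t * (b - a)) • h := by
      intro t
      rw [add_sub_add_left_eq_sub, ← sub_smul, smul_smul, add_assoc, ← add_smul]
    have hleast : IsLeast (hitTimes S (z + a • h) (z + b • h)) (-a / (b - a)) := by
      constructor
      · refine ⟨⟨div_nonneg (by linarith) hab.le, (div_le_one hab).2 (by linarith)⟩, ?_⟩
        rw [hpar, div_mul_cancel₀ _ hab.ne', add_neg_cancel, zero_smul, add_zero]
        exact hzn.1
      · rintro t ⟨-, ht⟩
        rw [hpar] at ht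
        by_contra! hlt
        rw [lt_div_iff₀ hab] at hlt
        have := line_mem_of_convex hCc hCo hε ht.1 (c := 0) (Or.inr ⟨by linarith, hε0'.le⟩)
        rw [zero_smul, add_zero] at this
        exact hzC this
    refine ⟨⟨_, hleast.1⟩, ?_⟩
    rw [hitPt, hleast.csInf_eq, hpar, div_mul_cancel₀ _ hab.ne', add_neg_cancel, zero_smul, add_zero]

/-- Entrance points on the same line coincide. -/
theorem CylinderInDomain.entrance_unique (H : CylinderInDomain S D R N Q m) {z z' : Euc (n + 2)}
    (hz : z ∈ Q) (hz' : z' ∈ Q) (hm : 0 < (inner ℝ h (m z) : ℝ)) (hm' : 0 < (inner ℝ h (m z') : ℝ))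
    {s : ℝ} (hs : z' = z + s • h) : z = z' := by
  have hCo := isOpen_cylinder H.open_S
  have hCc := convex_cylinder H.convex_S
  rcases lt_trichotomy s 0 with hlt | rfl | hgt
  · exfalso
    have hs' : z = z' + (-s) • h := by rw [hs, neg_smul]; abel
    refine not_enter_twice hCc hCo (s := -s) (by linarith) (H.normal_m z' hz') hm' ?_ hm
    rw [← hs']
    exact H.normal_m z hz
  · rw [hs, zero_smul, add_zero]
  · exfalso
    refine not_enter_twice hCc hCo hgt (H.normal_m z hz) hm ?_ hm'
    rw [← hs]
    exact H.normal_m z' hz'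

/-- Chords on the same line that enter the cylinder have the same starting point. -/
theorem CylinderInDomain.start_unique (H : CylinderInDomain S D R N Q m) {x' y' : Euc (n + 2)}
    (hl : NiceLine S D R N Q m h x) (hl' : NiceLine S D R N Q m h x')
    (hx : x ∈ R) (hx' : x' ∈ R) (hy : y ∈ R) (hy' : y' ∈ R) (hs : Seen D x y) (hs' : Seen D x' y')
    (hd : dir x y = h) (hd' : dir x' y' = h)
    (hh : (hitTimes S x y).Nonempty) (hh' : (hitTimes S x' y').Nonempty)
    (hm : 0 < (inner ℝ h (m (hitPt S x y)) : ℝ)) (hm' : 0 < (inner ℝ h (m (hitPt S x' y')) : ℝ))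
    {s : ℝ} (hxs : x' = x + s • h) : x = x' := by
  have hne := (seen_iff.1 hs).1
  have hne' := (seen_iff.1 hs').1
  have h0 : 0 < ‖y - x‖ := norm_pos_iff.2 (sub_ne_zero.2 hne.symm)
  have h0' : 0 < ‖y' - x'‖ := norm_pos_iff.2 (sub_ne_zero.2 hne'.symm)
  have hlt := H.sInf_hitTimes_lt_one (by rw [hd]; exact hl) hy hs hh (by rw [hd]; exact hm)
  have hlt' := H.sInf_hitTimes_lt_one (by rw [hd']; exact hl') hy' hs' hh' (by rw [hd']; exact hm')
  have hz := hitPt_eq (S := S) hne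
  have hz' := hitPt_eq (S := S) hne'
  rw [hd] at hz
  rw [hd'] at hz'
  set c := sInf (hitTimes S x y) * ‖y - x‖ with hc
  set c' := sInf (hitTimes S x' y') * ‖y' - x'‖ with hc'
  have hc0 : 0 ≤ c := mul_nonneg hitTimes_nonneg h0.le
  have hc0' : 0 ≤ c' := mul_nonneg hitTimes_nonneg h0'.le
  have hcl : c < ‖y - x‖ := by nlinarith
  have hcl' : c' < ‖y' - x'‖ := by nlinarith
  have hzQ : hitPt S x y ∈ Q := by
    rw [hz]
    exact (hl.2 c (by rw [← hz]; exact hitPt_mem_frontier hh)).1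
  have hzQ' : hitPt S x' y' ∈ Q := by
    rw [hz']
    exact (hl'.2 c' (by rw [← hz']; exact hitPt_mem_frontier hh')).1
  have heq : hitPt S x y = hitPt S x' y' := by
    refine H.entrance_unique hzQ hzQ' hm hm' (s := s + c' - c) ?_
    rw [hz, hz', hxs, sub_smul, add_smul]; abel
  have hh1 : ‖h‖ = 1 := by rw [← hd]; exact norm_dir hne
  have hsc : s = c - c' := by
    rw [hz, hz', hxs, add_assoc, ← add_smul, add_right_inj] at heq
    have h2 : (c - (s + c')) • h = 0 := by rw [sub_smul, heq, sub_self]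
    rw [smul_eq_zero] at h2
    rcases h2 with h2 | h2
    · linarith
    · rw [h2, norm_zero] at hh1; exact absurd hh1 zero_ne_one
  -- Both chords reach the same entrance point strictly before their ends. If the starts differed,
  -- the later one would lie in the interior of the other chord, hence in `D`.
  rcases lt_trichotomy s 0 with hlt | h0s | hgt
  · exfalso
    refine notMem_of_mem_frontier H.isOpen (H.R_subset hx) ?_
    have := hs'.mem (s := -s) (by linarith) (by linarith)
    rw [hd', hxs, neg_smul, add_neg_cancel_right] at this
    exact this
  · rw [hxs, h0s, zero_smul, add_zero]
  · exfalso
    refine notMem_of_mem_frontier H.isOpen (H.R_subset hx') ?_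
    have := hs.mem (s := s) hgt (by linarith)
    rw [hd, ← hxs] at this
    exact this

end Chords

/-- Near each point the set projects along its normal to a bounded part of a hyperplane, losing at
most a factor `2` of measure, and countably many such neighbourhoods cover it. The exchanges of
integrals over boundaries rest on this. -/
theorem sigmaFinite_of_strictNormal {k : ℕ} {Γ : Set (Euc (k + 1))}
    (hΓ : MeasurableSet Γ) {ν : Euc (k + 1) → Euc (k + 1)} (hν : ∀ x ∈ Γ, StrictNormal Γ x (ν x)) :
    SigmaFinite ((μHE[k] : Measure (Euc (k + 1))).restrict Γ) := by
  have hloc : ∀ x, ∃ V : Set (Euc (k + 1)), x ∈ Γ → V ∈ 𝓝[Γ] x ∧ μHE[k] V < ⊤ := by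
    intro x
    by_cases hx : x ∈ Γ
    swap
    · exact ⟨∅, fun h => absurd h hx⟩
    have hv := (hν x hx).1
    obtain ⟨N, hN, -, hNb⟩ := (hν x hx).exists_measure_image_bounds (strictPerp_perp Γ x (ν x)) hv
      (by rw [real_inner_self_eq_norm_sq, hv]; norm_num) one_pos (δ := 2) one_lt_two
    refine ⟨Γ ∩ (N ∩ Metric.ball x 1), fun _ => ⟨inter_mem self_mem_nhdsWithin
      (mem_nhdsWithin_of_mem_nhds (inter_mem hN (Metric.ball_mem_nhds x one_pos))), ?_⟩⟩
    have h2 := (hNb (Γ ∩ (N ∩ Metric.ball x 1)) (by gcongr; exact inter_subset_left)).2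
    rw [one_pow, one_mul, real_inner_self_eq_norm_sq, hv, one_pow, abs_one, ENNReal.ofReal_one,
      one_mul] at h2
    refine h2.trans_lt (ENNReal.mul_lt_top ENNReal.coe_lt_top ?_)
    obtain ⟨R, hR⟩ := exists_linearIsometryEquiv_last hv
    have hlip : LipschitzWith 1 fun p : Euc k => R.symm (snocPt p 0) := by
      refine LipschitzWith.of_dist_le_mul fun p q => ?_
      rw [R.symm.dist_map, dist_eq_norm, dist_eq_norm, snocPt_sub, NNReal.coe_one, one_mul, sub_zero]
      simpa using norm_snocPt_le (p - q) 0
    have h1 := euclideanHausdorffMeasure_image_le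
      (hlip.lipschitzOnWith (s := Metric.closedBall (0 : Euc k) (‖x‖ + 1))) k
    refine (measure_mono ?_).trans_lt (h1.trans_lt ?_)
    · rintro _ ⟨y, hy, rfl⟩
      refine ⟨initCoords (R (perp (ν x) y)), ?_, ?_⟩
      · rw [mem_closedBall_zero_iff]
        refine (norm_initCoords_le _).trans ?_
        rw [R.norm_map]
        refine (norm_perp_le hv y).trans ?_
        have h3 := hy.2.2
        rw [Metric.mem_ball, dist_eq_norm] at h3
        have := norm_le_norm_add_norm_sub' y x
        linarith
      · simp only
        have h3 : R (perp (ν x) y) (Fin.last k) = 0 := by rw [hR, inner_perp hv]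
        rw [← h3, snocPt_initCoords, R.symm_apply_apply]
    · rw [EuclideanSpace.euclideanHausdorffMeasure_eq_volume]
      refine ENNReal.mul_lt_top (by simp) ?_
      exact (isCompact_closedBall _ _).measure_lt_top
  choose V hV using hloc
  obtain ⟨t, htΓ, htc, ht⟩ := TopologicalSpace.countable_cover_nhdsWithin (f := V) (s := Γ)
    fun x hx => (hV x hx).1
  refine Measure.sigmaFinite_of_countable (S := insert Γᶜ (V '' t)) ((htc.image V).insert _) ?_ ?_
  · rintro s (rfl | ⟨x, hx, rfl⟩)
    · rw [Measure.restrict_apply hΓ.compl, compl_inter_self, measure_empty]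
      exact ENNReal.zero_lt_top
    · exact (Measure.restrict_apply_le _ _).trans_lt (hV x (htΓ hx)).2
  · rw [sUnion_insert, sUnion_image, eq_univ_iff_forall]
    intro x
    by_cases hx : x ∈ Γ
    · exact Or.inr (ht hx)
    · exact Or.inl hx

/-- Moving `y` along the ray from `x` leaves the direction unchanged, and orthogonal displacements
are divided by the distance; the map is built from functions strictly differentiable away from `x`.
-/
theorem strictPerp_dir {k : ℕ} (Γ : Set (Euc k)) {x y : Euc k} (hxy : x ≠ y) :
    StrictPerp Γ (dir x) y (dir x y) ‖y - x‖⁻¹ := by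
  intro η hη
  have hv : y - x ≠ 0 := sub_ne_zero.2 hxy.symm
  have hv0 : 0 < ‖y - x‖ := norm_pos_iff.2 hv
  have hid : HasStrictFDerivAt (fun z : Euc k => z - x) (ContinuousLinearMap.id ℝ (Euc k)) y :=
    (hasStrictFDerivAt_id y).sub_const x
  have h1 := (hasStrictFDerivAt_norm_sq (y - x)).comp y hid
  have h2 := HasStrictFDerivAt.sqrt h1 (by simpa using hv)
  have h3 := (hasStrictDerivAt_inv (x := √(‖y - x‖ ^ 2)) (by simpa using hv)).comp_hasStrictFDerivAt y h2
  have h4 := h3.smul hid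
  have hd : (fun z : Euc k => ((·⁻¹) ∘ fun z => √(((fun x => ‖x‖ ^ 2) ∘ fun z => z - x) z)) z • (z - x)) = dir x := by
    ext1 z
    simp only [Function.comp, dir, Real.sqrt_sq (norm_nonneg _)]
  have h5 := (h4.congr_of_eventuallyEq (Filter.EventuallyEq.of_eq hd)).isLittleO.def hη
  rw [nhds_prod_eq, Filter.eventually_prod_self_iff'] at h5
  obtain ⟨t, ht, h6⟩ := h5
  obtain ⟨ρ, hρ, hball⟩ := Metric.mem_nhds_iff.1 ht
  refine ⟨ρ, hρ, fun z hz z' hz' => ?_⟩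
  have h7 := h6 z (hball hz.2) z' (hball hz'.2)
  simp only at h7
  refine (le_of_eq (congrArg (‖·‖) ?_)).trans h7
  rw [perp_apply]
  simp only [Function.comp, dir, Real.sqrt_sq (norm_nonneg _), _root_.add_apply,
    _root_.smul_apply, ContinuousLinearMap.smulRight_apply,
    ContinuousLinearMap.comp_apply, ContinuousLinearMap.id_apply, innerSL_apply_apply, inner_smul_left]
  rw [sub_right_inj, smul_sub, sub_eq_add_neg, smul_smul, smul_smul, ← neg_smul]
  congr 2
  simp
  field_simp

/-! ### The chords between regular boundary points -/

/-- The pairs of boundary points in `E` that are the ends of a chord of `D`. -/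
def chords {k : ℕ} (D R : Set (Euc k)) (N : Euc k → Euc k) (E : Set (Euc k × Euc k)) :
    Set (Euc k × Euc k) :=
  {p | p.1 ∈ R ∧ p.2 ∈ R ∧ Seen D p.1 p.2 ∧ (inner ℝ (dir p.1 p.2) (N p.2) : ℝ) ≠ 0 ∧ p ∈ E}

/-- The starting points and directions of the chords in `E`. -/
def rays {k : ℕ} (D R : Set (Euc k)) (N : Euc k → Euc k) (E : Set (Euc k × Euc k)) :
    Set (Euc k × Euc k) :=
  (fun p => (p.1, dir p.1 p.2)) '' chords D R N E

open Classical in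
/-- The unnormalized density of the cosine law for the endpoint of a chord. -/
noncomputable def cosKernel {n : ℕ} (D : Set (Euc (n + 2))) (N : Euc (n + 2) → Euc (n + 2))
    (x y : Euc (n + 2)) : ℝ :=
  if Seen D x y then (inner ℝ (y - x) (N x) * inner ℝ (x - y) (N y)) / ‖x - y‖ ^ (n + 3) else 0

theorem measurable_dir {k : ℕ} : Measurable fun p : Euc k × Euc k => dir p.1 p.2 := by
  unfold dir; fun_prop

theorem measurableSet_seen_const {k : ℕ} {D : Set (Euc k)} (hD : IsOpen D) :
    MeasurableSet {p : Euc k × Euc k | Seen D p.1 p.2} :=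
  (measurableSet_seen (T := Unit) (IsRandomOpen.const hD)).preimage
    (f := fun p : Euc k × Euc k => ((), p)) (by fun_prop)

section

variable {n : ℕ} {S : Set (Euc (n + 1))} {D R : Set (Euc (n + 2))} {N : Euc (n + 2) → Euc (n + 2)}
  {Q : Set (Euc (n + 2))} {m : Euc (n + 2) → Euc (n + 2)} {E : Set (Euc (n + 2) × Euc (n + 2))}

theorem CylinderInDomain.measurableSet_chords (H : CylinderInDomain S D R N Q m)
    (hE : MeasurableSet E) : MeasurableSet (chords D R N E) := by
  have hN := H.meas_N
  have hd := measurable_dir (k := n + 2)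
  have h1 : Measurable fun p : Euc (n + 2) × Euc (n + 2) => (inner ℝ (dir p.1 p.2) (N p.2) : ℝ) :=
    hd.inner (hN.comp measurable_snd)
  exact (measurable_fst H.meas_R).inter ((measurable_snd H.meas_R).inter
    ((measurableSet_seen_const H.isOpen).inter
      ((measurableSet_eq_fun h1 measurable_const).compl.inter hE)))

theorem CylinderInDomain.injOn_chords (H : CylinderInDomain S D R N Q m) :
    InjOn (fun p : Euc (n + 2) × Euc (n + 2) => (p.1, dir p.1 p.2)) (chords D R N E) := by
  rintro ⟨x, y⟩ hp ⟨x', y'⟩ hp' heq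
  simp only [Prod.mk.injEq] at heq
  obtain ⟨rfl, hd⟩ := heq
  have h1 : y = y' := Seen.eq_of_dir_eq (notMem_of_mem_frontier H.isOpen (H.R_subset hp.2.1))
    (notMem_of_mem_frontier H.isOpen (H.R_subset hp'.2.1)) hp.2.2.1 hp'.2.2.1 hd
  rw [h1]

/-- A chord is determined by its start and direction, and injective measurable images of Borel sets
are Borel. -/
theorem CylinderInDomain.measurableSet_rays (H : CylinderInDomain S D R N Q m)
    (hE : MeasurableSet E) : MeasurableSet (rays D R N E) :=
  (H.measurableSet_chords hE).image_of_measurable_injOn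
    (measurable_fst.prodMk measurable_dir) H.injOn_chords

theorem CylinderInDomain.sigmaFinite (H : CylinderInDomain S D R N Q m) :
    SigmaFinite ((μHE[n + 1] : Measure (Euc (n + 2))).restrict R) :=
  sigmaFinite_of_strictNormal H.meas_R fun x hx => (H.strict x hx).mono H.R_subset

theorem CylinderInDomain.strictNormal_Q (H : CylinderInDomain S D R N Q m) {z : Euc (n + 2)}
    (hz : z ∈ Q) : StrictNormal Q z (m z) :=
  ((H.normal_m z hz).strictNormal_of_convex (convex_cylinder H.convex_S)
    (isOpen_cylinder H.open_S)).mono H.Q_subset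

theorem CylinderInDomain.sigmaFinite_Q (H : CylinderInDomain S D R N Q m) :
    SigmaFinite ((μHE[n + 1] : Measure (Euc (n + 2))).restrict Q) :=
  sigmaFinite_of_strictNormal H.meas_Q fun z hz => H.strictNormal_Q hz

/-- Polar coordinates seen from `x`: with `r` the distance, `y ↦ dir x y` has Jacobian `|h · N y| /
r^(n+1)`. The kernel `(r h · N x)(-r h · N y) / r^(n+3)` is exactly `h · N x` times this Jacobian.
-/
theorem CylinderInDomain.lintegral_cosKernel (H : CylinderInDomain S D R N Q m)
    (hE : MeasurableSet E) {x : Euc (n + 2)} (hx : x ∈ R) :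
    ∫⁻ y in R, ENNReal.ofReal (cosKernel D N x y) * E.indicator 1 (x, y) ∂μHE[n + 1] =
      ∫⁻ h, (rays D R N E).indicator (fun p => ENNReal.ofReal (inner ℝ p.2 (N p.1))) (x, h)
        ∂(sphMeasure (n + 1)) := by
  classical
  set Γ : Set (Euc (n + 2)) := {y | (x, y) ∈ chords D R N E} with hΓ
  have hΓm : MeasurableSet Γ := (H.measurableSet_chords hE).preimage measurable_prodMk_left
  have hΓR : Γ ⊆ R := fun y hy => hy.2.1
  have hN := H.meas_N
  have hdx : Measurable (dir x) := by unfold dir; fun_prop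
  have hne : ∀ y ∈ Γ, x ≠ y := fun y hy => (seen_iff.1 hy.2.2.1).1
  have himg : dir x '' Γ = {h | (x, h) ∈ rays D R N E} := by
    ext h
    constructor
    · rintro ⟨y, hy, rfl⟩
      exact ⟨(x, y), hy, rfl⟩
    · rintro ⟨⟨x', y⟩, hy, heq⟩
      simp only [Prod.mk.injEq] at heq
      obtain ⟨rfl, rfl⟩ := heq
      exact ⟨y, hy, rfl⟩
  have hsph : dir x '' Γ ⊆ Metric.sphere 0 1 := by
    rintro _ ⟨y, hy, rfl⟩
    exact mem_sphere_zero_iff_norm.2 (norm_dir (hne y hy))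
  have hrm : MeasurableSet (dir x '' Γ) := by
    rw [himg]
    exact (H.measurableSet_rays hE).preimage measurable_prodMk_left
  have h1 := area_formula_lintegral (k := n + 1) hΓm (ν := N) (h := dir x) (ψ := dir x)
    (l := fun y => ‖y - x‖⁻¹) (fun y hy => (H.strict y (hΓR hy)).mono (hΓR.trans H.R_subset))
    (fun y hy => strictPerp_dir Γ (hne y hy)) (fun y hy => norm_dir (hne y hy))
    (fun y hy => inv_pos.2 (norm_pos_iff.2 (sub_ne_zero.2 (hne y hy).symm)))
    (fun y hy => hy.2.2.2.1) (fun y hy y' hy' heq => by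
      have := H.injOn_chords (E := E) hy hy' (Prod.ext rfl heq)
      exact congrArg Prod.snd this) (by
      have : Measurable fun y => (inner ℝ (dir x y) (N y) : ℝ) := hdx.inner hN
      fun_prop) hdx (G := fun h => ENNReal.ofReal (inner ℝ h (N x))) (by fun_prop)
  have h2 : ∫⁻ h, (rays D R N E).indicator (fun p => ENNReal.ofReal (inner ℝ p.2 (N p.1))) (x, h)
      ∂(sphMeasure (n + 1)) = ∫⁻ h in dir x '' Γ, ENNReal.ofReal (inner ℝ h (N x)) ∂μHE[n + 1] := by
    rw [← inter_eq_left.2 hsph, ← Measure.restrict_restrict hrm, ← sphMeasure,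
      ← lintegral_indicator hrm]
    refine lintegral_congr fun h => ?_
    rw [himg, Set.indicator_apply, Set.indicator_apply]
    rfl
  rw [h2, h1, ← inter_eq_left.2 hΓR, ← Measure.restrict_restrict hΓm, ← lintegral_indicator hΓm]
  refine setLIntegral_congr_fun H.meas_R fun y hy => ?_
  simp only [Set.indicator_apply]
  by_cases hyΓ : y ∈ Γ
  · rw [if_pos hyΓ, if_pos hyΓ.2.2.2.2, Pi.one_apply, mul_one, ← ENNReal.ofReal_mul (by positivity)]
    congr 1
    have hr : 0 < ‖y - x‖ := norm_pos_iff.2 (sub_ne_zero.2 (hne y hyΓ).symm)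
    have h3 := H.inner_right_nonpos hy hyΓ.2.2.1
    rw [cosKernel, if_pos hyΓ.2.2.1, abs_of_nonpos h3, ← neg_sub y x, inner_neg_left, norm_neg,
      ← norm_sub_smul_dir (hne y hyΓ), inner_smul_left, inner_smul_left, norm_smul, norm_norm,
      norm_dir (hne y hyΓ), mul_one]
    simp only [conj_trivial]
    have hr' := hr.ne'
    generalize ‖y - x‖ = r at hr'
    rw [inv_pow, pow_add _ n 3, pow_succ]
    field_simp
    ring
  · rw [if_neg hyΓ]
    by_cases hyE : (x, y) ∈ E
    · by_cases hs : Seen D x y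
      -- Tangential arrivals are left out of `chords`, and the kernel vanishes there.
      · have h0 : (inner ℝ (dir x y) (N y) : ℝ) = 0 := by
          by_contra h0
          exact hyΓ ⟨hx, hy, hs, h0, hyE⟩
        rw [cosKernel, if_pos hs, ← neg_sub y x, inner_neg_left,
          ← norm_sub_smul_dir (seen_iff.1 hs).1, inner_smul_left _ (N y), h0]
        simp
      · rw [cosKernel, if_neg hs]; simp
    · rw [if_neg hyE, mul_zero]

/-- Tonelli: for a fixed direction there remains the flux of `h` through the starting points, an
integral that the area formula for `perp h` can compute. -/
theorem CylinderInDomain.lintegral_lintegral_cosKernel (H : CylinderInDomain S D R N Q m)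
    (hE : MeasurableSet E) :
    ∫⁻ x in R, ∫⁻ y in R, ENNReal.ofReal (cosKernel D N x y) * E.indicator 1 (x, y)
        ∂μHE[n + 1] ∂μHE[n + 1] =
      ∫⁻ h, ∫⁻ x in {x | (x, h) ∈ rays D R N E}, ENNReal.ofReal (inner ℝ h (N x)) ∂μHE[n + 1]
        ∂(sphMeasure (n + 1)) := by
  classical
  have := H.sigmaFinite
  have hN := H.meas_N
  have hm := H.measurableSet_rays hE
  rw [setLIntegral_congr_fun H.meas_R fun x hx => H.lintegral_cosKernel hE hx,
    lintegral_lintegral_swap]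
  · refine lintegral_congr fun h => ?_
    have hmh : MeasurableSet {x | (x, h) ∈ rays D R N E} := hm.preimage measurable_prodMk_right
    have hsub : {x | (x, h) ∈ rays D R N E} ⊆ R := by
      rintro x ⟨p, hp, heq⟩
      have h1 : p.1 = x := congrArg Prod.fst heq
      rw [← h1]
      exact hp.1
    conv_rhs => rw [← inter_eq_left.2 hsub, ← Measure.restrict_restrict hmh, ← lintegral_indicator hmh]
    rfl
  · refine (Measurable.indicator ?_ hm).aemeasurable
    have : Measurable fun p : Euc (n + 2) × Euc (n + 2) => (inner ℝ p.2 (N p.1) : ℝ) :=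
      measurable_snd.inner (hN.comp measurable_fst)
    exact this.ennreal_ofReal

/-- The total mass of the cosine law. -/
theorem CylinderInDomain.lintegral_cosKernel_le (H : CylinderInDomain S D R N Q m)
    {x : Euc (n + 2)} (hx : x ∈ R) :
    ENNReal.ofReal (gammaConst n) * ∫⁻ y in R, ENNReal.ofReal (cosKernel D N x y) ∂μHE[n + 1] ≤ 1 := by
  classical
  have h1 := H.lintegral_cosKernel (E := univ) .univ hx
  simp only [indicator_univ, Pi.one_apply, mul_one] at h1
  rw [h1, ← ofReal_gammaConst_mul_lintegral (n := n)]
  refine mul_le_mul_right ?_ _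
  -- A reflection takes `e` to the normal at `x`, so the directions leaving `x` can be compared with
  -- the standard half-sphere.
  set T := Submodule.reflection (ℝ ∙ (e n - N x))ᗮ
  have hT : T (e n) = N x := Submodule.reflection_sub (norm_e.trans (H.normal x hx).2.1.symm)
  rw [← lintegral_sphMeasure_comp T, ← lintegral_indicator measurableSet_halfSphere]
  refine lintegral_mono_ae ?_
  filter_upwards [ae_sphMeasure_norm] with h hh
  refine (indicator_le_self _ _ _).trans ?_
  simp only
  have h2 : (inner ℝ (T h) (N x) : ℝ) = inner ℝ h (e n) := by rw [← hT, T.inner_map_map]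
  rw [h2, Set.indicator_apply]
  split_ifs with h3
  · exact le_rfl
  · rw [ENNReal.ofReal_of_nonpos]
    by_contra! h4
    exact h3 ⟨hh, h4⟩

end

/-! ### Crossings of a cylinder in a domain -/

/-- For a fixed point the tangential directions form a null great sphere; Fubini exchanges the roles
of point and direction. -/
theorem ae_measure_inner_eq_zero {k : ℕ} {Γ : Set (Euc (k + 2))} (hΓ : MeasurableSet Γ)
    [SigmaFinite ((μHE[k + 1] : Measure (Euc (k + 2))).restrict Γ)]
    {ν : Euc (k + 2) → Euc (k + 2)} (hν : Measurable ν) (h1 : ∀ x ∈ Γ, ‖ν x‖ = 1) :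
    ∀ᵐ h ∂(sphMeasure (k + 1)), μHE[k + 1] {x | x ∈ Γ ∧ (inner ℝ h (ν x) : ℝ) = 0} = 0 := by
  have hin : Measurable fun p : Euc (k + 2) × Euc (k + 2) => (inner ℝ p.2 (ν p.1) : ℝ) :=
    measurable_snd.inner (hν.comp measurable_fst)
  have hT : MeasurableSet {p : Euc (k + 2) × Euc (k + 2) | (inner ℝ p.2 (ν p.1) : ℝ) = 0} :=
    measurableSet_eq_fun hin measurable_const
  have h2 : ∀ᵐ x ∂((μHE[k + 1] : Measure (Euc (k + 2))).restrict Γ), ∀ᵐ h ∂(sphMeasure (k + 1)),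
      ¬(inner ℝ h (ν x) : ℝ) = 0 := by
    filter_upwards [self_mem_ae_restrict hΓ] with x hx
    have hm : MeasurableSet {h : Euc (k + 2) | (inner ℝ h (ν x) : ℝ) = 0} :=
      measurableSet_eq_fun (by fun_prop) measurable_const
    rw [ae_iff]
    simp only [not_not]
    rw [sphMeasure, Measure.restrict_apply hm, inter_comm]
    exact measure_sphere_inner_eq_zero (h1 x hx)
  have h3 := (Measure.ae_ae_comm (p := fun x h => ¬(inner ℝ h (ν x) : ℝ) = 0) hT.compl).1 h2
  filter_upwards [h3] with h hh
  have hm : MeasurableSet {x : Euc (k + 2) | (inner ℝ h (ν x) : ℝ) = 0} :=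
    hT.preimage measurable_prodMk_right
  rw [ae_iff] at hh
  simp only [not_not] at hh
  rw [Measure.restrict_apply hm] at hh
  refine measure_mono_null ?_ hh
  exact fun x hx => ⟨hx.2, hx.1⟩

theorem perp_add_smul {k : ℕ} {h : Euc k} (hh : ‖h‖ = 1) (x : Euc k) (t : ℝ) :
    perp h (x + t • h) = perp h x := by
  rw [perp_apply, perp_apply, inner_add_right, inner_smul_right, real_inner_self_eq_norm_sq, hh,
    add_smul, one_pow, mul_one]
  abel

theorem eq_add_smul_of_perp_eq {k : ℕ} {h x x' : Euc k} (heq : perp h x = perp h x') :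
    x' = x + ((inner ℝ h x' : ℝ) - inner ℝ h x) • h := by
  rw [perp_apply, perp_apply] at heq
  rw [sub_smul, add_sub, add_comm x, add_sub_assoc, heq]
  abel

section

variable {n : ℕ} {S : Set (Euc (n + 1))} {D R : Set (Euc (n + 2))} {N : Euc (n + 2) → Euc (n + 2)}
  {Q : Set (Euc (n + 2))} {m : Euc (n + 2) → Euc (n + 2)} {E : Set (Euc (n + 2) × Euc (n + 2))}

/-- In almost every direction, almost every line is transversal. -/
theorem CylinderInDomain.ae_niceLine (H : CylinderInDomain S D R N Q m) :
    ∀ᵐ h ∂(sphMeasure (n + 1)), ‖h‖ = 1 ∧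
      μHE[n + 1] {x | x ∈ R ∧ (inner ℝ h (N x) : ℝ) = 0} = 0 ∧
      ∃ Z : Set (Euc (n + 2)), MeasurableSet Z ∧ μHE[n + 1] Z = 0 ∧
        ∀ x, perp h x ∉ Z → NiceLine S D R N Q m h x := by
  have := H.sigmaFinite
  have := H.sigmaFinite_Q
  filter_upwards [ae_sphMeasure_norm,
    ae_measure_inner_eq_zero H.meas_R H.meas_N fun x hx => (H.normal x hx).2.1,
    ae_measure_inner_eq_zero H.meas_Q H.meas_m fun x hx => (H.normal_m x hx).2.1] with h hh hR hQ
  refine ⟨hh, hR, ?_⟩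
  -- The exceptional boundary points form a null set, and projection along `h` keeps it null. A line
  -- avoids all of them as soon as its projection avoids the projected set.
  set bad := (frontier D \ R) ∪ {x | x ∈ R ∧ (inner ℝ h (N x) : ℝ) = 0} ∪
    ((frontier (cylinder S) \ Q) ∪ {x | x ∈ Q ∧ (inner ℝ h (m x) : ℝ) = 0}) with hbad
  have hb0 : μHE[n + 1] bad = 0 :=
    measure_union_null (measure_union_null H.null_R hR) (measure_union_null H.null_Q hQ)
  refine ⟨toMeasurable μHE[n + 1] (perp h '' bad), measurableSet_toMeasurable _ _, ?_, fun x hx => ?_⟩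
  · rw [measure_toMeasurable]
    exact measure_perp_image_eq_zero hh hb0
  have hnb : ∀ t : ℝ, x + t • h ∉ bad := fun t ht =>
    hx (subset_toMeasurable _ _ ⟨_, ht, perp_add_smul hh x t⟩)
  refine ⟨fun t ht => ?_, fun t ht => ?_⟩
  · by_cases hxR : x + t • h ∈ R
    · exact ⟨hxR, fun h0 => hnb t (Or.inl (Or.inr ⟨hxR, h0⟩))⟩
    · exact absurd (Or.inl (Or.inl ⟨ht, hxR⟩)) (hnb t)
  · by_cases hxQ : x + t • h ∈ Q
    · exact ⟨hxQ, fun h0 => hnb t (Or.inr (Or.inr ⟨hxQ, h0⟩))⟩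
    · exact absurd (Or.inr (Or.inl ⟨ht, hxQ⟩)) (hnb t)

/-- A part of the boundary over a null set of lines does not count. -/
theorem CylinderInDomain.measure_inter_perp_preimage (H : CylinderInDomain S D R N Q m)
    {h : Euc (n + 2)} (hh : ‖h‖ = 1) (hR : μHE[n + 1] {x | x ∈ R ∧ (inner ℝ h (N x) : ℝ) = 0} = 0)
    {Z : Set (Euc (n + 2))} (hZ : μHE[n + 1] Z = 0) :
    μHE[n + 1] {x | x ∈ R ∧ perp h x ∈ Z} = 0 := by
  have h1 : μHE[n + 1] {x | x ∈ R ∧ perp h x ∈ Z ∧ (inner ℝ h (N x) : ℝ) ≠ 0} = 0 := by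
    refine measure_eq_zero_of_perp_image (Γ := frontier D) (ν := N) (fun x hx => H.strict x hx.1)
      (fun x hx => H.R_subset hx.1) hh (fun x hx => hx.2.2) (measure_mono_null ?_ hZ)
    rintro _ ⟨x, hx, rfl⟩
    exact hx.2.1
  refine measure_mono_null (fun x hx => ?_) (measure_union_null h1 hR)
  by_cases h0 : (inner ℝ h (N x) : ℝ) = 0
  · exact Or.inr ⟨hx.1, h0⟩
  · exact Or.inl ⟨hx.1, hx.2, h0⟩

/-- Events that do not occur on transversal lines are negligible. -/
theorem CylinderInDomain.lintegral_cosKernel_eq_zero (H : CylinderInDomain S D R N Q m)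
    (hE : MeasurableSet E)
    (hn : ∀ x ∈ R, ∀ y ∈ R, Seen D x y → NiceLine S D R N Q m (dir x y) x → (x, y) ∉ E) :
    ∫⁻ x in R, ∫⁻ y in R, ENNReal.ofReal (cosKernel D N x y) * E.indicator 1 (x, y)
        ∂μHE[n + 1] ∂μHE[n + 1] = 0 := by
  rw [H.lintegral_lintegral_cosKernel hE]
  refine lintegral_eq_zero_of_ae_eq_zero ?_
  filter_upwards [H.ae_niceLine] with h ⟨hh, hR, Z, hZm, hZ, hnice⟩
  refine setLIntegral_measure_zero _ _ (measure_mono_null ?_ (H.measure_inter_perp_preimage hh hR hZ))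
  rintro x ⟨⟨x', y⟩, hp, heq⟩
  simp only [Prod.mk.injEq] at heq
  obtain ⟨rfl, rfl⟩ := heq
  refine ⟨hp.1, ?_⟩
  by_contra hxZ
  exact hn x' hp.1 y hp.2.1 hp.2.2.1 (hnice _ hxZ) hp.2.2.2.2

/-- The jumps that enter the cylinder at a point and in a direction in `W`. -/
def entering (S : Set (Euc (n + 1))) (W : Set (Euc (n + 2) × Euc (n + 2))) :
    Set (Euc (n + 2) × Euc (n + 2)) :=
  {p | (hitTimes S p.1 p.2).Nonempty ∧ (hitPt S p.1 p.2, dir p.1 p.2) ∈ W}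

theorem measurableSet_entering {W : Set (Euc (n + 2) × Euc (n + 2))} (hW : MeasurableSet W) :
    MeasurableSet (entering S W) :=
  measurableSet_hitTimes_nonempty.inter (hW.preimage (measurable_hitPt.prodMk measurable_dir))

/-- The core of the argument: by the area formula each side is the measure of a projection along
`h`, of the starting points on the left and of the entrance points on the right. These projections
agree over transversal lines, and each line contributes once to either side. -/
theorem CylinderInDomain.ae_lintegral_rays (H : CylinderInDomain S D R N Q m)
    {W : Set (Euc (n + 2) × Euc (n + 2))} (hW : MeasurableSet W)
    (hpos : ∀ p ∈ W, 0 < (inner ℝ p.2 (m p.1) : ℝ)) :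
    ∀ᵐ h ∂(sphMeasure (n + 1)),
      ∫⁻ x in {x | (x, h) ∈ rays D R N (entering S W)}, ENNReal.ofReal (inner ℝ h (N x)) ∂μHE[n + 1] =
      ∫⁻ z in {z | z ∈ Q ∧ (z, h) ∈ W}, ENNReal.ofReal (inner ℝ h (m z)) ∂μHE[n + 1] := by
  filter_upwards [H.ae_niceLine] with h ⟨hh, hR, Z, hZm, hZ, hnice⟩
  have hpm : Measurable (perp h) := (continuous_perp h).measurable
  set A := {x | (x, h) ∈ rays D R N (entering S W)} with hA
  set B := {z | z ∈ Q ∧ (z, h) ∈ W} with hB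
  have hAm : MeasurableSet A := (H.measurableSet_rays (measurableSet_entering hW)).preimage
    measurable_prodMk_right
  have hBm : MeasurableSet B := H.meas_Q.inter (hW.preimage measurable_prodMk_right)
  have hAe : ∀ x ∈ A, ∃ y, (x, y) ∈ chords D R N (entering S W) ∧ dir x y = h := by
    rintro x ⟨⟨x', y⟩, hp, heq⟩
    simp only [Prod.mk.injEq] at heq
    obtain ⟨rfl, rfl⟩ := heq
    exact ⟨y, hp, rfl⟩
  -- Lines over the null set `Z` are discarded; they carry no measure of either `A` or `B`.
  set A' := A \ perp h ⁻¹' Z with hA'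
  set B' := B \ perp h ⁻¹' Z with hB'
  have hA'm : MeasurableSet A' := hAm.diff (hZm.preimage hpm)
  have hB'm : MeasurableSet B' := hBm.diff (hZm.preimage hpm)
  have hAA' : A' =ᵐ[μHE[n + 1]] A := by
    refine sdiff_ae_eq_self.2 (measure_mono_null (fun x hx => ?_) (H.measure_inter_perp_preimage hh hR hZ))
    obtain ⟨y, hy, -⟩ := hAe x hx.1
    exact ⟨hy.1, hx.2⟩
  have hBB' : B' =ᵐ[μHE[n + 1]] B := by
    refine sdiff_ae_eq_self.2 (measure_eq_zero_of_perp_image (Γ := Q) (ν := m) (h := h)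
      (fun z hz => H.strictNormal_Q hz.1.1) (fun z hz => hz.1.1) hh
      (fun z hz => (hpos _ hz.1.2).ne') (measure_mono_null ?_ hZ))
    rintro _ ⟨z, hz, rfl⟩
    exact hz.2
  rw [← setLIntegral_congr hAA', ← setLIntegral_congr hBB']
  have hA'ne : ∀ x ∈ A', 0 < (inner ℝ h (N x) : ℝ) := fun x hx => by
    obtain ⟨y, hy, hd⟩ := hAe x hx.1
    have h1 := ((hnice x hx.2).1 0 (by rw [zero_smul, add_zero]; exact H.R_subset hy.1)).2
    rw [zero_smul, add_zero] at h1
    have h2 := H.inner_left_nonneg hy.1 hy.2.2.1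
    rw [hd] at h2
    exact lt_of_le_of_ne h2 h1.symm
  have hB'ne : ∀ z ∈ B', 0 < (inner ℝ h (m z) : ℝ) := fun z hz => hpos _ hz.1.2
  have hAf := area_formula_perp (k := n + 1) hA'm (ν := N) (h := h)
    (fun x hx => (H.strict x (hAe x hx.1).choose_spec.1.1).mono
      fun x hx => H.R_subset (hAe x hx.1).choose_spec.1.1) hh (fun x hx => (hA'ne x hx).ne')
    (fun x hx x' hx' heq => by
      obtain ⟨y, hy, hd⟩ := hAe x hx.1
      obtain ⟨y', hy', hd'⟩ := hAe x' hx'.1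
      refine H.start_unique (hnice x hx.2) (hnice x' hx'.2) hy.1 hy'.1 hy.2.1 hy'.2.1 hy.2.2.1
        hy'.2.2.1 hd hd' hy.2.2.2.2.1 hy'.2.2.2.2.1 ?_ ?_ (eq_add_smul_of_perp_eq heq)
      · have := hpos _ hy.2.2.2.2.2
        simp only [hd] at this
        exact this
      · have := hpos _ hy'.2.2.2.2.2
        simp only [hd'] at this
        exact this) H.meas_N
  have hBf := area_formula_perp (k := n + 1) hB'm (ν := m) (h := h)
    (fun z hz => (H.strictNormal_Q hz.1.1).mono fun z hz => hz.1.1) hh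
    (fun z hz => (hB'ne z hz).ne')
    (fun z hz z' hz' heq => H.entrance_unique hz.1.1 hz'.1.1 (hB'ne z hz) (hB'ne z' hz')
      (eq_add_smul_of_perp_eq heq)) H.meas_m
  -- An entering chord yields its entrance point on the same line; conversely
  -- `CylinderInDomain.exists_chord` extends each entrance point to a chord.
  have himg : perp h '' A' = perp h '' B' := by
    apply Subset.antisymm
    · rintro _ ⟨x, hx, rfl⟩
      obtain ⟨y, hy, hd⟩ := hAe x hx.1
      have hne := (seen_iff.1 hy.2.2.1).1
      have hz := hitPt_eq (S := S) hne
      rw [hd] at hz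
      have hp : perp h (hitPt S x y) = perp h x := by rw [hz, perp_add_smul hh]
      have hzQ := ((hnice x hx.2).2 (sInf (hitTimes S x y) * ‖y - x‖) (by
        rw [← hz]; exact hitPt_mem_frontier hy.2.2.2.2.1)).1
      rw [← hz] at hzQ
      refine ⟨hitPt S x y, ⟨⟨hzQ, ?_⟩, ?_⟩, hp⟩
      · have := hy.2.2.2.2.2
        simp only [hd] at this
        exact this
      · rw [mem_preimage, hp]
        exact hx.2
    · rintro _ ⟨z, hz, rfl⟩
      obtain ⟨a, b, haR, hbR, hs, hd, hhit, hpt⟩ :=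
        H.exists_chord hh hz.1.1 (hnice z hz.2) (hB'ne z hz)
      have hp : perp h (z + a • h) = perp h z := perp_add_smul hh z a
      refine ⟨z + a • h, ⟨⟨(z + a • h, z + b • h), ⟨haR, hbR, hs, ?_, hhit, ?_⟩, ?_⟩, ?_⟩, hp⟩
      · simp only [hd]
        exact ((hnice z hz.2).1 b (H.R_subset hbR)).2
      · simp only [hd, hpt]
        exact hz.1.2
      · simp only [hd]
      · rw [mem_preimage, hp]
        exact hz.2
  calc ∫⁻ x in A', ENNReal.ofReal (inner ℝ h (N x)) ∂μHE[n + 1]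
      = ∫⁻ x in A', ENNReal.ofReal |(inner ℝ h (N x) : ℝ)| ∂μHE[n + 1] :=
        setLIntegral_congr_fun hA'm fun x hx => by rw [abs_of_pos (hA'ne x hx)]
    _ = ∫⁻ z in B', ENNReal.ofReal |(inner ℝ h (m z) : ℝ)| ∂μHE[n + 1] := by rw [← hAf, ← hBf, himg]
    _ = ∫⁻ z in B', ENNReal.ofReal (inner ℝ h (m z)) ∂μHE[n + 1] :=
        setLIntegral_congr_fun hB'm fun z hz => by rw [abs_of_pos (hB'ne z hz)]

/-- The flux of chords into the cylinder. -/
theorem CylinderInDomain.lintegral_cosKernel_entering (H : CylinderInDomain S D R N Q m)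
    {W : Set (Euc (n + 2) × Euc (n + 2))} (hW : MeasurableSet W)
    (hpos : ∀ p ∈ W, 0 < (inner ℝ p.2 (m p.1) : ℝ)) :
    ∫⁻ x in R, ∫⁻ y in R, ENNReal.ofReal (cosKernel D N x y) * (entering S W).indicator 1 (x, y)
        ∂μHE[n + 1] ∂μHE[n + 1] =
      ∫⁻ z in Q, ∫⁻ h, W.indicator (fun p => ENNReal.ofReal (inner ℝ p.2 (m p.1))) (z, h)
        ∂(sphMeasure (n + 1)) ∂μHE[n + 1] := by
  classical
  have := H.sigmaFinite_Q
  have hmm := H.meas_m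
  rw [H.lintegral_lintegral_cosKernel (measurableSet_entering hW),
    lintegral_congr_ae (H.ae_lintegral_rays hW hpos), lintegral_lintegral_swap]
  · refine lintegral_congr fun h => ?_
    have hWh : MeasurableSet {z | (z, h) ∈ W} := hW.preimage measurable_prodMk_right
    have h1 : {z | z ∈ Q ∧ (z, h) ∈ W} = {z | (z, h) ∈ W} ∩ Q := by ext z; exact and_comm
    rw [h1, ← Measure.restrict_restrict hWh, ← lintegral_indicator hWh]
    rfl
  · refine (Measurable.indicator ?_ hW).aemeasurable
    have : Measurable fun p : Euc (n + 2) × Euc (n + 2) => (inner ℝ p.2 (m p.1) : ℝ) :=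
      measurable_snd.inner (hmm.comp measurable_fst)
    exact this.ennreal_ofReal

end

/-! ### Translations -/

section Translation

variable {k : ℕ} {A : Set (Euc k)} {b x y v : Euc k}

theorem frontier_preimage_add (A : Set (Euc k)) (b : Euc k) :
    frontier ((· + b) ⁻¹' A) = (· + b) ⁻¹' frontier A :=
  ((Homeomorph.addRight b).preimage_frontier A).symm

theorem isInnerNormal_preimage_add :
    IsInnerNormal ((· + b) ⁻¹' A) x v ↔ IsInnerNormal A (x + b) v := by
  have hmap : 𝓝 (x + b) = Filter.map (· + b) (𝓝 x) := ((Homeomorph.addRight b).map_nhds_eq x).symm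
  rw [IsInnerNormal, IsInnerNormal, frontier_preimage_add, mem_preimage, hmap]
  simp only [eventually_map, add_sub_add_right_eq_sub, mem_preimage]

theorem innerNormal_preimage_add (A : Set (Euc k)) (b x : Euc k) :
    innerNormal ((· + b) ⁻¹' A) x = innerNormal A (x + b) := by
  by_cases h : ∃ v, IsInnerNormal A (x + b) v
  · obtain ⟨v, hv⟩ := h
    rw [innerNormal_eq hv, innerNormal_eq (isInnerNormal_preimage_add.2 hv)]
  · have h' : ¬∃ v, IsInnerNormal ((· + b) ⁻¹' A) x v := by
      simpa only [isInnerNormal_preimage_add] using h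
    rw [innerNormal, innerNormal, dif_neg h, dif_neg h']

theorem IsC1BoundaryAt.preimage_add {A : Set (Euc (k + 1))} {b x : Euc (k + 1)}
    (h : IsC1BoundaryAt A (x + b)) : IsC1BoundaryAt ((· + b) ⁻¹' A) x := by
  obtain ⟨I, f, r, hr, hf, hI0, hf0, hI⟩ := h
  have hadd : ∀ y, AffineIsometryEquiv.constVAdd ℝ (Euc (k + 1)) b y = y + b := fun y => by
    rw [AffineIsometryEquiv.coe_constVAdd]
    exact add_comm b y
  refine ⟨(AffineIsometryEquiv.constVAdd ℝ _ b).trans I, f, r, hr, hf, ?_, hf0, ?_⟩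
  · rw [AffineIsometryEquiv.coe_trans, Function.comp_apply, hadd, hI0]
  · rw [AffineIsometryEquiv.coe_trans, image_comp, ← hI]
    congr 1
    ext y
    constructor
    · rintro ⟨z, ⟨hz, hzb⟩, rfl⟩
      rw [hadd]
      refine ⟨hz, ?_⟩
      rw [Metric.mem_ball, dist_add_right]
      exact hzb
    · rintro ⟨hy, hyb⟩
      refine ⟨y - b, ⟨?_, ?_⟩, ?_⟩
      · rw [mem_preimage, sub_add_cancel]
        exact hy
      · rw [Metric.mem_ball, dist_eq_norm] at hyb ⊢
        rwa [sub_sub, add_comm b]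
      · rw [hadd, sub_add_cancel]

theorem isC1BoundaryAt_preimage_add {A : Set (Euc (k + 1))} {b x : Euc (k + 1)} :
    IsC1BoundaryAt ((· + b) ⁻¹' A) x ↔ IsC1BoundaryAt A (x + b) := by
  refine ⟨fun h => ?_, fun h => h.preimage_add⟩
  have h1 : IsC1BoundaryAt ((· + b) ⁻¹' A) ((x + b) + -b) := by rwa [add_neg_cancel_right]
  have h2 := h1.preimage_add
  rwa [← preimage_comp, show ((· + b) ∘ (· + -b) : Euc (k + 1) → Euc (k + 1)) = id by
    ext1 y; simp, preimage_id] at h2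

theorem seen_preimage_add : Seen ((· + b) ⁻¹' A) x y ↔ Seen A (x + b) (y + b) := by
  rw [seen_iff, seen_iff, Ne, Ne, add_left_inj]
  simp only [mem_preimage, add_sub_add_right_eq_sub, add_right_comm]

theorem setLIntegral_preimage_add (d : ℕ) {A : Set (Euc k)} (hA : MeasurableSet A) (b : Euc k)
    (f : Euc k → ℝ≥0∞) :
    ∫⁻ x in (· + b) ⁻¹' A, f (x + b) ∂μHE[d] = ∫⁻ x in A, f x ∂μHE[d] := by
  have h1 : MeasurePreserving (IsometryEquiv.addRight b) (μHE[d] : Measure (Euc k)) μHE[d] :=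
    (IsometryEquiv.addRight b).measurePreserving_euclideanHausdorffMeasure d
  exact (h1.restrict_preimage hA).lintegral_comp_emb
    (IsometryEquiv.addRight b).toHomeomorph.measurableEmbedding f

end Translation

/-! ### Shifts of the environment -/

section Shift

variable {n : ℕ} {M : ℝ} {ω : Env n M} {a : ℝ} {x y : Euc (n + 2)}

theorem pt_add_smul_e (α a : ℝ) (u : Euc (n + 1)) : pt α u + a • e n = pt (α + a) u := by
  rw [e_eq_pt, pt_smul, pt_add, mul_one, smul_zero, add_zero]

theorem add_smul_e_zero (x : Euc (n + 2)) (a : ℝ) : (x + a • e n) 0 = x 0 + a := by simp [e]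

theorem tube_shift (a : ℝ) (ω : Env n M) : tube (shift a ω) = (· + a • e n) ⁻¹' tube ω := by
  ext x
  rw [mem_preimage, tube, tube, mem_ofPred_eq, mem_ofPred_eq, proj_add_smul_e, add_smul_e_zero]
  rfl

theorem mem_regularPoints_shift :
    x ∈ regularPoints (shift a ω) ↔ x + a • e n ∈ regularPoints ω := by
  rw [regularPoints, regularPoints, mem_ofPred_eq, mem_ofPred_eq, tube_shift, frontier_preimage_add,
    isC1BoundaryAt_preimage_add, innerNormal_preimage_add]
  rfl

theorem weight_shift : weight (shift a ω) x = weight ω (x + a • e n) := by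
  by_cases h : x ∈ regularPoints (shift a ω)
  · rw [weight, weight, if_pos h, if_pos (mem_regularPoints_shift.1 h), kappa_eq, kappa_eq,
      tube_shift, innerNormal_preimage_add]
  · rw [weight, weight, if_neg h, if_neg fun h' => h (mem_regularPoints_shift.2 h')]

theorem density_shift : density (shift a ω) x y = density ω (x + a • e n) (y + a • e n) := by
  have hiff : (x ∈ regularPoints (shift a ω) ∧ y ∈ regularPoints (shift a ω) ∧
      Seen (tube (shift a ω)) x y) ↔ (x + a • e n ∈ regularPoints ω ∧ y + a • e n ∈ regularPoints ω ∧
      Seen (tube ω) (x + a • e n) (y + a • e n)) := by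
    rw [mem_regularPoints_shift, mem_regularPoints_shift, tube_shift, seen_preimage_add]
  by_cases h : x ∈ regularPoints (shift a ω) ∧ y ∈ regularPoints (shift a ω) ∧
      Seen (tube (shift a ω)) x y
  · rw [density, density, if_pos h, if_pos (hiff.1 h), tube_shift, innerNormal_preimage_add,
      innerNormal_preimage_add, add_sub_add_right_eq_sub, add_sub_add_right_eq_sub]
  · rw [density, density, if_neg h, if_neg fun h' => h (hiff.2 h')]

theorem stepMean_shift (w : Euc (n + 2) → Euc (n + 2) → ℝ≥0∞) :
    stepMean (shift a ω) (fun x y => w (x + a • e n) (y + a • e n)) x =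
      stepMean ω w (x + a • e n) := by
  rw [stepMean, stepMean, surfaceMeasure, surfaceMeasure, tube_shift, frontier_preimage_add,
    ← setLIntegral_preimage_add (n + 1) isClosed_frontier.measurableSet (a • e n)]
  simp only [density_shift]

theorem sliceMeasure_shift : sliceMeasure (shift a ω) 0 = sliceMeasure ω a := by
  rw [sliceMeasure, sliceMeasure, slice, slice, shift]
  simp only [zero_add]

end Shift

/-! ### Integration along the tube -/

section Palm

variable {n : ℕ} {M : ℝ} {P : Measure (Env n M)} {G : Set (Env n M)} {ε L : ℝ}

theorem measurable_extend {A : Type*} [MeasurableSpace A] (hGm : MeasurableSet G)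
    {q : A → Env n M → ℝ≥0∞} (hq : Measurable fun p : A × G => q p.1 p.2.1) :
    Measurable fun p : A × Env n M => G.indicator (q p.1) p.2 := by
  classical
  have hs : MeasurableSet {p : A × Env n M | p.2 ∈ G} := measurable_snd hGm
  have h1 : Measurable fun p : {p : A × Env n M | p.2 ∈ G} => q p.1.1 p.1.2 := by
    have h2 : Measurable fun p : {p : A × Env n M | p.2 ∈ G} => ((p.1.1, ⟨p.1.2, p.2⟩) : A × G) := by
      refine Measurable.prodMk (by fun_prop) (Measurable.subtype_mk (by fun_prop))
    have h3 := hq.comp h2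
    simp only [Function.comp_def] at h3
    exact h3
  refine measurable_of_restrict_of_restrict_compl hs ?_ ?_
  · convert h1 using 1
    ext1 p
    exact indicator_of_mem (s := G) (a := p.1.2) p.2 _
  · convert measurable_const (a := (0 : ℝ≥0∞)) using 1
    ext1 p
    exact indicator_of_notMem (s := G) (a := p.1.2) p.2 _

/-- Averages over the position are computed along the tube. -/
theorem lintegral_lintegral_shift [IsProbabilityMeasure P] (hP : ∀ a, MeasurePreserving (shift a) P P)
    (hGm : MeasurableSet G) (hG0 : ∀ᵐ ω ∂P, ω ∈ G)
    {q : ℝ → Env n M → ℝ≥0∞} (hq : Measurable fun p : ℝ × G => q p.1 p.2.1) :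
    ∫⁻ ω, (∫⁻ α, q α ω) ∂P = ∫⁻ ω, (∫⁻ α, q α (shift α ω)) ∂P := by
  have hm := measurable_extend hGm hq
  have hms : Measurable fun p : ℝ × Env n M => G.indicator (q p.1) (shift p.1 p.2) :=
    hm.comp (measurable_fst.prodMk measurable_shift)
  have h1 : ∫⁻ ω, (∫⁻ α, q α ω) ∂P = ∫⁻ ω, (∫⁻ α, G.indicator (q α) ω) ∂P := by
    refine lintegral_congr_ae ?_
    filter_upwards [hG0] with ω hω
    simp only [indicator_of_mem hω]
  have h2 : ∫⁻ ω, (∫⁻ α, q α (shift α ω)) ∂P = ∫⁻ ω, (∫⁻ α, G.indicator (q α) (shift α ω)) ∂P := by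
    have h3 : ∀ᵐ ω ∂P, ∀ᵐ α : ℝ, shift α ω ∈ G := by
      refine (Measure.ae_ae_comm (μ := (volume : Measure ℝ)) (p := fun α ω => shift α ω ∈ G)
        (measurable_shift hGm)).1 (ae_of_all _ fun α => ?_)
      exact (hP α).quasiMeasurePreserving.ae hG0
    refine lintegral_congr_ae ?_
    filter_upwards [h3] with ω hω
    refine lintegral_congr_ae ?_
    filter_upwards [hω] with α hα
    rw [indicator_of_mem hα]
  have hsw : Measurable fun p : Env n M × ℝ => (p.2, p.1) := measurable_swap
  have hm' : Measurable fun p : Env n M × ℝ => G.indicator (q p.2) p.1 := hm.comp hsw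
  have hms' : Measurable fun p : Env n M × ℝ => G.indicator (q p.2) (shift p.2 p.1) := hms.comp hsw
  rw [h1, h2, lintegral_lintegral_swap (f := fun ω α => G.indicator (q α) ω) hm'.aemeasurable,
    lintegral_lintegral_swap (f := fun ω α => G.indicator (q α) (shift α ω)) hms'.aemeasurable]
  refine lintegral_congr fun α => ?_
  exact ((hP α).lintegral_comp (hm.comp measurable_prodMk_left)).symm

theorem regNormal_spec {ω : Env n M} {x : Euc (n + 2)} (hx : x ∈ regularPoints ω) :
    IsInnerNormal (tube ω) x (regNormal ω x) ∧
      StrictNormal (frontier (tube ω)) x (regNormal ω x) := by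
  rw [regNormal_of_mem hx]
  exact hx.2.1.normals hx.1

theorem proj_regNormal_ne_zero {ω : Env n M} {x : Euc (n + 2)} (hx : x ∈ regularPoints ω) :
    proj (regNormal ω x) ≠ 0 := by
  intro h0
  have h1 := (regNormal_spec hx).1.2.1
  rw [regNormal_of_mem hx] at h0 h1
  refine hx.2.2 ?_
  rw [inner_e]
  have h2 := norm_pt_sq ((innerNormal (tube ω) x) 0) (proj (innerNormal (tube ω) x))
  rw [pt_proj, h0, norm_zero, h1] at h2
  rw [← sq_eq_sq₀ (abs_nonneg _) zero_le_one, sq_abs]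
  linarith

theorem frontier_slice_subset (hT : IsOpen (tube ω)) (α : ℝ) :
    frontier (slice ω α) ⊆ sliceAt (frontier (tube ω)) α := by
  intro u hu
  rw [(isOpen_slice ω α).frontier_eq] at hu
  have hs : ∀ u, u ∈ slice ω α ↔ pt α u ∈ tube ω := fun u => by
    rw [tube, mem_ofPred_eq, proj_pt, pt_zero]
  rw [sliceAt, mem_ofPred_eq, hT.frontier_eq]
  refine ⟨?_, fun h => hu.2 ((hs u).2 h)⟩
  exact map_mem_closure (continuous_pt_right α) hu.1 fun v hv => (hs v).1 hv

/-- At a regular point the normal is not parallel to `e`, so moving inside the slice along plus or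
minus its projection enters and leaves the tube. -/
theorem sliceAt_regularPoints_subset {ω : Env n M} (α : ℝ) :
    sliceAt (regularPoints ω) α ⊆ frontier (slice ω α) := by
  intro u hu
  have hu' : pt α u ∈ regularPoints ω := hu
  obtain ⟨hn, -⟩ := regNormal_spec hu'
  have hne := proj_regNormal_ne_zero hu'
  set v := regNormal ω (pt α u)
  have hs : ∀ u, u ∈ slice ω α ↔ pt α u ∈ tube ω := fun u => by
    rw [tube, mem_ofPred_eq, proj_pt, pt_zero]
  have hin : (inner ℝ (pt 0 (proj v)) v : ℝ) = ‖proj v‖ ^ 2 := by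
    rw [real_inner_comm, inner_pt, mul_zero, zero_add, real_inner_self_eq_norm_sq]
  have hpos : 0 < ‖proj v‖ ^ 2 := by have := norm_pos_iff.2 hne; positivity
  have hpt : ∀ s : ℝ, pt α u + s • pt 0 (proj v) = pt α (u + s • proj v) := fun s => by
    rw [pt_smul, pt_add, mul_zero, add_zero]
  have hpt' : ∀ s : ℝ, pt α u + s • (-pt 0 (proj v)) = pt α (u + (-s) • proj v) := fun s => by
    rw [smul_neg, ← neg_smul, hpt]
  have h1 := hn.eventually_mem (w := pt 0 (proj v)) (by rw [hin]; exact hpos)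
  have h2 := hn.eventually_notMem (w := -pt 0 (proj v)) (by rw [inner_neg_left, hin]; linarith)
  simp only [hpt, hpt', ← hs] at h1 h2
  have hlim : Tendsto (fun s : ℝ => u + s • proj v) (𝓝[>] 0) (𝓝 u) := by
    have : Continuous fun s : ℝ => u + s • proj v := by fun_prop
    simpa using (this.tendsto 0).mono_left nhdsWithin_le_nhds
  have hlim' : Tendsto (fun s : ℝ => u + (-s) • proj v) (𝓝[>] 0) (𝓝 u) := by
    have : Continuous fun s : ℝ => u + (-s) • proj v := by fun_prop
    simpa using (this.tendsto 0).mono_left nhdsWithin_le_nhds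
  rw [frontier_eq_closure_inter_closure]
  exact ⟨mem_closure_of_tendsto hlim h1, mem_closure_of_tendsto hlim' h2⟩

theorem measurableSet_regularPoints_apply (hε : 0 < ε) (hL : 0 ≤ L) {ω : Env n M}
    (hω : LipschitzBoundary (tube ω) ε L) : MeasurableSet (regularPoints ω) := by
  have hG : ∀ ω' ∈ ({ω} : Set (Env n M)), LipschitzBoundary (tube ω') ε L := by
    rintro _ rfl
    exact hω
  have h1 : Measurable fun x : Euc (n + 2) => ((⟨ω, rfl⟩ : ({ω} : Set (Env n M))), x) :=
    measurable_prodMk_left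
  have h2 := h1 (measurableSet_regularPoints hε hL hG)
  simp only [preimage_ofPred_eq, ofPred_mem_eq] at h2
  exact h2

theorem measurable_regNormal_apply (hε : 0 < ε) (hL : 0 ≤ L) {ω : Env n M}
    (hω : LipschitzBoundary (tube ω) ε L) : Measurable (regNormal ω) := by
  have hG : ∀ ω' ∈ ({ω} : Set (Env n M)), LipschitzBoundary (tube ω') ε L := by
    rintro _ rfl
    exact hω
  have h1 : Measurable fun x : Euc (n + 2) => ((⟨ω, rfl⟩ : ({ω} : Set (Env n M))), x) :=
    measurable_prodMk_left
  have h2 := (measurable_regNormal hε hL hG).comp h1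
  simp only [Function.comp_def] at h2
  exact h2

theorem measurable_weight_apply (hε : 0 < ε) (hL : 0 ≤ L) {ω : Env n M}
    (hω : LipschitzBoundary (tube ω) ε L) : Measurable (weight ω) := by
  have hG : ∀ ω' ∈ ({ω} : Set (Env n M)), LipschitzBoundary (tube ω') ε L := by
    rintro _ rfl
    exact hω
  have h1 : Measurable fun x : Euc (n + 2) => ((⟨ω, rfl⟩ : ({ω} : Set (Env n M))), x) :=
    measurable_prodMk_left
  have h2 := (measurable_weight hε hL hG).comp h1
  simp only [Function.comp_def] at h2
  exact h2

/-- The sections, weighted with `κ⁻¹`, sweep the surface measure. -/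
theorem lintegral_weight_sliceMeasure (hε : 0 < ε) (hL : 0 ≤ L) {ω : Env n M}
    (hω : LipschitzBoundary (tube ω) ε L) {f : Euc (n + 2) → ℝ≥0∞} (hf : Measurable f) :
    ∫⁻ α, ∫⁻ u, weight ω (pt α u) * f (pt α u) ∂(sliceMeasure ω α) =
      ∫⁻ x in regularPoints ω, f x ∂μHE[n + 1] := by
  classical
  have hR := measurableSet_regularPoints_apply hε hL hω
  have hw := measurable_weight_apply hε hL hω
  have h1 := (coarea_formula_lintegral hR (ν := regNormal ω)
    (fun x hx => (regNormal_spec hx).2.mono fun y hy => hy.1) (fun x hx => proj_regNormal_ne_zero hx)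
    (measurable_regNormal_apply hε hL hω) (G := fun x => weight ω x * f x) (hw.mul hf)).2
  -- The coarea factor `κ` cancels the weight `κ⁻¹`.
  have h2 : ∫⁻ x in regularPoints ω, ENNReal.ofReal ‖proj (regNormal ω x)‖ * (weight ω x * f x)
      ∂μHE[n + 1] = ∫⁻ x in regularPoints ω, f x ∂μHE[n + 1] := by
    refine setLIntegral_congr_fun hR fun x hx => ?_
    rw [weight, if_pos hx, kappa_eq, regNormal_of_mem hx, ← mul_assoc, ENNReal.mul_inv_cancel,
      one_mul]
    · have := norm_pos_iff.2 (proj_regNormal_ne_zero hx)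
      rw [regNormal_of_mem hx] at this
      exact (ENNReal.ofReal_pos.2 this).ne'
    · exact ENNReal.ofReal_ne_top
  rw [← h2, ← h1]
  refine lintegral_congr fun α => ?_
  have hsm : MeasurableSet (sliceAt (regularPoints ω) α) := measurableSet_sliceAt hR α
  rw [sliceMeasure, ← inter_eq_left.2 (sliceAt_regularPoints_subset (ω := ω) α),
    ← Measure.restrict_restrict hsm, ← lintegral_indicator hsm]
  refine lintegral_congr fun u => ?_
  rw [Set.indicator_apply]
  split_ifs with h
  · rfl
  · have h' : pt α u ∉ regularPoints ω := h
    rw [weight, if_neg h', zero_mul]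

end Palm

/-! ### Stationarity: from the section at the origin to the whole boundary -/

section PalmFormulas

variable {n : ℕ} {M : ℝ} {P : Measure (Env n M)} {G : Set (Env n M)} {ε L : ℝ}

/-- A stationary law that is concentrated on tubes with uniformly Lipschitz boundaries. -/
structure IsGoodLaw (P : Measure (Env n M)) (G : Set (Env n M)) (ε L : ℝ) : Prop where
  stationary : ∀ a, MeasurePreserving (shift a) P P
  meas : MeasurableSet G
  ae_mem : ∀ᵐ ω ∂P, ω ∈ G
  eps_pos : 0 < ε
  L_nonneg : 0 ≤ L
  lip : ∀ ω ∈ G, LipschitzBoundary (tube ω) ε L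

theorem IsGoodLaw.aemeasurable (hG : IsGoodLaw P G ε L) {F : Env n M → ℝ≥0∞}
    (hF : Measurable fun ω : G => F ω.1) : AEMeasurable F P := by
  have h1 : Measurable fun p : Unit × G => F p.2.1 := hF.comp measurable_snd
  have h2 := measurable_extend hG.meas (q := fun (_ : Unit) ω => F ω) h1
  have h3 : Measurable fun ω : Env n M => ((), ω) := measurable_prodMk_left
  refine ⟨G.indicator F, ?_, ?_⟩
  · have h4 := h2.comp h3
    simp only [Function.comp_def] at h4
    exact h4
  · filter_upwards [hG.ae_mem] with ω hω
    rw [indicator_of_mem hω]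

/-- Stationarity replaces the section at `0`, averaged over environments, by the section at `α` of a
fixed environment; integrating over `α`, the weighted sections sweep the surface measure. -/
theorem IsGoodLaw.lintegral_palm [IsProbabilityMeasure P] (hG : IsGoodLaw P G ε L)
    {f : ℝ → Env n M → Euc (n + 2) → ℝ≥0∞} {g : Env n M → Euc (n + 2) → ℝ≥0∞}
    (hfg : ∀ α ω x, f α (shift α ω) x = g ω (x + α • e n)) (hg : ∀ ω ∈ G, Measurable (g ω))
    (hf : Measurable fun p : ℝ × G =>
      ∫⁻ u, weight p.2.1 (pt 0 u) * f p.1 p.2.1 (pt 0 u) ∂(sliceMeasure p.2.1 0)) :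
    ∫⁻ ω, (∫⁻ α, ∫⁻ u, weight ω (pt 0 u) * f α ω (pt 0 u) ∂(sliceMeasure ω 0)) ∂P =
      ∫⁻ ω, ∫⁻ x in regularPoints ω, g ω x ∂μHE[n + 1] ∂P := by
  rw [lintegral_lintegral_shift hG.stationary hG.meas hG.ae_mem
    (q := fun α ω => ∫⁻ u, weight ω (pt 0 u) * f α ω (pt 0 u) ∂(sliceMeasure ω 0)) hf]
  refine lintegral_congr_ae ?_
  filter_upwards [hG.ae_mem] with ω hω
  rw [← lintegral_weight_sliceMeasure hG.eps_pos hG.L_nonneg (hG.lip ω hω) (hg ω hω)]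
  refine lintegral_congr fun α => ?_
  rw [sliceMeasure_shift]
  refine lintegral_congr fun u => ?_
  rw [weight_shift, hfg, pt_add_smul_e, zero_add]

theorem lintegral_indicator_Ico_one (a : ℝ) (c : ℝ≥0∞) :
    ∫⁻ α, (Ico a (a + 1)).indicator 1 α * c = c := by
  rw [lintegral_mul_const _ (measurable_one.indicator measurableSet_Ico),
    lintegral_indicator_one measurableSet_Ico, Real.volume_Ico]
  simp

/-- Almost surely almost all points of the section are regular. -/
theorem IsGoodLaw.ae_sliceMeasure_irregular [IsProbabilityMeasure P] (hG : IsGoodLaw P G ε L)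
    (hReg : ∀ ω ∈ G, μHE[n + 1] (frontier (tube ω) \ regularPoints ω) = 0) :
    ∀ᵐ ω ∂P, sliceMeasure ω 0 {u | pt 0 u ∉ regularPoints ω} = 0 := by
  have hm := measurable_sliceMeasure_irregular hG.eps_pos hG.L_nonneg hG.lip
  have hq : Measurable fun p : ℝ × G => (Ico (0 : ℝ) (0 + 1)).indicator 1 p.1 *
      sliceMeasure p.2.1 0 {u | pt 0 u ∉ regularPoints p.2.1} := by
    have h1 : Measurable fun p : ℝ × G => (Ico (0 : ℝ) (0 + 1)).indicator (1 : ℝ → ℝ≥0∞) p.1 :=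
      (measurable_one.indicator measurableSet_Ico).comp measurable_fst
    exact h1.mul (hm.comp measurable_snd)
  -- Spreading the quantity over a unit window of positions trades the section at `0` for almost
  -- every section of a fixed tube, where `ae_measure_sliceAt_eq_zero` applies.
  have h1 := lintegral_lintegral_shift hG.stationary hG.meas hG.ae_mem
    (q := fun α ω => (Ico (0 : ℝ) (0 + 1)).indicator 1 α *
      sliceMeasure ω 0 {u | pt 0 u ∉ regularPoints ω}) hq
  simp only [lintegral_indicator_Ico_one] at h1
  have h2 : ∫⁻ ω, (∫⁻ α, (Ico (0 : ℝ) (0 + 1)).indicator 1 α *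
      sliceMeasure (shift α ω) 0 {u | pt 0 u ∉ regularPoints (shift α ω)}) ∂P = 0 := by
    refine lintegral_eq_zero_of_ae_eq_zero ?_
    filter_upwards [hG.ae_mem] with ω hω
    refine lintegral_eq_zero_of_ae_eq_zero ?_
    filter_upwards [ae_measure_sliceAt_eq_zero (hReg ω hω)] with α hα
    have h3 : sliceMeasure (shift α ω) 0 {u | pt 0 u ∉ regularPoints (shift α ω)} = 0 := by
      rw [sliceMeasure_shift, sliceMeasure, Measure.restrict_apply' isClosed_frontier.measurableSet]
      refine measure_mono_null ?_ hα
      intro u hu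
      rw [sliceAt, mem_ofPred_eq]
      refine ⟨?_, ?_⟩
      · exact frontier_slice_subset ((hG.lip ω hω).isOpen hG.eps_pos) α hu.2
      · have := hu.1
        rw [mem_ofPred_eq, mem_regularPoints_shift, pt_add_smul_e, zero_add] at this
        exact this
    rw [h3, mul_zero, Pi.zero_apply]
  rw [h2] at h1
  exact (lintegral_eq_zero_iff' (hG.aemeasurable hm)).1 h1

/-- The normalizing constant is the mean surface area of a piece of the tube of length one. -/
theorem IsGoodLaw.normConst_eq [IsProbabilityMeasure P] (hG : IsGoodLaw P G ε L)
    (hReg : ∀ ω ∈ G, μHE[n + 1] (frontier (tube ω) \ regularPoints ω) = 0) (a : ℝ) :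
    normConst P =
      ∫⁻ ω, μHE[n + 1] (regularPoints ω ∩ {x : Euc (n + 2) | x 0 ∈ Ico a (a + 1)}) ∂P := by
  have hI : MeasurableSet {x : Euc (n + 2) | x 0 ∈ Ico a (a + 1)} := by
    have h0 : Measurable fun x : Euc (n + 2) => x 0 := by fun_prop
    exact h0 measurableSet_Ico
  have hind : Measurable fun α : ℝ => (Ico a (a + 1)).indicator (1 : ℝ → ℝ≥0∞) α :=
    measurable_one.indicator measurableSet_Ico
  have h0 : Measurable fun x : Euc (n + 2) => x 0 := by fun_prop
  have hmw := measurable_weightMean hG.eps_pos hG.L_nonneg hG.lip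
  have hsplit : ∀ (α : ℝ) (ω : Env n M),
      ∫⁻ u, weight ω (pt 0 u) * (Ico a (a + 1)).indicator 1 ((pt 0 u : Euc (n + 2)) 0 + α)
        ∂(sliceMeasure ω 0) =
      (Ico a (a + 1)).indicator 1 α * ∫⁻ u, weight ω (pt 0 u) ∂(sliceMeasure ω 0) := fun α ω => by
    simp only [pt_zero, zero_add]
    rw [lintegral_mul_const', mul_comm]
    rw [Set.indicator_apply]
    split_ifs <;> simp
  have h1 := hG.lintegral_palm
    (f := fun α _ x => (Ico a (a + 1)).indicator 1 (x 0 + α))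
    (g := fun _ x => (Ico a (a + 1)).indicator 1 (x 0)) (fun α ω x => by rw [add_smul_e_zero])
    (fun ω _ => hind.comp h0) (by
      simp only [hsplit]
      exact (hind.comp measurable_fst).mul (hmw.comp measurable_snd))
  simp only [hsplit, lintegral_indicator_Ico_one] at h1
  rw [normConst]
  refine Eq.trans ?_ (h1.trans ?_)
  · refine lintegral_congr_ae ?_
    filter_upwards [hG.ae_sliceMeasure_irregular hReg] with ω hω
    refine lintegral_congr_ae ?_
    have h2 : ∀ᵐ u ∂(sliceMeasure ω 0), pt 0 u ∈ regularPoints ω := hω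
    filter_upwards [h2] with u hu
    rw [weight, if_pos hu]
  · refine lintegral_congr fun ω => ?_
    have h3 : ∀ x : Euc (n + 2), (Ico a (a + 1)).indicator (1 : ℝ → ℝ≥0∞) (x 0) =
        {x : Euc (n + 2) | x 0 ∈ Ico a (a + 1)}.indicator 1 x := fun x => rfl
    simp only [h3]
    rw [lintegral_indicator_one hI, Measure.restrict_apply hI, inter_comm]

theorem tube_norm_proj_le {ω : Env n M} {x : Euc (n + 2)} (hx : x ∈ tube ω) : ‖proj x‖ ≤ M :=
  mem_closedBall_zero_iff.1 (slice_subset ω _ hx)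

theorem frontier_tube_norm_proj_le {ω : Env n M} {x : Euc (n + 2)} (hx : x ∈ frontier (tube ω)) :
    ‖proj x‖ ≤ M := by
  have hc : IsClosed {x : Euc (n + 2) | ‖proj x‖ ≤ M} :=
    isClosed_le continuous_proj.norm continuous_const
  exact closure_minimal (fun y hy => tube_norm_proj_le hy) hc hx.1

/-- The uniform chart constants bound the boundary area in a unit window by a constant that does not
depend on `ω`. -/
theorem IsGoodLaw.normConst_lt_top [IsProbabilityMeasure P] (hG : IsGoodLaw P G ε L)
    (hReg : ∀ ω ∈ G, μHE[n + 1] (frontier (tube ω) \ regularPoints ω) = 0) : normConst P < ⊤ := by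
  set K : Set (Euc (n + 2)) := {x | ‖proj x‖ ≤ M ∧ x 0 ∈ Ico (0 : ℝ) (0 + 1)} with hK
  have hKb : Bornology.IsBounded K := by
    rw [isBounded_iff_forall_norm_le]
    refine ⟨1 + M, fun x hx => ?_⟩
    have h1 : x = pt (x 0) 0 + pt 0 (proj x) := by rw [pt_add, add_zero, zero_add, pt_proj]
    have h2 : ‖(pt (x 0) 0 : Euc (n + 2))‖ ≤ 1 := by
      have h3 := norm_pt_sq (x 0) (0 : Euc (n + 1))
      rw [norm_zero] at h3
      have := hx.2.1
      have := hx.2.2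
      refine (sq_le_one_iff₀ (norm_nonneg _)).1 ?_
      rw [h3]
      nlinarith
    calc ‖x‖ ≤ ‖(pt (x 0) 0 : Euc (n + 2))‖ + ‖(pt 0 (proj x) : Euc (n + 2))‖ := by
          conv_lhs => rw [h1]
          exact norm_add_le _ _
      _ ≤ 1 + M := by
          rw [norm_pt_zero]
          exact add_le_add h2 hx.1
  obtain ⟨C, hC, hb⟩ := exists_measure_frontier_le (k := n + 1) hG.eps_pos hG.L_nonneg hKb
  rw [hG.normConst_eq hReg 0]
  refine lt_of_le_of_lt (b := ∫⁻ _, C ∂P) (lintegral_mono_ae ?_) (by simpa using hC)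
  filter_upwards [hG.ae_mem] with ω hω
  refine (measure_mono ?_).trans (hb _ (hG.lip ω hω))
  exact fun x hx => ⟨hx.1.1, frontier_tube_norm_proj_le hx.1.1, hx.2⟩

theorem IsGoodLaw.measurable_measure_regularPoints (hG : IsGoodLaw P G ε L)
    {I : Set (Euc (n + 2))} (hI : MeasurableSet I) :
    Measurable fun ω : G => μHE[n + 1] (regularPoints ω.1 ∩ I) := by
  have hR := measurableSet_regularPoints hG.eps_pos hG.L_nonneg hG.lip
  have h1 : MeasurableSet {p : G × Euc (n + 2) | p.2 ∈ regularPoints p.1.1 ∧ p.2 ∈ I} :=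
    hR.inter (measurable_snd hI)
  have := isSFiniteKernel_surfaceKernel hG.eps_pos hG.L_nonneg hG.lip
  have h2 := ProbabilityTheory.Kernel.measurable_kernel_prodMk_left
    (κ := surfaceKernel hG.eps_pos hG.L_nonneg hG.lip) h1
  convert h2 using 1
  ext1 ω
  have h3 : (surfaceKernel hG.eps_pos hG.L_nonneg hG.lip) ω = surfaceMeasure ω.1 := rfl
  rw [h3, surfaceMeasure, Measure.restrict_apply' isClosed_frontier.measurableSet]
  congr 1
  ext x
  exact ⟨fun h => ⟨⟨h.1, h.2⟩, h.1.1⟩, fun h => ⟨h.1.1, h.1.2⟩⟩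

/-- If the constant vanished, almost every tube would have boundary of area zero in each unit
window, hence in total. But a nonempty tube of bounded cross-section has a boundary point, and the
Lipschitz graph around it has positive area. -/
theorem IsGoodLaw.normConst_pos [IsProbabilityMeasure P] (hG : IsGoodLaw P G ε L)
    (hReg : ∀ ω ∈ G, μHE[n + 1] (frontier (tube ω) \ regularPoints ω) = 0)
    (hne : ∀ ω ∈ G, (tube ω).Nonempty) : 0 < normConst P := by
  rw [pos_iff_ne_zero]
  intro h0
  have hI : ∀ k : ℤ, MeasurableSet {x : Euc (n + 2) | x 0 ∈ Ico (k : ℝ) (k + 1)} := fun k => by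
    have h0 : Measurable fun x : Euc (n + 2) => x 0 := by fun_prop
    exact h0 measurableSet_Ico
  have h1 : ∀ k : ℤ, ∀ᵐ ω ∂P,
      μHE[n + 1] (regularPoints ω ∩ {x : Euc (n + 2) | x 0 ∈ Ico (k : ℝ) (k + 1)}) = 0 := fun k =>
    (lintegral_eq_zero_iff' (hG.aemeasurable (hG.measurable_measure_regularPoints (hI k)))).1
      (by rw [← hG.normConst_eq hReg k, h0])
  obtain ⟨ω, h2, hω⟩ := ((ae_all_iff.2 h1).and hG.ae_mem).exists
  have h3 : μHE[n + 1] (regularPoints ω) = 0 := by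
    refine measure_mono_null (fun x hx => ?_) (measure_iUnion_null h2)
    exact mem_iUnion.2 ⟨⌊x 0⌋, hx, Int.floor_le _, Int.lt_floor_add_one _⟩
  have h4 : μHE[n + 1] (frontier (tube ω)) = 0 := by
    refine measure_mono_null (fun x hx => ?_) (measure_union_null h3 (hReg ω hω))
    by_cases hxR : x ∈ regularPoints ω
    · exact Or.inl hxR
    · exact Or.inr ⟨hx, hxR⟩
  have hfr : (frontier (tube ω)).Nonempty := by
    rw [nonempty_frontier_iff]
    refine ⟨hne ω hω, fun huniv => ?_⟩
    have h5 : ∀ t : ℝ, t ≤ M := fun t => by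
      have h6 := tube_norm_proj_le (ω := ω) (x := pt 0 (EuclideanSpace.single 0 t))
        (by rw [huniv]; exact mem_univ _)
      rw [proj_pt, PiLp.norm_single] at h6
      exact (le_abs_self t).trans h6
    linarith [h5 (M + 1)]
  obtain ⟨x, hx⟩ := hfr
  exact ((hG.lip ω hω).measure_frontier_pos hG.eps_pos hx).ne'
    (measure_mono_null inter_subset_left h4)

/-- The mass transport formula for functions of a step. -/
theorem IsGoodLaw.lintegral_palmMean [IsProbabilityMeasure P] (hG : IsGoodLaw P G ε L)
    {w : Euc (n + 2) × Euc (n + 2) → ℝ≥0∞} (hw : Measurable w) :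
    ∫⁻ ω, palmMean ω (fun x y => ∫⁻ α : ℝ, w (x + α • e n, y + α • e n)) ∂P =
      ∫⁻ ω, ∫⁻ x in regularPoints ω, stepMean ω (fun x y => w (x, y)) x ∂μHE[n + 1] ∂P := by
  have hε := hG.eps_pos
  have hL := hG.L_nonneg
  have hw' : Measurable fun p : ℝ × (Euc (n + 2) × Euc (n + 2)) =>
      w (p.2.1 + p.1 • e n, p.2.2 + p.1 • e n) := by
    have h1 : Measurable fun p : ℝ × (Euc (n + 2) × Euc (n + 2)) =>
      (p.2.1 + p.1 • e n, p.2.2 + p.1 • e n) := by fun_prop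
    exact hw.comp h1
  have h1 := hG.lintegral_palm
    (f := fun α ω x => stepMean ω (fun x y : Euc (n + 2) => w (x + α • e n, y + α • e n)) x)
    (g := fun ω x => stepMean ω (fun x y => w (x, y)) x)
    (fun α ω x => stepMean_shift (fun x y => w (x, y))) (fun ω hω => by
      have h2 : Measurable fun x : Euc (n + 2) => (((), (⟨ω, hω⟩ : G)), x) := measurable_prodMk_left
      have h3 : Measurable fun p : Unit × (Euc (n + 2) × Euc (n + 2)) => w p.2 := hw.comp measurable_snd
      have h4 := (measurable_stepMean hε hL hG.lip h3).comp h2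
      simp only [Function.comp_def] at h4
      exact h4) (measurable_palmMean hε hL hG.lip hw')
  rw [← h1]
  refine lintegral_congr_ae ?_
  filter_upwards [hG.ae_mem] with ω hω
  have := sigmaFinite_surfaceMeasure hε hL (hG.lip ω hω)
  have hm1 : Measurable fun p : Euc (n + 1) × ℝ =>
      weight ω (pt 0 p.1) * stepMean ω (fun x y => w (x + p.2 • e n, y + p.2 • e n)) (pt 0 p.1) := by
    have hpt : Measurable fun u : Euc (n + 1) => pt 0 u := (continuous_pt_right 0).measurable
    have h2 : Measurable fun p : Euc (n + 1) × ℝ => ((p.2, (⟨ω, hω⟩ : G)), pt 0 p.1) := by fun_prop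
    have h4 := (measurable_stepMean hε hL hG.lip hw').comp h2
    have h5 : Measurable fun p : Euc (n + 1) × ℝ => pt 0 p.1 := by fun_prop
    have h6 := (measurable_weight_apply hε hL (hG.lip ω hω)).comp h5
    simp only [Function.comp_def] at h4 h6
    exact h6.mul h4
  have hm2 : ∀ x, Measurable fun p : Euc (n + 2) × ℝ =>
      ENNReal.ofReal (density ω x p.1) * w (x + p.2 • e n, p.1 + p.2 • e n) := fun x => by
    have h2 : Measurable fun p : Euc (n + 2) × ℝ => ((⟨ω, hω⟩ : G), (x, p.1)) := by fun_prop
    have h3 := ((measurable_density hε hL hG.lip).comp h2).ennreal_ofReal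
    have h4 : Measurable fun p : Euc (n + 2) × ℝ => (x + p.2 • e n, p.1 + p.2 • e n) := by fun_prop
    have h5 := hw.comp h4
    simp only [Function.comp_def] at h3 h5
    exact h3.mul h5
  rw [lintegral_lintegral_swap (f := fun α u => weight ω (pt 0 u) *
    stepMean ω (fun x y : Euc (n + 2) => w (x + α • e n, y + α • e n)) (pt 0 u)) (by
      have h2 : Measurable fun p : ℝ × Euc (n + 1) => (p.2, p.1) := measurable_swap
      have h3 := hm1.comp h2
      simp only [Function.comp_def] at h3
      exact h3.aemeasurable), palmMean]
  refine lintegral_congr fun u => ?_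
  have hms : Measurable fun α : ℝ => stepMean ω (fun x y : Euc (n + 2) => w (x + α • e n, y + α • e n)) (pt 0 u) := by
    have h2 : Measurable fun α : ℝ => ((α, (⟨ω, hω⟩ : G)), (pt 0 u : Euc (n + 2))) := by fun_prop
    have h4 := (measurable_stepMean hε hL hG.lip hw').comp h2
    simp only [Function.comp_def] at h4
    exact h4
  rw [lintegral_const_mul _ hms]
  congr 1
  simp only [stepMean]
  rw [lintegral_lintegral_swap (f := fun α y => ENNReal.ofReal (density ω (pt 0 u) y) *
    w (pt 0 u + α • e n, y + α • e n)) (by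
      have h2 : Measurable fun p : ℝ × Euc (n + 2) => (p.2, p.1) := measurable_swap
      have h3 := (hm2 (pt 0 u)).comp h2
      simp only [Function.comp_def] at h3
      exact h3.aemeasurable)]
  refine lintegral_congr fun y => ?_
  rw [lintegral_const_mul' _ _ ENNReal.ofReal_ne_top]

end PalmFormulas

/-! ### Crossing probabilities as fluxes -/

section CrossingFlux

variable {n : ℕ} {M : ℝ} {P : Measure (Env n M)} {G : Set (Env n M)} {ε L : ℝ}
  {S : Set (Euc (n + 1))} {U : Euc (n + 1) → Euc (n + 2) ≃ₗᵢ[ℝ] Euc (n + 2)}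
  {D R Q : Set (Euc (n + 2))} {N : Euc (n + 2) → Euc (n + 2)}
  {B₁ : Set (Euc (n + 1))} {B₂ : Set (Euc (n + 2))} {x y : Euc (n + 2)}

theorem cylNormal_of_mem {z : Euc (n + 2)} (hz : proj z ∈ frontier S) :
    cylNormal S U z = U (proj z) (e n) := indicator_of_mem hz _

theorem symm_mem_halfSphere_iff {z h : Euc (n + 2)} (hz : proj z ∈ frontier S) (hh : ‖h‖ = 1) :
    (U (proj z)).symm h ∈ halfSphere n ↔ 0 < (inner ℝ h (cylNormal S U z) : ℝ) := by
  rw [halfSphere, mem_ofPred_eq, LinearIsometryEquiv.norm_map, cylNormal_of_mem hz,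
    ← LinearIsometryEquiv.inner_map_map (U (proj z)), LinearIsometryEquiv.apply_symm_apply]
  exact and_iff_right hh

/-- The entrance data in a unit piece of the cylinder that correspond to `B₁` and `B₂`. -/
def entrances (S : Set (Euc (n + 1))) (U : Euc (n + 1) → Euc (n + 2) ≃ₗᵢ[ℝ] Euc (n + 2))
    (B₁ : Set (Euc (n + 1))) (B₂ : Set (Euc (n + 2))) : Set (Euc (n + 2) × Euc (n + 2)) :=
  {p | proj p.1 ∈ B₁ ∧ invRot S U (proj p.1) p.2 ∈ B₂ ∧ p.1 0 ∈ Ico (0 : ℝ) 1}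

theorem measurableSet_entrances (hU : IsNormalFrame S U) (hB₁ : MeasurableSet B₁)
    (hB₂ : MeasurableSet B₂) : MeasurableSet (entrances S U B₁ B₂) := by
  have h1 : Measurable fun p : Euc (n + 2) × Euc (n + 2) => proj p.1 :=
    continuous_proj.measurable.comp measurable_fst
  have h2 : Measurable fun p : Euc (n + 2) × Euc (n + 2) => invRot S U (proj p.1) p.2 := by
    have h := (measurable_invRot hU.1).comp (h1.prodMk measurable_snd)
    simp only [Function.comp_def] at h
    exact h
  have h3 : Measurable fun p : Euc (n + 2) × Euc (n + 2) => p.1 0 := by fun_prop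
  have h4 : entrances S U B₁ B₂ = (fun p => proj p.1) ⁻¹' B₁ ∩
      ((fun p => invRot S U (proj p.1) p.2) ⁻¹' B₂ ∩ (fun p => p.1 0) ⁻¹' Ico (0 : ℝ) 1) := rfl
  rw [h4]
  exact (h1 hB₁).inter ((h2 hB₂).inter (h3 measurableSet_Ico))

/-- The flux of chords through a piece of the cylinder, per unit of length. -/
theorem CylinderInDomain.lintegral_cosKernel_entrances
    (H : CylinderInDomain S D R N Q (cylNormal S U)) (hU : IsNormalFrame S U)
    (hB₁ : MeasurableSet B₁) (hB₁S : B₁ ⊆ frontier S) (hB₂ : MeasurableSet B₂)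
    (hB₂h : B₂ ⊆ halfSphere n) :
    ∫⁻ x in R, ∫⁻ y in R, ENNReal.ofReal (cosKernel D N x y) *
        (entering S (entrances S U B₁ B₂)).indicator 1 (x, y) ∂μHE[n + 1] ∂μHE[n + 1] =
      μHE[n] B₁ * ∫⁻ h in B₂, ENNReal.ofReal (inner ℝ h (e n)) ∂(sphMeasure (n + 1)) := by
  classical
  rw [H.lintegral_cosKernel_entering (measurableSet_entrances hU hB₁ hB₂)]
  swap
  · rintro ⟨z, h⟩ ⟨h1, h2, -⟩
    simp only at h1 h2 ⊢
    rw [invRot_eq (hB₁S h1)] at h2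
    have h3 := hB₂h h2
    have h4 := h3.1
    rw [LinearIsometryEquiv.norm_map] at h4
    exact (symm_mem_halfSphere_iff (hB₁S h1) h4).1 h3
  set c := ∫⁻ h in B₂, ENNReal.ofReal (inner ℝ h (e n)) ∂(sphMeasure (n + 1)) with hc
  set V : Set (Euc (n + 2)) := {z | proj z ∈ B₁ ∧ z 0 ∈ Ico (0 : ℝ) 1} with hV
  have hVm : MeasurableSet V := by
    have h3 : Measurable fun z : Euc (n + 2) => z 0 := by fun_prop
    exact (continuous_proj.measurable hB₁).inter (h3 measurableSet_Ico)
  -- For a fixed entrance point the rotation `U` carries `e` to the normal and preserves the surface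
  -- measure of the sphere, so the integral over directions does not depend on the point.
  have h1 : ∀ z, ∫⁻ h, (entrances S U B₁ B₂).indicator
      (fun p => ENNReal.ofReal (inner ℝ p.2 (cylNormal S U p.1))) (z, h) ∂(sphMeasure (n + 1)) =
      V.indicator (fun _ => c) z := fun z => by
    by_cases hz : z ∈ V
    · rw [indicator_of_mem hz, hc, ← lintegral_indicator hB₂]
      refine Eq.trans ?_ (lintegral_sphMeasure_comp (U (proj z)).symm _)
      refine lintegral_congr fun h => ?_
      have hiff : (z, h) ∈ entrances S U B₁ B₂ ↔ (U (proj z)).symm h ∈ B₂ := by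
        rw [entrances, mem_ofPred_eq, invRot_eq (hB₁S hz.1)]
        exact ⟨fun h => h.2.1, fun h => ⟨hz.1, h, hz.2⟩⟩
      have hin : (inner ℝ h (cylNormal S U z) : ℝ) = inner ℝ ((U (proj z)).symm h) (e n) := by
        rw [cylNormal_of_mem (hB₁S hz.1),
          ← LinearIsometryEquiv.inner_map_map (U (proj z)) ((U (proj z)).symm h),
          LinearIsometryEquiv.apply_symm_apply]
      rw [Set.indicator_apply, Set.indicator_apply]
      simp only [hiff, hin]
    · rw [indicator_of_notMem hz]
      refine lintegral_eq_zero_of_ae_eq_zero (ae_of_all _ fun h => ?_)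
      exact indicator_of_notMem (fun hmem => hz ⟨hmem.1, hmem.2.2⟩) _
  simp only [h1]
  rw [lintegral_indicator_const hVm, Measure.restrict_apply hVm, mul_comm]
  congr 1
  rw [← measure_cylinder_piece H.meas_Q H.open_S H.convex_S hU H.null_Q H.normal_m hB₁ hB₁S]
  congr 1
  ext z
  exact ⟨fun h => ⟨h.2, h.1.1, h.1.2⟩, fun h => ⟨⟨h.2.1, h.2.2⟩, h.1⟩⟩

theorem CylinderInDomain.crossesIn_of_crosses (H : CylinderInDomain S D R N Q (cylNormal S U))
    (hx : x ∈ R) (hs : Seen D x y) (hl : NiceLine S D R N Q (cylNormal S U) (dir x y) x)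
    (hc : Crosses S x y) : CrossesIn S U (frontier S) (halfSphere n) x y := by
  have hne := (seen_iff.1 hs).1
  obtain ⟨hh, hm⟩ := H.enters hl hx hne hc
  have hfr := hitPt_mem_frontier hh
  rw [frontier_cylinder] at hfr
  exact crossesIn_iff.2 ⟨hh, hfr, (symm_mem_halfSphere_iff hfr (norm_dir hne)).2 hm⟩

theorem CylinderInDomain.crosses_of_crossesIn (H : CylinderInDomain S D R N Q (cylNormal S U))
    (hB₂h : B₂ ⊆ halfSphere n) (hy : y ∈ R) (hs : Seen D x y)
    (hl : NiceLine S D R N Q (cylNormal S U) (dir x y) x) (hc : CrossesIn S U B₁ B₂ x y) :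
    Crosses S x y := by
  have hne := (seen_iff.1 hs).1
  obtain ⟨hh, -, h2⟩ := crossesIn_iff.1 hc
  have hfr := hitPt_mem_frontier hh
  rw [frontier_cylinder] at hfr
  exact H.crosses hl hy hs hh ((symm_mem_halfSphere_iff hfr (norm_dir hne)).1 (hB₂h h2))

/-! ### Translation invariance of the events -/

theorem hitTimes_add_smul_e (a : ℝ) :
    hitTimes S (x + a • e n) (y + a • e n) = hitTimes S x y := by
  ext t
  rw [hitTimes, hitTimes, mem_ofPred_eq, mem_ofPred_eq, add_sub_add_right_eq_sub, add_right_comm,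
    frontier_cylinder, mem_ofPred_eq, mem_ofPred_eq, proj_add_smul_e]

theorem hitPt_add_smul_e (a : ℝ) :
    hitPt S (x + a • e n) (y + a • e n) = hitPt S x y + a • e n := by
  rw [hitPt, hitPt, hitTimes_add_smul_e, add_sub_add_right_eq_sub, add_right_comm]

theorem dir_add_add (a : ℝ) : dir (x + a • e n) (y + a • e n) = dir x y := by
  rw [dir, dir, add_sub_add_right_eq_sub]

theorem crossesIn_add_smul_e (a : ℝ) :
    CrossesIn S U B₁ B₂ (x + a • e n) (y + a • e n) ↔ CrossesIn S U B₁ B₂ x y := by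
  rw [crossesIn_iff, crossesIn_iff, hitTimes_add_smul_e, hitPt_add_smul_e, proj_add_smul_e,
    add_sub_add_right_eq_sub]

theorem crosses_add_smul_e (a : ℝ) : Crosses S (x + a • e n) (y + a • e n) ↔ Crosses S x y := by
  rw [Crosses, Crosses]
  simp only [add_sub_add_right_eq_sub, add_right_comm x (a • e n), add_smul_e_mem_cylinder]

/-- An axial translation affects the entrance data only through the height of the entrance point, so
the translations that bring it into the window have total length one. -/
theorem mem_entering_entrances (hB₁S : B₁ ⊆ frontier S) (a : ℝ) :
    (x + a • e n, y + a • e n) ∈ entering S (entrances S U B₁ B₂) ↔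
      hitPt S x y 0 + a ∈ Ico (0 : ℝ) 1 ∧ CrossesIn S U B₁ B₂ x y := by
  rw [entering, entrances, mem_ofPred_eq, hitTimes_add_smul_e, mem_ofPred_eq, hitPt_add_smul_e,
    dir_add_add, proj_add_smul_e, add_smul_e_zero, crossesIn_iff]
  constructor
  · rintro ⟨h1, h2, h3, h4⟩
    rw [invRot_eq (hB₁S h2)] at h3
    exact ⟨h4, h1, h2, h3⟩
  · rintro ⟨h4, h1, h2, h3⟩
    refine ⟨h1, h2, ?_, h4⟩
    rw [invRot_eq (hB₁S h2)]
    exact h3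

/-! ### Averages of step events -/

theorem lintegral_indicator_Ico_add (c : ℝ) (k : ℝ≥0∞) :
    ∫⁻ α, (Ico (0 : ℝ) 1).indicator 1 (c + α) * k = k := by
  have h1 := lintegral_indicator_Ico_one 0 k
  rw [zero_add] at h1
  conv_rhs => rw [← h1]
  exact lintegral_add_left_eq_self (μ := volume) (fun α => (Ico (0 : ℝ) 1).indicator 1 α * k) c

theorem density_of_notMem {ω : Env n M} (h : ¬(x ∈ regularPoints ω ∧ y ∈ regularPoints ω)) :
    density ω x y = 0 := by
  rw [density, if_neg fun h' => h ⟨h'.1, h'.2.1⟩]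

theorem density_eq_cosKernel {ω : Env n M} (hx : x ∈ regularPoints ω) (hy : y ∈ regularPoints ω) :
    density ω x y = gammaConst n * cosKernel (tube ω) (regNormal ω) x y := by
  by_cases hs : Seen (tube ω) x y
  · rw [density, if_pos ⟨hx, hy, hs⟩, cosKernel, if_pos hs, regNormal_of_mem hx, regNormal_of_mem hy,
      mul_div_assoc]
  · rw [density, if_neg fun h => hs h.2.2, cosKernel, if_neg hs, mul_zero]

theorem stepMean_eq {ω : Env n M} (hR : MeasurableSet (regularPoints ω))
    (w : Euc (n + 2) → Euc (n + 2) → ℝ≥0∞) (hx : x ∈ regularPoints ω) :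
    stepMean ω w x = ENNReal.ofReal (gammaConst n) * ∫⁻ y in regularPoints ω,
      ENNReal.ofReal (cosKernel (tube ω) (regNormal ω) x y) * w x y ∂μHE[n + 1] := by
  classical
  have hsub : regularPoints ω ⊆ frontier (tube ω) := fun y hy => hy.1
  rw [← lintegral_const_mul' _ _ ENNReal.ofReal_ne_top, stepMean, surfaceMeasure,
    ← inter_eq_left.2 hsub, ← Measure.restrict_restrict hR, ← lintegral_indicator hR]
  refine lintegral_congr fun y => ?_
  rw [Set.indicator_apply]
  split_ifs with hy
  · rw [density_eq_cosKernel hx hy, ENNReal.ofReal_mul gammaConst_pos.le, mul_assoc]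
  · rw [density_of_notMem fun h => hy h.2, ENNReal.ofReal_zero, zero_mul]

theorem stepProb_eq (P : Measure (Env n M)) {ev : Euc (n + 2) → Euc (n + 2) → Prop}
    (hev : MeasurableSet {p : Euc (n + 2) × Euc (n + 2) | ev p.1 p.2}) :
    stepProb P ev = (normConst P)⁻¹ * ∫⁻ ω, palmMean ω
      (fun x y => {p : Euc (n + 2) × Euc (n + 2) | ev p.1 p.2}.indicator 1 (x, y)) ∂P := by
  classical
  rw [stepProb, avgQ]
  congr 1
  refine lintegral_congr fun ω => lintegral_congr fun u => ?_
  have hm : MeasurableSet {y | ev (pt 0 u) y} := hev.preimage measurable_prodMk_left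
  rw [stepLaw, withDensity_apply _ hm, ← lintegral_indicator hm]
  by_cases hx : pt 0 u ∈ regularPoints ω
  · rw [weight, if_pos hx, stepMean]
    congr 1
    refine lintegral_congr fun y => ?_
    simp only [Set.indicator_apply, mem_ofPred_eq]
    split_ifs <;> simp
  -- From an irregular starting point the density vanishes, so the product is `0` whether or not
  -- `κ⁻¹` is replaced by `0`.
  · have h0 : ∀ y, density ω (pt 0 u) y = 0 := fun y => density_of_notMem fun h => hx h.1
    rw [weight, if_neg hx, zero_mul]
    simp [h0]

theorem stepMean_mono {ω : Env n M} {w w' : Euc (n + 2) → Euc (n + 2) → ℝ≥0∞}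
    (h : ∀ x y, w x y ≤ w' x y) (x : Euc (n + 2)) : stepMean ω w x ≤ stepMean ω w' x :=
  lintegral_mono fun y => mul_le_mul_right (h x y) _

theorem palmMean_mono {ω : Env n M} {w w' : Euc (n + 2) → Euc (n + 2) → ℝ≥0∞}
    (h : ∀ x y, w x y ≤ w' x y) : palmMean ω w ≤ palmMean ω w' :=
  lintegral_mono fun u => mul_le_mul_right (stepMean_mono h _) _

theorem IsGoodLaw.lintegral_palmMean_add [IsProbabilityMeasure P] (hG : IsGoodLaw P G ε L)
    {w w' : Euc (n + 2) × Euc (n + 2) → ℝ≥0∞} (hw : Measurable w) :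
    ∫⁻ ω, palmMean ω (fun x y => w (x, y) + w' (x, y)) ∂P =
      ∫⁻ ω, palmMean ω (fun x y => w (x, y)) ∂P + ∫⁻ ω, palmMean ω (fun x y => w' (x, y)) ∂P := by
  have hε := hG.eps_pos
  have hL := hG.L_nonneg
  have hw1 : Measurable fun p : Unit × (Euc (n + 2) × Euc (n + 2)) => w p.2 := hw.comp measurable_snd
  have hpm : AEMeasurable (fun ω => palmMean ω (fun x y => w (x, y))) P := by
    refine hG.aemeasurable ?_
    have h2 : Measurable fun ω : G => ((), ω) := measurable_prodMk_left
    have h3 := (measurable_palmMean hε hL hG.lip hw1).comp h2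
    simp only [Function.comp_def] at h3
    exact h3
  rw [← lintegral_add_left' hpm]
  refine lintegral_congr_ae ?_
  filter_upwards [hG.ae_mem] with ω hω
  have hsm : Measurable fun x => stepMean ω (fun x y => w (x, y)) x := by
    have h2 : Measurable fun x : Euc (n + 2) => (((), (⟨ω, hω⟩ : G)), x) := measurable_prodMk_left
    have h4 := (measurable_stepMean hε hL hG.lip hw1).comp h2
    simp only [Function.comp_def] at h4
    exact h4
  have hadd : ∀ x, stepMean ω (fun x y => w (x, y) + w' (x, y)) x =
      stepMean ω (fun x y => w (x, y)) x + stepMean ω (fun x y => w' (x, y)) x := fun x => by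
    rw [stepMean, stepMean, stepMean, ← lintegral_add_left]
    · simp only [mul_add]
    · have h2 : Measurable fun y : Euc (n + 2) => ((⟨ω, hω⟩ : G), (x, y)) := by fun_prop
      have h3 := ((measurable_density hε hL hG.lip).comp h2).ennreal_ofReal
      simp only [Function.comp_def] at h3
      exact h3.mul (hw.comp measurable_prodMk_left)
  simp only [palmMean, hadd, mul_add]
  have hpt : Measurable fun u : Euc (n + 1) => pt 0 u := (continuous_pt_right 0).measurable
  exact lintegral_add_left (((measurable_weight_apply hε hL (hG.lip ω hω)).comp hpt).mul
    (hsm.comp hpt)) _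

theorem IsGoodLaw.lintegral_palmMean_le_of_diff [IsProbabilityMeasure P] (hG : IsGoodLaw P G ε L)
    {E E' : Set (Euc (n + 2) × Euc (n + 2))} (hE' : MeasurableSet E')
    (h0 : ∫⁻ ω, palmMean ω (fun x y => (E \ E').indicator 1 (x, y)) ∂P = 0) :
    ∫⁻ ω, palmMean ω (fun x y => E.indicator 1 (x, y)) ∂P ≤
      ∫⁻ ω, palmMean ω (fun x y => E'.indicator 1 (x, y)) ∂P := by
  classical
  rw [← add_zero (∫⁻ ω, palmMean ω (fun x y => E'.indicator 1 (x, y)) ∂P), ← h0,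
    ← hG.lintegral_palmMean_add (w := E'.indicator 1) (w' := (E \ E').indicator 1)
      (measurable_one.indicator hE')]
  refine lintegral_mono fun ω => palmMean_mono fun x y => ?_
  simp only [Set.indicator_apply, Set.mem_sdiff]
  by_cases h1 : (x, y) ∈ E <;> by_cases h2 : (x, y) ∈ E' <;> simp [h1, h2]

/-- Mass transport with the unit window placed at the starting point turns the average of an
invariant event into an integral over chords of a fixed tube, where events absent from transversal
lines are negligible. -/
theorem IsGoodLaw.lintegral_palmMean_eq_zero [IsProbabilityMeasure P] (hG : IsGoodLaw P G ε L)
    (hC : ∀ ω ∈ G, CylinderInDomain S (tube ω) (regularPoints ω) (regNormal ω) Q (cylNormal S U))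
    {E : Set (Euc (n + 2) × Euc (n + 2))}
    (hE : MeasurableSet E)
    (hinv : ∀ (a : ℝ) x y, (x + a • e n, y + a • e n) ∈ E ↔ (x, y) ∈ E)
    (hn : ∀ ω ∈ G, ∀ x ∈ regularPoints ω, ∀ y ∈ regularPoints ω, Seen (tube ω) x y →
      NiceLine S (tube ω) (regularPoints ω) (regNormal ω) Q (cylNormal S U) (dir x y) x →
      (x, y) ∉ E) :
    ∫⁻ ω, palmMean ω (fun x y => E.indicator 1 (x, y)) ∂P = 0 := by
  classical
  have h0 : Measurable fun p : Euc (n + 2) × Euc (n + 2) => p.1 0 := by fun_prop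
  have hw : Measurable fun p : Euc (n + 2) × Euc (n + 2) =>
      (Ico (0 : ℝ) 1).indicator (1 : ℝ → ℝ≥0∞) (p.1 0) * E.indicator 1 p :=
    ((measurable_one.indicator measurableSet_Ico).comp h0).mul (measurable_one.indicator hE)
  have h1 := hG.lintegral_palmMean hw
  have h2 : ∀ (a : ℝ) (x y : Euc (n + 2)), E.indicator (1 : Euc (n + 2) × Euc (n + 2) → ℝ≥0∞)
      (x + a • e n, y + a • e n) = E.indicator 1 (x, y) := fun a x y => by
    simp only [Set.indicator_apply, hinv, Pi.one_apply]
  simp only [h2, add_smul_e_zero, lintegral_indicator_Ico_add] at h1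
  rw [h1]
  refine lintegral_eq_zero_of_ae_eq_zero ?_
  filter_upwards [hG.ae_mem] with ω hω
  have hR := (hC ω hω).meas_R
  have h3 := (hC ω hω).lintegral_cosKernel_eq_zero hE (hn ω hω)
  rw [Pi.zero_apply, ← nonpos_iff_eq_zero]
  calc ∫⁻ x in regularPoints ω, stepMean ω (fun x y => (Ico (0 : ℝ) 1).indicator 1 (x 0) *
        E.indicator 1 (x, y)) x ∂μHE[n + 1]
      ≤ ∫⁻ x in regularPoints ω, stepMean ω (fun x y => E.indicator 1 (x, y)) x ∂μHE[n + 1] := by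
        refine lintegral_mono fun x => stepMean_mono (fun x y => ?_) x
        refine (mul_le_mul_left (indicator_le_self' (fun _ _ => zero_le) (x 0)) _).trans ?_
        rw [Pi.one_apply, one_mul]
    _ = 0 := by
        rw [setLIntegral_congr_fun hR fun x hx => stepMean_eq hR _ hx,
          lintegral_const_mul' _ _ ENNReal.ofReal_ne_top, h3, mul_zero]

/-- Mass transport with the window placed at the entrance point: over all translations the windowed
indicator integrates to that of the event, and for a fixed tube the flux through the window is the
same for every `ω`. -/
theorem IsGoodLaw.lintegral_palmMean_crossesIn [IsProbabilityMeasure P] (hG : IsGoodLaw P G ε L)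
    (hC : ∀ ω ∈ G, CylinderInDomain S (tube ω) (regularPoints ω) (regNormal ω) Q (cylNormal S U))
    (hU : IsNormalFrame S U)
    (hB₁ : MeasurableSet B₁) (hB₁S : B₁ ⊆ frontier S) (hB₂ : MeasurableSet B₂)
    (hB₂h : B₂ ⊆ halfSphere n) :
    ∫⁻ ω, palmMean ω (fun x y =>
      {p : Euc (n + 2) × Euc (n + 2) | CrossesIn S U B₁ B₂ p.1 p.2}.indicator 1 (x, y)) ∂P =
      ENNReal.ofReal (gammaConst n) *
        (μHE[n] B₁ * ∫⁻ h in B₂, ENNReal.ofReal (inner ℝ h (e n)) ∂(sphMeasure (n + 1))) := by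
  classical
  have hEm := measurableSet_entering (S := S) (measurableSet_entrances hU hB₁ hB₂)
  have h1 := hG.lintegral_palmMean
    (w := (entering S (entrances S U B₁ B₂)).indicator 1) (measurable_one.indicator hEm)
  have h2 : ∀ (a : ℝ) (x y : Euc (n + 2)), (entering S (entrances S U B₁ B₂)).indicator
      (1 : Euc (n + 2) × Euc (n + 2) → ℝ≥0∞) (x + a • e n, y + a • e n) =
      (Ico (0 : ℝ) 1).indicator 1 (hitPt S x y 0 + a) *
      {p : Euc (n + 2) × Euc (n + 2) | CrossesIn S U B₁ B₂ p.1 p.2}.indicator 1 (x, y) :=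
    fun a x y => by
      simp only [Set.indicator_apply, mem_entering_entrances hB₁S, mem_ofPred_eq, Pi.one_apply]
      split_ifs <;> simp_all
  simp only [h2, lintegral_indicator_Ico_add] at h1
  rw [h1]
  refine (lintegral_congr_ae ?_).trans (lintegral_const _) |>.trans (by rw [measure_univ, mul_one])
  filter_upwards [hG.ae_mem] with ω hω
  have hR := (hC ω hω).meas_R
  rw [setLIntegral_congr_fun hR fun x hx => stepMean_eq hR _ hx,
    lintegral_const_mul' _ _ ENNReal.ofReal_ne_top,
    (hC ω hω).lintegral_cosKernel_entrances hU hB₁ hB₁S hB₂ hB₂h]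

/-- The step law from a regular point has mass at most one. -/
theorem IsGoodLaw.lintegral_palmMean_le [IsProbabilityMeasure P] (hG : IsGoodLaw P G ε L)
    (hC : ∀ ω ∈ G, CylinderInDomain S (tube ω) (regularPoints ω) (regNormal ω) Q (cylNormal S U))
    (E : Set (Euc (n + 2) × Euc (n + 2))) :
    ∫⁻ ω, palmMean ω (fun x y => E.indicator 1 (x, y)) ∂P ≤ normConst P := by
  refine lintegral_mono_ae ?_
  filter_upwards [hG.ae_mem] with ω hω
  refine lintegral_mono fun u => ?_
  by_cases hx : pt 0 u ∈ regularPoints ω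
  · rw [weight, if_pos hx]
    refine (mul_le_mul_right ?_ _).trans (mul_one _).le
    rw [stepMean_eq (hC ω hω).meas_R _ hx]
    refine le_trans ?_ ((hC ω hω).lintegral_cosKernel_le hx)
    refine mul_le_mul_right (lintegral_mono fun y => ?_) _
    refine (mul_le_mul_right (indicator_le_self' (fun _ _ => zero_le) _) _).trans ?_
    rw [Pi.one_apply, mul_one]
  · rw [weight, if_neg hx, zero_mul]
    exact zero_le

end CrossingFlux

/-! ### Assembly of the crossing law -/

variable {n : ℕ} {M : ℝ} {P : Measure (Env n M)} {G : Set (Env n M)} {ε L : ℝ}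
  {S : Set (Euc (n + 1))} {U : Euc (n + 1) → Euc (n + 2) ≃ₗᵢ[ℝ] Euc (n + 2)}
  {Q : Set (Euc (n + 2))} {B₁ : Set (Euc (n + 1))} {B₂ : Set (Euc (n + 2))}

/-- A measurable null hull of the exceptional environments is removed, so that the almost sure
properties hold everywhere on a measurable set of full measure; connectedness supplies nonemptiness.
-/
theorem exists_isGoodLaw [IsProbabilityMeasure P] (hP : ∀ a, MeasurePreserving (shift a) P P)
    (hconn : ∀ᵐ ω ∂P, IsConnected (tube ω)) (hε : 0 < ε) (hL : 0 ≤ L)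
    (hLip : ∀ᵐ ω ∂P, LipschitzBoundary (tube ω) ε L)
    (hReg : ∀ᵐ ω ∂P, surfaceMeasure ω (frontier (tube ω) \ regularPoints ω) = 0)
    (hSω : ∀ᵐ ω ∂P, cylinder S ⊆ tube ω) :
    ∃ G, IsGoodLaw P G ε L ∧ (∀ ω ∈ G, (tube ω).Nonempty) ∧
      (∀ ω ∈ G, μHE[n + 1] (frontier (tube ω) \ regularPoints ω) = 0) ∧
      ∀ ω ∈ G, cylinder S ⊆ tube ω := by
  have hall := hconn.and (hLip.and (hReg.and hSω))
  obtain ⟨T, hT, hTm, hT0⟩ := exists_measurable_superset_of_null (ae_iff.1 hall)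
  have hG : ∀ ω ∈ Tᶜ, IsConnected (tube ω) ∧ LipschitzBoundary (tube ω) ε L ∧
      surfaceMeasure ω (frontier (tube ω) \ regularPoints ω) = 0 ∧ cylinder S ⊆ tube ω := by
    intro ω hω
    by_contra h
    exact hω (hT h)
  refine ⟨Tᶜ, ⟨hP, hTm.compl, ?_, hε, hL, fun ω hω => (hG ω hω).2.1⟩,
    fun ω hω => (hG ω hω).1.nonempty, fun ω hω => ?_, fun ω hω => (hG ω hω).2.2.2⟩
  · rw [ae_iff]
    simpa using hT0
  · have h := (hG ω hω).2.2.1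
    rwa [surfaceMeasure, Measure.restrict_apply' isClosed_frontier.measurableSet,
      inter_eq_left.2 sdiff_subset] at h

theorem IsGoodLaw.cylinderInDomain (hG : IsGoodLaw P G ε L)
    (hReg : ∀ ω ∈ G, μHE[n + 1] (frontier (tube ω) \ regularPoints ω) = 0)
    (hSω : ∀ ω ∈ G, cylinder S ⊆ tube ω) (hSopen : IsOpen S) (hSconv : Convex ℝ S)
    (hU : IsNormalFrame S U) :
    ∃ Q, ∀ ω ∈ G,
      CylinderInDomain S (tube ω) (regularPoints ω) (regNormal ω) Q (cylNormal S U) := by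
  obtain ⟨Q, hQm, hQs, hQ0, hQn⟩ := exists_regular_cylinder hSopen hSconv hU
  refine ⟨Q, fun ω hω => ?_⟩
  exact
    { isOpen := (hG.lip ω hω).isOpen hG.eps_pos
      bounded := ⟨M, fun x hx => tube_norm_proj_le hx⟩
      meas_R := measurableSet_regularPoints_apply hG.eps_pos hG.L_nonneg (hG.lip ω hω)
      R_subset := fun x hx => hx.1
      null_R := hReg ω hω
      meas_N := measurable_regNormal_apply hG.eps_pos hG.L_nonneg (hG.lip ω hω)
      normal := fun x hx => (regNormal_spec hx).1
      strict := fun x hx => (regNormal_spec hx).2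
      open_S := hSopen
      convex_S := hSconv
      cylinder_subset := hSω ω hω
      meas_Q := hQm
      Q_subset := hQs
      null_Q := hQ0
      meas_m := measurable_cylNormal hU
      normal_m := hQn }

theorem IsGoodLaw.stepProb_crossesIn [IsProbabilityMeasure P] (hG : IsGoodLaw P G ε L)
    (hC : ∀ ω ∈ G, CylinderInDomain S (tube ω) (regularPoints ω) (regNormal ω) Q (cylNormal S U))
    (hU : IsNormalFrame S U) (hB₁ : MeasurableSet B₁) (hB₁S : B₁ ⊆ frontier S)
    (hB₂ : MeasurableSet B₂) (hB₂h : B₂ ⊆ halfSphere n) :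
    stepProb P (CrossesIn S U B₁ B₂) = (normConst P)⁻¹ * (μHE[n] B₁ * ENNReal.ofReal (gammaConst n *
      ∫ h in B₂, inner ℝ h (e n) ∂(μHE[n + 1] : Measure (Euc (n + 2))))) := by
  rw [stepProb_eq P (measurableSet_crossesIn hU.1 hB₁ hB₁S hB₂),
    hG.lintegral_palmMean_crossesIn hC hU hB₁ hB₁S hB₂ hB₂h, ENNReal.ofReal_mul gammaConst_pos.le,
    ofReal_integral_inner_e hB₂ hB₂h, mul_left_comm (ENNReal.ofReal _)]

/-- On a transversal line a chord that hits the boundary of the cylinder in an inward direction also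
crosses the cylinder, so the extra condition removes only a negligible event. -/
theorem IsGoodLaw.stepProb_crosses_and [IsProbabilityMeasure P] (hG : IsGoodLaw P G ε L)
    (hC : ∀ ω ∈ G, CylinderInDomain S (tube ω) (regularPoints ω) (regNormal ω) Q (cylNormal S U))
    (hU : IsNormalFrame S U) (hS : IsOpen S) (hB₁ : MeasurableSet B₁) (hB₁S : B₁ ⊆ frontier S)
    (hB₂ : MeasurableSet B₂) (hB₂h : B₂ ⊆ halfSphere n) :
    stepProb P (fun x y => Crosses S x y ∧ CrossesIn S U B₁ B₂ x y) =
      stepProb P (CrossesIn S U B₁ B₂) := by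
  have hm := measurableSet_crossesIn hU.1 hB₁ hB₁S hB₂
  have hm' := (measurableSet_crosses hS).inter hm
  rw [stepProb_eq P hm, stepProb_eq P (ev := fun x y => Crosses S x y ∧ CrossesIn S U B₁ B₂ x y) hm']
  congr 1
  refine le_antisymm (lintegral_mono fun ω => palmMean_mono fun x y => ?_)
    (hG.lintegral_palmMean_le_of_diff hm' ?_)
  · exact indicator_le_indicator_of_subset (fun p hp => hp.2) (fun _ => zero_le) _
  · refine hG.lintegral_palmMean_eq_zero hC (hm.diff hm') (fun a x y => ?_) ?_
    · simp only [Set.mem_sdiff, mem_inter_iff, mem_ofPred_eq, crossesIn_add_smul_e, crosses_add_smul_e]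
    · rintro ω hω x hx y hy hs hl ⟨h1, h2⟩
      exact h2 ⟨(hC ω hω).crosses_of_crossesIn hB₂h hy hs hl h1, h1⟩

/-- On transversal lines crossing the cylinder is the same as first hitting its boundary in an
inward direction, so both differences of the two events are negligible. -/
theorem IsGoodLaw.stepProb_crosses [IsProbabilityMeasure P] (hG : IsGoodLaw P G ε L)
    (hC : ∀ ω ∈ G, CylinderInDomain S (tube ω) (regularPoints ω) (regNormal ω) Q (cylNormal S U))
    (hU : IsNormalFrame S U) (hS : IsOpen S) :
    stepProb P (Crosses S) = stepProb P (CrossesIn S U (frontier S) (halfSphere n)) := by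
  have hm := measurableSet_crosses hS
  have hm' := measurableSet_crossesIn hU.1 isClosed_frontier.measurableSet (subset_refl (frontier S))
    (measurableSet_halfSphere (n := n))
  rw [stepProb_eq P hm, stepProb_eq P hm']
  congr 1
  refine le_antisymm (hG.lintegral_palmMean_le_of_diff hm' ?_)
    (hG.lintegral_palmMean_le_of_diff hm ?_)
  · refine hG.lintegral_palmMean_eq_zero hC (hm.diff hm') (fun a x y => ?_) ?_
    · simp only [Set.mem_sdiff, mem_ofPred_eq, crossesIn_add_smul_e, crosses_add_smul_e]
    · rintro ω hω x hx y hy hs hl ⟨h1, h2⟩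
      exact h2 ((hC ω hω).crossesIn_of_crosses hx hs hl h1)
  · refine hG.lintegral_palmMean_eq_zero hC (hm'.diff hm) (fun a x y => ?_) ?_
    · simp only [Set.mem_sdiff, mem_ofPred_eq, crossesIn_add_smul_e, crosses_add_smul_e]
    · rintro ω hω x hx y hy hs hl ⟨h1, h2⟩
      exact h2 ((hC ω hω).crosses_of_crossesIn subset_rfl hy hs hl h1)

theorem gammaConst_mul_integral :
    gammaConst n * ∫ h in halfSphere n, inner ℝ h (e n) ∂(μHE[n + 1] : Measure (Euc (n + 2))) = 1 := by
  have h := gammaConst_pos (n := n)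
  rw [gammaConst, inv_pos] at h
  rw [gammaConst, inv_mul_cancel₀ h.ne']

/-- The measure of `∂S` is the unnormalized probability of entering, hence at most the normalizing
constant. Finiteness is needed to cancel it in the final formula. -/
theorem IsGoodLaw.measure_frontier_lt_top [IsProbabilityMeasure P] (hG : IsGoodLaw P G ε L)
    (hC : ∀ ω ∈ G, CylinderInDomain S (tube ω) (regularPoints ω) (regNormal ω) Q (cylNormal S U))
    (hU : IsNormalFrame S U) (hZ : normConst P < ⊤) : μHE[n] (frontier S) < ⊤ := by
  refine lt_of_le_of_lt ?_ hZ
  have h := hG.lintegral_palmMean_le hC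
    {p | CrossesIn S U (frontier S) (halfSphere n) p.1 p.2}
  rwa [hG.lintegral_palmMean_crossesIn hC hU isClosed_frontier.measurableSet subset_rfl
    measurableSet_halfSphere subset_rfl, mul_left_comm, ofReal_gammaConst_mul_lintegral, mul_one] at h

end KnudsenTube

theorem mainTheorem5 (n : ℕ) (M : ℝ) (hM : 0 < M)
    (P : Measure (Env n M)) [IsProbabilityMeasure P]
    (hP : IsStationaryErgodic P)
    (hconn : ∀ᵐ ω ∂P, IsConnected (tube ω))
    (hLip : ∃ ε > 0, ∃ L > 0, ∀ᵐ ω ∂P, LipschitzBoundary (tube ω) ε L)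
    (hReg : ∀ᵐ ω ∂P, surfaceMeasure ω (frontier (tube ω) \ regularPoints ω) = 0)
    (S : Set (Euc (n + 1))) (hSΛ : S ⊆ Metric.closedBall 0 M)
    (hSopen : IsOpen S) (hSconv : Convex ℝ S)
    (hSω : ∀ᵐ ω ∂P, cylinder S ⊆ tube ω)
    (U : Euc (n + 1) → Euc (n + 2) ≃ₗᵢ[ℝ] Euc (n + 2)) (hU : IsNormalFrame S U) :
    (0 < normConst P ∧ normConst P < ⊤) ∧
    stepProb P (Crosses S) = μHE[n] (frontier S) / normConst P ∧
    ∀ (B₁ : Set (Euc (n + 1))) (B₂ : Set (Euc (n + 2))),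
      MeasurableSet B₁ → B₁ ⊆ frontier S → MeasurableSet B₂ → B₂ ⊆ halfSphere n →
      stepProb P (CrossesIn S U B₁ B₂) =
        μHE[n] (frontier S) / normConst P * (μHE[n] B₁ / μHE[n] (frontier S)) *
          ENNReal.ofReal (gammaConst n *
            ∫ h in B₂, inner ℝ h (e n) ∂(μHE[n + 1] : Measure (Euc (n + 2)))) ∧
      stepProb P (fun x y => Crosses S x y ∧ CrossesIn S U B₁ B₂ x y) =
        μHE[n] (frontier S) / normConst P * (μHE[n] B₁ / μHE[n] (frontier S)) *
          ENNReal.ofReal (gammaConst n *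
            ∫ h in B₂, inner ℝ h (e n) ∂(μHE[n + 1] : Measure (Euc (n + 2)))) := by
  obtain ⟨ε, hε, L, hL, hLip⟩ := hLip
  obtain ⟨G, hG, hne, hReg', hSω'⟩ := exists_isGoodLaw hP.1 hconn hε hL.le hLip hReg hSω
  obtain ⟨Q, hC⟩ := hG.cylinderInDomain hReg' hSω' hSopen hSconv hU
  have hZ := hG.normConst_lt_top hReg'
  have hS := hG.measure_frontier_lt_top hC hU hZ
  have hfr := (isClosed_frontier (s := S)).measurableSet
  -- If `∂S` has measure `0`, as for `S = ∅`, both sides are `0`; otherwise its measure is also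
  -- finite and cancels.
  have key : ∀ (B₁ : Set (Euc (n + 1))) (c : ℝ≥0∞), B₁ ⊆ frontier S →
      (normConst P)⁻¹ * (μHE[n] B₁ * c) =
        μHE[n] (frontier S) / normConst P * (μHE[n] B₁ / μHE[n] (frontier S)) * c := by
    intro B₁ c hB₁S
    rcases eq_or_ne (μHE[n] (frontier S)) 0 with h0 | h0
    · rw [h0, measure_mono_null hB₁S h0]
      simp
    · rw [ENNReal.div_eq_inv_mul, mul_assoc (normConst P)⁻¹, ENNReal.mul_div_cancel h0 hS.ne, mul_assoc]
  refine ⟨⟨hG.normConst_pos hReg' hne, hZ⟩, ?_, fun B₁ B₂ hB₁ hB₁S hB₂ hB₂h => ⟨?_, ?_⟩⟩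
  · rw [hG.stepProb_crosses hC hU hSopen, hG.stepProb_crossesIn hC hU hfr subset_rfl
      measurableSet_halfSphere subset_rfl, gammaConst_mul_integral, ENNReal.ofReal_one, mul_one,
      ENNReal.div_eq_inv_mul]
  · rw [hG.stepProb_crossesIn hC hU hB₁ hB₁S hB₂ hB₂h, key B₁ _ hB₁S]
  · rw [hG.stepProb_crosses_and hC hU hSopen hB₁ hB₁S hB₂ hB₂h,
      hG.stepProb_crossesIn hC hU hB₁ hB₁S hB₂ hB₂h, key B₁ _ hB₁S]
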